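/- Let $N\ge 2$, let $\Omega\subset\mathbb{R}^N$ be open and bounded with smooth boundary, let $Y=(0,1)^N$, let $Y^H\subset Y$ be compact with smooth boundary, and assume that $Y^*=Y\setminus Y^H$ is connected. Put $E_\sharp(Y^*)=\mathbb{R}^N\setminus\bigcup_{k\in\mathbb{Z}^N}(k+Y^H)$. For $\varepsilon>0$ let $\Omega_\varepsilon$ be $\Omega$ with the holes $\varepsilon(k+Y^H)$ removed for all those $k\in\mathbb{Z}^N$ for which the cell $\varepsilon(k+Y)$ does not meet $\partial\Omega$. Let $T>0$, $r>0$, and let $\varepsilon$ run through a sequence of positive numbers tending to $0$. Write $D(U)$ for the smooth functions with compact support in $U$, $C^\infty_\sharp(0,1)$ for the smooth $1$-periodic functions on $\mathbb{R}$, $H^1_\sharp(Y^*)/\mathbb{R}$ for the $\mathbb{Z}^N$-periodic functions in $H^1_{loc}(E_\sharp(Y^*))$ with finite $H^1(Y^*)$-norm and zero mean over $Y^*$, and $C_\sharp(Y\times(0,1))$ for the continuous functions on $\mathbb{R}^N\times\mathbb{R}$ that are $1$-periodic in each coordinate. Assume that $\{u_\varepsilon\}$ is bounded in $L^2(0,T;H^1(\Omega_\varepsilon))$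 and that for all $v_1\in D(\Omega)$, $c_1\in D(0,T)$, $c_2\in C^\infty_\sharp(0,1)$ $$\varepsilon^r\int_0^T\!\int_{\Omega_\varepsilon}u_\varepsilon(x,t)\,v_1(x)\,\partial_t\Big(c_1(t)\,c_2\big(\tfrac{t}{\varepsilon^r}\big)\Big)\,dx\,dt\to 0 .$$ Then there are a subsequence and functions $u\in L^2(0,T;H^1(\Omega))$ and $u_1\in L^2(\Omega\times(0,T)\times(0,1);H^1_\sharp(Y^*)/\mathbb{R})$ such that, along the subsequence, $$\int_0^T\!\int_{\Omega_\varepsilon}\nabla u_\varepsilon(x,t)\cdot v\big(x,t,\tfrac{x}{\varepsilon},\tfrac{t}{\varepsilon^r}\big)\,dx\,dt\to\int_0^T\!\int_\Omega\int_0^1\!\int_{Y^*}\big(\nabla u(x,t)+\nabla_y u_1(x,t,y,s)\big)\cdot v(x,t,y,s)\,dy\,ds\,dx\,dt\qquad(*)$$ for all $v\in L^2(\Omega\times(0,T);C_\sharp(Y\times(0,1)))^N$. Moreover, for every subsequence and every such pair $(u,u_1)$ for which $(*)$ holds, one has along the same subsequence $$\int_0^T\!\int_{\Omega_\varepsilon}\varepsilon^{-1}u_\varepsilon(x,t)\,v_1(x)\,v_2\big(\tfrac{x}{\varepsilon}\big)\,c_1(t)\,c_2\big(\tfrac{t}{\varepsilon^r}\big)\,dx\,dt\to\int_0^T\!\int_\Omega\int_0^1\!\int_{Y^*}u_1(x,t,y,s)\,v_1(x)\,v_2(y)\,c_1(t)\,c_2(s)\,dy\,ds\,dx\,dt$$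 for all $v_1\in D(\Omega)$, $c_1\in D(0,T)$, $c_2\in C^\infty_\sharp(0,1)$ and all $\mathbb{Z}^N$-periodic $v_2\in C^\infty(E_\sharp(Y^*))$ with $v_2\in L^2(Y^*)$ and $\int_{Y^*}v_2\,dy=0$. -/

import Mathlib

open MeasureTheory Filter Topology Set
open scoped ContDiff

noncomputable section

namespace Perforated

/-- Euclidean space `ℝ^N`. -/
abbrev Space (N : ℕ) : Type := EuclideanSpace ℝ (Fin N)

variable {N : ℕ}

/-- An integer vector, seen as a point of `ℝ^N`. -/
def intVec (k : Fin N → ℤ) : Space N := WithLp.toLp 2 (fun i => (k i : ℝ))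

/-- The open unit cube `Y = (0,1)^N`. -/
def unitCube (N : ℕ) : Set (Space N) := {y | ∀ i, 0 < y i ∧ y i < 1}

/-- `A` has smooth boundary: near each boundary point, the interior and the closure of `A` are
`{f < 0}` and `{f ≤ 0}` for a smooth `f` with nonzero derivative at the point. -/
def HasSmoothBoundary (A : Set (Space N)) : Prop :=
  ∀ p ∈ frontier A, ∃ (U : Set (Space N)) (f : Space N → ℝ),
    IsOpen U ∧ p ∈ U ∧ ContDiffOn ℝ ∞ f U ∧ fderiv ℝ f p ≠ 0 ∧
      interior A ∩ U = {x | f x < 0} ∩ U ∧ closure A ∩ U = {x | f x ≤ 0} ∩ U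

/-- The solid part `Y* = Y \ Y^H` of the unit cell; `YH` is the (closed) hole. -/
def solidCell (YH : Set (Space N)) : Set (Space N) := unitCube N \ YH

/-- The periodic extension `E_♯(Y*)` of `Y*`: all of `ℝ^N` except the integer translates of the
hole. It contains the faces of the cells, so neighbouring copies of `Y*` are joined. -/
def periodicExt (YH : Set (Space N)) : Set (Space N) :=
  {y | ∀ k : Fin N → ℤ, y - intVec k ∉ YH}

/-- The open cube `ε (k + Y)`. -/
def cell (ε : ℝ) (k : Fin N → ℤ) : Set (Space N) := {x | ε⁻¹ • x - intVec k ∈ unitCube N}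

/-- The perforated domain `Ω_ε`: the holes `ε (k + Y^H)` are removed from `Ω`, except in the cells
`ε (k + Y)` that meet the boundary of `Ω`, which are not perforated. -/
def perforated (Ω YH : Set (Space N)) (ε : ℝ) : Set (Space N) :=
  {x | x ∈ Ω ∧ ∀ k : Fin N → ℤ, cell ε k ∩ frontier Ω = ∅ → ε⁻¹ • x - intVec k ∉ YH}

/-- The test functions `D(U)`: smooth with compact support in `U`. -/
def IsTest {F : Type*} [NormedAddCommGroup F] [NormedSpace ℝ F] (U : Set F) (φ : F → ℝ) : Prop :=
  ContDiff ℝ ∞ φ ∧ HasCompactSupport φ ∧ tsupport φ ⊆ U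

/-- `c ∈ C_♯^∞(0,1)`: smooth and `1`-periodic on the line. -/
def IsSmoothPeriodic (c : ℝ → ℝ) : Prop := ContDiff ℝ ∞ c ∧ Function.Periodic c 1

/-- `v ∈ C_♯^∞(Y*) / ℝ`: smooth and periodic on `E_♯(Y*)`, square integrable on `Y*`,
with zero mean over `Y*`. -/
def IsZeroMeanCellTest (YH : Set (Space N)) (v : Space N → ℝ) : Prop :=
  ContDiffOn ℝ ∞ v (periodicExt YH) ∧
  (∀ k : Fin N → ℤ, ∀ y ∈ periodicExt YH, v (y + intVec k) = v y) ∧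
  MemLp v 2 (volume.restrict (solidCell YH)) ∧
  ∫ y in solidCell YH, v y = 0

/-- `G` is the weak (distributional) gradient of `w` in the open set `U`. -/
def HasWeakGrad (U : Set (Space N)) (w : Space N → ℝ) (G : Space N → Space N) : Prop :=
  LocallyIntegrableOn w U ∧ LocallyIntegrableOn G U ∧
  ∀ φ : Space N → ℝ, IsTest U φ → ∀ ξ : Space N,
    ∫ x in U, w x * fderiv ℝ φ x ξ = - ∫ x in U, φ x * inner ℝ (G x) ξ

/-- `u ∈ L²(0,T;H¹(U))`, with (spatial) gradient `g`. -/
def IsL2H1 (U : Set (Space N)) (T : ℝ) (u : Space N → ℝ → ℝ) (g : Space N → ℝ → Space N) : Prop :=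
  MemLp (fun p : Space N × ℝ => u p.1 p.2) 2 (volume.restrict (U ×ˢ Ioo 0 T)) ∧
  MemLp (fun p : Space N × ℝ => g p.1 p.2) 2 (volume.restrict (U ×ˢ Ioo 0 T)) ∧
  ∀ᵐ t ∂(volume.restrict (Ioo 0 T)), HasWeakGrad U (fun x => u x t) (fun x => g x t)

/-- `u₁ ∈ L²(Ω × (0,T) × (0,1); H¹_♯(Y*) / ℝ)`, with gradient `g₁` in the cell variable; the
arguments of `u₁` are `x, t, y, s`. -/
def IsCellCorrector (Ω YH : Set (Space N)) (T : ℝ) (u₁ : Space N → ℝ → Space N → ℝ → ℝ)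
    (g₁ : Space N → ℝ → Space N → ℝ → Space N) : Prop :=
  MemLp (fun p : Space N × ℝ × Space N × ℝ => u₁ p.1 p.2.1 p.2.2.1 p.2.2.2) 2
    (volume.restrict (Ω ×ˢ Ioo 0 T ×ˢ solidCell YH ×ˢ Ioo 0 1)) ∧
  MemLp (fun p : Space N × ℝ × Space N × ℝ => g₁ p.1 p.2.1 p.2.2.1 p.2.2.2) 2
    (volume.restrict (Ω ×ˢ Ioo 0 T ×ˢ solidCell YH ×ˢ Ioo 0 1)) ∧
  ∀ᵐ q : Space N × ℝ × ℝ ∂(volume.restrict (Ω ×ˢ Ioo 0 T ×ˢ Ioo 0 1)),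
    (∀ k : Fin N → ℤ, ∀ᵐ y ∂(volume.restrict (periodicExt YH)),
      u₁ q.1 q.2.1 (y + intVec k) q.2.2 = u₁ q.1 q.2.1 y q.2.2) ∧
    HasWeakGrad (periodicExt YH) (fun y => u₁ q.1 q.2.1 y q.2.2)
      (fun y => g₁ q.1 q.2.1 y q.2.2) ∧
    ∫ y in solidCell YH, u₁ q.1 q.2.1 y q.2.2 = 0

/-- `{u k}` is bounded in `L²(0,T;H¹(Ω_{ε k}))`, where `g k` is the gradient of `u k`. -/
def BoundedL2H1 (Ω YH : Set (Space N)) (T : ℝ) (ε : ℕ → ℝ) (u : ℕ → Space N → ℝ → ℝ)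
    (g : ℕ → Space N → ℝ → Space N) : Prop :=
  (∀ k, IsL2H1 (perforated Ω YH (ε k)) T (u k) (g k)) ∧
  ∃ C : ℝ, ∀ k,
    ∫ p in perforated Ω YH (ε k) ×ˢ Ioo 0 T, (u k p.1 p.2 ^ 2 + ‖g k p.1 p.2‖ ^ 2) ≤ C

/-- `ε^r ∫₀ᵀ ∫_{Ω_ε} u_ε(x,t) v₁(x) ∂ₜ(c₁(t) c₂(t/ε^r)) dx dt → 0`
for all `v₁ ∈ D(Ω)`, `c₁ ∈ D(0,T)` and `c₂ ∈ C_♯^∞(0,1)`. -/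
def TimeOscillationVanishes (Ω YH : Set (Space N)) (T r : ℝ) (ε : ℕ → ℝ)
    (u : ℕ → Space N → ℝ → ℝ) : Prop :=
  ∀ (v₁ : Space N → ℝ) (c₁ c₂ : ℝ → ℝ), IsTest Ω v₁ → IsTest (Ioo 0 T) c₁ →
    IsSmoothPeriodic c₂ →
    Tendsto (fun k => ε k ^ r * ∫ p in perforated Ω YH (ε k) ×ˢ Ioo 0 T,
        u k p.1 p.2 * v₁ p.1 * deriv (fun τ => c₁ τ * c₂ (τ / ε k ^ r)) p.2)
      atTop (𝓝 0)

/-- The point of the torus `ℝ^N / ℤ^N` under a point of `ℝ^N`. -/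
def toTorus (y : Space N) : UnitAddTorus (Fin N) := fun i => (y i : UnitAddCircle)

/-- The gradients `g k = ∇u_{ε k}` satisfy
`∫₀ᵀ ∫_{Ω_ε} ∇u_ε · v(x, t, x/ε, t/ε^r) dx dt → ∫₀ᵀ ∫_Ω ∫₀¹ ∫_{Y*} (∇u + ∇_y u₁) · v dy ds dx dt`
for all `v ∈ L²(Ω × (0,T); C_♯(Y × (0,1)))^N`, where `h = ∇u` and `g₁ = ∇_y u₁`. Continuous periodic
functions of `(y,s)` are continuous functions on a torus. -/
def GradientsConverge (Ω YH : Set (Space N)) (T r : ℝ) (ε : ℕ → ℝ)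
    (g : ℕ → Space N → ℝ → Space N) (h : Space N → ℝ → Space N)
    (g₁ : Space N → ℝ → Space N → ℝ → Space N) : Prop :=
  ∀ v : Space N × ℝ → C(UnitAddTorus (Fin N) × UnitAddCircle, Space N),
    MemLp v 2 (volume.restrict (Ω ×ˢ Ioo 0 T)) →
    Tendsto (fun k => ∫ p in perforated Ω YH (ε k) ×ˢ Ioo 0 T,
        inner ℝ (g k p.1 p.2)
          (v p (toTorus ((ε k)⁻¹ • p.1), ((p.2 / ε k ^ r : ℝ) : UnitAddCircle))))
      atTop (𝓝 (∫ p in Ω ×ˢ Ioo 0 T ×ˢ solidCell YH ×ˢ Ioo 0 1,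
        inner ℝ (h p.1 p.2.1 + g₁ p.1 p.2.1 p.2.2.1 p.2.2.2)
          (v (p.1, p.2.1) (toTorus p.2.2.1, ((p.2.2.2 : ℝ) : UnitAddCircle)))))

/-- `∫₀ᵀ ∫_{Ω_ε} ε⁻¹ u_ε(x,t) v₁(x) v₂(x/ε) c₁(t) c₂(t/ε^r) dx dt`
`→ ∫₀ᵀ ∫_Ω ∫₀¹ ∫_{Y*} u₁(x,t,y,s) v₁(x) v₂(y) c₁(t) c₂(s) dy ds dx dt`
for all `v₁ ∈ D(Ω)`, `v₂ ∈ C_♯^∞(Y*) / ℝ`, `c₁ ∈ D(0,T)` and `c₂ ∈ C_♯^∞(0,1)`. -/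
def ConvergesVeryWeakly (Ω YH : Set (Space N)) (T r : ℝ) (ε : ℕ → ℝ)
    (u : ℕ → Space N → ℝ → ℝ) (u₁ : Space N → ℝ → Space N → ℝ → ℝ) : Prop :=
  ∀ (v₁ v₂ : Space N → ℝ) (c₁ c₂ : ℝ → ℝ), IsTest Ω v₁ → IsZeroMeanCellTest YH v₂ →
    IsTest (Ioo 0 T) c₁ → IsSmoothPeriodic c₂ →
    Tendsto (fun k => ∫ p in perforated Ω YH (ε k) ×ˢ Ioo 0 T,
        (ε k)⁻¹ * u k p.1 p.2 * v₁ p.1 * v₂ ((ε k)⁻¹ • p.1) * c₁ p.2 * c₂ (p.2 / ε k ^ r))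
      atTop (𝓝 (∫ p in Ω ×ˢ Ioo 0 T ×ˢ solidCell YH ×ˢ Ioo 0 1,
        u₁ p.1 p.2.1 p.2.2.1 p.2.2.2 * v₁ p.1 * v₂ p.2.2.1 * c₁ p.2.1 * c₂ p.2.2.2))

end Perforated

end

open Perforated

/-! The argument works on the perforated domains directly, without extending functions into the
holes. Call `(ψ, Θ)` a cell pair when `∫ ψ w = ∫ Θ · ∇w` over `Y*` for every periodic `w` in
`H¹(Y*)`; weakly, `ψ = -div Θ` with zero flux through the boundary of the hole. Every mean-free `ψ`
in `L²(Y*)` has such a `Θ`: by the Poincaré inequality on `Y*` (`solidCell_poincare`) a mean-free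
potential is a bounded function `S` of its gradient, and `Θ = S* ψ` (`exists_isCellPair`). Since `N
≥ 2`, `Θ` can also be given mean zero (`exists_isCellPair_mean_zero`): a periodic function `Φ` of
one coordinate `y_j` with `j ≠ i`, concentrated near the faces of the cells, makes `Φ e_i` a
divergence free field that vanishes in the hole and has nonzero mean.

The central identity (`integral_mul_cellPair`, and `jInt_cellPair` in space-time) is `∫ u v ψ(x/ε) =
ε ∫ (v ∇u + u ∇v) · Θ(x/ε)` over `Ω_ε`. Summing the rescaled copies of `u v` over all cells gives a
periodic function on `Y*` whose gradient is `ε` times the sum of the copies of `∇(u v)`, and the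
definition of a cell pair applies to this sum.

For the very weak convergence, divide the identity by `ε` and take `ψ = v₂` with a mean-free `Θ`.
The term with `∇u_ε` converges by `(*)`, once `(*)` is extended from continuous to square integrable
fields of the fast variables (`tendsto_iInt_of_gradientsConverge`). In its limit `∇u` drops out
because `Θ` has mean zero, and `∫ Θ · ∇_y u₁ = ∫ v₂ u₁`. The term with `u_ε ∇v₁ · Θ` tends to zero:
the components of `Θ` are mean-free, hence divergences themselves, and the identity yields a further
factor `ε`.

For the compactness, unfolding turns two-scale convergence into weak convergence in `L²` of a
product. Along a subsequence the functions extended by zero converge weakly to some `U`, and the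
unfolded gradients to some `G` that vanishes in the hole. The hypothesis on time derivatives,
applied to a periodic primitive of `c₂` minus its mean, shows that fast oscillations in time average
out, so `u_ε` tested with `ψ(x/ε) c₂(t/ε^r)` sees only the means of `ψ` and `c₂` (`tendsto_jInt`).
The central identity with `ψ = 0` passes to the limit (`integral_limit_add`). The fields `Φ e_i`
then identify `F = ∇(U/|Y*|)`, and general divergence free fields show that `G - F` is orthogonal to
all of them for almost every `(x,t,s)`. It is therefore a gradient in the cell. Its potential
depends measurably on `(x,t,s)` because the linear problem is solved in `L²` of the whole product at
once (`exists_fiber_solution`). -/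

noncomputable section

set_option linter.unusedSectionVars false

namespace Perforated
variable {N : ℕ}

/-! ### Pairings of square integrable functions. -/

section L2
variable {α : Type*} [MeasurableSpace α] {μ : Measure α}
  {E : Type*} [NormedAddCommGroup E]

lemma eLpNorm_two_sq {f : α → E} : eLpNorm f 2 μ ^ 2 = ∫⁻ x, ‖f x‖ₑ ^ 2 ∂μ := by
  have := eLpNorm_nnreal_pow_eq_lintegral (μ := μ) (f := f) (p := 2) (by norm_num)
  have h2 : ((2 : NNReal) : ℝ) = ((2 : ℕ) : ℝ) := by norm_num
  rw [h2] at this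
  simpa only [ENNReal.rpow_natCast, ENNReal.coe_ofNat] using this

variable [InnerProductSpace ℝ E]

lemma integrable_inner_of_memLp {f g : α → E} (hf : MemLp f 2 μ) (hg : MemLp g 2 μ) :
    Integrable (fun x => inner ℝ (f x) (g x)) μ := by
  refine (L2.integrable_inner (𝕜 := ℝ) hf.toLp hg.toLp).congr ?_
  filter_upwards [hf.coeFn_toLp, hg.coeFn_toLp] with x h1 h2
  rw [h1, h2]

lemma inner_toLp_eq_integral {f g : α → E} (hf : MemLp f 2 μ) (hg : MemLp g 2 μ) :
    inner ℝ (hf.toLp f) (hg.toLp g) = ∫ x, inner ℝ (f x) (g x) ∂μ := by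
  rw [L2.inner_def]
  refine integral_congr_ae ?_
  filter_upwards [hf.coeFn_toLp, hg.coeFn_toLp] with x h1 h2
  rw [h1, h2]

lemma abs_integral_inner_le {f g : α → E} (hf : MemLp f 2 μ) (hg : MemLp g 2 μ) :
    |∫ x, inner ℝ (f x) (g x) ∂μ| ≤ (eLpNorm f 2 μ).toReal * (eLpNorm g 2 μ).toReal := by
  rw [← inner_toLp_eq_integral hf hg, ← Lp.norm_toLp f hf, ← Lp.norm_toLp g hg]
  exact abs_real_inner_le_norm _ _

lemma integrable_mul_of_memLp {f g : α → ℝ} (hf : MemLp f 2 μ) (hg : MemLp g 2 μ) :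
    Integrable (fun x => f x * g x) μ := by
  have := integrable_inner_of_memLp hg hf
  simpa using this

lemma inner_toLp_eq_integral_mul {f g : α → ℝ} (hf : MemLp f 2 μ) (hg : MemLp g 2 μ) :
    inner ℝ (hf.toLp f) (hg.toLp g) = ∫ x, f x * g x ∂μ := by
  rw [real_inner_comm, inner_toLp_eq_integral hg hf]
  simp

lemma abs_integral_mul_le {f g : α → ℝ} (hf : MemLp f 2 μ) (hg : MemLp g 2 μ) :
    |∫ x, f x * g x ∂μ| ≤ (eLpNorm f 2 μ).toReal * (eLpNorm g 2 μ).toReal := by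
  have := abs_integral_inner_le hg hf
  rw [mul_comm]
  simpa using this

end L2

/-! ### Test functions: density in `L²`, duality and translations. -/

section Tests
variable {E : Type*} [NormedAddCommGroup E] [NormedSpace ℝ E] [FiniteDimensional ℝ E]
  [MeasurableSpace E] [BorelSpace E] {μ : Measure E} [IsFiniteMeasureOnCompacts μ]

lemma IsTest.continuous {F : Type*} [NormedAddCommGroup F] [NormedSpace ℝ F] {U : Set F}
    {φ : F → ℝ} (h : IsTest U φ) : Continuous φ := h.1.continuous

lemma IsTest.memLp {A B : Set E} {φ : E → ℝ} (h : IsTest A φ) (p : ENNReal) :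
    MemLp φ p (μ.restrict B) :=
  (h.continuous.memLp_of_hasCompactSupport h.2.1).restrict B

lemma IsTest.mono {F : Type*} [NormedAddCommGroup F] [NormedSpace ℝ F] {A B : Set F}
    {φ : F → ℝ} (h : IsTest A φ) (hAB : A ⊆ B) : IsTest B φ := ⟨h.1, h.2.1, h.2.2.trans hAB⟩

/-- The classes of test functions supported in `A`, as a subspace of `L²(A)`. -/
def testSubmodule (μ : Measure E) [IsFiniteMeasureOnCompacts μ] (A : Set E) :
    Submodule ℝ (Lp ℝ 2 (μ.restrict A)) where
  carrier := {f | ∃ φ : E → ℝ, IsTest A φ ∧ f =ᵐ[μ.restrict A] φ}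
  add_mem' := by
    rintro f g ⟨φ, hφ, hf⟩ ⟨ψ, hψ, hg⟩
    refine ⟨φ + ψ, ⟨hφ.1.add hψ.1, hφ.2.1.add hψ.2.1, ?_⟩, (Lp.coeFn_add f g).trans (hf.add hg)⟩
    exact (tsupport_add φ ψ).trans (union_subset hφ.2.2 hψ.2.2)
  zero_mem' := ⟨0, ⟨contDiff_const, HasCompactSupport.zero, by simp [tsupport]⟩, Lp.coeFn_zero _ _ _⟩
  smul_mem' := by
    rintro c f ⟨φ, hφ, hf⟩
    refine ⟨c • φ, ⟨contDiff_const.smul hφ.1, hφ.2.1.smul_left (f := fun _ => c), ?_⟩,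
      (Lp.coeFn_smul c f).trans (hf.const_smul c)⟩
    exact (closure_mono (Function.support_const_smul_subset c φ)).trans hφ.2.2

/-- A function orthogonal to all test functions vanishes almost everywhere, by the fundamental lemma
of the calculus of variations; hence the orthogonal complement is trivial. -/
lemma testSubmodule_topologicalClosure {A : Set E} (hA : IsOpen A) :
    (testSubmodule μ A).topologicalClosure = ⊤ := by
  rw [Submodule.topologicalClosure_eq_top_iff, Submodule.eq_bot_iff]
  intro f hf
  rw [Submodule.mem_orthogonal] at hf
  have hloc : LocallyIntegrableOn (f : E → ℝ) A μ := by
    have := (Lp.memLp f).locallyIntegrable (by norm_num)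
    exact locallyIntegrableOn_of_locallyIntegrable_restrict this
  have := hA.ae_eq_zero_of_integral_contDiff_smul_eq_zero (μ := μ) hloc (fun φ h1 h2 h3 => by
    have hφ : IsTest A φ := ⟨h1, h2, h3⟩
    have h4 := hf ((hφ.memLp 2).toLp φ) ⟨φ, hφ, MemLp.coeFn_toLp _⟩
    rw [L2.inner_def] at h4
    have h5 : ∫ x in A, φ x • f x ∂μ = 0 := by
      rw [← h4]
      refine integral_congr_ae ?_
      filter_upwards [(hφ.memLp (μ := μ) (B := A) 2).coeFn_toLp] with x hx
      rw [hx]; simp [mul_comm]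
    rw [← h5]
    refine (setIntegral_eq_integral_of_forall_compl_eq_zero fun x hx => ?_).symm
    rw [image_eq_zero_of_notMem_tsupport (fun h => hx (h3 h)), zero_smul])
  rw [Lp.eq_zero_iff_ae_eq_zero]
  filter_upwards [(ae_restrict_iff' hA.measurableSet).2 this] with x hx using hx

/-- Duality: the `L²(A)` norm is controlled by pairings with test functions. -/
lemma eLpNorm_le_of_forall_test {A : Set E} (hA : IsOpen A) {f : E → ℝ}
    (hf : MemLp f 2 (μ.restrict A)) {K : ℝ} (hK : 0 ≤ K)
    (h : ∀ φ, IsTest A φ → |∫ x in A, f x * φ x ∂μ| ≤ K * (eLpNorm φ 2 (μ.restrict A)).toReal) :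
    eLpNorm f 2 (μ.restrict A) ≤ ENNReal.ofReal K := by
  -- The estimate is a closed condition on `g`, so it extends from test functions to all of `L²` by
  -- density. Choosing `g` to be the class of `f` then gives `‖f‖² ≤ K ‖f‖`.
  have key : ∀ g : Lp ℝ 2 (μ.restrict A), |inner ℝ (hf.toLp f) g| ≤ K * ‖g‖ := by
    intro g
    have hg : g ∈ closure (testSubmodule μ A : Set (Lp ℝ 2 (μ.restrict A))) := by
      have := testSubmodule_topologicalClosure (μ := μ) hA
      rw [← Submodule.topologicalClosure_coe, this]; trivial
    have hcl : IsClosed {g : Lp ℝ 2 (μ.restrict A) | |inner ℝ (hf.toLp f) g| ≤ K * ‖g‖} :=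
      isClosed_le (by fun_prop) (by fun_prop)
    refine closure_minimal ?_ hcl hg
    rintro g ⟨φ, hφ, hgφ⟩
    have hφ2 : MemLp φ 2 (μ.restrict A) := hφ.memLp 2
    have : g = hφ2.toLp φ := by
      apply Lp.ext; exact hgφ.trans hφ2.coeFn_toLp.symm
    simp only [mem_ofPred_eq]
    rw [this, inner_toLp_eq_integral_mul hf hφ2, Lp.norm_toLp]
    exact h φ hφ
  have h1 := key (hf.toLp f)
  rw [real_inner_self_eq_norm_sq, abs_of_nonneg (sq_nonneg _)] at h1
  have h2 : ‖hf.toLp f‖ ≤ K := by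
    by_contra! h3
    nlinarith [norm_nonneg (hf.toLp f)]
  rw [Lp.norm_toLp] at h2
  exact (ENNReal.le_ofReal_iff_toReal_le hf.eLpNorm_ne_top hK).2 h2

end Tests

lemma IsTest.comp_sub {A D : Set (Space N)} {φ : Space N → ℝ} (h : IsTest A φ) {v : Space N}
    (hv : ∀ x ∈ A, x + v ∈ D) : IsTest D (fun x => φ (x - v)) := by
  refine ⟨h.1.comp (contDiff_id.sub contDiff_const), ?_, ?_⟩
  · exact h.2.1.comp_homeomorph (Homeomorph.subRight v)
  · intro x hx
    have := tsupport_comp_subset_preimage φ (f := fun x => x - v) (by fun_prop) hx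
    simpa using hv _ (h.2.2 this)

lemma measurePreserving_restrict_add {D : Set (Space N)} (hD : MeasurableSet D) (v : Space N) :
    MeasurePreserving (fun x : Space N => x + v) (volume.restrict ((fun x => x + v) ⁻¹' D))
      (volume.restrict D) :=
  (measurePreserving_add_right volume v).restrict_preimage hD

lemma memLp_comp_add {A D : Set (Space N)} (hD : MeasurableSet D) {v : Space N}
    (hv : ∀ x ∈ A, x + v ∈ D) {w : Space N → ℝ} (hw : MemLp w 2 (volume.restrict D)) :
    MemLp (fun x => w (x + v)) 2 (volume.restrict A) :=
  (hw.comp_measurePreserving (measurePreserving_restrict_add hD v)).mono_measure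
    (Measure.restrict_mono hv le_rfl)

lemma eLpNorm_comp_add_le {A D : Set (Space N)} (hD : MeasurableSet D) {v : Space N}
    (hv : ∀ x ∈ A, x + v ∈ D) {w : Space N → ℝ} (hw : MemLp w 2 (volume.restrict D)) :
    eLpNorm (fun x => w (x + v)) 2 (volume.restrict A) ≤ eLpNorm w 2 (volume.restrict D) := by
  rw [← eLpNorm_comp_measurePreserving hw.1 (measurePreserving_restrict_add hD v)]
  exact eLpNorm_mono_measure _ (Measure.restrict_mono hv le_rfl)

/-- Translates of a function with square integrable weak gradient. -/
lemma eLpNorm_translate_sub_le {D A : Set (Space N)} (hD : IsOpen D) (hDfin : volume D ≠ ⊤)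
    (hA : IsOpen A) {v : Space N} (hseg : ∀ x ∈ A, ∀ σ ∈ Icc (0 : ℝ) 1, x + σ • v ∈ D)
    {w : Space N → ℝ} {F : Space N → Space N} (h : HasWeakGrad D w F)
    (hw : MemLp w 2 (volume.restrict D)) (hF : MemLp F 2 (volume.restrict D)) :
    eLpNorm (fun x => w (x + v) - w x) 2 (volume.restrict A) ≤
      ENNReal.ofReal (‖v‖ * (eLpNorm F 2 (volume.restrict D)).toReal) := by
  have h0 : ∀ x ∈ A, x ∈ D := fun x hx => by simpa using hseg x hx 0 (by simp)
  have h1 : ∀ x ∈ A, x + v ∈ D := fun x hx => by simpa using hseg x hx 1 (by simp)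
  have hfin : IsFiniteMeasure (volume.restrict D) := ⟨by simpa using hDfin.lt_top⟩
  have hwA : MemLp w 2 (volume.restrict A) := hw.mono_measure (Measure.restrict_mono h0 le_rfl)
  have hwvA := memLp_comp_add hD.measurableSet h1 hw
  refine eLpNorm_le_of_forall_test hA (hwvA.sub hwA) (by positivity) fun φ hφ => ?_
  -- The translation is moved onto the test function: the pairing of `w(· + v) - w` with `φ` is `J 1
  -- - J 0`. The derivative of `J` at `σ` is a pairing of `w` with a derivative of `φ(· - σ v)`, a
  -- test function of `D` by `hseg`, so the weak gradient and Cauchy–Schwarz bound it. The mean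
  -- value inequality concludes, with no smoothing of `w`.
  set J : ℝ → ℝ := fun σ => ∫ x in D, w x * φ (x - σ • v)
  have hφσ : ∀ σ ∈ Icc (0 : ℝ) 1, IsTest D (fun x => φ (x - σ • v)) := fun σ hσ =>
    hφ.comp_sub (fun x hx => hseg x hx σ hσ)
  have hfd : Continuous (fun x => fderiv ℝ φ x v) :=
    (hφ.1.continuous_fderiv (by simp)).clm_apply continuous_const
  obtain ⟨M, hM⟩ : ∃ M, ∀ x, ‖fderiv ℝ φ x v‖ ≤ M :=
    hfd.bounded_above_of_compact_support
      ((hφ.2.1.fderiv (𝕜 := ℝ)).comp_left (g := fun L : Space N →L[ℝ] ℝ => L v) (by simp))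
  have hwint : Integrable w (volume.restrict D) := hw.integrable (by norm_num)
  have hφd : Differentiable ℝ φ := hφ.1.differentiable (by simp)
  have hderiv : ∀ σ ∈ Icc (0 : ℝ) 1, HasDerivWithinAt J
      (∫ x in D, w x * -(fderiv ℝ φ (x - σ • v) v)) (Icc 0 1) σ := by
    intro σ hσ
    refine (hasDerivAt_integral_of_dominated_loc_of_deriv_le (bound := fun x => ‖w x‖ * M)
      (F := fun σ x => w x * φ (x - σ • v)) (F' := fun σ x => w x * -(fderiv ℝ φ (x - σ • v) v))
      (s := univ) univ_mem ?_ ?_ ?_ ?_ ?_ ?_).2.hasDerivWithinAt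
    · filter_upwards with τ
      exact hw.1.mul (hφ.continuous.comp (by fun_prop)).aestronglyMeasurable
    · exact integrable_mul_of_memLp hw ((hφσ σ hσ).memLp 2)
    · exact hw.1.mul (hfd.comp (g := fun x => fderiv ℝ φ x v)
        (f := fun x => x - σ • v) (by fun_prop)).neg.aestronglyMeasurable
    · filter_upwards with x τ _
      rw [norm_mul, norm_neg]
      gcongr
      exact hM _
    · exact hwint.norm.mul_const _
    · filter_upwards with x τ _
      refine HasDerivAt.const_mul _ ?_
      have h2 : HasDerivAt (fun τ : ℝ => x - τ • v) (-v) τ := by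
        simpa using ((hasDerivAt_id τ).smul_const v).const_sub x
      have := (hφd (x - τ • v)).hasFDerivAt.comp_hasDerivAt τ h2
      rw [map_neg] at this
      exact this
  have hbound : ∀ σ ∈ Ico (0 : ℝ) 1, ‖∫ x in D, w x * -(fderiv ℝ φ (x - σ • v) v)‖ ≤
      ‖v‖ * (eLpNorm F 2 (volume.restrict D)).toReal *
        (eLpNorm φ 2 (volume.restrict A)).toReal := by
    intro σ hσ
    have ht := hφσ σ ⟨hσ.1, hσ.2.le⟩
    have hwg := h.2.2 _ ht v
    have e1 : ∫ x in D, w x * -(fderiv ℝ φ (x - σ • v) v) =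
        ∫ x in D, inner ℝ (F x) (φ (x - σ • v) • v) := by
      have : ∀ x, fderiv ℝ (fun x => φ (x - σ • v)) x v = fderiv ℝ φ (x - σ • v) v := by
        intro x; rw [fderiv_comp_sub]
      simp only [this] at hwg
      simp only [mul_neg, integral_neg, hwg, neg_neg, inner_smul_right]
    have hm : MemLp (fun x => φ (x - σ • v) • v) 2 (volume.restrict D) :=
      (ContinuousLinearMap.toSpanSingleton ℝ v).comp_memLp' (ht.memLp 2)
    rw [e1, Real.norm_eq_abs]
    refine (abs_integral_inner_le hF hm).trans ?_
    have : (eLpNorm (fun x => φ (x - σ • v) • v) 2 (volume.restrict D)).toReal ≤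
        (eLpNorm φ 2 (volume.restrict A)).toReal * ‖v‖ := by
      have e2 : eLpNorm (fun x => φ (x - σ • v) • v) 2 (volume.restrict D) ≤
          eLpNorm φ 2 (volume.restrict A) * ‖v‖ₑ := by
        calc eLpNorm (fun x => φ (x - σ • v) • v) 2 (volume.restrict D)
            ≤ eLpNorm (fun x => φ (x - σ • v) • v) 2 volume :=
              eLpNorm_mono_measure _ Measure.restrict_le_self
          _ = eLpNorm ((fun x => φ x • v) ∘ (fun x => x - σ • v)) 2 volume := rfl
          _ = eLpNorm (fun x => φ x • v) 2 volume :=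
              eLpNorm_comp_measurePreserving
                ((hφ.continuous.smul continuous_const).aestronglyMeasurable)
                (measurePreserving_sub_right volume _)
          _ = eLpNorm (fun x => ‖v‖ • φ x) 2 volume := by
              refine eLpNorm_congr_norm_ae (ae_of_all _ fun x => ?_)
              simp [norm_smul, mul_comm]
          _ = ‖v‖ₑ * eLpNorm φ 2 volume := by
              rw [show (fun x => ‖v‖ • φ x) = ‖v‖ • φ from rfl, eLpNorm_const_smul, enorm_norm]
          _ = eLpNorm φ 2 (volume.restrict A) * ‖v‖ₑ := by
              rw [mul_comm, eLpNorm_restrict_eq_of_support_subset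
                ((subset_tsupport _).trans hφ.2.2)]
      refine (ENNReal.toReal_mono ?_ e2).trans (by simp)
      exact ENNReal.mul_ne_top (hφ.memLp 2).eLpNorm_ne_top (by simp)
    calc _ ≤ (eLpNorm F 2 (volume.restrict D)).toReal *
        ((eLpNorm φ 2 (volume.restrict A)).toReal * ‖v‖) := by gcongr
      _ = _ := by ring
  have hJ := norm_image_sub_le_of_norm_deriv_le_segment_01' hderiv hbound
  have e3 : ∫ x in A, (w (x + v) - w x) * φ x = J 1 - J 0 := by
    have hz : ∀ x, x ∉ A → φ x = 0 := fun x hx =>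
      image_eq_zero_of_notMem_tsupport (fun h => hx (hφ.2.2 h))
    have a1 : J 1 = ∫ x in A, w (x + v) * φ x := by
      have : J 1 = ∫ x, w x * φ (x - v) := by
        simp only [J, one_smul]
        refine setIntegral_eq_integral_of_forall_compl_eq_zero fun x hx => ?_
        rw [hz (x - v) (fun h => hx (by simpa using h1 _ h)), mul_zero]
      rw [this, ← integral_add_right_eq_self _ v]
      simp only [add_sub_cancel_right]
      refine (setIntegral_eq_integral_of_forall_compl_eq_zero fun x hx => ?_).symm
      rw [hz x hx, mul_zero]
    have a0 : J 0 = ∫ x in A, w x * φ x := by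
      simp only [J, zero_smul, sub_zero]
      rw [setIntegral_eq_integral_of_forall_compl_eq_zero,
        setIntegral_eq_integral_of_forall_compl_eq_zero]
      · intro x hx; rw [hz x hx, mul_zero]
      · intro x hx; rw [hz x (fun h => hx (h0 _ h)), mul_zero]
    rw [a1, a0, ← integral_sub (integrable_mul_of_memLp hwvA (hφ.memLp 2))
      (integrable_mul_of_memLp hwA (hφ.memLp 2))]
    simp only [sub_mul]
  simp only [Pi.sub_apply]
  rw [e3]
  exact hJ

end Perforated

/-! ### Poincaré inequalities on bounded connected open sets. -/

namespace Perforated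
variable {N : ℕ}

/-- The functions with square integrable weak gradient on `D` are controlled in `L²(A)`, up to a
constant, by the `L²(D)` norm of the gradient. -/
def OscControl (D A : Set (Space N)) : Prop :=
  ∃ C : ENNReal, C ≠ ⊤ ∧ ∀ (w : Space N → ℝ) (F : Space N → Space N), HasWeakGrad D w F →
    MemLp w 2 (volume.restrict D) → MemLp F 2 (volume.restrict D) →
    ∃ m : ℝ, eLpNorm (fun x => w x - m) 2 (volume.restrict A) ≤ C * eLpNorm F 2 (volume.restrict D)

lemma OscControl.mono {D A B : Set (Space N)} (h : OscControl D A) (hBA : B ⊆ A) :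
    OscControl D B := by
  obtain ⟨C, hC, h⟩ := h
  refine ⟨C, hC, fun w F h1 h2 h3 => ?_⟩
  obtain ⟨m, hm⟩ := h w F h1 h2 h3
  exact ⟨m, (eLpNorm_mono_measure _ (Measure.restrict_mono hBA le_rfl)).trans hm⟩

lemma ennreal_le_of_sq_le_sq {a b : ENNReal} (h : a ^ 2 ≤ b ^ 2) : a ≤ b := by
  by_contra! h2
  exact absurd (ENNReal.pow_lt_pow_left (n := 2) (by norm_num) h2) (not_lt.2 h)

lemma eLpNorm_restrict_union_le {α E : Type*} [MeasurableSpace α] [NormedAddCommGroup E]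
    {μ : Measure α} (A B : Set α) (f : α → E) :
    eLpNorm f 2 (μ.restrict (A ∪ B)) ≤
      eLpNorm f 2 (μ.restrict A) + eLpNorm f 2 (μ.restrict B) := by
  apply ennreal_le_of_sq_le_sq
  calc _ ≤ eLpNorm f 2 (μ.restrict A) ^ 2 + eLpNorm f 2 (μ.restrict B) ^ 2 := by
        rw [eLpNorm_two_sq, eLpNorm_two_sq, eLpNorm_two_sq]
        exact lintegral_union_le _ _ _
    _ ≤ _ := by
        rw [add_sq]
        gcongr
        exact le_self_add

lemma HasWeakGrad.congr_left {D : Set (Space N)} {w w' : Space N → ℝ} {F : Space N → Space N}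
    (h : HasWeakGrad D w F) (hw' : IntegrableOn w' D) (hww : w =ᵐ[volume.restrict D] w') :
    HasWeakGrad D w' F := by
  refine ⟨hw'.locallyIntegrableOn, h.2.1, fun φ hφ ξ => ?_⟩
  rw [← h.2.2 φ hφ ξ]
  refine integral_congr_ae ?_
  filter_upwards [hww] with x hx
  rw [hx]

/-- The translation estimate is averaged over all pairs of points of `B`. With `z = y - x`, the
double integral of `|w y - w x|²` becomes an integral over `z` of `‖w(· + z) - w‖²` on `B ∩ (B -
z)`. Convexity keeps the segments inside `B`, and only `z` in a ball of radius `R` contribute, each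
at most `(R ‖F‖)²`. Some `x` in `B` does no worse than the average. -/
lemma oscControl_of_convex {D B : Set (Space N)} (hD : IsOpen D) (hDfin : volume D ≠ ⊤)
    (hB : IsOpen B) (hBc : Convex ℝ B) (hBb : Bornology.IsBounded B) (hne : B.Nonempty)
    (hBD : B ⊆ D) : OscControl D B := by
  obtain ⟨R, hRpos, hR⟩ : ∃ R : ℝ, 0 < R ∧ ∀ x ∈ B, ∀ y ∈ B, ‖y - x‖ < R := by
    refine ⟨Metric.diam B + 1, by positivity, fun x hx y hy => ?_⟩
    have := Metric.dist_le_diam_of_mem hBb hy hx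
    rw [dist_eq_norm] at this; linarith
  have hBpos : volume B ≠ 0 := (hB.measure_pos volume hne).ne'
  have hBfin : volume B ≠ ⊤ := hBb.measure_lt_top.ne
  set V : ENNReal := volume (Metric.ball (0 : Space N) R)
  have hV : V ≠ ⊤ := measure_ball_lt_top.ne
  refine ⟨((volume B)⁻¹ * V) ^ (1 / 2 : ℝ) * ENNReal.ofReal R, ?_, fun w₀ F h0 hw0 hF => ?_⟩
  · refine ENNReal.mul_ne_top (ENNReal.rpow_ne_top_of_nonneg (by norm_num) ?_) (by simp)
    exact ENNReal.mul_ne_top (ENNReal.inv_ne_top.2 hBpos) hV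
  have hfin : IsFiniteMeasure (volume.restrict D) := ⟨by simpa using hDfin.lt_top⟩
  -- A measurable representative: the value of `w` at a single point will serve as the constant, and
  -- Tonelli's theorem is applied to the function of two variables.
  set w := hw0.1.mk w₀
  have hwm : StronglyMeasurable w := hw0.1.stronglyMeasurable_mk
  have hww : w₀ =ᵐ[volume.restrict D] w := hw0.1.ae_eq_mk
  have hw : MemLp w 2 (volume.restrict D) := hw0.ae_eq hww
  have h : HasWeakGrad D w F := h0.congr_left (hw.integrable (by norm_num)) hww
  set f : Space N → Space N → ENNReal :=
    fun x y => B.indicator (fun _ => 1) x * B.indicator (fun _ => 1) y * ‖w y - w x‖ₑ ^ 2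
  have hfm : Measurable (Function.uncurry f) := by
    have hi : Measurable (B.indicator (fun _ => (1 : ENNReal))) :=
      measurable_const.indicator hB.measurableSet
    have hwm' := hwm.measurable
    refine ((hi.comp measurable_fst).mul (hi.comp measurable_snd)).mul ?_
    exact ((hwm'.comp measurable_snd).sub (hwm'.comp measurable_fst)).enorm.pow_const 2
  set K : ENNReal := ENNReal.ofReal R * eLpNorm F 2 (volume.restrict D)
  have hz : ∀ z : Space N, ∫⁻ x, f x (x + z) ≤
      (Metric.ball (0 : Space N) R).indicator (fun _ => K ^ 2) z := by
    intro z
    set A : Set (Space N) := B ∩ (fun x => x + z) ⁻¹' B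
    have hA : IsOpen A := hB.inter (hB.preimage (by fun_prop))
    have e1 : ∀ x, f x (x + z) = A.indicator (fun x => ‖w (x + z) - w x‖ₑ ^ 2) x := by
      intro x
      simp only [f, A, indicator]
      by_cases h1 : x ∈ B <;> by_cases h2 : x + z ∈ B <;> simp [h1, h2]
    simp only [e1]
    rw [lintegral_indicator hA.measurableSet]
    by_cases hzR : z ∈ Metric.ball (0 : Space N) R
    · rw [indicator_of_mem hzR, ← eLpNorm_two_sq]
      have h3 := eLpNorm_translate_sub_le hD hDfin hA (v := z) (fun x hx σ hσ => hBD (by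
        have := hBc hx.1 hx.2 (a := 1 - σ) (b := σ) (by linarith [hσ.2]) hσ.1 (by ring)
        convert this using 1
        module)) h hw hF
      gcongr
      refine h3.trans ?_
      rw [ENNReal.ofReal_mul (norm_nonneg _), ENNReal.ofReal_toReal hF.eLpNorm_ne_top]
      simp only [K]
      gcongr
      simpa using (mem_ball_zero_iff.1 hzR).le
    · have hAe : A = ∅ := by
        rw [eq_empty_iff_forall_notMem]
        intro x hx
        apply hzR
        have := hR x hx.1 (x + z) hx.2
        simpa using this
      simp [hAe]
  have htot : ∫⁻ x, ∫⁻ y, f x y ≤ V * K ^ 2 := by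
    calc ∫⁻ x, ∫⁻ y, f x y = ∫⁻ x, ∫⁻ z, f x (x + z) := by
          refine lintegral_congr fun x => ?_
          exact (lintegral_add_left_eq_self (fun y => f x y) x).symm
      _ = ∫⁻ z, ∫⁻ x, f x (x + z) := by
          refine lintegral_lintegral_swap (f := fun x z => f x (x + z)) ?_
          exact (hfm.comp (measurable_fst.prodMk (measurable_fst.add measurable_snd))).aemeasurable
      _ ≤ ∫⁻ z, (Metric.ball (0 : Space N) R).indicator (fun _ => K ^ 2) z := lintegral_mono hz
      _ = V * K ^ 2 := by
          rw [lintegral_indicator measurableSet_ball, setLIntegral_const, mul_comm]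
  -- The constant approximating `w` on `B` is `w x` at a point where the inner integral is at most
  -- its average over `B`.
  obtain ⟨x, hxB, hx⟩ := exists_le_setLAverage (μ := volume) (s := B) (f := fun x => ∫⁻ y, f x y)
    hBpos hBfin (hfm.lintegral_prod_right').aemeasurable
  refine ⟨w x, ?_⟩
  have e2 : eLpNorm (fun y => w₀ y - w x) 2 (volume.restrict B) =
      eLpNorm (fun y => w y - w x) 2 (volume.restrict B) := by
    refine eLpNorm_congr_ae ?_
    filter_upwards [ae_mono (Measure.restrict_mono hBD le_rfl) hww] with y hy
    rw [hy]
  rw [e2]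
  apply ennreal_le_of_sq_le_sq
  have e3 : eLpNorm (fun y => w y - w x) 2 (volume.restrict B) ^ 2 = ∫⁻ y, f x y := by
    rw [eLpNorm_two_sq, ← lintegral_indicator hB.measurableSet]
    refine lintegral_congr fun y => ?_
    simp only [f, indicator]
    by_cases h1 : y ∈ B <;> simp [h1, hxB]
  rw [e3]
  refine hx.trans ?_
  rw [setLAverage_eq, ENNReal.div_eq_inv_mul]
  calc (volume B)⁻¹ * ∫⁻ x in B, ∫⁻ y, f x y ≤ (volume B)⁻¹ * (V * K ^ 2) := by
        gcongr
        exact (setLIntegral_le_lintegral _ _).trans htot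
    _ = _ := by
        have hs : (((volume B)⁻¹ * V) ^ (1 / 2 : ℝ)) ^ 2 = (volume B)⁻¹ * V := by
          rw [← ENNReal.rpow_natCast, ← ENNReal.rpow_mul]
          norm_num
        rw [mul_assoc _ _ (eLpNorm F 2 _), mul_pow (_ ^ (1 / 2 : ℝ)), hs, mul_assoc]

/-- On the overlap `w` is close to both constants, so `|m₂ - m₁| |A ∩ B|^(1/2)` is at most `(C₁ +
C₂) ‖F‖`. Since the overlap has positive measure, `m₁` can replace `m₂` on `B`. -/
lemma OscControl.union {D A B : Set (Space N)} (hA : OscControl D A) (hB : OscControl D B)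
    (hAD : A ⊆ D) (hBD : B ⊆ D) (hDfin : volume D ≠ ⊤) (hAB : volume (A ∩ B) ≠ 0) :
    OscControl D (A ∪ B) := by
  obtain ⟨C₁, hC₁, hA⟩ := hA
  obtain ⟨C₂, hC₂, hB⟩ := hB
  have hI : volume (A ∩ B) ≠ ⊤ := measure_ne_top_of_subset (inter_subset_left.trans hAD) hDfin
  have hBf : volume B ≠ ⊤ := measure_ne_top_of_subset hBD hDfin
  set a : ENNReal := volume (A ∩ B) ^ (1 / 2 : ℝ)
  have ha0 : a ≠ 0 := by simp [a, hAB, hI]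
  have hat : a ≠ ⊤ := ENNReal.rpow_ne_top_of_nonneg (by norm_num) hI
  set b : ENNReal := volume B ^ (1 / 2 : ℝ)
  have hbt : b ≠ ⊤ := ENNReal.rpow_ne_top_of_nonneg (by norm_num) hBf
  refine ⟨C₁ + (C₂ + (C₁ + C₂) * a⁻¹ * b), ?_, fun w F h hw hF => ?_⟩
  · refine ENNReal.add_ne_top.2 ⟨hC₁, ENNReal.add_ne_top.2 ⟨hC₂, ?_⟩⟩
    refine ENNReal.mul_ne_top (ENNReal.mul_ne_top (ENNReal.add_ne_top.2 ⟨hC₁, hC₂⟩) ?_) hbt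
    exact ENNReal.inv_ne_top.2 ha0
  obtain ⟨m₁, h1⟩ := hA w F h hw hF
  obtain ⟨m₂, h2⟩ := hB w F h hw hF
  refine ⟨m₁, (eLpNorm_restrict_union_le A B _).trans ?_⟩
  have hconst : ∀ (S : Set (Space N)) (c : ℝ), volume S ≠ 0 →
      eLpNorm (fun _ => c) 2 (volume.restrict S) = ‖c‖ₑ * volume S ^ (1 / 2 : ℝ) := by
    intro S c hS
    rw [eLpNorm_const _ (by norm_num) (by rwa [Ne, Measure.restrict_eq_zero])]
    simp
  have meas : ∀ (S : Set (Space N)) (m : ℝ), S ⊆ D →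
      AEStronglyMeasurable (fun x => w x - m) (volume.restrict S) := fun S m hS =>
    (hw.1.mono_measure (Measure.restrict_mono hS le_rfl)).sub aestronglyMeasurable_const
  set f := eLpNorm F 2 (volume.restrict D)
  have hd : ‖m₂ - m₁‖ₑ ≤ (C₁ + C₂) * f * a⁻¹ := by
    have : ‖m₂ - m₁‖ₑ * a ≤ (C₁ + C₂) * f := by
      rw [← hconst _ _ hAB]
      have e : (fun _ : Space N => m₂ - m₁) = (fun x => w x - m₁) - (fun x => w x - m₂) := by
        ext x; simp
      rw [e]
      refine (eLpNorm_sub_le (meas _ _ (inter_subset_left.trans hAD))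
        (meas _ _ (inter_subset_left.trans hAD)) (by norm_num)).trans ?_
      rw [add_mul]
      refine add_le_add ((eLpNorm_mono_measure _ ?_).trans h1) ((eLpNorm_mono_measure _ ?_).trans h2)
      · exact Measure.restrict_mono inter_subset_left le_rfl
      · exact Measure.restrict_mono inter_subset_right le_rfl
    rw [← div_eq_mul_inv]
    rwa [ENNReal.le_div_iff_mul_le (Or.inl ha0) (Or.inl hat)]
  have hB0 : volume B ≠ 0 := fun h0 => hAB (measure_mono_null inter_subset_right h0)
  have h3 : eLpNorm (fun x => w x - m₁) 2 (volume.restrict B) ≤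
      C₂ * f + (C₁ + C₂) * f * a⁻¹ * b := by
    have e : (fun x => w x - m₁) = (fun x => w x - m₂) + (fun _ : Space N => m₂ - m₁) := by
      ext x; simp
    rw [e]
    refine (eLpNorm_add_le (meas _ _ hBD) aestronglyMeasurable_const (by norm_num)).trans ?_
    rw [hconst _ _ hB0]
    gcongr
  calc _ ≤ C₁ * f + (C₂ * f + (C₁ + C₂) * f * a⁻¹ * b) := add_le_add h1 h3
    _ = _ := by ring

/-- Writing `w x = w (x + v) - (w (x + v) - w x)`, the first term is controlled in `B` and the
second by the translation estimate. Nothing is asked of the shape of `A`, so pieces of `D` that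
touch the boundary are covered. -/
lemma OscControl.union_translate {D A B : Set (Space N)} (hB : OscControl D B) (hD : IsOpen D)
    (hDfin : volume D ≠ ⊤) (hA : IsOpen A) (hBm : IsOpen B) (hBD : B ⊆ D) {v : Space N}
    (hseg : ∀ x ∈ A, ∀ σ ∈ Icc (0 : ℝ) 1, x + σ • v ∈ D) (hAB : ∀ x ∈ A, x + v ∈ B) :
    OscControl D (A ∪ B) := by
  obtain ⟨C, hC, hB⟩ := hB
  have hAD : ∀ x ∈ A, x ∈ D := fun x hx => by simpa using hseg x hx 0 (by simp)
  refine ⟨ENNReal.ofReal ‖v‖ + C + C, by simp [hC], fun w F h hw hF => ?_⟩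
  obtain ⟨m, hm⟩ := hB w F h hw hF
  refine ⟨m, (eLpNorm_restrict_union_le A B _).trans ?_⟩
  rw [add_mul]
  refine add_le_add ?_ hm
  have hfin : IsFiniteMeasure (volume.restrict D) := ⟨by simpa using hDfin.lt_top⟩
  have hwB : MemLp (fun x => w x - m) 2 (volume.restrict B) :=
    (hw.sub (memLp_const m)).mono_measure (Measure.restrict_mono hBD le_rfl)
  have e : (fun x => w x - m) =
      (fun x => (fun x => w x - m) (x + v)) - (fun x => w (x + v) - w x) := by
    ext x; simp
  have hwA : MemLp w 2 (volume.restrict A) := hw.mono_measure (Measure.restrict_mono hAD le_rfl)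
  have hwv : MemLp (fun x => w (x + v)) 2 (volume.restrict A) :=
    memLp_comp_add hD.measurableSet (fun x hx => hBD (hAB x hx)) hw
  rw [e, add_mul, add_comm (_ * _)]
  refine (eLpNorm_sub_le (memLp_comp_add hBm.measurableSet hAB hwB).1
    (hwv.1.sub hwA.1) (by norm_num)).trans (add_le_add ?_ ?_)
  · exact (eLpNorm_comp_add_le hBm.measurableSet hAB hwB).trans hm
  · refine (eLpNorm_translate_sub_le hD hDfin hA hseg h hw hF).trans ?_
    rw [ENNReal.ofReal_mul (norm_nonneg _), ENNReal.ofReal_toReal hF.eLpNorm_ne_top]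

/-- Gradient control on a bounded connected open set whose boundary points can be moved inside. -/
lemma oscControl_self {D : Set (Space N)} (hD : IsOpen D) (hDb : Bornology.IsBounded D)
    (hDc : IsConnected D)
    (hbd : ∀ p ∈ frontier D, ∃ U ∈ 𝓝 p, ∃ v : Space N, p + v ∈ D ∧
      ∀ x ∈ U ∩ D, ∀ σ ∈ Icc (0 : ℝ) 1, x + σ • v ∈ D) : OscControl D D := by
  have hDfin : volume D ≠ ⊤ := hDb.measure_lt_top.ne
  have hball : ∀ x ∈ D, ∃ r > 0, Metric.ball x r ⊆ D ∧ OscControl D (Metric.ball x r) := by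
    intro x hx
    obtain ⟨r, hr, hrD⟩ := Metric.isOpen_iff.1 hD x hx
    exact ⟨r, hr, hrD, oscControl_of_convex hD hDfin Metric.isOpen_ball (convex_ball x r)
      Metric.isBounded_ball ⟨x, Metric.mem_ball_self hr⟩ hrD⟩
  have hun : ∀ A B : Set (Space N), IsOpen A → IsOpen B → A ⊆ D → B ⊆ D → OscControl D A →
      OscControl D B → (A ∩ B).Nonempty → OscControl D (A ∪ B) := fun A B hA hB hAD hBD h1 h2 hne =>
    h1.union h2 hAD hBD hDfin ((hA.inter hB).measure_pos volume hne).ne'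
  -- Lying in a common controlled open set is a symmetric and transitive relation, since sets
  -- sharing a point can be united, and it holds between nearby points because of the balls. By
  -- connectedness it relates all points of `D`.
  have hchain : ∀ x ∈ D, ∀ y ∈ D, ∃ A, IsOpen A ∧ A ⊆ D ∧ x ∈ A ∧ y ∈ A ∧ OscControl D A := by
    intro x hx y hy
    refine hDc.isPreconnected.induction₂
      (fun x y => ∃ A, IsOpen A ∧ A ⊆ D ∧ x ∈ A ∧ y ∈ A ∧ OscControl D A) ?_ ?_ ?_ hx hy
    · intro x hx
      obtain ⟨r, hr, hrD, h⟩ := hball x hx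
      filter_upwards [mem_nhdsWithin_of_mem_nhds (Metric.ball_mem_nhds x hr)] with y hy
      exact ⟨_, Metric.isOpen_ball, hrD, Metric.mem_ball_self hr, hy, h⟩
    · rintro x y z - - - ⟨A, hA, hAD, hxA, hyA, h1⟩ ⟨B, hB, hBD, hyB, hzB, h2⟩
      exact ⟨A ∪ B, hA.union hB, union_subset hAD hBD, Or.inl hxA, Or.inr hzB,
        hun A B hA hB hAD hBD h1 h2 ⟨y, hyA, hyB⟩⟩
    · rintro x y - - ⟨A, hA, hAD, hxA, hyA, h1⟩
      exact ⟨A, hA, hAD, hyA, hxA, h1⟩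
  obtain ⟨x₀, hx₀⟩ := hDc.nonempty
  have hcomp : IsCompact (closure D) := hDb.isCompact_closure
  -- Compactness of the closure reduces the claim to neighbourhoods of single points. Requiring the
  -- base point `x₀` in every controlled set makes any two of them overlap, so that finite unions
  -- remain controlled.
  obtain ⟨A, -, -, -, hDA, h⟩ := hcomp.induction_on
    (p := fun s => ∃ A, IsOpen A ∧ A ⊆ D ∧ x₀ ∈ A ∧ s ∩ D ⊆ A ∧ OscControl D A)
    (by
      obtain ⟨A, h1, h2, h3, -, h5⟩ := hchain x₀ hx₀ x₀ hx₀
      exact ⟨A, h1, h2, h3, by simp, h5⟩)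
    (by
      rintro s t hst ⟨A, h1, h2, h3, h4, h5⟩
      exact ⟨A, h1, h2, h3, (inter_subset_inter_left _ hst).trans h4, h5⟩)
    (by
      rintro s t ⟨A, h1, h2, h3, h4, h5⟩ ⟨B, h1', h2', h3', h4', h5'⟩
      refine ⟨A ∪ B, h1.union h1', union_subset h2 h2', Or.inl h3, ?_,
        hun A B h1 h1' h2 h2' h5 h5' ⟨x₀, h3, h3'⟩⟩
      rw [union_inter_distrib_right]
      exact union_subset_union h4 h4')
    (by
      intro p hp
      by_cases hpD : p ∈ D
      · obtain ⟨A, h1, h2, h3, h4, h5⟩ := hchain x₀ hx₀ p hpD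
        exact ⟨A, mem_nhdsWithin_of_mem_nhds (h1.mem_nhds h4), A, h1, h2, h3, inter_subset_left, h5⟩
      -- Near a boundary point the part of `D` is pushed by `v` into a ball inside `D`, and this
      -- ball is linked to `x₀` by a controlled set.
      · obtain ⟨U, hU, v, hpv, hseg⟩ := hbd p ⟨hp, by rwa [hD.interior_eq]⟩
        obtain ⟨r, hr, hrD, hb⟩ := hball _ hpv
        set b := Metric.ball (p + v) r
        have hU' : interior U ∩ (fun x => x + v) ⁻¹' b ∈ 𝓝 p :=
          inter_mem (interior_mem_nhds.2 hU) ((by fun_prop : Continuous (fun x : Space N => x + v)).continuousAt.preimage_mem_nhds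
            (Metric.ball_mem_nhds _ hr))
        set W := interior U ∩ (fun x => x + v) ⁻¹' b
        have hWo : IsOpen W := isOpen_interior.inter (Metric.isOpen_ball.preimage (by fun_prop))
        have hWD : OscControl D ((W ∩ D) ∪ b) :=
          hb.union_translate hD hDfin (hWo.inter hD) Metric.isOpen_ball hrD
            (fun x hx σ hσ => hseg x ⟨interior_subset hx.1.1, hx.2⟩ σ hσ) (fun x hx => hx.1.2)
        obtain ⟨A, h1, h2, h3, h4, h5⟩ := hchain x₀ hx₀ _ hpv
        have hpb : p + v ∈ b := Metric.mem_ball_self hr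
        refine ⟨W, mem_nhdsWithin_of_mem_nhds hU', A ∪ ((W ∩ D) ∪ b),
          h1.union ((hWo.inter hD).union Metric.isOpen_ball),
          union_subset h2 (union_subset inter_subset_right hrD), Or.inl h3,
          fun x hx => Or.inr (Or.inl hx), ?_⟩
        exact hun _ _ h1 ((hWo.inter hD).union Metric.isOpen_ball) h2
          (union_subset inter_subset_right hrD) h5 hWD ⟨p + v, h4, Or.inr hpb⟩)
  exact h.mono fun x hx => hDA ⟨subset_closure hx, hx⟩

/-- For mean-free `w` and any constant `m`, `‖w‖² = ∫ w (w - m) ≤ ‖w‖ ‖w - m‖`, so removing a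
constant cannot decrease the norm. -/
lemma OscControl.poincare {D : Set (Space N)} (h : OscControl D D) (hDfin : volume D ≠ ⊤) :
    ∃ C : ENNReal, C ≠ ⊤ ∧ ∀ (w : Space N → ℝ) (F : Space N → Space N), HasWeakGrad D w F →
      MemLp w 2 (volume.restrict D) → MemLp F 2 (volume.restrict D) → ∫ x in D, w x = 0 →
      eLpNorm w 2 (volume.restrict D) ≤ C * eLpNorm F 2 (volume.restrict D) := by
  obtain ⟨C, hC, h⟩ := h
  refine ⟨C, hC, fun w F h1 hw hF h0 => ?_⟩
  have hfin : IsFiniteMeasure (volume.restrict D) := ⟨by simpa using hDfin.lt_top⟩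
  obtain ⟨m, hm⟩ := h w F h1 hw hF
  refine le_trans ?_ hm
  have hwm : MemLp (fun x => w x - m) 2 (volume.restrict D) := hw.sub (memLp_const m)
  have e : ∫ x in D, w x * w x = ∫ x in D, w x * (w x - m) := by
    simp only [mul_sub]
    rw [integral_sub (integrable_mul_of_memLp hw hw)
      ((hw.integrable (by norm_num)).mul_const m), integral_mul_const, h0]
    simp
  have h2 := abs_integral_mul_le hw hwm
  rw [← e, ← inner_toLp_eq_integral_mul hw hw, real_inner_self_eq_norm_sq, Lp.norm_toLp,
    abs_of_nonneg (sq_nonneg _)] at h2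
  rw [← ENNReal.toReal_le_toReal hw.eLpNorm_ne_top hwm.eLpNorm_ne_top]
  by_contra! h3
  have := ENNReal.toReal_nonneg (a := eLpNorm (fun x => w x - m) 2 (volume.restrict D))
  nlinarith

end Perforated

/-! ### Geometry of the unit cell and its Poincaré inequality. -/

namespace Perforated
variable {N : ℕ}

lemma unitCube_eq_iInter : unitCube N = ⋂ i : Fin N, (fun y : Space N => y i) ⁻¹' Ioo 0 1 := by
  ext y; simp [unitCube]

lemma isOpen_unitCube : IsOpen (unitCube N) := by
  rw [unitCube_eq_iInter]
  refine isOpen_iInter_of_finite fun i => ?_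
  exact isOpen_Ioo.preimage (by fun_prop)

lemma norm_le_of_forall_abs_le_one {y : Space N} (h : ∀ i, |y i| ≤ 1) : ‖y‖ ≤ Real.sqrt N := by
  rw [EuclideanSpace.norm_eq]
  refine Real.sqrt_le_sqrt ?_
  calc ∑ i, ‖y i‖ ^ 2 ≤ ∑ _i : Fin N, (1 : ℝ) := by
        refine Finset.sum_le_sum fun i _ => ?_
        rw [Real.norm_eq_abs]
        exact pow_le_one₀ (abs_nonneg _) (h i)
    _ = N := by simp

lemma isBounded_unitCube : Bornology.IsBounded (unitCube N) := by
  refine (Metric.isBounded_closedBall (x := (0 : Space N)) (r := Real.sqrt N)).subset fun y hy => ?_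
  rw [mem_closedBall_zero_iff]
  refine norm_le_of_forall_abs_le_one fun i => ?_
  rw [abs_le]
  constructor <;> linarith [(hy i).1, (hy i).2]

lemma isOpen_solidCell {YH : Set (Space N)} (hY : IsCompact YH) : IsOpen (solidCell YH) :=
  isOpen_unitCube.sdiff hY.isClosed

lemma isBounded_solidCell {YH : Set (Space N)} : Bornology.IsBounded (solidCell YH) :=
  isBounded_unitCube.subset sdiff_subset

lemma closure_unitCube_subset : closure (unitCube N) ⊆ {y | ∀ i, 0 ≤ y i ∧ y i ≤ 1} := by
  refine closure_minimal (fun y hy i => ⟨(hy i).1.le, (hy i).2.le⟩) ?_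
  have : {y : Space N | ∀ i, 0 ≤ y i ∧ y i ≤ 1} =
      ⋂ i, (fun y : Space N => y i) ⁻¹' Icc 0 1 := by
    ext; simp
  rw [this]
  exact isClosed_iInter fun i => isClosed_Icc.preimage (by fun_prop)

/-- Near `p` the hole is `{f ≤ 0}` with a nonzero derivative of `f`. Along a direction `e` of
increase, `f` is strictly increasing near `p`, so short moves along `e` never enter the hole from
outside, and they leave it from `p` itself. -/
lemma exists_inward_of_mem_frontier_hole {YH : Set (Space N)} (hY : IsCompact YH)
    (hYY : YH ⊆ unitCube N) (hYs : HasSmoothBoundary YH) {p : Space N}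
    (hp : p ∈ closure (solidCell YH)) (hpY : p ∈ YH) :
    ∃ U ∈ 𝓝 p, ∃ v : Space N, p + v ∈ solidCell YH ∧
      ∀ x ∈ U ∩ solidCell YH, ∀ σ ∈ Icc (0 : ℝ) 1, x + σ • v ∈ solidCell YH := by
  have hpf : p ∈ frontier YH := by
    rw [frontier_eq_closure_inter_closure]
    exact ⟨subset_closure hpY, closure_mono (fun x hx => hx.2) hp⟩
  obtain ⟨U, f, hU, hpU, hf, hdf, hint, hcl⟩ := hYs p hpf
  rw [hY.isClosed.closure_eq] at hcl
  obtain ⟨e, he⟩ : ∃ e, 0 < fderiv ℝ f p e := by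
    by_contra! hcon
    apply hdf
    ext e
    have h1 := hcon e
    have h2 := hcon (-e)
    rw [map_neg] at h2
    simp only [zero_apply]
    linarith
  have hcont : ContinuousOn (fun x => fderiv ℝ f x e) U :=
    (hf.continuousOn_fderiv_of_isOpen hU (by simp)).clm_apply continuousOn_const
  have hnhds : {x | 0 < fderiv ℝ f x e} ∩ U ∩ unitCube N ∈ 𝓝 p :=
    inter_mem (inter_mem ((hcont.continuousAt (hU.mem_nhds hpU)).eventually (lt_mem_nhds he))
      (hU.mem_nhds hpU)) (isOpen_unitCube.mem_nhds (hYY hpY))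
  obtain ⟨ρ, hρ, hball⟩ := Metric.mem_nhds_iff.1 hnhds
  -- This makes `‖v‖ < ρ/2`: segments along `v` that start in the ball of radius `ρ/2` stay in the
  -- ball of radius `ρ`, where the derivative along `e` is positive and the cube is not left.
  set c : ℝ := ρ / (4 * (‖e‖ + 1))
  have hc : 0 < c := by positivity
  set v := c • e
  have hv : ‖v‖ < ρ / 2 := by
    rw [norm_smul, Real.norm_of_nonneg hc.le]
    have : c * (‖e‖ + 1) = ρ / 4 := by
      simp only [c]; field_simp
    nlinarith [norm_nonneg e]
  have hmem : ∀ x ∈ Metric.ball p (ρ / 2), ∀ σ ∈ Icc (0 : ℝ) 1, x + σ • v ∈ Metric.ball p ρ := by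
    intro x hx σ hσ
    rw [mem_ball_iff_norm] at hx ⊢
    have h1 : ‖σ • v‖ ≤ ‖v‖ := by
      rw [norm_smul, Real.norm_of_nonneg hσ.1]
      nlinarith [norm_nonneg v, hσ.2]
    calc ‖x + σ • v - p‖ = ‖(x - p) + σ • v‖ := by congr 1; abel
      _ ≤ ‖x - p‖ + ‖σ • v‖ := norm_add_le _ _
      _ < ρ := by linarith
  have hmono : ∀ x ∈ Metric.ball p (ρ / 2), StrictMonoOn (fun σ : ℝ => f (x + σ • v)) (Icc 0 1) := by
    intro x hx
    have hd : ∀ σ ∈ Icc (0 : ℝ) 1,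
        HasDerivAt (fun σ : ℝ => f (x + σ • v)) (fderiv ℝ f (x + σ • v) v) σ := by
      intro σ hσ
      have h1 := (hball (hmem x hx σ hσ)).1.2
      have h2 : DifferentiableAt ℝ f (x + σ • v) :=
        (hf.contDiffAt (hU.mem_nhds h1)).differentiableAt (by simp)
      have h3 : HasDerivAt (fun σ : ℝ => x + σ • v) v σ := by
        simpa using ((hasDerivAt_id σ).smul_const v).const_add x
      exact h2.hasFDerivAt.comp_hasDerivAt σ h3
    refine strictMonoOn_of_deriv_pos (convex_Icc 0 1)
      (fun σ hσ => (hd σ hσ).continuousAt.continuousWithinAt) fun σ hσ => ?_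
    rw [interior_Icc] at hσ
    have hσ' : σ ∈ Icc (0 : ℝ) 1 := Ioo_subset_Icc_self hσ
    rw [(hd σ hσ').deriv, map_smul]
    exact mul_pos hc (hball (hmem x hx σ hσ')).1.1
  have hout : ∀ x ∈ Metric.ball p ρ, (x ∉ YH ↔ 0 < f x) := by
    intro x hx
    have hxU := (hball hx).1.2
    have h1 : x ∈ YH ↔ f x ≤ 0 :=
      ⟨fun h => (hcl.subset ⟨h, hxU⟩).1, fun h => (hcl.superset ⟨h, hxU⟩).1⟩
    rw [h1, not_le]
  have hpb : p ∈ Metric.ball p (ρ / 2) := Metric.mem_ball_self (by positivity)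
  have hfp : 0 ≤ f p := by
    by_contra! hneg
    have : p ∈ interior YH := (hint.superset ⟨hneg, hpU⟩).1
    exact hpf.2 this
  refine ⟨Metric.ball p (ρ / 2), Metric.ball_mem_nhds _ (by positivity), v, ?_, ?_⟩
  · have h1 := hmem p hpb 1 (by simp)
    have h2 := hmono p hpb (a := 0) (b := 1) (by simp) (by simp) (by norm_num)
    simp only [zero_smul, add_zero, one_smul] at h1 h2
    exact ⟨(hball h1).2, (hout _ h1).2 (by linarith)⟩
  · intro x hx σ hσ
    have h1 := hmem x hx.1 σ hσ
    refine ⟨(hball h1).2, (hout _ h1).2 ?_⟩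
    have h2 : 0 < f x := (hout x (Metric.ball_subset_ball (by linarith) hx.1)).1 hx.2.2
    have h3 := (hmono x hx.1).monotoneOn (a := 0) (b := σ) (by simp) hσ hσ.1
    simp only [zero_smul, add_zero] at h3
    linarith

/-- Away from the hole the solid cell is locally the open cube, and the move goes towards the centre
of the cube. The displacement is computed at `p` and not at `x`, but `x + σ v` is still a convex
combination of `x` and of `x - p` plus the centre; the latter lies in the cube when `x` is within
`1/2` of `p`. This treats faces, edges and corners alike. -/
lemma exists_inward_of_notMem_hole {YH : Set (Space N)} (hY : IsCompact YH) {p : Space N}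
    (hp : p ∈ closure (solidCell YH)) (hpY : p ∉ YH) :
    ∃ U ∈ 𝓝 p, ∃ v : Space N, p + v ∈ solidCell YH ∧
      ∀ x ∈ U ∩ solidCell YH, ∀ σ ∈ Icc (0 : ℝ) 1, x + σ • v ∈ solidCell YH := by
  have hp01 : ∀ i, 0 ≤ p i ∧ p i ≤ 1 := closure_unitCube_subset (closure_mono sdiff_subset hp)
  obtain ⟨ρ, hρ, hball⟩ := Metric.isOpen_iff.1 hY.isClosed.isOpen_compl p hpY
  set d : Space N := WithLp.toLp 2 (fun i => 1 / 2 - p i)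
  -- The first bound keeps the weight `σ c` of the convex combination below one; the second keeps
  -- the move inside a ball that misses the hole.
  set c : ℝ := min (1 / 2) (ρ / (4 * (‖d‖ + 1)))
  have hc : 0 < c := by positivity
  have hc2 : c ≤ 1 / 2 := min_le_left _ _
  set v := c • d
  have hvi : ∀ i, v i = c * (1 / 2 - p i) := fun i => by simp [v, d]
  have hv : ‖v‖ < ρ / 2 := by
    rw [norm_smul, Real.norm_of_nonneg hc.le]
    have : c * (‖d‖ + 1) ≤ ρ / 4 := by
      calc c * (‖d‖ + 1) ≤ ρ / (4 * (‖d‖ + 1)) * (‖d‖ + 1) := by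
            gcongr; exact min_le_right _ _
        _ = ρ / 4 := by field_simp
    nlinarith [norm_nonneg d]
  refine ⟨Metric.ball p (min (ρ / 2) (1 / 2)), Metric.ball_mem_nhds _ (by positivity), v, ⟨?_, ?_⟩, ?_⟩
  · intro i
    rw [PiLp.add_apply, hvi]
    constructor <;> nlinarith [hp01 i]
  · apply hball
    rw [mem_ball_iff_norm]; simp; linarith
  · rintro x ⟨hx, hxD⟩ σ hσ
    rw [mem_ball_iff_norm, lt_min_iff] at hx
    refine ⟨fun i => ?_, hball ?_⟩
    · have h1 : |x i - p i| < 1 / 2 := by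
        have := PiLp.norm_apply_le (x - p) i
        rw [PiLp.sub_apply, Real.norm_eq_abs] at this
        linarith [hx.2]
      rw [abs_lt] at h1
      have h2 := hxD.1 i
      rw [PiLp.add_apply, PiLp.smul_apply, hvi, smul_eq_mul]
      have hs0 : 0 ≤ σ * c := mul_nonneg hσ.1 hc.le
      have hs1 : σ * c ≤ 1 / 2 := by nlinarith [hσ.2]
      constructor
      · nlinarith [mul_nonneg hs0 (by linarith : (0 : ℝ) ≤ x i - p i + 1 / 2)]
      · nlinarith [mul_nonneg hs0 (by linarith : (0 : ℝ) ≤ 1 / 2 - (x i - p i))]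
    · rw [mem_ball_iff_norm]
      have h1 : ‖σ • v‖ ≤ ‖v‖ := by
        rw [norm_smul, Real.norm_of_nonneg hσ.1]
        nlinarith [norm_nonneg v, hσ.2]
      calc ‖x + σ • v - p‖ = ‖(x - p) + σ • v‖ := by congr 1; abel
        _ ≤ ‖x - p‖ + ‖σ • v‖ := norm_add_le _ _
        _ < ρ := by linarith [hx.1]

/-- The Poincaré inequality on the solid part of the unit cell. -/
theorem solidCell_poincare {YH : Set (Space N)} (hY : IsCompact YH) (hYY : YH ⊆ unitCube N)
    (hYs : HasSmoothBoundary YH) (hYconn : IsConnected (solidCell YH)) :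
    ∃ C : ENNReal, C ≠ ⊤ ∧ ∀ (w : Space N → ℝ) (F : Space N → Space N),
      HasWeakGrad (solidCell YH) w F → MemLp w 2 (volume.restrict (solidCell YH)) →
      MemLp F 2 (volume.restrict (solidCell YH)) → ∫ x in solidCell YH, w x = 0 →
      eLpNorm w 2 (volume.restrict (solidCell YH)) ≤
        C * eLpNorm F 2 (volume.restrict (solidCell YH)) := by
  refine (oscControl_self (isOpen_solidCell hY) isBounded_solidCell hYconn fun p hp => ?_).poincare
    isBounded_solidCell.measure_lt_top.ne
  by_cases hpY : p ∈ YH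
  · exact exists_inward_of_mem_frontier_hole hY hYY hYs hp.1 hpY
  · exact exists_inward_of_notMem_hole hY hp.1 hpY

end Perforated

/-! ### Weak compactness in `L²` and unfolding over a lattice. -/

namespace Perforated
variable {N : ℕ}

instance fact_two_ne_top : Fact ((2 : ENNReal) ≠ ⊤) := ⟨by norm_num⟩

/-- Weak sequential compactness of bounded sequences in `L²`. -/
lemma exists_weak_limit {α : Type*} [MeasurableSpace α] {μ : Measure α} [IsSeparable μ]
    {H : Type*} [NormedAddCommGroup H] [InnerProductSpace ℝ H] [CompleteSpace H]
    [TopologicalSpace.SeparableSpace H] (f : ℕ → α → H) (hf : ∀ n, MemLp (f n) 2 μ) {C : ℝ}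
    (hC : ∀ n, (eLpNorm (f n) 2 μ).toReal ≤ C) :
    ∃ (φ : ℕ → ℕ) (G : α → H), StrictMono φ ∧ MemLp G 2 μ ∧ ∀ v, MemLp v 2 μ →
      Tendsto (fun n => ∫ x, inner ℝ (f (φ n) x) (v x) ∂μ) atTop (𝓝 (∫ x, inner ℝ (G x) (v x) ∂μ)) := by
  -- Riesz representation carries the sequence into a ball of the dual space, which is weak-*
  -- sequentially compact because `L²` is separable.
  set J := InnerProductSpace.toDual ℝ (Lp H 2 μ)
  set x : ℕ → WeakDual ℝ (Lp H 2 μ) := fun n => StrongDual.toWeakDual (J ((hf n).toLp (f n)))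
  have hx : ∀ n, x n ∈ WeakDual.toStrongDual ⁻¹' Metric.closedBall (0 : StrongDual ℝ (Lp H 2 μ)) C := by
    intro n
    have h : ‖J ((hf n).toLp (f n))‖ ≤ C := by
      rw [LinearIsometryEquiv.norm_map, Lp.norm_toLp]; exact hC n
    have h' : J ((hf n).toLp (f n)) ∈ Metric.closedBall (0 : StrongDual ℝ (Lp H 2 μ)) C :=
      mem_closedBall_zero_iff.2 h
    exact h'
  obtain ⟨a, -, φ, hφ, hlim⟩ := WeakDual.isSeqCompact_closedBall ℝ (Lp H 2 μ) 0 C hx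
  set g : Lp H 2 μ := J.symm (WeakDual.toStrongDual a)
  refine ⟨φ, g, hφ, Lp.memLp g, fun v hv => ?_⟩
  have h1 := ((WeakDual.eval_continuous (𝕜 := ℝ) (hv.toLp v)).tendsto a).comp hlim
  have h2 : a (hv.toLp v) = ∫ x, inner ℝ (g x) (v x) ∂μ := by
    calc a (hv.toLp v) = J g (hv.toLp v) := by simp [g]
      _ = inner ℝ g (hv.toLp v) := rfl
      _ = ∫ x, inner ℝ (g x) (v x) ∂μ := by
        conv_lhs => rw [← Lp.toLp_coeFn g (Lp.memLp g)]
        exact inner_toLp_eq_integral (Lp.memLp g) hv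
  rw [h2] at h1
  refine h1.congr fun n => ?_
  rw [← inner_toLp_eq_integral (hf _) hv]
  rfl

/-- A lattice in `E`, with a bounded measurable cell of volume one and the corresponding
integer part. -/
structure LatticeCell (E K : Type*) [NormedAddCommGroup E] [MeasureSpace E] [MeasurableSpace K] where
  vec : K → E
  fl : E → K
  cell : Set E
  measurable_fl : Measurable fl
  measurableSet_cell : MeasurableSet cell
  sub_mem : ∀ y, y - vec (fl y) ∈ cell
  fl_add : ∀ k, ∀ z ∈ cell, fl (vec k + z) = k
  bound : ℝ
  norm_le : ∀ z ∈ cell, ‖z‖ ≤ bound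
  volume_cell : volume cell = 1

namespace LatticeCell

section Fold
variable {E K : Type*} [NormedAddCommGroup E] [MeasureSpace E] [BorelSpace E]
  [(volume : Measure E).IsAddLeftInvariant]
  [MeasurableSpace K] [MeasurableSingletonClass K] [Countable K] (L : LatticeCell E K)

/-- The fractional part. -/
def frac (y : E) : E := y - L.vec (L.fl y)

lemma vec_fl_add_frac (y : E) : L.vec (L.fl y) + L.frac y = y := by simp [frac]

lemma frac_mem (y : E) : L.frac y ∈ L.cell := L.sub_mem y

lemma frac_add (k : K) {z : E} (hz : z ∈ L.cell) : L.frac (L.vec k + z) = z := by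
  simp [frac, L.fl_add k z hz]

lemma fl_preimage (k : K) (z : E) : L.fl (L.vec k + z) = k ↔ z ∈ L.cell := by
  refine ⟨fun h => ?_, L.fl_add k z⟩
  have := L.sub_mem (L.vec k + z)
  rw [h] at this
  simpa using this

lemma bound_nonneg [Nonempty E] : 0 ≤ L.bound :=
  (norm_nonneg _).trans (L.norm_le _ (L.frac_mem 0))

lemma measurable_frac [MeasurableSub₂ E] : Measurable L.frac :=
  measurable_id.sub ((measurable_of_countable L.vec).comp L.measurable_fl)

lemma iUnion_preimage : (⋃ k, L.fl ⁻¹' {k}) = univ := by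
  ext; simp

lemma pairwise_disjoint_preimage : Pairwise (Function.onFun Disjoint fun k => L.fl ⁻¹' {k}) := by
  intro j k hjk
  refine Set.disjoint_left.2 fun x hx hx' => hjk ?_
  rw [← (hx : L.fl x = j), (hx' : L.fl x = k)]

lemma indicator_preimage {B : Type*} [Zero B] (f : E → B) (k : K) (z : E) :
    (L.fl ⁻¹' {k}).indicator f (L.vec k + z) = L.cell.indicator (fun z => f (L.vec k + z)) z := by
  by_cases h : z ∈ L.cell
  · rw [indicator_of_mem h, indicator_of_mem (show _ ∈ L.fl ⁻¹' {k} from (L.fl_preimage k z).2 h)]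
  · rw [indicator_of_notMem h,
      indicator_of_notMem (show _ ∉ L.fl ⁻¹' {k} from fun h' => h ((L.fl_preimage k z).1 h'))]

lemma setLIntegral_preimage (f : E → ENNReal) (k : K) :
    ∫⁻ x in L.fl ⁻¹' {k}, f x = ∫⁻ z in L.cell, f (L.vec k + z) := by
  rw [← lintegral_indicator (L.measurable_fl (measurableSet_singleton k)),
    ← lintegral_indicator L.measurableSet_cell, ← lintegral_add_left_eq_self _ (L.vec k)]
  exact lintegral_congr fun z => L.indicator_preimage f k z

lemma lintegral_eq_tsum (f : E → ENNReal) :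
    ∫⁻ x, f x = ∑' k, ∫⁻ z in L.cell, f (L.vec k + z) := by
  rw [← setLIntegral_univ, ← L.iUnion_preimage,
    lintegral_iUnion (fun k => L.measurable_fl (measurableSet_singleton k))
      L.pairwise_disjoint_preimage]
  exact tsum_congr fun k => L.setLIntegral_preimage f k

lemma setIntegral_preimage {B : Type*} [NormedAddCommGroup B] [NormedSpace ℝ B] (f : E → B) (k : K) :
    ∫ x in L.fl ⁻¹' {k}, f x = ∫ z in L.cell, f (L.vec k + z) := by
  rw [← integral_indicator (L.measurable_fl (measurableSet_singleton k)),
    ← integral_indicator L.measurableSet_cell, ← integral_add_left_eq_self _ (L.vec k)]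
  exact integral_congr_ae (ae_of_all _ fun z => L.indicator_preimage f k z)

lemma integral_eq_sum {B : Type*} [NormedAddCommGroup B] [NormedSpace ℝ B] {f : E → B}
    (hf : Integrable f) (s : Finset K) (hs : ∀ x, L.fl x ∉ s → f x = 0) :
    ∫ x, f x = ∑ k ∈ s, ∫ z in L.cell, f (L.vec k + z) := by
  have h := hasSum_integral_iUnion (fun k => L.measurable_fl (measurableSet_singleton k))
    L.pairwise_disjoint_preimage (f := f) (μ := volume) hf.integrableOn
  rw [L.iUnion_preimage, setIntegral_univ] at h
  rw [← h.tsum_eq]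
  simp only [L.setIntegral_preimage]
  refine tsum_eq_sum fun k hk => ?_
  refine setIntegral_eq_zero_of_forall_eq_zero fun z hz => hs _ ?_
  rwa [L.fl_add k z hz]

end Fold

section Unfold
variable {E K : Type*} [NormedAddCommGroup E] [NormedSpace ℝ E] [FiniteDimensional ℝ E]
  [MeasureSpace E] [BorelSpace E] [(volume : Measure E).IsAddHaarMeasure]
  [MeasurableSpace K] [MeasurableSingletonClass K] [Countable K] (L : LatticeCell E K)

/-- The measure on `E × cell`. -/
abbrev unfMeasure : Measure (E × E) := (volume : Measure E).prod (volume.restrict L.cell)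

/-- The unfolding map: the cell `δ(k + cell)` of the first argument, and the position in this cell
given by the second one. -/
def unf (δ : E ≃L[ℝ] E) (p : E × E) : E := δ (L.vec (L.fl (δ.symm p.1)) + p.2)

lemma measurable_unf (δ : E ≃L[ℝ] E) : Measurable (L.unf δ) := by
  have h1 : Measurable (fun p : E × E => L.vec (L.fl (δ.symm p.1))) :=
    (measurable_of_countable L.vec).comp
      (L.measurable_fl.comp (δ.symm.continuous.measurable.comp measurable_fst))
  exact δ.continuous.measurable.comp (h1.add measurable_snd)

lemma isProbabilityMeasure_cell : IsProbabilityMeasure (volume.restrict L.cell : Measure E) :=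
  ⟨by simp [L.volume_cell]⟩

lemma symm_unf (δ : E ≃L[ℝ] E) (p : E × E) :
    δ.symm (L.unf δ p) = L.vec (L.fl (δ.symm p.1)) + p.2 := by simp [unf]

lemma frac_symm_unf (δ : E ≃L[ℝ] E) {p : E × E} (hp : p.2 ∈ L.cell) :
    L.frac (δ.symm (L.unf δ p)) = p.2 := by rw [symm_unf, L.frac_add _ hp]

lemma norm_unf_sub_le (δ : E ≃L[ℝ] E) {p : E × E} (hp : p.2 ∈ L.cell) :
    ‖L.unf δ p - p.1‖ ≤ ‖(δ : E →L[ℝ] E)‖ * (2 * L.bound) := by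
  have e : L.unf δ p - p.1 = (δ : E →L[ℝ] E) (p.2 - L.frac (δ.symm p.1)) := by
    simp only [unf, frac, ContinuousLinearEquiv.coe_coe, map_add, map_sub,
      ContinuousLinearEquiv.apply_symm_apply]
    abel
  rw [e]
  refine (ContinuousLinearMap.le_opNorm _ _).trans ?_
  gcongr
  refine (norm_sub_le _ _).trans ?_
  linarith [L.norm_le _ hp, L.norm_le _ (L.frac_mem (δ.symm p.1))]

/-- The first argument enters only through the index of its cell. Integrating it out produces the
volume of the scaled cell, which is the factor relating an integral over this cell to the mean over
the unit cell. The Jacobian constant `c` of `δ⁻¹` is introduced and removed again, so its value does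
not matter. -/
lemma measurePreserving_unf (δ : E ≃L[ℝ] E) :
    MeasurePreserving (L.unf δ) L.unfMeasure volume := by
  have := L.isProbabilityMeasure_cell
  refine ⟨L.measurable_unf δ, ?_⟩
  refine Measure.ext_of_lintegral _ fun f hf => ?_
  obtain ⟨c, hc⟩ : ∃ c : ENNReal, Measure.map δ.symm (volume : Measure E) = c • volume := by
    have hdet : LinearMap.det (δ.symm.toLinearEquiv : E →ₗ[ℝ] E) ≠ 0 :=
      (LinearEquiv.isUnit_det' δ.symm.toLinearEquiv).ne_zero
    exact ⟨_, Measure.map_linearMap_addHaar_eq_smul_addHaar volume hdet⟩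
  have hcv : ∀ g : E → ENNReal, Measurable g → ∫⁻ x, g (δ.symm x) = c * ∫⁻ x, g x := by
    intro g hg
    rw [← lintegral_map hg δ.symm.continuous.measurable, hc, lintegral_smul_measure, smul_eq_mul]
  rw [lintegral_map hf (L.measurable_unf δ),
    lintegral_prod (fun p => f (L.unf δ p)) (hf.comp (L.measurable_unf δ)).aemeasurable]
  set g : E → ENNReal := fun x => ∫⁻ y in L.cell, f (δ (L.vec (L.fl x) + y))
  have hg : Measurable g := by
    have : Measurable (fun k : K => ∫⁻ y in L.cell, f (δ (L.vec k + y))) := measurable_of_countable _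
    exact this.comp L.measurable_fl
  calc ∫⁻ x, ∫⁻ y in L.cell, f (L.unf δ (x, y)) = ∫⁻ x, g (δ.symm x) := rfl
    _ = c * ∫⁻ x, g x := hcv g hg
    _ = c * ∫⁻ x, f (δ x) := by
      congr 1
      rw [L.lintegral_eq_tsum, L.lintegral_eq_tsum (fun x => f (δ x))]
      refine tsum_congr fun k => ?_
      rw [setLIntegral_congr_fun (g := fun _ => ∫⁻ y in L.cell, f (δ (L.vec k + y)))
        L.measurableSet_cell (fun z hz => by simp only [g, L.fl_add k z hz]), setLIntegral_const,
        L.volume_cell, mul_one]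
    _ = ∫⁻ x, f (δ (δ.symm x)) := (hcv (fun x => f (δ x)) (hf.comp δ.continuous.measurable)).symm
    _ = ∫⁻ x, f x := by simp

lemma ae_snd_mem : ∀ᵐ p ∂L.unfMeasure, p.2 ∈ L.cell := by
  have h : ∀ᵐ y ∂(volume.restrict L.cell : Measure E), y ∈ L.cell := ae_restrict_mem L.measurableSet_cell
  exact Measure.quasiMeasurePreserving_snd.ae h

lemma measurePreserving_fst :
    MeasurePreserving (Prod.fst : E × E → E) L.unfMeasure volume := by
  have := L.isProbabilityMeasure_cell
  exact MeasureTheory.measurePreserving_fst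

/-- Unfolding converges strongly in `L²`. -/
lemma tendsto_eLpNorm_unf_sub {B : Type*} [NormedAddCommGroup B] [NormedSpace ℝ B]
    {δ : ℕ → E ≃L[ℝ] E} (hδ : Tendsto (fun n => ‖(δ n : E →L[ℝ] E)‖) atTop (𝓝 0))
    {v : E → B} (hv : MemLp v 2 volume) :
    Tendsto (fun n => eLpNorm (fun p => v (L.unf (δ n) p) - v p.1) 2 L.unfMeasure) atTop (𝓝 0) := by
  rw [ENNReal.tendsto_nhds_zero]
  intro η hη
  obtain ⟨η', hη', hηη⟩ : ∃ η' : ENNReal, η' ≠ 0 ∧ η' + η' + η' ≤ η :=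
    ⟨η / 3, (ENNReal.div_pos hη.ne' (by norm_num)).ne', (ENNReal.add_thirds η).le⟩
  -- Up to `η'` in norm, `v` is a continuous function `w` with compact support. Both `unf` and the
  -- first projection preserve measure, so the error counts twice, and the third `η'` is left for
  -- `w`, which is uniformly continuous, while `unf` displaces points by at most `‖δ‖ · 2 · bound`.
  obtain ⟨w, hwc, hvw, hw, hw2⟩ := hv.exists_hasCompactSupport_eLpNorm_sub_le (by norm_num) hη'
  obtain ⟨R, hR⟩ := hwc.isCompact.isBounded.subset_closedBall (0 : E)
  have hwR : ∀ x, R < ‖x‖ → w x = 0 := fun x hx =>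
    image_eq_zero_of_notMem_tsupport fun h => by
      have := mem_closedBall_zero_iff.1 (hR h); linarith
  -- Once displacements are below one, both `w (unf p)` and `w p.1` vanish outside `S`; this is the
  -- reason for the radius `R + 1`.
  set S : Set (E × E) := Metric.closedBall (0 : E) (R + 1) ×ˢ univ
  have hSm : MeasurableSet S := measurableSet_closedBall.prod MeasurableSet.univ
  have hS : L.unfMeasure S ≠ ⊤ := by
    have := L.isProbabilityMeasure_cell
    rw [Measure.prod_prod, measure_univ, mul_one]
    exact measure_closedBall_lt_top.ne
  obtain ⟨c, hc, hcS⟩ : ∃ c : ℝ, 0 < c ∧ ENNReal.ofReal c * L.unfMeasure S ^ (1 / 2 : ℝ) ≤ η' := by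
    have ht : Tendsto (fun c : ℝ => ENNReal.ofReal c * L.unfMeasure S ^ (1 / 2 : ℝ)) (𝓝[>] 0) (𝓝 0) := by
      have h1 : Tendsto (fun c : ℝ => ENNReal.ofReal c) (𝓝[>] 0) (𝓝 0) := by
        have := (ENNReal.continuous_ofReal.tendsto 0).mono_left (nhdsWithin_le_nhds (s := Ioi 0))
        simpa using this
      have := ENNReal.Tendsto.mul_const h1 (Or.inr (ENNReal.rpow_ne_top_of_nonneg (by norm_num : (0:ℝ) ≤ 1 / 2) hS))
      simpa using this
    have := (ht.eventually (ENNReal.nhds_zero_basis_Iic.mem_of_mem (pos_iff_ne_zero.2 hη'))).and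
      self_mem_nhdsWithin
    obtain ⟨c, h1, h2⟩ := this.exists
    exact ⟨c, h2, h1⟩
  obtain ⟨θ, hθ, huc⟩ := Metric.uniformContinuous_iff.1
    (hwc.uniformContinuous_of_continuous hw) c hc
  have hsmall : ∀ᶠ n in atTop, ‖(δ n : E →L[ℝ] E)‖ * (2 * L.bound) < min θ 1 := by
    have := hδ.mul_const (2 * L.bound)
    rw [zero_mul] at this
    exact this.eventually_lt_const (by positivity)
  filter_upwards [hsmall] with n hn
  have hmp := L.measurePreserving_unf (δ n)
  have hmf := L.measurePreserving_fst
  have hr : MemLp (v - w) 2 volume := hv.sub hw2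
  have e : (fun p => v (L.unf (δ n) p) - v p.1) =
      ((v - w) ∘ L.unf (δ n) - (v - w) ∘ Prod.fst) + (fun p => w (L.unf (δ n) p) - w p.1) := by
    ext p
    simp only [Pi.add_apply, Pi.sub_apply, Function.comp_apply]
    abel
  have hmid : eLpNorm (fun p => w (L.unf (δ n) p) - w p.1) 2 L.unfMeasure ≤ η' := by
    refine le_trans ?_ hcS
    have hb : ∀ᵐ p ∂L.unfMeasure, ‖w (L.unf (δ n) p) - w p.1‖ ≤ ‖S.indicator (fun _ => c) p‖ := by
      filter_upwards [L.ae_snd_mem] with p hp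
      have h1 := (L.norm_unf_sub_le (δ n) hp).trans_lt hn
      rw [lt_min_iff] at h1
      by_cases hpS : p ∈ S
      · rw [indicator_of_mem hpS, Real.norm_of_nonneg hc.le, ← dist_eq_norm]
        exact (huc (by rw [dist_eq_norm]; exact h1.1)).le
      · have h2 : R + 1 < ‖p.1‖ := by
          by_contra! h3
          exact hpS ⟨by simpa using h3, trivial⟩
        rw [hwR p.1 (by linarith), hwR (L.unf (δ n) p), indicator_of_notMem hpS]
        · simp
        · have := norm_sub_norm_le p.1 (L.unf (δ n) p)
          rw [norm_sub_rev] at this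
          linarith [h1.2]
    refine (eLpNorm_mono_ae hb).trans ?_
    refine (eLpNorm_indicator_const_le _ _).trans ?_
    rw [Real.enorm_of_nonneg hc.le]
    simp
  calc _ ≤ eLpNorm ((v - w) ∘ L.unf (δ n)) 2 L.unfMeasure + eLpNorm ((v - w) ∘ Prod.fst) 2 L.unfMeasure
        + eLpNorm (fun p => w (L.unf (δ n) p) - w p.1) 2 L.unfMeasure := by
        rw [e]
        have m1 := (hr.comp_measurePreserving hmp).1
        have m2 := (hr.comp_measurePreserving hmf).1
        refine (eLpNorm_add_le (m1.sub m2) ?_ (by norm_num)).trans ?_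
        · exact ((hw2.comp_measurePreserving hmp).1).sub ((hw2.comp_measurePreserving hmf).1)
        · gcongr
          exact eLpNorm_sub_le m1 m2 (by norm_num)
    _ ≤ η' + η' + η' := by
        rw [eLpNorm_comp_measurePreserving hr.1 hmp, eLpNorm_comp_measurePreserving hr.1 hmf]
        gcongr
    _ ≤ η := hηη

end Unfold
end LatticeCell
end Perforated

/-! ### Oscillating functions and two-scale convergence. -/

namespace Perforated
variable {N : ℕ}

namespace LatticeCell
variable {E K : Type*} [NormedAddCommGroup E] [NormedSpace ℝ E] [FiniteDimensional ℝ E]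
  [MeasureSpace E] [BorelSpace E] [(volume : Measure E).IsAddHaarMeasure]
  [MeasurableSpace K] [MeasurableSingletonClass K] [Countable K] (L : LatticeCell E K)

lemma measurable_frac_symm (δ : E ≃L[ℝ] E) : Measurable (fun x => L.frac (δ.symm x)) :=
  L.measurable_frac.comp δ.symm.continuous.measurable

/-- Composed with the measure preserving unfolding map, the fractional part becomes the second
projection, which pulls null sets back to null sets. Thus an oscillating function depends only on
the class of its profile. -/
lemma quasiMeasurePreserving_frac (δ : E ≃L[ℝ] E) :
    Measure.QuasiMeasurePreserving (fun x => L.frac (δ.symm x)) volume (volume.restrict L.cell) := by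
  refine ⟨L.measurable_frac_symm δ, ?_⟩
  refine Measure.AbsolutelyContinuous.mk fun s hs h0 => ?_
  have := L.isProbabilityMeasure_cell
  have hmp := L.measurePreserving_unf δ
  have hm := L.measurable_frac_symm δ hs
  rw [Measure.map_apply (L.measurable_frac_symm δ) hs, ← hmp.measure_preimage hm.nullMeasurableSet]
  have h1 : L.unfMeasure (univ ×ˢ s) = 0 := by rw [Measure.prod_prod, h0, mul_zero]
  rw [← h1]
  refine measure_congr ?_
  filter_upwards [L.ae_snd_mem] with p hp
  apply propext
  change L.frac (δ.symm (L.unf δ p)) ∈ s ↔ p ∈ univ ×ˢ s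
  rw [L.frac_symm_unf δ hp]
  simp

/-- After unfolding, the oscillating function depends on the second argument alone, and the integral
splits into a product. The first argument ranges over a set enlarged by the displacement of the
unfolding map, which explains the radius. -/
lemma eLpNorm_comp_frac_le {H : Type*} [NormedAddCommGroup H] (δ : E ≃L[ℝ] E) {b : E → H}
    (hb : MemLp b 2 (volume.restrict L.cell)) {B : Set E} (hBm : MeasurableSet B) {R : ℝ}
    (hB : B ⊆ Metric.closedBall 0 R) :
    eLpNorm (fun x => b (L.frac (δ.symm x))) 2 (volume.restrict B) ≤
      volume (Metric.closedBall (0 : E) (R + ‖(δ : E →L[ℝ] E)‖ * (2 * L.bound))) ^ (1 / 2 : ℝ) *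
        eLpNorm b 2 (volume.restrict L.cell) := by
  have := L.isProbabilityMeasure_cell
  have hq := L.quasiMeasurePreserving_frac δ
  set b' := hb.1.mk b
  have hbb : b =ᵐ[volume.restrict L.cell] b' := hb.1.ae_eq_mk
  have hb' : StronglyMeasurable b' := hb.1.stronglyMeasurable_mk
  have e1 : eLpNorm (fun x => b (L.frac (δ.symm x))) 2 (volume.restrict B) =
      eLpNorm (fun x => b' (L.frac (δ.symm x))) 2 (volume.restrict B) :=
    eLpNorm_congr_ae (ae_restrict_of_ae (hq.ae_eq hbb))
  rw [e1, eLpNorm_congr_ae hbb]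
  set V := volume (Metric.closedBall (0 : E) (R + ‖(δ : E →L[ℝ] E)‖ * (2 * L.bound)))
  apply ennreal_le_of_sq_le_sq
  have hs : (V ^ (1 / 2 : ℝ)) ^ 2 = V := by
    rw [← ENNReal.rpow_natCast, ← ENNReal.rpow_mul]
    norm_num
  rw [mul_pow, hs, eLpNorm_two_sq, eLpNorm_two_sq, ← lintegral_indicator hBm]
  have hmeas : Measurable (B.indicator fun x => ‖b' (L.frac (δ.symm x))‖ₑ ^ 2) :=
    ((hb'.enorm.comp (L.measurable_frac_symm δ)).pow_const 2).indicator hBm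
  rw [← (L.measurePreserving_unf δ).lintegral_comp hmeas]
  set S := Metric.closedBall (0 : E) (R + ‖(δ : E →L[ℝ] E)‖ * (2 * L.bound))
  calc _ ≤ ∫⁻ p, S.indicator (fun _ => 1) p.1 * ‖b' p.2‖ₑ ^ 2 ∂L.unfMeasure := by
        refine lintegral_mono_ae ?_
        filter_upwards [L.ae_snd_mem] with p hp
        by_cases hpB : L.unf δ p ∈ B
        · rw [indicator_of_mem hpB, L.frac_symm_unf δ hp, indicator_of_mem, one_mul]
          have h1 := L.norm_unf_sub_le δ hp
          have h2 := mem_closedBall_zero_iff.1 (hB hpB)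
          have h3 := norm_sub_norm_le p.1 (L.unf δ p)
          rw [norm_sub_rev] at h3
          refine mem_closedBall_zero_iff.2 ?_
          linarith
        · rw [indicator_of_notMem hpB]
          exact zero_le
    _ = V * ∫⁻ y in L.cell, ‖b' y‖ₑ ^ 2 := by
        rw [lintegral_prod_mul (f := S.indicator fun _ => 1) (g := fun y => ‖b' y‖ₑ ^ 2)
          (measurable_const.indicator measurableSet_closedBall).aemeasurable
          (hb'.enorm.pow_const 2).aemeasurable, lintegral_indicator measurableSet_closedBall]
        simp [V]

lemma memLp_comp_frac {H : Type*} [NormedAddCommGroup H] (δ : E ≃L[ℝ] E) {b : E → H}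
    (hb : MemLp b 2 (volume.restrict L.cell)) {B : Set E} (hBm : MeasurableSet B)
    (hB : Bornology.IsBounded B) :
    MemLp (fun x => b (L.frac (δ.symm x))) 2 (volume.restrict B) := by
  obtain ⟨R, hR⟩ := hB.subset_closedBall 0
  refine ⟨(hb.1.comp_quasiMeasurePreserving (L.quasiMeasurePreserving_frac δ)).restrict, ?_⟩
  refine (L.eLpNorm_comp_frac_le δ hb hBm hR).trans_lt (ENNReal.mul_lt_top ?_ hb.2)
  exact ENNReal.rpow_lt_top_of_nonneg (by norm_num) measure_closedBall_lt_top.ne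

/-- Oscillating functions are bounded in `L²` on bounded sets, uniformly in the scale. -/
lemma exists_eLpNorm_comp_frac_le {B : Set E} (hBm : MeasurableSet B)
    (hB : Bornology.IsBounded B) :
    ∃ C : ENNReal, C ≠ ⊤ ∧ ∀ (δ : E ≃L[ℝ] E), ‖(δ : E →L[ℝ] E)‖ ≤ 1 →
      ∀ {H : Type} [NormedAddCommGroup H] (b : E → H), MemLp b 2 (volume.restrict L.cell) →
      eLpNorm (fun x => b (L.frac (δ.symm x))) 2 (volume.restrict B) ≤
        C * eLpNorm b 2 (volume.restrict L.cell) := by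
  obtain ⟨R, hR⟩ := hB.subset_closedBall 0
  refine ⟨volume (Metric.closedBall (0 : E) (R + 1 * (2 * L.bound))) ^ (1 / 2 : ℝ),
    ENNReal.rpow_ne_top_of_nonneg (by norm_num) measure_closedBall_lt_top.ne,
    fun δ hδ H _ b hb => (L.eLpNorm_comp_frac_le δ hb hBm hR).trans ?_⟩
  have := L.bound_nonneg
  gcongr

section Torus
variable {M : Type*} [TopologicalSpace M] [CompactSpace M] [T2Space M]
  [TopologicalSpace.PseudoMetrizableSpace M]
  {H : Type*} [NormedAddCommGroup H] [InnerProductSpace ℝ H] [CompleteSpace H]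
  {π : E → M}

lemma aestronglyMeasurable_eval (hπ : Continuous π) {α : Type*} [MeasurableSpace α] {μ : Measure α}
    {v : α → C(M, H)} (hv : AEStronglyMeasurable v μ) {f : α → E} (hf : Measurable f) :
    AEStronglyMeasurable (fun x => v x (π (f x))) μ := by
  have h1 : AEStronglyMeasurable (fun x => π (f x)) μ :=
    (hπ.stronglyMeasurable.comp_measurable hf).aestronglyMeasurable
  exact (continuous_eval (F := C(M, H))).comp_aestronglyMeasurable (hv.prodMk h1)

lemma memLp_eval (hπ : Continuous π) {α : Type*} [MeasurableSpace α] {μ : Measure α}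
    {v : α → C(M, H)} (hv : MemLp v 2 μ) {f : α → E} (hf : Measurable f) :
    MemLp (fun x => v x (π (f x))) 2 μ :=
  hv.of_le (aestronglyMeasurable_eval hπ hv.1 hf) (ae_of_all _ fun x => (v x).norm_coe_le_norm _)

/-- Weak convergence of the unfolded functions is two-scale convergence. -/
lemma tendsto_integral_of_unf (hπ : Continuous π) (hper : ∀ k z, π (L.vec k + z) = π z)
    {δ : ℕ → E ≃L[ℝ] E} (hδ : Tendsto (fun n => ‖(δ n : E →L[ℝ] E)‖) atTop (𝓝 0))
    {F : ℕ → E → H} (hF : ∀ n, MemLp (F n) 2 volume) {C : ℝ}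
    (hC : ∀ n, (eLpNorm (F n) 2 volume).toReal ≤ C) {G : E × E → H}
    (hG : ∀ v, MemLp v 2 L.unfMeasure → Tendsto
      (fun n => ∫ p, inner ℝ (F n (L.unf (δ n) p)) (v p) ∂L.unfMeasure) atTop
      (𝓝 (∫ p, inner ℝ (G p) (v p) ∂L.unfMeasure)))
    {v : E → C(M, H)} (hv : MemLp v 2 volume) :
    Tendsto (fun n => ∫ x, inner ℝ (F n x) (v x (π ((δ n).symm x)))) atTop
      (𝓝 (∫ p, inner ℝ (G p) (v p.1 (π p.2)) ∂L.unfMeasure)) := by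
  have hmf := L.measurePreserving_fst
  have hvf : MemLp (fun p : E × E => v p.1) 2 L.unfMeasure := hv.comp_measurePreserving hmf
  have hlim := hG (fun p => v p.1 (π p.2)) (memLp_eval hπ hvf measurable_snd)
  have hFu : ∀ n, MemLp (fun p => F n (L.unf (δ n) p)) 2 L.unfMeasure := fun n =>
    (hF n).comp_measurePreserving (L.measurePreserving_unf (δ n))
  have hvu : ∀ n, MemLp (fun p => v (L.unf (δ n) p)) 2 L.unfMeasure := fun n =>
    hv.comp_measurePreserving (L.measurePreserving_unf (δ n))
  -- Unfolding preserves the integral and, by periodicity, turns the fast argument `π (δ⁻¹ x)` into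
  -- `π p.2`.
  have e1 : ∀ n, ∫ x, inner ℝ (F n x) (v x (π ((δ n).symm x))) =
      ∫ p, inner ℝ (F n (L.unf (δ n) p)) (v (L.unf (δ n) p) (π p.2)) ∂L.unfMeasure := by
    intro n
    have hm := L.measurePreserving_unf (δ n)
    have hint : AEStronglyMeasurable (fun x => inner ℝ (F n x) (v x (π ((δ n).symm x))))
        (Measure.map (L.unf (δ n)) L.unfMeasure) := by
      rw [hm.map_eq]
      exact (hF n).1.inner (aestronglyMeasurable_eval hπ hv.1 (δ n).symm.continuous.measurable)
    conv_lhs => rw [← hm.map_eq]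
    rw [integral_map hm.measurable.aemeasurable hint]
    refine integral_congr_ae (ae_of_all _ fun p => ?_)
    simp only [symm_unf, hper]
  -- It remains to replace the slow argument `unf p` by `p.1`. The error is the strong unfolding
  -- error of `v` as a map into continuous functions with the sup norm, uniformly in the fast
  -- argument.
  have hdiff : Tendsto (fun n => ∫ p, inner ℝ (F n (L.unf (δ n) p))
      (v (L.unf (δ n) p) (π p.2) - v p.1 (π p.2)) ∂L.unfMeasure) atTop (𝓝 0) := by
    have hz : Tendsto (fun n => C * (eLpNorm (fun p => v (L.unf (δ n) p) - v p.1) 2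
        L.unfMeasure).toReal) atTop (𝓝 0) := by
      have := (ENNReal.tendsto_toReal (by simp)).comp (L.tendsto_eLpNorm_unf_sub hδ hv)
      simpa using this.const_mul C
    refine squeeze_zero_norm (fun n => ?_) hz
    have hd : MemLp (fun p => v (L.unf (δ n) p) - v p.1) 2 L.unfMeasure := (hvu n).sub hvf
    have hd' : MemLp (fun p => v (L.unf (δ n) p) (π p.2) - v p.1 (π p.2)) 2 L.unfMeasure :=
      (memLp_eval hπ (hvu n) measurable_snd).sub (memLp_eval hπ hvf measurable_snd)
    refine (abs_integral_inner_le (hFu n) hd').trans ?_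
    have h0 : 0 ≤ C := ENNReal.toReal_nonneg.trans (hC n)
    gcongr
    · rw [eLpNorm_comp_measurePreserving (hF n).1 (L.measurePreserving_unf (δ n)) (g := F n)
        (f := L.unf (δ n)) |> fun h => (by exact h : eLpNorm (fun p => F n (L.unf (δ n) p)) 2
          L.unfMeasure = _)]
      exact hC n
    · exact hd.eLpNorm_ne_top
    · refine eLpNorm_mono fun p => ?_
      exact (v (L.unf (δ n) p) - v p.1).norm_coe_le_norm (π p.2)
  have := hlim.add hdiff
  rw [add_zero] at this
  refine this.congr fun n => ?_
  rw [e1, ← integral_add]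
  · refine integral_congr_ae (ae_of_all _ fun p => ?_)
    simp only [← inner_add_right, add_sub_cancel]
  · exact integrable_inner_of_memLp (hFu n) (memLp_eval hπ hvf measurable_snd)
  · exact integrable_inner_of_memLp (hFu n)
      ((memLp_eval hπ (hvu n) measurable_snd).sub (memLp_eval hπ hvf measurable_snd))

/-- Continuous functions on the torus are dense in `L²` of the cell. -/
lemma exists_continuousMap_eLpNorm_sub_le [MeasurableSpace M] [BorelSpace M] (hπ : Continuous π)
    {sec : M → E} (hsec : Measurable sec) (hs : ∀ z ∈ L.cell, sec (π z) = z) {b : E → H}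
    (hb : MemLp b 2 (volume.restrict L.cell)) {η : ENNReal} (hη : η ≠ 0) :
    ∃ β : C(M, H), eLpNorm (fun y => b y - β (π y)) 2 (volume.restrict L.cell) ≤ η := by
  have := L.isProbabilityMeasure_cell
  set b' := hb.1.mk b
  have hbb : b =ᵐ[volume.restrict L.cell] b' := hb.1.ae_eq_mk
  have hb' : StronglyMeasurable b' := hb.1.stronglyMeasurable_mk
  -- The measure of the cell is pushed to `M`, where `b' ∘ sec` stands for `b`. On a metrizable
  -- space bounded continuous functions are dense in `L²` of a finite measure.
  set m : Measure M := Measure.map π (volume.restrict L.cell)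
  have hπm : MeasurePreserving π (volume.restrict L.cell) m := ⟨hπ.measurable, rfl⟩
  have hfin : IsFiniteMeasure m := Measure.isFiniteMeasure_map _ _
  have hsm : StronglyMeasurable (fun x => b' (sec x)) := hb'.comp_measurable hsec
  have hae : ∀ᵐ y ∂(volume.restrict L.cell), b' (sec (π y)) = b y := by
    filter_upwards [hbb, ae_restrict_mem L.measurableSet_cell] with y hy hyc
    rw [hs y hyc, hy]
  have hmem : MemLp (fun x => b' (sec x)) 2 m := by
    refine ⟨hsm.aestronglyMeasurable, ?_⟩
    rw [← eLpNorm_comp_measurePreserving hsm.aestronglyMeasurable hπm]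
    exact (hb.ae_eq (hae.mono fun y hy => hy.symm)).2
  let := TopologicalSpace.pseudoMetrizableSpacePseudoMetric M
  obtain ⟨β, hβ, -⟩ := hmem.exists_boundedContinuous_eLpNorm_sub_le (by norm_num) hη
  refine ⟨β.toContinuousMap, le_trans (le_of_eq ?_) hβ⟩
  rw [← eLpNorm_comp_measurePreserving (hsm.aestronglyMeasurable.sub
    β.continuous.aestronglyMeasurable) hπm]
  refine eLpNorm_congr_ae ?_
  filter_upwards [hae] with y hy
  simp only [Function.comp_apply, Pi.sub_apply, hy]
  rfl

end Torus
end LatticeCell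
end Perforated

/-! ### The lattices of `ℝ^N`, of `ℝ` and of space-time, and the torus. -/

namespace Perforated
variable {N : ℕ}

instance : (volume : Measure (Space N × ℝ)).IsAddHaarMeasure :=
  inferInstanceAs ((volume : Measure (Space N)).prod (volume : Measure ℝ)).IsAddHaarMeasure

@[simp] lemma intVec_apply (k : Fin N → ℤ) (i : Fin N) : intVec k i = (k i : ℝ) := rfl

/-- The half-open unit cube. -/
def halfOpenCube (N : ℕ) : Set (Space N) := {y | ∀ i, 0 ≤ y i ∧ y i < 1}

lemma halfOpenCube_eq_preimage :
    halfOpenCube N = WithLp.ofLp ⁻¹' (univ.pi fun _ : Fin N => Ico (0 : ℝ) 1) := by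
  ext; simp [halfOpenCube]

lemma unitCube_eq_preimage :
    unitCube N = WithLp.ofLp ⁻¹' (univ.pi fun _ : Fin N => Ioo (0 : ℝ) 1) := by
  ext; simp [unitCube]

lemma unitCube_ae_eq : unitCube N =ᵐ[volume] halfOpenCube N := by
  rw [unitCube_eq_preimage, halfOpenCube_eq_preimage]
  refine (PiLp.volume_preserving_ofLp (Fin N)).quasiMeasurePreserving.preimage_ae_eq ?_
  exact (Measure.univ_pi_Ioo_ae_eq_Icc (f := fun _ : Fin N => (0 : ℝ)) (g := fun _ => 1)).trans
    (Measure.univ_pi_Ico_ae_eq_Icc (f := fun _ : Fin N => (0 : ℝ)) (g := fun _ => 1)).symm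

lemma unitCube_subset_halfOpenCube : unitCube N ⊆ halfOpenCube N :=
  fun _ hy i => ⟨(hy i).1.le, (hy i).2⟩

/-- The integer lattice of `ℝ^N`. -/
def spaceLattice (N : ℕ) : LatticeCell (Space N) (Fin N → ℤ) where
  vec := intVec
  fl y i := ⌊y i⌋
  cell := halfOpenCube N
  measurable_fl := measurable_pi_iff.2 fun i =>
    Int.measurable_floor.comp (by fun_prop : Continuous fun y : Space N => y i).measurable
  measurableSet_cell := by
    rw [halfOpenCube_eq_preimage]
    exact (PiLp.volume_preserving_ofLp (Fin N)).measurable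
      (MeasurableSet.univ_pi fun _ => measurableSet_Ico)
  sub_mem y i := by
    simp only [PiLp.sub_apply, intVec_apply]
    exact ⟨Int.fract_nonneg _, Int.fract_lt_one _⟩
  fl_add k z hz := by
    funext i
    simp only [PiLp.add_apply, intVec_apply, Int.floor_intCast_add]
    rw [Int.floor_eq_zero_iff.2 ⟨(hz i).1, (hz i).2⟩, add_zero]
  bound := Real.sqrt N
  norm_le z hz := norm_le_of_forall_abs_le_one fun i => by
    rw [abs_of_nonneg (hz i).1]; exact (hz i).2.le
  volume_cell := by
    rw [halfOpenCube_eq_preimage, (PiLp.volume_preserving_ofLp (Fin N)).measure_preimage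
      (MeasurableSet.univ_pi fun _ => measurableSet_Ico).nullMeasurableSet]
    simp [volume_pi_pi]

/-- The integers in the real line. -/
def realLattice : LatticeCell ℝ ℤ where
  vec k := k
  fl y := ⌊y⌋
  cell := Ico 0 1
  measurable_fl := Int.measurable_floor
  measurableSet_cell := measurableSet_Ico
  sub_mem y := ⟨Int.fract_nonneg _, Int.fract_lt_one _⟩
  fl_add k z hz := by
    rw [Int.floor_intCast_add, Int.floor_eq_zero_iff.2 hz, add_zero]
  bound := 1
  norm_le z hz := by rw [Real.norm_of_nonneg hz.1]; exact hz.2.le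
  volume_cell := by simp

/-- The product of two lattices. -/
def LatticeCell.prod {E₁ E₂ K₁ K₂ : Type*} [NormedAddCommGroup E₁] [NormedAddCommGroup E₂]
    [MeasureSpace E₁] [MeasureSpace E₂] [SFinite (volume : Measure E₂)]
    [MeasurableSpace K₁] [MeasurableSpace K₂]
    (L₁ : LatticeCell E₁ K₁) (L₂ : LatticeCell E₂ K₂) : LatticeCell (E₁ × E₂) (K₁ × K₂) where
  vec k := (L₁.vec k.1, L₂.vec k.2)
  fl y := (L₁.fl y.1, L₂.fl y.2)
  cell := L₁.cell ×ˢ L₂.cell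
  measurable_fl := (L₁.measurable_fl.comp measurable_fst).prodMk
    (L₂.measurable_fl.comp measurable_snd)
  measurableSet_cell := L₁.measurableSet_cell.prod L₂.measurableSet_cell
  sub_mem y := ⟨L₁.sub_mem y.1, L₂.sub_mem y.2⟩
  fl_add k z hz := Prod.ext (L₁.fl_add k.1 z.1 hz.1) (L₂.fl_add k.2 z.2 hz.2)
  bound := max L₁.bound L₂.bound
  norm_le z hz := max_le_max (L₁.norm_le _ hz.1) (L₂.norm_le _ hz.2)
  volume_cell := by
    rw [Measure.volume_eq_prod, Measure.prod_prod, L₁.volume_cell, L₂.volume_cell, one_mul]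

/-- The space-time lattice. -/
abbrev stLattice (N : ℕ) : LatticeCell (Space N × ℝ) ((Fin N → ℤ) × ℤ) :=
  (spaceLattice N).prod realLattice

/-- The fractional part of a point of `ℝ^N`. -/
abbrev fract (y : Space N) : Space N := (spaceLattice N).frac y

lemma fract_mem (y : Space N) : fract y ∈ halfOpenCube N := (spaceLattice N).frac_mem y

lemma fract_eq_self {y : Space N} (hy : y ∈ halfOpenCube N) : fract y = y := by
  have := (spaceLattice N).frac_add 0 (z := y) hy
  have h0 : (spaceLattice N).vec 0 = 0 := by
    change intVec 0 = 0
    ext i; simp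
  rwa [h0, zero_add] at this

lemma intVec_add (j k : Fin N → ℤ) : intVec (j + k) = intVec j + intVec k := by
  ext i; simp

lemma fract_add_intVec (y : Space N) (k : Fin N → ℤ) : fract (y + intVec k) = fract y := by
  have h := (spaceLattice N).vec_fl_add_frac y
  have h2 : y + intVec k = (spaceLattice N).vec ((spaceLattice N).fl y + k) + fract y := by
    change _ = intVec _ + _
    rw [intVec_add]
    change intVec _ + _ = y at h
    conv_lhs => rw [← h]
    abel
  rw [h2]
  exact (spaceLattice N).frac_add _ (fract_mem y)

lemma exists_eq_fract_add (y : Space N) : ∃ k, y = fract y + intVec k :=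
  ⟨(spaceLattice N).fl y, by rw [add_comm]; exact ((spaceLattice N).vec_fl_add_frac y).symm⟩

/-- The dilation `x ↦ a x` of `ℝ^N`. -/
def spaceScale (a : ℝ) (ha : a ≠ 0) : Space N ≃L[ℝ] Space N :=
  ContinuousLinearEquiv.smulLeft (Units.mk0 a ha)

/-- The anisotropic dilation `(x,t) ↦ (a x, b t)`. -/
def stScale (a b : ℝ) (ha : a ≠ 0) (hb : b ≠ 0) : (Space N × ℝ) ≃L[ℝ] (Space N × ℝ) :=
  (spaceScale a ha).prodCongr (ContinuousLinearEquiv.smulLeft (Units.mk0 b hb))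

lemma stScale_symm_apply (a b : ℝ) (ha : a ≠ 0) (hb : b ≠ 0) (p : Space N × ℝ) :
    (stScale a b ha hb).symm p = (a⁻¹ • p.1, p.2 / b) := by
  rw [div_eq_inv_mul]; rfl

lemma norm_stScale_le {a b : ℝ} (ha : 0 < a) (hb : 0 < b) :
    ‖(stScale (N := N) a b ha.ne' hb.ne' : Space N × ℝ →L[ℝ] Space N × ℝ)‖ ≤ max a b := by
  refine ContinuousLinearMap.opNorm_le_bound _ (by positivity) fun p => ?_
  have h : (stScale (N := N) a b ha.ne' hb.ne' : Space N × ℝ →L[ℝ] Space N × ℝ) p = (a • p.1, b • p.2) := rfl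
  rw [h, Prod.norm_def]
  refine max_le ?_ ?_
  · rw [norm_smul, Real.norm_of_nonneg ha.le]
    exact mul_le_mul (le_max_left _ _) (norm_fst_le p) (norm_nonneg _) (by positivity)
  · rw [norm_smul, Real.norm_of_nonneg hb.le]
    exact mul_le_mul (le_max_right _ _) (norm_snd_le p) (norm_nonneg _) (by positivity)

/-- The space-time torus under a point. -/
def stTorus (p : Space N × ℝ) : UnitAddTorus (Fin N) × UnitAddCircle :=
  (toTorus p.1, ((p.2 : ℝ) : UnitAddCircle))

lemma continuous_stTorus : Continuous (stTorus (N := N)) := by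
  refine Continuous.prodMk ?_ ?_
  · refine continuous_pi fun i => ?_
    exact (AddCircle.continuous_mk' 1).comp (by fun_prop : Continuous fun p : Space N × ℝ => p.1 i)
  · exact (AddCircle.continuous_mk' 1).comp continuous_snd

lemma unitAddCircle_int_add (k : ℤ) (z : ℝ) : (((k : ℝ) + z : ℝ) : UnitAddCircle) = (z : UnitAddCircle) := by
  rw [AddCircle.coe_add]
  have h : ((k : ℝ) : UnitAddCircle) = 0 := by
    rw [AddCircle.coe_eq_zero_iff]
    exact ⟨k, by simp⟩
  rw [h, zero_add]

lemma stTorus_vec_add (k : (Fin N → ℤ) × ℤ) (z : Space N × ℝ) :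
    stTorus ((stLattice N).vec k + z) = stTorus z := by
  refine Prod.ext ?_ ?_
  · funext i
    exact unitAddCircle_int_add (k.1 i) (z.1 i)
  · exact unitAddCircle_int_add k.2 z.2

/-- A measurable section of the projection to the torus. -/
def torusSection (q : UnitAddTorus (Fin N) × UnitAddCircle) : Space N × ℝ :=
  (WithLp.toLp 2 fun i => (AddCircle.measurableEquivIco (1 : ℝ) 0 (q.1 i) : ℝ),
    (AddCircle.measurableEquivIco (1 : ℝ) 0 q.2 : ℝ))

lemma measurable_torusSection : Measurable (torusSection (N := N)) := by
  have h : Measurable fun x : UnitAddCircle => (AddCircle.measurableEquivIco (1 : ℝ) 0 x : ℝ) :=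
    measurable_subtype_coe.comp (AddCircle.measurableEquivIco (1 : ℝ) 0).measurable
  refine Measurable.prodMk ?_ (h.comp measurable_snd)
  refine (PiLp.volume_preserving_toLp (Fin N)).measurable.comp (measurable_pi_iff.2 fun i => ?_)
  exact h.comp ((measurable_pi_apply i).comp measurable_fst)

lemma measurableEquivIco_coe {z : ℝ} (hz : z ∈ Ico (0 : ℝ) 1) :
    (AddCircle.measurableEquivIco (1 : ℝ) 0 (z : UnitAddCircle) : ℝ) = z := by
  have h : z ∈ Ico (0 : ℝ) (0 + 1) := by simpa using hz
  exact congrArg Subtype.val ((AddCircle.equivIco (1 : ℝ) 0).apply_symm_apply ⟨z, h⟩)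

lemma torusSection_stTorus {z : Space N × ℝ} (hz : z ∈ (stLattice N).cell) :
    torusSection (stTorus z) = z := by
  refine Prod.ext ?_ (measurableEquivIco_coe hz.2)
  ext i
  exact measurableEquivIco_coe (hz.1 i)

lemma solidCell_ae_eq (YH : Set (Space N)) : solidCell YH =ᵐ[volume] (halfOpenCube N \ YH : Set _) :=
  ae_eq_set_sdiff unitCube_ae_eq (ae_eq_refl _)

end Perforated

/-! ### Periodic functions and weak gradients on the periodic perforated space. -/

namespace Perforated
variable {N : ℕ} {YH : Set (Space N)}

/-- The hole lies inside the open cube, so a translate of it stays in its own cell, and only the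
integer part of `y` can give a translate containing `y`. -/
lemma mem_periodicExt_iff (hYY : YH ⊆ unitCube N) {y : Space N} :
    y ∈ periodicExt YH ↔ fract y ∉ YH := by
  refine ⟨fun h => h ((spaceLattice N).fl y), fun h k hk => h ?_⟩
  have h1 : fract (y - intVec k) = y - intVec k :=
    fract_eq_self (unitCube_subset_halfOpenCube (hYY hk))
  have h2 : fract (y - intVec k) = fract y := by
    have := fract_add_intVec (y - intVec k) k
    rw [sub_add_cancel] at this
    exact this.symm
  rw [← h2, h1]
  exact hk

lemma add_intVec_mem_periodicExt (hYY : YH ⊆ unitCube N) {y : Space N} (k : Fin N → ℤ) :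
    y + intVec k ∈ periodicExt YH ↔ y ∈ periodicExt YH := by
  rw [mem_periodicExt_iff hYY, mem_periodicExt_iff hYY, fract_add_intVec]

lemma solidCell_subset_periodicExt (hYY : YH ⊆ unitCube N) : solidCell YH ⊆ periodicExt YH := by
  intro y hy
  rw [mem_periodicExt_iff hYY, fract_eq_self (unitCube_subset_halfOpenCube hy.1)]
  exact hy.2

lemma continuous_toTorus : Continuous (toTorus (N := N)) :=
  continuous_pi fun i => (AddCircle.continuous_mk' 1).comp
    (by fun_prop : Continuous fun p : Space N => p i)

lemma toTorus_add_intVec (y : Space N) (k : Fin N → ℤ) : toTorus (y + intVec k) = toTorus y := by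
  funext i
  have := unitAddCircle_int_add (k i) (y i)
  rwa [add_comm] at this

lemma exists_intVec_of_toTorus_eq {y z : Space N} (h : toTorus y = toTorus z) :
    ∃ k, y = z + intVec k := by
  have h1 : ∀ i, ∃ n : ℤ, (n : ℝ) = y i - z i := by
    intro i
    have h2 : ((y i - z i : ℝ) : UnitAddCircle) = 0 := by
      rw [AddCircle.coe_sub, sub_eq_zero]
      exact congrFun h i
    obtain ⟨n, hn⟩ := AddCircle.coe_eq_zero_iff (1 : ℝ) |>.1 h2
    exact ⟨n, by simpa using hn⟩
  choose k hk using h1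
  refine ⟨k, ?_⟩
  ext i
  simp [hk]

/-- The integer translates of a compact set form a closed set. -/
lemma isClosed_preimage_image_toTorus {A : Set (Space N)} (hA : IsCompact A) :
    IsClosed (toTorus ⁻¹' (toTorus '' A)) :=
  (hA.image continuous_toTorus).isClosed.preimage continuous_toTorus

/-- The union of all translates of the hole is the preimage of its image in the torus, which is
compact and hence closed. -/
lemma isOpen_periodicExt (hY : IsCompact YH) : IsOpen (periodicExt YH) := by
  have : periodicExt YH = (toTorus ⁻¹' (toTorus '' YH))ᶜ := by
    ext y
    simp only [mem_compl_iff, mem_preimage, mem_image, not_exists, not_and]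
    refine ⟨fun h z hz hzy => ?_, fun h k hk => ?_⟩
    · obtain ⟨k, hk⟩ := exists_intVec_of_toTorus_eq hzy.symm
      exact h k (by rwa [hk, add_sub_cancel_right])
    · refine h _ hk ?_
      have := toTorus_add_intVec (y - intVec k) k
      rw [sub_add_cancel] at this
      exact this.symm
  rw [this]
  exact (isClosed_preimage_image_toTorus hY).isOpen_compl

lemma restrict_solidCell_eq (YH : Set (Space N)) :
    (volume.restrict (solidCell YH) : Measure (Space N)) = volume.restrict (halfOpenCube N \ YH) :=
  Measure.restrict_congr_set (solidCell_ae_eq YH)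

lemma setIntegral_cell_eq {g : Space N → ℝ} (hg : ∀ y ∈ YH, g y = 0) :
    ∫ y in halfOpenCube N, g y = ∫ y in solidCell YH, g y := by
  rw [restrict_solidCell_eq]
  have hm : MeasurableSet (halfOpenCube N) := (spaceLattice N).measurableSet_cell
  refine (setIntegral_eq_of_subset_of_forall_sdiff_eq_zero (s := halfOpenCube N \ YH)
    (t := halfOpenCube N) hm sdiff_subset fun x hx => hg x ?_)
  by_contra h
  exact hx.2 ⟨hx.1, h⟩

lemma memLp_cell {B : Type*} [NormedAddCommGroup B] (hY : IsCompact YH) {g : Space N → B}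
    (hg : MemLp g 2 (volume.restrict (solidCell YH))) (h0 : ∀ y ∈ YH, g y = 0) :
    MemLp g 2 (volume.restrict (halfOpenCube N)) := by
  rw [restrict_solidCell_eq] at hg
  have hm := (spaceLattice N).measurableSet_cell.diff hY.measurableSet
  have h1 := (memLp_indicator_iff_restrict (μ := (volume : Measure (Space N))) hm).2 hg
  have h2 := h1.restrict (halfOpenCube N)
  refine h2.ae_eq ?_
  filter_upwards [ae_restrict_mem (spaceLattice N).measurableSet_cell] with y hy
  by_cases hyY : y ∈ YH
  · rw [indicator_of_notMem (fun h => h.2 hyY), h0 y hyY]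
  · exact indicator_of_mem (show y ∈ (spaceLattice N).cell \ YH from ⟨hy, hyY⟩) g

lemma integrable_mul_of_tsupport_subset {f χ : Space N → ℝ} {U : Set (Space N)}
    (hf : LocallyIntegrableOn f U) (hχ : Continuous χ) (hc : HasCompactSupport χ)
    (hU : tsupport χ ⊆ U) : Integrable (fun x => f x * χ x) := by
  have h1 : IntegrableOn f (tsupport χ) := hf.integrableOn_compact_subset hU hc
  have h2 := h1.mul_continuousOn hχ.continuousOn hc
  refine (integrableOn_iff_integrable_of_support_subset fun x hx => ?_).1 h2
  exact subset_tsupport _ (right_ne_zero_of_mul hx)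

/-- Smooth periodic functions on `ℝ^N` vanishing near the holes. -/
def IsPeriodicTest (YH : Set (Space N)) (Φ : Space N → ℝ) : Prop :=
  ContDiff ℝ ∞ Φ ∧ (∀ k y, Φ (y + intVec k) = Φ y) ∧ tsupport Φ ⊆ periodicExt YH

/-- `F` is the weak gradient of `w` on the periodic solid part, with Neumann condition-free
periodic test functions. Only the values in the unit cell matter. -/
def CellGrad (YH : Set (Space N)) (w : Space N → ℝ) (F : Space N → Space N) : Prop :=
  MemLp w 2 (volume.restrict (solidCell YH)) ∧ MemLp F 2 (volume.restrict (solidCell YH)) ∧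
  ∀ Φ, IsPeriodicTest YH Φ → ∀ ξ,
    ∫ y in solidCell YH, w y * fderiv ℝ Φ y ξ = -∫ y in solidCell YH, Φ y * inner ℝ (F y) ξ

/-- Integrals over `periodicExt` of a periodic function against a compactly supported one. -/
lemma setIntegral_periodicExt_eq (hYY : YH ⊆ unitCube N)
    {f : Space N → ℝ}
    (hper : ∀ k : Fin N → ℤ, ∀ᵐ y ∂(volume.restrict (periodicExt YH)), f (y + intVec k) = f y)
    {P : Space N → ℝ} (hP : ∀ k y, P (y + intVec k) = P y) (hP0 : ∀ y, y ∉ periodicExt YH → P y = 0)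
    {X : Space N → ℝ} (hint : Integrable (fun y => f y * (X y * P y))) (s : Finset (Fin N → ℤ))
    (hs : ∀ x, (spaceLattice N).fl x ∉ s → X x = 0) :
    ∫ y in periodicExt YH, f y * (X y * P y) =
      ∫ z in solidCell YH, f z * P z * ∑ k ∈ s, X (z + intVec k) := by
  -- The integral is split into cells. Of the three factors only `X` is not periodic, so the folding
  -- sums the translates of `X` alone.
  rw [setIntegral_eq_integral_of_forall_compl_eq_zero (fun y hy => by rw [hP0 y hy]; simp),
    (spaceLattice N).integral_eq_sum hint s (fun x hx => by rw [hs x hx]; simp)]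
  have e : ∀ k, ∫ z in halfOpenCube N, f (intVec k + z) * (X (intVec k + z) * P (intVec k + z)) =
      ∫ z in solidCell YH, f z * P z * X (z + intVec k) := by
    intro k
    rw [setIntegral_cell_eq (YH := YH)]
    · refine integral_congr_ae ?_
      have h1 := ae_mono (Measure.restrict_mono (solidCell_subset_periodicExt hYY) le_rfl) (hper k)
      filter_upwards [h1] with z hz
      rw [add_comm, hz, hP]; ring
    · intro y hy
      rw [hP0 (intVec k + y)]
      · simp
      · rw [add_comm, add_intVec_mem_periodicExt hYY, mem_periodicExt_iff hYY,
          fract_eq_self (unitCube_subset_halfOpenCube (hYY hy))]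
        simpa using hy
  change ∑ k ∈ s, ∫ z in halfOpenCube N, f (intVec k + z) * (X (intVec k + z) * P (intVec k + z)) = _
  simp only [e, Finset.mul_sum]
  rw [integral_finsetSum]
  intro k _
  have h2 : Integrable (fun z => f (z + intVec k) * (X (z + intVec k) * P (z + intVec k))) :=
    hint.comp_add_right (intVec k)
  refine (h2.restrict (s := solidCell YH)).congr ?_
  have h1 := ae_mono (Measure.restrict_mono (solidCell_subset_periodicExt hYY) le_rfl) (hper k)
  filter_upwards [h1] with z hz
  rw [hz, hP]; ring

section PartitionOfUnity

/-- A smooth function of one variable whose integer translates sum up to one. -/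
def pouOne (x : ℝ) : ℝ := Real.smoothTransition (x + 1) - Real.smoothTransition x

lemma contDiff_pouOne : ContDiff ℝ ∞ pouOne :=
  (Real.smoothTransition.contDiff.comp (contDiff_id.add contDiff_const)).sub
    Real.smoothTransition.contDiff

lemma pouOne_eq_zero {x : ℝ} (hx : x ≤ -1 ∨ 1 ≤ x) : pouOne x = 0 := by
  unfold pouOne
  rcases hx with h | h
  · rw [Real.smoothTransition.zero_of_nonpos (by linarith),
      Real.smoothTransition.zero_of_nonpos (by linarith), sub_zero]
  · rw [Real.smoothTransition.one_of_one_le (by linarith),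
      Real.smoothTransition.one_of_one_le h, sub_self]

/-- The sum telescopes to `smoothTransition (z + 3) - smoothTransition (z - 2)`, and for `z` in `[0,
1]` these values are one and zero. -/
lemma sum_pouOne {z : ℝ} (hz : z ∈ Icc (0 : ℝ) 1) :
    ∑ k ∈ Finset.Icc (-2 : ℤ) 2, pouOne (z + k) = 1 := by
  have h : (Finset.Icc (-2 : ℤ) 2) = {-2, -1, 0, 1, 2} := by decide
  rw [h]
  have h1 := Real.smoothTransition.one_of_one_le (x := z + 2 + 1) (by linarith [hz.1])
  have h2 := Real.smoothTransition.zero_of_nonpos (x := z + -2) (by linarith [hz.2])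
  simp only [pouOne, Int.reduceNeg]
  norm_num
  rw [h1, h2, show z + -2 + 1 = z + -1 by ring, show z + 1 + 1 = z + 2 by ring]
  ring

/-- A smooth function whose integer translates sum up to one. -/
def pou (y : Space N) : ℝ := ∏ i, pouOne (y i)

lemma contDiff_pou : ContDiff ℝ ∞ (pou (N := N)) := by
  unfold pou
  refine contDiff_prod fun i _ => contDiff_pouOne.comp ?_
  exact (EuclideanSpace.proj (𝕜 := ℝ) i).contDiff

/-- The integer vectors of the cells that meet the support of `pou`. -/
def pouIndex (N : ℕ) : Finset (Fin N → ℤ) := Fintype.piFinset fun _ => Finset.Icc (-2) 2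

lemma pou_eq_zero {y : Space N} {i : Fin N} (h : y i ≤ -1 ∨ 1 ≤ y i) : pou y = 0 :=
  Finset.prod_eq_zero (Finset.mem_univ i) (pouOne_eq_zero h)

lemma pou_eq_zero_of_fl {y : Space N} (h : (spaceLattice N).fl y ∉ pouIndex N) : pou y = 0 := by
  simp only [pouIndex, Fintype.mem_piFinset, not_forall] at h
  obtain ⟨i, hi⟩ := h
  refine pou_eq_zero (i := i) ?_
  by_contra! h
  apply hi
  change ⌊y i⌋ ∈ _
  rw [Finset.mem_Icc]
  constructor
  · rw [Int.le_floor]; push_cast; linarith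
  · exact (Int.floor_lt.2 (by push_cast; linarith : y i < ((3 : ℤ) : ℝ))) |> Int.lt_add_one_iff.1

lemma hasCompactSupport_pou : HasCompactSupport (pou (N := N)) := by
  refine HasCompactSupport.of_support_subset_isCompact
    (isCompact_closedBall (0 : Space N) (Real.sqrt N)) fun y hy => ?_
  refine mem_closedBall_zero_iff.2 (norm_le_of_forall_abs_le_one fun i => ?_)
  rw [abs_le]
  by_contra h
  rw [not_and_or, not_le, not_le] at h
  exact hy (pou_eq_zero (i := i) (h.imp le_of_lt le_of_lt))

lemma sum_pou {z : Space N} (hz : ∀ i, z i ∈ Icc (0 : ℝ) 1) :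
    ∑ k ∈ pouIndex N, pou (z + intVec k) = 1 := by
  have := Finset.prod_univ_sum (fun _ : Fin N => Finset.Icc (-2 : ℤ) 2)
    (fun i k => pouOne (z i + k))
  simp only [pou, pouIndex, PiLp.add_apply, intVec_apply]
  rw [← this]
  simp [sum_pouOne (hz _)]

lemma sum_fderiv_pou {z : Space N} (hz : z ∈ unitCube N) (ξ : Space N) :
    ∑ k ∈ pouIndex N, fderiv ℝ pou (z + intVec k) ξ = 0 := by
  have h1 : (fun z : Space N => ∑ k ∈ pouIndex N, pou (z + intVec k)) =ᶠ[𝓝 z] fun _ => 1 := by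
    filter_upwards [isOpen_unitCube.mem_nhds hz] with y hy
    exact sum_pou fun i => ⟨(hy i).1.le, (hy i).2.le⟩
  have h2 := h1.fderiv_eq (𝕜 := ℝ)
  have hd : ∀ k ∈ pouIndex N, DifferentiableAt ℝ (fun z : Space N => pou (z + intVec k)) z :=
    fun k _ => (contDiff_pou.comp (contDiff_id.add contDiff_const)).differentiable (by simp) z
  rw [fderiv_fun_sum hd] at h2
  have h3 := congrArg (fun L : Space N →L[ℝ] ℝ => L ξ) h2
  simp only [fderiv_comp_add_right, sum_apply] at h3
  rw [h3]
  simp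

end PartitionOfUnity

lemma IsPeriodicTest.fderiv_add {Φ : Space N → ℝ} (h : IsPeriodicTest YH Φ) (k : Fin N → ℤ)
    (y : Space N) : fderiv ℝ Φ (y + intVec k) = fderiv ℝ Φ y := by
  have : (fun z => Φ (z + intVec k)) = Φ := funext (h.2.1 k)
  conv_rhs => rw [← this]
  rw [fderiv_comp_add_right]

/-- The weak gradient of a periodic function is periodic. -/
lemma HasWeakGrad.periodic (hYY : YH ⊆ unitCube N) (hY : IsCompact YH) {w : Space N → ℝ}
    {F : Space N → Space N} (h : HasWeakGrad (periodicExt YH) w F)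
    (hper : ∀ k : Fin N → ℤ, ∀ᵐ y ∂(volume.restrict (periodicExt YH)), w (y + intVec k) = w y)
    (k : Fin N → ℤ) :
    ∀ᵐ y ∂(volume.restrict (periodicExt YH)), F (y + intVec k) = F y := by
  have hE := isOpen_periodicExt hY
  have hshift : ∀ g : Space N → ℝ, ∫ y in periodicExt YH, g (y + intVec k) =
      ∫ y in periodicExt YH, g y := by
    intro g
    rw [← integral_indicator hE.measurableSet, ← integral_indicator hE.measurableSet,
      ← integral_add_right_eq_self (fun y => (periodicExt YH).indicator g y) (intVec k)]
    refine integral_congr_ae (ae_of_all _ fun y => ?_)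
    simp only
    by_cases hy : y ∈ periodicExt YH
    · rw [indicator_of_mem hy, indicator_of_mem ((add_intVec_mem_periodicExt hYY k).2 hy)]
    · rw [indicator_of_notMem hy,
        indicator_of_notMem (fun h => hy ((add_intVec_mem_periodicExt hYY k).1 h))]
  have hFk : LocallyIntegrableOn (fun y => F (y + intVec k)) (periodicExt YH) := by
    rw [locallyIntegrableOn_iff hE.isLocallyClosed]
    intro K hKE hK
    have hK' : IsCompact ((fun y => y + intVec k) '' K) := hK.image (by fun_prop)
    have h1 : IntegrableOn F ((fun y => y + intVec k) '' K) := by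
      refine h.2.1.integrableOn_compact_subset ?_ hK'
      rintro _ ⟨y, hy, rfl⟩
      exact (add_intVec_mem_periodicExt hYY k).2 (hKE hy)
    have h2 := (measurePreserving_add_right (volume : Measure (Space N)) (intVec k)).integrableOn_image
      (Homeomorph.addRight (intVec k)).measurableEmbedding (f := F) (s := K)
    exact h2.1 h1
  -- `F (· + k)` and `F` are weak gradients of the same function, since `w` is periodic; two weak
  -- gradients agree almost everywhere.
  have hdiff : ∀ᵐ y ∂(volume : Measure (Space N)), y ∈ periodicExt YH →
      F (y + intVec k) - F y = 0 := by
    refine hE.ae_eq_zero_of_integral_contDiff_smul_eq_zero (hFk.sub h.2.1) fun φ h1 h2 h3 => ?_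
    have hφ : IsTest (periodicExt YH) φ := ⟨h1, h2, h3⟩
    have hφk : IsTest (periodicExt YH) (fun y => φ (y - intVec k)) :=
      hφ.comp_sub fun x hx => (add_intVec_mem_periodicExt hYY k).2 hx
    have iF : Integrable (fun y => φ y • (F y)) := by
      refine (integrableOn_iff_integrable_of_support_subset (s := tsupport φ) ?_).1 ?_
      · intro x hx; exact subset_tsupport _ (left_ne_zero_of_smul hx)
      · exact (h.2.1.integrableOn_compact_subset h3 h2).continuousOn_smul h1.continuous.continuousOn h2
    have iFk : Integrable (fun y => φ y • (F (y + intVec k))) := by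
      refine (integrableOn_iff_integrable_of_support_subset (s := tsupport φ) ?_).1 ?_
      · intro x hx; exact subset_tsupport _ (left_ne_zero_of_smul hx)
      · exact (hFk.integrableOn_compact_subset h3 h2).continuousOn_smul h1.continuous.continuousOn h2
    refine integral_eq_zero_of_forall_integral_inner_eq_zero ℝ _ ?_ fun ξ => ?_
    · simp only [smul_sub]
      exact iFk.sub iF
    have g1 := h.2.2 φ hφ ξ
    have g2 := h.2.2 _ hφk ξ
    rw [← hshift] at g2
    rw [← hshift (fun y => φ (y - intVec k) * inner ℝ (F y) ξ)] at g2
    simp only [add_sub_cancel_right, fderiv_comp_sub] at g2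
    have g3 : ∫ y in periodicExt YH, w (y + intVec k) * fderiv ℝ φ y ξ =
        ∫ y in periodicExt YH, w y * fderiv ℝ φ y ξ := by
      refine integral_congr_ae ?_
      filter_upwards [hper k] with y hy
      rw [hy]
    have g4 : ∀ G : Space N → Space N, ∫ y in periodicExt YH, φ y * inner ℝ (G y) ξ =
        ∫ y, inner ℝ ξ (φ y • G y) := by
      intro G
      rw [setIntegral_eq_integral_of_forall_compl_eq_zero]
      · simp only [inner_smul_right, real_inner_comm]
      · intro x hx
        rw [image_eq_zero_of_notMem_tsupport (fun h' => hx (h3 h')), zero_mul]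
    rw [g4] at g1
    rw [g4 fun y => F (y + intVec k)] at g2
    have g5 : ∫ y, inner ℝ ξ (φ y • (F (y + intVec k) - F y)) =
        (∫ y, inner ℝ ξ (φ y • F (y + intVec k))) - ∫ y, inner ℝ ξ (φ y • F y) := by
      have j1 : Integrable fun y => inner ℝ ξ (φ y • F (y + intVec k)) := iFk.const_inner ξ
      have j2 : Integrable fun y => inner ℝ ξ (φ y • F y) := iF.const_inner ξ
      rw [← integral_sub j1 j2]
      simp only [smul_sub, inner_sub_right]
    rw [g5]
    linarith
  rw [ae_restrict_iff' hE.measurableSet]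
  filter_upwards [hdiff] with y hy hyE
  exact sub_eq_zero.1 (hy hyE)

/-- A periodic test function has no compact support, but its product with `pou` does. When the weak
identity for the product is folded to the cell, the translates of `pou` add up to one and those of
its derivative to zero, so the cutoff leaves no trace. -/
lemma HasWeakGrad.cellGrad (hYY : YH ⊆ unitCube N) (hY : IsCompact YH) {w : Space N → ℝ}
    {F : Space N → Space N} (h : HasWeakGrad (periodicExt YH) w F)
    (hper : ∀ k : Fin N → ℤ, ∀ᵐ y ∂(volume.restrict (periodicExt YH)), w (y + intVec k) = w y)
    (hw : MemLp w 2 (volume.restrict (solidCell YH)))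
    (hF : MemLp F 2 (volume.restrict (solidCell YH))) : CellGrad YH w F := by
  refine ⟨hw, hF, fun Φ hΦ ξ => ?_⟩
  have hFper := h.periodic hYY hY hper
  have hz : ∀ y, y ∉ periodicExt YH → Φ y = 0 := fun y hy =>
    image_eq_zero_of_notMem_tsupport fun h' => hy (hΦ.2.2 h')
  have hz' : ∀ y, y ∉ periodicExt YH → fderiv ℝ Φ y ξ = 0 := fun y hy => by
    rw [fderiv_of_notMem_tsupport ℝ fun h' => hy (hΦ.2.2 h')]; simp
  have hΦc : Continuous Φ := hΦ.1.continuous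
  have hdΦ : Continuous fun y => fderiv ℝ Φ y ξ :=
    (hΦ.1.continuous_fderiv (by simp)).clm_apply continuous_const
  have hpc : Continuous (pou (N := N)) := contDiff_pou.continuous
  have hdp : Continuous fun y : Space N => fderiv ℝ pou y ξ :=
    (contDiff_pou.continuous_fderiv (by simp)).clm_apply continuous_const
  have hdpc : HasCompactSupport fun y : Space N => fderiv ℝ pou y ξ :=
    (hasCompactSupport_pou.fderiv (𝕜 := ℝ)).comp_left (g := fun L : Space N →L[ℝ] ℝ => L ξ) (by simp)
  have hdp0 : ∀ x, (spaceLattice N).fl x ∉ pouIndex N → fderiv ℝ pou x ξ = 0 := by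
    intro x hx
    have : x ∉ tsupport (pou (N := N)) := by
      intro hxt
      have hbox : tsupport (pou (N := N)) ⊆ ⋂ i, (fun y : Space N => y i) ⁻¹' Icc (-1) 1 := by
        refine closure_minimal ?_ (isClosed_iInter fun i => isClosed_Icc.preimage (by fun_prop))
        intro y hy
        rw [mem_iInter]
        intro i
        by_contra hcon
        rw [mem_preimage, mem_Icc, not_and_or, not_le, not_le] at hcon
        exact hy (pou_eq_zero (i := i) (hcon.imp le_of_lt le_of_lt))
      have := hbox hxt
      rw [mem_iInter] at this
      apply hx
      rw [pouIndex, Fintype.mem_piFinset]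
      intro i
      obtain ⟨h1, h2⟩ := this i
      change ⌊x i⌋ ∈ _
      rw [Finset.mem_Icc]
      constructor
      · rw [Int.le_floor]; push_cast; simp only at h1; linarith
      · exact (Int.floor_lt.2 (by push_cast; simp only at h2; linarith : x i < ((3 : ℤ) : ℝ))) |>
          Int.lt_add_one_iff.1
    rw [fderiv_of_notMem_tsupport ℝ this]; simp
  have supp : ∀ {A B : Space N → ℝ}, HasCompactSupport A → tsupport B ⊆ periodicExt YH →
      HasCompactSupport (fun y => A y * B y) ∧ tsupport (fun y => A y * B y) ⊆ periodicExt YH :=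
    fun {A B} hA hB => ⟨hA.mul_right, (tsupport_mul_subset_right (f := A) (g := B)).trans hB⟩
  have htd : tsupport (fun y => fderiv ℝ Φ y ξ) ⊆ periodicExt YH :=
    (tsupport_fderiv_apply_subset ℝ ξ).trans hΦ.2.2
  have s1 := supp hasCompactSupport_pou htd
  have s2 := supp hdpc hΦ.2.2
  have s3 := supp hasCompactSupport_pou hΦ.2.2
  have i1 : Integrable fun y => w y * (pou y * fderiv ℝ Φ y ξ) := integrable_mul_of_tsupport_subset h.1 (hpc.mul hdΦ) s1.1 s1.2
  have i2 : Integrable fun y => w y * (fderiv ℝ pou y ξ * Φ y) := integrable_mul_of_tsupport_subset h.1 (hdp.mul hΦc) s2.1 s2.2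
  have hFξ : LocallyIntegrableOn (fun y => inner ℝ (F y) ξ) (periodicExt YH) := by
    intro x hx
    obtain ⟨t, ht, hFt⟩ := h.2.1 x hx
    exact ⟨t, ht, hFt.inner_const ξ⟩
  have i3 : Integrable fun y => inner ℝ (F y) ξ * (pou y * Φ y) := integrable_mul_of_tsupport_subset hFξ (hpc.mul hΦc) s3.1 s3.2
  have htest : IsTest (periodicExt YH) (fun y => pou y * Φ y) := ⟨contDiff_pou.mul hΦ.1, s3.1, s3.2⟩
  have key := h.2.2 _ htest ξ
  have hd : ∀ y, fderiv ℝ (fun y => pou y * Φ y) y ξ =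
      pou y * fderiv ℝ Φ y ξ + fderiv ℝ pou y ξ * Φ y := by
    intro y
    rw [fderiv_fun_mul (contDiff_pou.differentiable (by simp) y) (hΦ.1.differentiable (by simp) y)]
    simp [mul_comm]
  simp only [hd, mul_add] at key
  rw [integral_add i1.integrableOn i2.integrableOn,
    setIntegral_periodicExt_eq hYY hper (P := fun y => fderiv ℝ Φ y ξ)
      (fun k y => by rw [hΦ.fderiv_add]) hz' i1 (pouIndex N) (fun x hx => pou_eq_zero_of_fl hx),
    setIntegral_periodicExt_eq hYY hper (P := Φ) (X := fun y => fderiv ℝ pou y ξ)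
      hΦ.2.1 hz i2 (pouIndex N) hdp0] at key
  have e3 : ∫ y in periodicExt YH, pou y * Φ y * inner ℝ (F y) ξ =
      ∫ y in solidCell YH, Φ y * inner ℝ (F y) ξ := by
    have := setIntegral_periodicExt_eq hYY (f := fun y => inner ℝ (F y) ξ)
      (fun k => by filter_upwards [hFper k] with y hy; rw [hy]) hΦ.2.1 hz i3 (pouIndex N)
      (fun x hx => pou_eq_zero_of_fl hx)
    calc _ = ∫ y in periodicExt YH, inner ℝ (F y) ξ * (pou y * Φ y) := by
          simp only [mul_comm]
      _ = _ := by
          rw [this]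
          refine setIntegral_congr_fun (isOpen_solidCell hY).measurableSet fun y hy => ?_
          rw [sum_pou fun i => ⟨(hy.1 i).1.le, (hy.1 i).2.le⟩, mul_one, mul_comm]
  rw [e3] at key
  rw [← key]
  have e1 : ∫ z in solidCell YH, w z * fderiv ℝ Φ z ξ * ∑ k ∈ pouIndex N, pou (z + intVec k) =
      ∫ z in solidCell YH, w z * fderiv ℝ Φ z ξ := by
    refine setIntegral_congr_fun (isOpen_solidCell hY).measurableSet fun y hy => ?_
    rw [sum_pou fun i => ⟨(hy.1 i).1.le, (hy.1 i).2.le⟩, mul_one]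
  have e2 : ∫ z in solidCell YH, w z * Φ z * ∑ k ∈ pouIndex N, fderiv ℝ pou (z + intVec k) ξ = 0 := by
    refine setIntegral_eq_zero_of_forall_eq_zero fun y hy => ?_
    rw [sum_fderiv_pou hy.1, mul_zero]
  rw [e1, e2, add_zero]

end Perforated

/-! ### From the cell to the periodic perforated space. -/

namespace Perforated
variable {N : ℕ} {YH : Set (Space N)}

/-- Only finitely many integer translates of a bounded set meet another bounded set. -/
lemma exists_finset_intVec {A B : Set (Space N)} (hA : Bornology.IsBounded A)
    (hB : Bornology.IsBounded B) :
    ∃ s : Finset (Fin N → ℤ), ∀ y ∈ A, ∀ k, y + intVec k ∈ B → k ∈ s := by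
  obtain ⟨R, hR⟩ := hA.exists_norm_le
  obtain ⟨S, hS⟩ := hB.exists_norm_le
  refine ⟨Fintype.piFinset fun _ => Finset.Icc (-⌈R + S⌉) ⌈R + S⌉, fun y hy k hk => ?_⟩
  rw [Fintype.mem_piFinset]
  intro i
  have h1 : ‖intVec k‖ ≤ R + S := by
    have h2 : intVec k = (y + intVec k) - y := by abel
    rw [h2]
    refine (norm_sub_le _ _).trans ?_
    linarith [hR y hy, hS _ hk]
  have h3 : |((k i : ℤ) : ℝ)| ≤ R + S := (PiLp.norm_apply_le (intVec k) i).trans h1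
  rw [abs_le] at h3
  rw [Finset.mem_Icc]
  have h4 := Int.le_ceil (R + S)
  constructor
  · have : (-(⌈R + S⌉ : ℤ) : ℝ) ≤ k i := by linarith
    exact_mod_cast this
  · have : ((k i : ℤ) : ℝ) ≤ ⌈R + S⌉ := by linarith
    exact_mod_cast this

/-- The sum of the integer translates of a function. -/
def perSum (φ : Space N → ℝ) (y : Space N) : ℝ := ∑ᶠ k : Fin N → ℤ, φ (y + intVec k)

lemma perSum_eq_sum {φ : Space N → ℝ} {y : Space N} {s : Finset (Fin N → ℤ)}
    (h : ∀ k, y + intVec k ∈ tsupport φ → k ∈ s) :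
    perSum φ y = ∑ k ∈ s, φ (y + intVec k) :=
  finsum_eq_sum_of_support_subset _ fun k hk => h k (subset_tsupport _ hk)

lemma perSum_add (φ : Space N → ℝ) (k : Fin N → ℤ) (y : Space N) :
    perSum φ (y + intVec k) = perSum φ y := by
  unfold perSum
  rw [← finsum_comp_equiv (Equiv.addLeft k) (f := fun j => φ (y + intVec j))]
  refine finsum_congr fun j => ?_
  simp [intVec_add, add_assoc]

lemma perSum_eventuallyEq {φ : Space N → ℝ} {A : Set (Space N)} (hA : IsOpen A) {y : Space N}
    (hy : y ∈ A) {s : Finset (Fin N → ℤ)}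
    (hs : ∀ z ∈ A, ∀ k, z + intVec k ∈ tsupport φ → k ∈ s) :
    perSum φ =ᶠ[𝓝 y] fun z => ∑ k ∈ s, φ (z + intVec k) := by
  filter_upwards [hA.mem_nhds hy] with z hz
  exact perSum_eq_sum (hs z hz)

lemma contDiff_perSum {φ : Space N → ℝ} (hφ : ContDiff ℝ ∞ φ) (hc : HasCompactSupport φ) :
    ContDiff ℝ ∞ (perSum φ) := by
  rw [contDiff_iff_contDiffAt]
  intro y
  obtain ⟨s, hs⟩ := exists_finset_intVec (Metric.isBounded_ball (x := y) (r := 1)) hc.isBounded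
  refine ContDiffAt.congr_of_eventuallyEq ?_
    (perSum_eventuallyEq Metric.isOpen_ball (Metric.mem_ball_self one_pos) hs)
  exact (ContDiff.sum fun k _ => hφ.comp (contDiff_id.add contDiff_const)).contDiffAt

lemma fderiv_perSum {φ : Space N → ℝ} (hφ : ContDiff ℝ ∞ φ) {A : Set (Space N)} (hA : IsOpen A)
    {y : Space N} (hy : y ∈ A) {s : Finset (Fin N → ℤ)}
    (hs : ∀ z ∈ A, ∀ k, z + intVec k ∈ tsupport φ → k ∈ s) (ξ : Space N) :
    fderiv ℝ (perSum φ) y ξ = ∑ k ∈ s, fderiv ℝ φ (y + intVec k) ξ := by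
  rw [(perSum_eventuallyEq hA hy hs).fderiv_eq]
  have hd : ∀ k ∈ s, DifferentiableAt ℝ (fun z : Space N => φ (z + intVec k)) y :=
    fun k _ => (hφ.comp (contDiff_id.add contDiff_const)).differentiable (by simp) y
  rw [fderiv_fun_sum hd]
  simp only [fderiv_comp_add_right, sum_apply]

lemma IsTest.perSum (hYY : YH ⊆ unitCube N) {φ : Space N → ℝ} (h : IsTest (periodicExt YH) φ) :
    IsPeriodicTest YH (perSum φ) := by
  refine ⟨contDiff_perSum h.1 h.2.1, perSum_add φ, ?_⟩
  -- The translates of the compact support of `φ` form a closed set, so taking the closure of the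
  -- support adds no point outside them.
  have h1 : tsupport (Perforated.perSum φ) ⊆ toTorus ⁻¹' (toTorus '' tsupport φ) := by
    refine closure_minimal (fun y hy => ?_) (isClosed_preimage_image_toTorus h.2.1)
    by_contra hcon
    refine hy (finsum_eq_zero_of_forall_eq_zero fun k => ?_)
    refine image_eq_zero_of_notMem_tsupport fun hk => hcon ⟨_, hk, toTorus_add_intVec y k⟩
  refine h1.trans ?_
  rintro y ⟨z, hz, hzy⟩
  obtain ⟨k, rfl⟩ := exists_intVec_of_toTorus_eq hzy.symm
  exact (add_intVec_mem_periodicExt hYY k).2 (h.2.2 hz)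

lemma locallyIntegrable_comp_fract {B : Type*} [NormedAddCommGroup B] {f : Space N → B}
    (hf : MemLp f 2 (volume.restrict (halfOpenCube N))) :
    LocallyIntegrable (fun y => f (fract y)) := by
  intro x
  refine ⟨Metric.ball x 1, Metric.ball_mem_nhds x one_pos, ?_⟩
  have h := (spaceLattice N).memLp_comp_frac (ContinuousLinearEquiv.refl ℝ (Space N)) hf
    (measurableSet_ball (x := x) (ε := 1)) Metric.isBounded_ball
  have : IsFiniteMeasure (volume.restrict (Metric.ball x 1)) :=
    ⟨by simpa using measure_ball_lt_top⟩
  exact h.integrable (by norm_num)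

/-- Folding an integral against a periodic function to the unit cell. -/
lemma setIntegral_fract_mul (hY : IsCompact YH) (hYY : YH ⊆ unitCube N) {f : Space N → ℝ}
    (hf : MemLp f 2 (volume.restrict (solidCell YH))) (hf0 : ∀ y ∈ YH, f y = 0)
    {χ : Space N → ℝ} (hχ : Continuous χ) (hc : HasCompactSupport χ) {s : Finset (Fin N → ℤ)}
    (hs : ∀ z ∈ halfOpenCube N, ∀ k, z + intVec k ∈ tsupport χ → k ∈ s) :
    ∫ y in periodicExt YH, f (fract y) * χ y =
      ∫ z in solidCell YH, f z * ∑ k ∈ s, χ (z + intVec k) := by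
  have hloc := locallyIntegrable_comp_fract (memLp_cell hY hf hf0)
  have hint : Integrable (fun y => f (fract y) * χ y) :=
    integrable_mul_of_tsupport_subset (hloc.locallyIntegrableOn univ) hχ hc (subset_univ _)
  rw [setIntegral_eq_integral_of_forall_compl_eq_zero]
  · rw [(spaceLattice N).integral_eq_sum hint s]
    · have e : ∀ k, ∫ z in halfOpenCube N, f (fract (intVec k + z)) * χ (intVec k + z) =
          ∫ z in solidCell YH, f z * χ (z + intVec k) := by
        intro k
        rw [← setIntegral_cell_eq (YH := YH) fun y hy => by rw [hf0 y hy, zero_mul]]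
        refine setIntegral_congr_fun (spaceLattice N).measurableSet_cell fun z hz => ?_
        rw [add_comm, fract_add_intVec, fract_eq_self hz]
      change ∑ k ∈ s, ∫ z in halfOpenCube N, f (fract (intVec k + z)) * χ (intVec k + z) = _
      simp only [e, Finset.mul_sum]
      rw [integral_finsetSum]
      intro k _
      refine integrable_mul_of_memLp hf ?_
      exact ((hχ.comp (continuous_id.add continuous_const)).memLp_of_hasCompactSupport
        (hc.comp_homeomorph (Homeomorph.addRight (intVec k)))).restrict _
    · intro x hx
      rw [image_eq_zero_of_notMem_tsupport (f := χ), mul_zero]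
      intro hxt
      refine hx (hs (fract x) (fract_mem x) _ ?_)
      have := (spaceLattice N).vec_fl_add_frac x
      rw [add_comm] at this
      exact this.symm ▸ hxt
  · intro x hx
    rw [mem_periodicExt_iff hYY, not_not] at hx
    rw [hf0 _ hx, zero_mul]

lemma isBounded_halfOpenCube : Bornology.IsBounded (halfOpenCube N) :=
  isBounded_iff_forall_norm_le.2 ⟨_, (spaceLattice N).norm_le⟩

/-- The periodic extension of a weakly differentiable function on the cell. -/
lemma CellGrad.hasWeakGrad_fract (hY : IsCompact YH) (hYY : YH ⊆ unitCube N) {w : Space N → ℝ}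
    {F : Space N → Space N} (h : CellGrad YH w F) (hw0 : ∀ y ∈ YH, w y = 0)
    (hF0 : ∀ y ∈ YH, F y = 0) :
    HasWeakGrad (periodicExt YH) (fun y => w (fract y)) (fun y => F (fract y)) := by
  refine ⟨(locallyIntegrable_comp_fract (memLp_cell hY h.1 hw0)).locallyIntegrableOn _,
    (locallyIntegrable_comp_fract (memLp_cell hY h.2.1 hF0)).locallyIntegrableOn _,
    fun φ hφ ξ => ?_⟩
  have hdc : Continuous fun y => fderiv ℝ φ y ξ :=
    (hφ.1.continuous_fderiv (by simp)).clm_apply continuous_const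
  have hds : tsupport (fun y => fderiv ℝ φ y ξ) ⊆ tsupport φ := tsupport_fderiv_apply_subset ℝ ξ
  have hdcs : HasCompactSupport fun y => fderiv ℝ φ y ξ := hφ.2.1.mono'
    ((subset_tsupport _).trans hds)
  obtain ⟨s, hs⟩ := exists_finset_intVec (isBounded_halfOpenCube (N := N)) hφ.2.1.isBounded
  have hsu : ∀ z ∈ unitCube N, ∀ k, z + intVec k ∈ tsupport φ → k ∈ s :=
    fun z hz => hs z (unitCube_subset_halfOpenCube hz)
  have e1 := setIntegral_fract_mul hY hYY h.1 hw0 hdc hdcs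
    (fun z hz k hk => hs z hz k (hds hk))
  have e2 := setIntegral_fract_mul hY hYY (f := fun y => inner ℝ (F y) ξ) (h.2.1.inner_const ξ)
    (fun y hy => by rw [hF0 y hy, inner_zero_left]) hφ.continuous hφ.2.1 hs
  have e3 : ∫ y in periodicExt YH, φ y * inner ℝ (F (fract y)) ξ =
      ∫ y in periodicExt YH, inner ℝ (F (fract y)) ξ * φ y := by simp only [mul_comm]
  rw [e1, e3, e2]
  -- Folding a pairing with `φ` over all cells amounts to testing in one cell with the periodization
  -- of `φ`, which is an admissible periodic test function.
  have key := h.2.2 _ (hφ.perSum hYY) ξ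
  have hm := (isOpen_solidCell hY).measurableSet
  have e4 : ∫ y in solidCell YH, w y * fderiv ℝ (Perforated.perSum φ) y ξ =
      ∫ z in solidCell YH, w z * ∑ k ∈ s, fderiv ℝ φ (z + intVec k) ξ :=
    setIntegral_congr_fun hm fun y hy => by
      rw [fderiv_perSum hφ.1 isOpen_unitCube hy.1 hsu]
  have e5 : ∫ y in solidCell YH, Perforated.perSum φ y * inner ℝ (F y) ξ =
      ∫ z in solidCell YH, inner ℝ (F z) ξ * ∑ k ∈ s, φ (z + intVec k) :=
    setIntegral_congr_fun hm fun y hy => by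
      rw [perSum_eq_sum (hsu y hy.1), mul_comm]
  rw [← e4, ← e5, key]

lemma CellGrad.congr {w w' : Space N → ℝ} {F F' : Space N → Space N} (h : CellGrad YH w F)
    (hw : w =ᵐ[volume.restrict (solidCell YH)] w') (hF : F =ᵐ[volume.restrict (solidCell YH)] F') :
    CellGrad YH w' F' := by
  refine ⟨h.1.ae_eq hw, h.2.1.ae_eq hF, fun Φ hΦ ξ => ?_⟩
  have := h.2.2 Φ hΦ ξ
  have e1 : ∫ y in solidCell YH, w y * fderiv ℝ Φ y ξ = ∫ y in solidCell YH, w' y * fderiv ℝ Φ y ξ :=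
    integral_congr_ae (by filter_upwards [hw] with y hy; rw [hy])
  have e2 : ∫ y in solidCell YH, Φ y * inner ℝ (F y) ξ =
      ∫ y in solidCell YH, Φ y * inner ℝ (F' y) ξ :=
    integral_congr_ae (by filter_upwards [hF] with y hy; rw [hy])
  rwa [e1, e2] at this

lemma isFiniteMeasure_solidCell : IsFiniteMeasure (volume.restrict (solidCell YH)) :=
  ⟨by simpa using isBounded_solidCell.measure_lt_top⟩

/-- Test functions on the solid cell are test functions on the periodic space, where the weak
identity is known for the periodic extension. Cutting the functions off outside the solid cell first
gives the values in the hole required there. -/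
lemma CellGrad.hasWeakGrad (hY : IsCompact YH) (hYY : YH ⊆ unitCube N) {w : Space N → ℝ}
    {F : Space N → Space N} (h : CellGrad YH w F) : HasWeakGrad (solidCell YH) w F := by
  have hfin := isFiniteMeasure_solidCell (YH := YH)
  have hm := (isOpen_solidCell hY).measurableSet
  have i1 : IntegrableOn w (solidCell YH) := h.1.integrable (by norm_num)
  have i2 : IntegrableOn F (solidCell YH) := h.2.1.integrable (by norm_num)
  refine ⟨i1.locallyIntegrableOn, i2.locallyIntegrableOn, fun φ hφ ξ => ?_⟩
  have h' := h.congr (w' := (solidCell YH).indicator w) (F' := (solidCell YH).indicator F)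
    (indicator_ae_eq_restrict hm).symm (indicator_ae_eq_restrict hm).symm
  have h0 : ∀ y ∈ YH, y ∉ solidCell YH := fun y hy h => h.2 hy
  have key := (h'.hasWeakGrad_fract hY hYY (fun y hy => indicator_of_notMem (h0 y hy) _)
    (fun y hy => indicator_of_notMem (h0 y hy) _)).2.2 φ
    (hφ.mono (solidCell_subset_periodicExt hYY)) ξ
  have z1 : ∀ y, y ∉ solidCell YH → φ y = 0 := fun y hy =>
    image_eq_zero_of_notMem_tsupport fun h => hy (hφ.2.2 h)
  have z2 : ∀ y, y ∉ solidCell YH → fderiv ℝ φ y ξ = 0 := fun y hy => by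
    rw [fderiv_of_notMem_tsupport ℝ fun h => hy (hφ.2.2 h)]; simp
  have hr : ∀ y ∈ solidCell YH, fract y = y := fun y hy =>
    fract_eq_self (unitCube_subset_halfOpenCube hy.1)
  have r1 : ∫ y in periodicExt YH, (solidCell YH).indicator w (fract y) * fderiv ℝ φ y ξ =
      ∫ y in solidCell YH, w y * fderiv ℝ φ y ξ := by
    rw [setIntegral_eq_integral_of_forall_compl_eq_zero fun y hy => by
      rw [z2 y fun h => hy (solidCell_subset_periodicExt hYY h), mul_zero],
      ← setIntegral_eq_integral_of_forall_compl_eq_zero (s := solidCell YH) fun y hy => by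
      rw [z2 y hy, mul_zero]]
    exact setIntegral_congr_fun hm fun y hy => by
      rw [hr y hy, indicator_of_mem hy]
  have r2 : ∫ y in periodicExt YH, φ y * inner ℝ ((solidCell YH).indicator F (fract y)) ξ =
      ∫ y in solidCell YH, φ y * inner ℝ (F y) ξ := by
    rw [setIntegral_eq_integral_of_forall_compl_eq_zero fun y hy => by
      rw [z1 y fun h => hy (solidCell_subset_periodicExt hYY h), zero_mul],
      ← setIntegral_eq_integral_of_forall_compl_eq_zero (s := solidCell YH) fun y hy => by
      rw [z1 y hy, zero_mul]]
    exact setIntegral_congr_fun hm fun y hy => by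
      rw [hr y hy, indicator_of_mem hy]
  rw [r1, r2] at key
  exact key

/-- Constants have zero gradient. -/
lemma cellGrad_one (hY : IsCompact YH) (hYY : YH ⊆ unitCube N) :
    CellGrad YH (fun _ => 1) (fun _ => 0) := by
  have hfin := isFiniteMeasure_solidCell (YH := YH)
  refine HasWeakGrad.cellGrad hYY hY ⟨?_, ?_, fun φ hφ ξ => ?_⟩ (fun k => ae_of_all _ fun _ => rfl)
    (memLp_const _) (memLp_const _)
  · exact continuous_const.locallyIntegrable.locallyIntegrableOn _
  · exact continuous_const.locallyIntegrable.locallyIntegrableOn _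
  · have hds : tsupport (fun y => fderiv ℝ φ y ξ) ⊆ tsupport φ := tsupport_fderiv_apply_subset ℝ ξ
    have hdcs : HasCompactSupport fun y => fderiv ℝ φ y ξ := hφ.2.1.mono'
      ((subset_tsupport _).trans hds)
    have hdc : Continuous fun y => fderiv ℝ φ y ξ :=
      (hφ.1.continuous_fderiv (by simp)).clm_apply continuous_const
    have h := integral_mul_fderiv_eq_neg_fderiv_mul_of_integrable (μ := (volume : Measure (Space N)))
      (f := fun _ => (1 : ℝ)) (g := φ) (v := ξ) (by simp)
      (by simpa using hdc.integrable_of_hasCompactSupport hdcs)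
      (by simpa using hφ.continuous.integrable_of_hasCompactSupport hφ.2.1)
      (by fun_prop) (fun x _ => hφ.1.differentiable (by simp) x)
    rw [setIntegral_eq_integral_of_forall_compl_eq_zero]
    · simpa using h
    · intro y hy
      rw [fderiv_of_notMem_tsupport ℝ fun h => hy (hφ.2.2 h)]; simp

end Perforated

/-! ### Potentials, and fields with prescribed divergence in the cell. -/

namespace Perforated
variable {N : ℕ} {YH : Set (Space N)}

/-- A closed graph over a subspace, with a bound of the first component by the second one, is given
by a continuous linear map defined on the whole space. -/
lemma exists_solution_operator {H₁ H₂ : Type*} [NormedAddCommGroup H₁] [InnerProductSpace ℝ H₁]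
    [CompleteSpace H₁] [NormedAddCommGroup H₂] [InnerProductSpace ℝ H₂] [CompleteSpace H₂]
    (V : Submodule ℝ (H₁ × H₂)) (hV : IsClosed (V : Set (H₁ × H₂))) {C : NNReal}
    (hC : ∀ p ∈ V, ‖p.1‖ ≤ C * ‖p.2‖) :
    ∃ S : H₂ →L[ℝ] H₁, (∀ p ∈ V, S p.2 = p.1) ∧
      ∀ F, (∀ Ψ : H₂, (∀ p ∈ V, inner ℝ p.2 Ψ = 0) → inner ℝ F Ψ = 0) → (S F, F) ∈ V := by
  have : CompleteSpace V := hV.completeSpace_coe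
  -- By the bound `hC` the second projection is bounded below on the closed graph, hence injective
  -- with closed range. `S` projects orthogonally onto this range, inverts, and takes the first
  -- component.
  set f : V →L[ℝ] H₂ := (ContinuousLinearMap.snd ℝ H₁ H₂).comp V.subtypeL
  have hf : AntilipschitzWith (max C 1) f := by
    refine ContinuousLinearMap.antilipschitz_of_bound f fun p => ?_
    change max ‖p.1.1‖ ‖p.1.2‖ ≤ ((max C 1 : NNReal) : ℝ) * ‖p.1.2‖
    refine max_le ((hC p.1 p.2).trans ?_) ?_
    · gcongr
      exact le_max_left _ _
    · refine le_mul_of_one_le_left (norm_nonneg _) ?_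
      exact_mod_cast le_max_right C 1
  have hclo := hf.isClosed_range f.uniformContinuous
  set e := f.equivRange hf.injective hclo
  have hR : IsClosed (f.range : Set H₂) := hclo
  have : CompleteSpace f.range := hR.completeSpace_coe
  set P := f.range.orthogonalProjectionOnto
  have hS : ∀ v : V, e.symm (P (f v)) = v := by
    intro v
    have h1 : P (f v) = ⟨f v, by simp⟩ :=
      Submodule.orthogonalProjectionOnto_mem_subspace_eq_self (⟨f v, by simp⟩ : f.range)
    rw [h1]
    exact f.equivRange_symm_apply hf.injective hclo v
  refine ⟨(ContinuousLinearMap.fst ℝ H₁ H₂).comp (V.subtypeL.comp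
    ((e.symm : f.range →L[ℝ] V).comp P)), fun p hp => ?_, fun F hF => ?_⟩
  · exact congrArg (fun v : V => v.1.1) (hS ⟨p, hp⟩)
  -- A closed subspace is its own double orthogonal complement, which is what the hypothesis on `F`
  -- expresses.
  · have hFR : F ∈ f.range := by
      rw [← Submodule.orthogonal_orthogonal f.range, Submodule.mem_orthogonal']
      intro Ψ hΨ
      refine hF Ψ fun p hp => ?_
      exact (Submodule.mem_orthogonal _ _).1 hΨ _ ⟨⟨p, hp⟩, rfl⟩
    obtain ⟨v, rfl⟩ := hFR
    change (((e.symm (P (f v)) : V) : H₁ × H₂).1, f v) ∈ V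
    rw [hS]
    exact v.2

lemma memLp_of_continuous {B : Type*} [NormedAddCommGroup B] {f : Space N → B} (hf : Continuous f) :
    MemLp f 2 (volume.restrict (solidCell YH)) := by
  have hfin := isFiniteMeasure_solidCell (YH := YH)
  obtain ⟨R, hR⟩ := (isBounded_solidCell (YH := YH)).subset_closedBall 0
  obtain ⟨C, hC⟩ := (isCompact_closedBall (0 : Space N) R).exists_bound_of_continuousOn hf.continuousOn
  have h1 := measure_closedBall_lt_top (μ := (volume : Measure (Space N))) (x := 0) (r := R)
  have : IsFiniteMeasure (volume.restrict (Metric.closedBall (0 : Space N) R)) := ⟨by simpa using h1⟩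
  have h2 : MemLp f 2 (volume.restrict (Metric.closedBall (0 : Space N) R)) :=
    MemLp.of_bound hf.aestronglyMeasurable C
      (ae_restrict_of_forall_mem measurableSet_closedBall hC)
  exact h2.mono_measure (Measure.restrict_mono hR le_rfl)

lemma memLp_const_solidCell {B : Type*} [NormedAddCommGroup B] (c : B) :
    MemLp (fun _ => c) 2 (volume.restrict (solidCell YH)) := memLp_of_continuous continuous_const

lemma IsPeriodicTest.continuous_fderiv {Φ : Space N → ℝ} (h : IsPeriodicTest YH Φ) (ξ : Space N) :
    Continuous fun y => fderiv ℝ Φ y ξ :=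
  (h.1.continuous_fderiv (by simp)).clm_apply continuous_const

/-- Square integrable functions on the solid cell. -/
abbrev CellL2 (YH : Set (Space N)) (B : Type) [NormedAddCommGroup B] : Type :=
  Lp B 2 (volume.restrict (solidCell YH))

/-- The functional of `L² × L²` that vanishes on pairs of a function and its weak gradient. -/
def cellFunctional (YH : Set (Space N)) (Φ : {Φ : Space N → ℝ // IsPeriodicTest YH Φ})
    (ξ : Space N) : CellL2 YH ℝ × CellL2 YH (Space N) →L[ℝ] ℝ :=
  (innerSL ℝ ((memLp_of_continuous (YH := YH) (Φ.2.continuous_fderiv ξ)).toLp _)).coprod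
    (innerSL ℝ ((memLp_of_continuous (YH := YH) (Φ.2.1.continuous.smul
      (continuous_const (y := ξ)))).toLp _))

lemma cellFunctional_apply (Φ : {Φ : Space N → ℝ // IsPeriodicTest YH Φ}) (ξ : Space N)
    {w : Space N → ℝ} {F : Space N → Space N} (hw : MemLp w 2 (volume.restrict (solidCell YH)))
    (hF : MemLp F 2 (volume.restrict (solidCell YH))) :
    cellFunctional YH Φ ξ (hw.toLp w, hF.toLp F) =
      (∫ y in solidCell YH, w y * fderiv ℝ Φ.1 y ξ) + ∫ y in solidCell YH, Φ.1 y * inner ℝ (F y) ξ := by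
  change inner ℝ ((memLp_of_continuous (YH := YH) (Φ.2.continuous_fderiv ξ)).toLp _) (hw.toLp w) +
    inner ℝ ((memLp_of_continuous (YH := YH) (Φ.2.1.continuous.smul
      (continuous_const (y := ξ)))).toLp _) (hF.toLp F) = _
  rw [inner_toLp_eq_integral_mul, inner_toLp_eq_integral]
  congr 1
  · simp only [mul_comm]
  · refine integral_congr_ae (ae_of_all _ fun y => ?_)
    change inner ℝ (Φ.1 y • ξ) (F y) = _
    rw [real_inner_smul_left, real_inner_comm]

/-- Mean-free functions of the cell with their weak gradients. -/
def cellGraph (YH : Set (Space N)) : Submodule ℝ (CellL2 YH ℝ × CellL2 YH (Space N)) :=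
  (⨅ Φ, ⨅ ξ, (cellFunctional YH Φ ξ).ker) ⊓
    ((innerSL ℝ ((memLp_const_solidCell (YH := YH) (1 : ℝ)).toLp _)).comp
      (ContinuousLinearMap.fst ℝ (CellL2 YH ℝ) (CellL2 YH (Space N)))).ker

lemma isClosed_cellGraph : IsClosed (cellGraph YH : Set (CellL2 YH ℝ × CellL2 YH (Space N))) := by
  rw [cellGraph, Submodule.coe_inf, Submodule.coe_iInf]
  refine IsClosed.inter (isClosed_iInter fun Φ => ?_) (ContinuousLinearMap.isClosed_ker _)
  rw [Submodule.coe_iInf]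
  exact isClosed_iInter fun ξ => ContinuousLinearMap.isClosed_ker _

lemma toLp_mem_cellGraph {w : Space N → ℝ} {F : Space N → Space N}
    (hw : MemLp w 2 (volume.restrict (solidCell YH)))
    (hF : MemLp F 2 (volume.restrict (solidCell YH))) :
    (hw.toLp w, hF.toLp F) ∈ cellGraph YH ↔ CellGrad YH w F ∧ ∫ y in solidCell YH, w y = 0 := by
  rw [cellGraph, Submodule.mem_inf, Submodule.mem_iInf]
  refine and_congr ⟨fun h => ⟨hw, hF, fun Φ hΦ ξ => ?_⟩, fun h Φ => ?_⟩ ?_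
  · have h1 := (Submodule.mem_iInf _).1 (h ⟨Φ, hΦ⟩) ξ
    have h2 : cellFunctional YH ⟨Φ, hΦ⟩ ξ (hw.toLp w, hF.toLp F) = 0 := h1
    rw [cellFunctional_apply] at h2
    linarith
  · rw [Submodule.mem_iInf]
    intro ξ
    change cellFunctional YH Φ ξ (hw.toLp w, hF.toLp F) = 0
    rw [cellFunctional_apply, h.2.2 Φ.1 Φ.2 ξ]
    ring
  · change inner ℝ ((memLp_const_solidCell (YH := YH) (1 : ℝ)).toLp _) (hw.toLp w) = 0 ↔ _
    rw [inner_toLp_eq_integral_mul]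
    simp

lemma mem_cellGraph {p : CellL2 YH ℝ × CellL2 YH (Space N)} :
    p ∈ cellGraph YH ↔ CellGrad YH p.1 p.2 ∧ ∫ y in solidCell YH, p.1 y = 0 := by
  have := toLp_mem_cellGraph (Lp.memLp p.1) (Lp.memLp p.2)
  rwa [Lp.toLp_coeFn, Lp.toLp_coeFn] at this

lemma exists_cellGraph_bound (hY : IsCompact YH) (hYY : YH ⊆ unitCube N)
    (hYs : HasSmoothBoundary YH) (hYconn : IsConnected (solidCell YH)) :
    ∃ C : NNReal, ∀ p ∈ cellGraph YH, ‖p.1‖ ≤ C * ‖p.2‖ := by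
  obtain ⟨C, hC, h⟩ := solidCell_poincare hY hYY hYs hYconn
  refine ⟨C.toNNReal, fun p hp => ?_⟩
  obtain ⟨h1, h2⟩ := mem_cellGraph.1 hp
  have h3 := h _ _ (h1.hasWeakGrad hY hYY) h1.1 h1.2.1 h2
  rw [Lp.norm_def, Lp.norm_def]
  have h4 := ENNReal.toReal_mono (ENNReal.mul_ne_top hC h1.2.1.eLpNorm_ne_top) h3
  rwa [ENNReal.toReal_mul] at h4

/-- `S` recovers a mean-free function from its weak gradient. -/
def IsPotentialOperator (YH : Set (Space N)) (S : CellL2 YH (Space N) →L[ℝ] CellL2 YH ℝ) : Prop :=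
  (∀ p ∈ cellGraph YH, S p.2 = p.1) ∧
    ∀ F, (∀ Ψ : CellL2 YH (Space N), (∀ p ∈ cellGraph YH, inner ℝ p.2 Ψ = 0) → inner ℝ F Ψ = 0) →
      (S F, F) ∈ cellGraph YH

lemma exists_isPotentialOperator (hY : IsCompact YH) (hYY : YH ⊆ unitCube N)
    (hYs : HasSmoothBoundary YH) (hYconn : IsConnected (solidCell YH)) :
    ∃ S, IsPotentialOperator YH S := by
  obtain ⟨C, hC⟩ := exists_cellGraph_bound hY hYY hYs hYconn
  exact exists_solution_operator _ isClosed_cellGraph hC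

lemma CellGrad.sub_const (hY : IsCompact YH) (hYY : YH ⊆ unitCube N) {w : Space N → ℝ}
    {F : Space N → Space N} (h : CellGrad YH w F) (m : ℝ) : CellGrad YH (fun y => w y - m) F := by
  refine ⟨h.1.sub (memLp_const_solidCell m), h.2.1, fun Φ hΦ ξ => ?_⟩
  have h1 := (cellGrad_one hY hYY).2.2 Φ hΦ ξ
  have hd := memLp_of_continuous (YH := YH) (hΦ.continuous_fderiv ξ)
  simp only [one_mul, inner_zero_left, mul_zero, integral_zero, neg_zero] at h1
  rw [← h.2.2 Φ hΦ ξ]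
  simp only [sub_mul]
  rw [integral_sub (integrable_mul_of_memLp h.1 hd)
    (integrable_mul_of_memLp (memLp_const_solidCell m) hd), integral_const_mul, h1]
  ring

/-- `ψ` is minus the divergence of `Θ` in the solid cell, with periodic and natural boundary
conditions; both vanish on the hole. -/
def IsCellPair (YH : Set (Space N)) (ψ : Space N → ℝ) (Θ : Space N → Space N) : Prop :=
  MemLp ψ 2 (volume.restrict (solidCell YH)) ∧ MemLp Θ 2 (volume.restrict (solidCell YH)) ∧
  (∀ y ∈ YH, ψ y = 0) ∧ (∀ y ∈ YH, Θ y = 0) ∧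
  ∀ w F, CellGrad YH w F → ∫ y in solidCell YH, ψ y * w y = ∫ y in solidCell YH, inner ℝ (Θ y) (F y)

lemma volume_solidCell_pos (hY : IsCompact YH) (hYconn : IsConnected (solidCell YH)) :
    0 < volume.real (solidCell YH) :=
  ENNReal.toReal_pos ((isOpen_solidCell hY).measure_pos volume hYconn.nonempty).ne'
    isBounded_solidCell.measure_lt_top.ne

lemma integral_sub_mean (hY : IsCompact YH) (hYconn : IsConnected (solidCell YH)) {w : Space N → ℝ}
    (hw : MemLp w 2 (volume.restrict (solidCell YH))) :
    ∫ y in solidCell YH, (w y - (∫ z in solidCell YH, w z) / volume.real (solidCell YH)) = 0 := by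
  have hfin := isFiniteMeasure_solidCell (YH := YH)
  rw [integral_sub (hw.integrable (by norm_num)) (integrable_const _), setIntegral_const, smul_eq_mul,
    mul_div_cancel₀ _ (volume_solidCell_pos hY hYconn).ne', sub_self]

/-- `Θ` is the adjoint of the potential operator applied to `ψ`: for a mean-free `w` with gradient
`F`, `⟨S* ψ, F⟩ = ⟨ψ, S F⟩ = ⟨ψ, w⟩`. The mean of a general `w` is invisible to the mean-free `ψ`.
This takes the place of solving a Neumann problem in the cell. -/
lemma exists_isCellPair (hY : IsCompact YH) (hYY : YH ⊆ unitCube N)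
    (hYs : HasSmoothBoundary YH) (hYconn : IsConnected (solidCell YH)) {ψ : Space N → ℝ}
    (hψ : MemLp ψ 2 (volume.restrict (solidCell YH))) (hψ0 : ∀ y ∈ YH, ψ y = 0)
    (hmean : ∫ y in solidCell YH, ψ y = 0) : ∃ Θ, IsCellPair YH ψ Θ := by
  obtain ⟨S, hS, -⟩ := exists_isPotentialOperator hY hYY hYs hYconn
  have hfin := isFiniteMeasure_solidCell (YH := YH)
  have hm := (isOpen_solidCell hY).measurableSet
  set Θ := ContinuousLinearMap.adjoint S (hψ.toLp ψ)
  have hind := indicator_ae_eq_restrict (μ := volume) (f := (Θ : Space N → Space N)) hm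
  refine ⟨(solidCell YH).indicator Θ, hψ, (Lp.memLp Θ).ae_eq hind.symm, hψ0,
    fun y hy => indicator_of_notMem (fun h => h.2 hy) _, fun w F h => ?_⟩
  set m := (∫ z in solidCell YH, w z) / volume.real (solidCell YH)
  have h1 := h.sub_const hY hYY m
  have hw1 : MemLp (fun y => w y - m) 2 (volume.restrict (solidCell YH)) := h1.1
  have hF1 : MemLp F 2 (volume.restrict (solidCell YH)) := h1.2.1
  have h2 : S (hF1.toLp F) = hw1.toLp _ :=
    hS _ ((toLp_mem_cellGraph hw1 hF1).2 ⟨h1, integral_sub_mean hY hYconn h.1⟩)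
  have h3 : ∫ y in solidCell YH, ψ y * w y = ∫ y in solidCell YH, ψ y * (w y - m) := by
    simp only [mul_sub]
    rw [integral_sub (integrable_mul_of_memLp hψ h.1)
      (integrable_mul_of_memLp hψ (memLp_const_solidCell m)), integral_mul_const, hmean]
    ring
  rw [h3, ← inner_toLp_eq_integral_mul hψ hw1, ← h2, ← ContinuousLinearMap.adjoint_inner_left]
  change inner ℝ Θ (hF1.toLp F) = _
  conv_lhs => rw [← Lp.toLp_coeFn Θ (Lp.memLp Θ), inner_toLp_eq_integral]
  refine integral_congr_ae ?_
  filter_upwards [hind] with y hy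
  rw [hy]

/-- Fields orthogonal to all gradients are divergence free. -/
lemma isCellPair_zero_of_orthogonal (hY : IsCompact YH) (hYY : YH ⊆ unitCube N)
    (hYconn : IsConnected (solidCell YH)) {Ψ : CellL2 YH (Space N)}
    (hΨ : ∀ p ∈ cellGraph YH, inner ℝ p.2 Ψ = 0) :
    IsCellPair YH (fun _ => 0) ((solidCell YH).indicator Ψ) := by
  have hm := (isOpen_solidCell hY).measurableSet
  have hind := indicator_ae_eq_restrict (μ := volume) (f := (Ψ : Space N → Space N)) hm
  refine ⟨memLp_const_solidCell 0, (Lp.memLp Ψ).ae_eq hind.symm, fun _ _ => rfl,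
    fun y hy => indicator_of_notMem (fun h => h.2 hy) _, fun w F h => ?_⟩
  have h1 := h.sub_const hY hYY ((∫ z in solidCell YH, w z) / volume.real (solidCell YH))
  have h2 := hΨ _ ((toLp_mem_cellGraph h1.1 h1.2.1).2 ⟨h1, integral_sub_mean hY hYconn h.1⟩)
  rw [real_inner_comm, ← Lp.toLp_coeFn Ψ (Lp.memLp Ψ), inner_toLp_eq_integral] at h2
  simp only [zero_mul, integral_zero]
  rw [← h2]
  refine integral_congr_ae ?_
  filter_upwards [hind] with y hy
  rw [hy]

/-- A compact subset of the open cube keeps a positive distance from the faces `y_j ∈ ℤ`, the only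
places where the cosine equals one. The gap leaves room for periodic functions supported near the
faces and away from all holes. -/
lemma exists_cos_lt (hY : IsCompact YH) (hYY : YH ⊆ unitCube N) (j : Fin N) :
    ∃ c < (1 : ℝ), ∀ y ∈ YH, Real.cos (2 * Real.pi * y j) < c := by
  rcases YH.eq_empty_or_nonempty with rfl | hne
  · exact ⟨0, by norm_num, by simp⟩
  · have hcont : Continuous fun y : Space N => Real.cos (2 * Real.pi * y j) := by fun_prop
    obtain ⟨z, hz, hmax⟩ := hY.exists_isMaxOn hne hcont.continuousOn
    have h1 : Real.cos (2 * Real.pi * z j) < 1 := by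
      refine lt_of_le_of_ne (Real.cos_le_one _) fun h => ?_
      obtain ⟨h2, h3⟩ := hYY hz j
      have hp := Real.pi_pos
      rw [Real.cos_eq_one_iff_of_lt_of_lt (by nlinarith) (by nlinarith)] at h
      nlinarith [mul_pos (mul_pos two_pos hp) h2]
    refine ⟨(Real.cos (2 * Real.pi * z j) + 1) / 2, by linarith, fun y hy => ?_⟩
    have : Real.cos (2 * Real.pi * y j) ≤ Real.cos (2 * Real.pi * z j) := hmax hy
    linarith

/-- A periodic test function of mean one that is constant in the direction `e_i`. -/
lemma exists_periodicTest_direction (hN : 2 ≤ N) (hY : IsCompact YH) (hYY : YH ⊆ unitCube N)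
    (i : Fin N) :
    ∃ Φ, IsPeriodicTest YH Φ ∧ ∫ y in solidCell YH, Φ y = 1 ∧
      ∀ y, fderiv ℝ Φ y (EuclideanSpace.single i 1) = 0 := by
  obtain ⟨j, hj⟩ : ∃ j : Fin N, j ≠ i := by
    have : Nontrivial (Fin N) := Fin.nontrivial_iff_two_le.2 hN
    exact exists_ne i
  obtain ⟨c, hc1, hc⟩ := exists_cos_lt hY hYY j
  -- `θ (y j)` is positive exactly where the cosine exceeds `c`, that is near the faces `y_j ∈ ℤ`,
  -- and it is constant in every direction other than `e_j`. An index `j ≠ i` exists because `N ≥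
  -- 2`.
  set θ : ℝ → ℝ := fun x => Real.smoothTransition ((Real.cos (2 * Real.pi * x) - c) / (1 - c))
  have hθ : ContDiff ℝ ∞ θ := by
    refine Real.smoothTransition.contDiff.comp ?_
    exact ((Real.contDiff_cos.comp (contDiff_const.mul contDiff_id)).sub contDiff_const).div_const _
  set Φ : Space N → ℝ := fun y => θ (y j)
  have hproj : ContDiff ℝ ∞ fun y : Space N => y j := (EuclideanSpace.proj (𝕜 := ℝ) j).contDiff
  have hΦ : ContDiff ℝ ∞ Φ := hθ.comp hproj
  have hper : ∀ k y, Φ (y + intVec k) = Φ y := by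
    intro k y
    simp only [Φ, θ, PiLp.add_apply, intVec_apply, mul_add]
    rw [show 2 * Real.pi * (k j : ℝ) = (k j : ℝ) * (2 * Real.pi) by ring, Real.cos_add_int_mul_two_pi]
  have hsupp : tsupport Φ ⊆ periodicExt YH := by
    have h1 : tsupport Φ ⊆ {y | c ≤ Real.cos (2 * Real.pi * y j)} := by
      refine closure_minimal (fun y hy => ?_) (isClosed_le continuous_const (by fun_prop))
      by_contra hcon
      rw [Set.mem_ofPred_eq, not_le] at hcon
      refine hy (Real.smoothTransition.zero_of_nonpos ?_)
      exact div_nonpos_of_nonpos_of_nonneg (by linarith) (by linarith)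
    intro y hy k hk
    have h2 := hc _ hk
    simp only [PiLp.sub_apply, intVec_apply, mul_sub] at h2
    rw [show 2 * Real.pi * (k j : ℝ) = (k j : ℝ) * (2 * Real.pi) by ring,
      Real.cos_sub_int_mul_two_pi] at h2
    exact absurd (h1 hy) (not_le.2 h2)
  have hpos : 0 < ∫ y in solidCell YH, Φ y := by
    rw [setIntegral_pos_iff_support_of_nonneg_ae (ae_of_all _ fun y => Real.smoothTransition.nonneg _)]
    · have hopen : IsOpen (Function.support Φ ∩ solidCell YH) :=
        (hΦ.continuous.isOpen_support).inter (isOpen_solidCell hY)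
      refine hopen.measure_pos volume ?_
      have h1 : Tendsto (fun x : ℝ => Real.cos (2 * Real.pi * x)) (𝓝[>] 0) (𝓝 1) := by
        have : Continuous fun x : ℝ => Real.cos (2 * Real.pi * x) := by fun_prop
        simpa using (this.tendsto 0).mono_left nhdsWithin_le_nhds
      have h2 : ∀ᶠ x : ℝ in 𝓝[>] 0, x < 1 := nhdsWithin_le_nhds (Iio_mem_nhds one_pos)
      -- A point `(x, …, x)` with small `x > 0` lies in the cube and close enough to the face to be
      -- outside the hole, so `Φ` is positive somewhere on the solid cell and its integral can be
      -- normalized.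
      obtain ⟨x, hx1, hx2, hx3⟩ := ((h1.eventually_const_lt hc1).and (h2.and self_mem_nhdsWithin)).exists
      refine ⟨WithLp.toLp 2 fun _ => x, ?_, fun i => ⟨hx3, hx2⟩, fun h => ?_⟩
      · exact (Real.smoothTransition.pos_of_pos (div_pos (by linarith) (by linarith))).ne'
      · exact absurd (hc _ h) (not_lt.2 hx1.le)
    · have hfin := isFiniteMeasure_solidCell (YH := YH)
      exact (memLp_of_continuous hΦ.continuous).integrable (by norm_num)
  set I := ∫ y in solidCell YH, Φ y
  refine ⟨fun y => I⁻¹ * Φ y, ⟨contDiff_const.mul hΦ, fun k y => congrArg (I⁻¹ * ·) (hper k y), ?_⟩, ?_, fun y => ?_⟩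
  · exact (tsupport_mul_subset_right (f := fun _ => I⁻¹) (g := Φ)).trans hsupp
  · rw [integral_const_mul, inv_mul_cancel₀ hpos.ne']
  · have hd1 : HasFDerivAt (fun y : Space N => y j) (EuclideanSpace.proj (𝕜 := ℝ) j) y :=
      (EuclideanSpace.proj (𝕜 := ℝ) j).hasFDerivAt
    have hd2 := ((hθ.differentiable (by simp) (y j)).hasDerivAt.comp_hasFDerivAt y hd1).const_mul I⁻¹
    have hd3 : fderiv ℝ (fun y => I⁻¹ * Φ y) y = _ := hd2.fderiv
    rw [hd3]
    simp [hj]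

/-- Testing a weak gradient with `Φ` in the direction `e_i` gives zero on the side of the
derivative, since `Φ` does not vary in that direction; what is left says that `∫ Φ F_i = 0`. -/
lemma isCellPair_direction (hYY : YH ⊆ unitCube N) {i : Fin N}
    {Φ : Space N → ℝ} (hΦ : IsPeriodicTest YH Φ)
    (hd : ∀ y, fderiv ℝ Φ y (EuclideanSpace.single i 1) = 0) :
    IsCellPair YH (fun _ => 0) (fun y => Φ y • EuclideanSpace.single i 1) := by
  refine ⟨memLp_const_solidCell 0, memLp_of_continuous (hΦ.1.continuous.smul continuous_const),
    fun _ _ => rfl, fun y hy => ?_, fun w F h => ?_⟩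
  · change Φ y • EuclideanSpace.single i (1 : ℝ) = 0
    rw [image_eq_zero_of_notMem_tsupport (f := Φ), zero_smul]
    intro hy'
    have := (mem_periodicExt_iff hYY).1 (hΦ.2.2 hy')
    rw [fract_eq_self (unitCube_subset_halfOpenCube (hYY hy))] at this
    exact this hy
  · have := h.2.2 Φ hΦ (EuclideanSpace.single i 1)
    simp only [hd, mul_zero, integral_zero] at this
    simp only [zero_mul, integral_zero, real_inner_smul_left]
    rw [zero_eq_neg] at this
    rw [← this]
    simp only [real_inner_comm]

end Perforated

/-! ### Folding functions on the perforated domain to the cell. -/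

namespace Perforated
variable {N : ℕ} {YH : Set (Space N)}

lemma memLp_comp_smul {B : Type*} [NormedAddCommGroup B] {A : Space N → B}
    (hA : MemLp A 2 volume) {a : ℝ} (ha : a ≠ 0) : MemLp (fun x => A (a • x)) 2 volume := by
  have he : MeasurableEmbedding fun x : Space N => a • x :=
    (Homeomorph.smulOfNeZero a ha).measurableEmbedding
  have h1 : MemLp A 2 (Measure.map (fun x : Space N => a • x) volume) := by
    rw [Measure.map_addHaar_smul _ ha]
    exact hA.smul_measure ENNReal.ofReal_ne_top
  exact (he.memLp_map_measure_iff).1 h1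

lemma memLp_comp_smul_add {B : Type*} [NormedAddCommGroup B] {A : Space N → B}
    (hA : MemLp A 2 volume) {a : ℝ} (ha : a ≠ 0) (v : Space N) :
    MemLp (fun x => A (a • (x + v))) 2 volume :=
  (memLp_comp_smul hA ha).comp_measurePreserving (measurePreserving_add_right volume v)

lemma memLp_comp_fract_smul {H : Type*} [NormedAddCommGroup H] (hY : IsCompact YH) {ε : ℝ}
    (hε : 0 < ε) {b : Space N → H} (hb : MemLp b 2 (volume.restrict (solidCell YH)))
    (hb0 : ∀ y ∈ YH, b y = 0) {B : Set (Space N)} (hBm : MeasurableSet B)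
    (hB : Bornology.IsBounded B) :
    MemLp (fun x => b (fract (ε⁻¹ • x))) 2 (volume.restrict B) :=
  (spaceLattice N).memLp_comp_frac (spaceScale ε hε.ne') (memLp_cell hY hb hb0) hBm hB

/-- Folding an integral with an `ε`-periodic factor to the unit cell. -/
lemma integral_inner_comp_fract {H : Type*} [NormedAddCommGroup H] [InnerProductSpace ℝ H]
    (hY : IsCompact YH) {ε : ℝ} (hε : 0 < ε) {A : Space N → H} (hA : MemLp A 2 volume)
    {K : Set (Space N)} (hK : Bornology.IsBounded K) (hA0 : ∀ x, x ∉ K → A x = 0) {b : Space N → H}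
    (hb : MemLp b 2 (volume.restrict (solidCell YH))) (hb0 : ∀ y ∈ YH, b y = 0)
    {s : Finset (Fin N → ℤ)} (hs : ∀ z ∈ halfOpenCube N, ∀ k, ε • (z + intVec k) ∈ K → k ∈ s) :
    ∫ x, inner ℝ (A x) (b (fract (ε⁻¹ • x))) =
      ε ^ N * ∫ z in solidCell YH, inner ℝ (∑ k ∈ s, A (ε • (z + intVec k))) (b z) := by
  set f : Space N → ℝ := fun x => inner ℝ (A x) (b (fract (ε⁻¹ • x)))
  have hf : Integrable f := by
    obtain ⟨R, hR⟩ := hK.subset_closedBall 0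
    refine (integrableOn_iff_integrable_of_support_subset (s := Metric.closedBall 0 R) ?_).1 ?_
    · intro x hx
      refine hR ?_
      by_contra hcon
      exact hx (by simp [f, hA0 x hcon])
    · exact integrable_inner_of_memLp (hA.restrict _)
        (memLp_comp_fract_smul hY hε hb hb0 measurableSet_closedBall Metric.isBounded_closedBall)
  have e1 : ∫ x, f x = ε ^ N * ∫ y, f (ε • y) := by
    rw [Measure.integral_comp_smul, finrank_euclideanSpace_fin, smul_eq_mul, abs_of_pos (by positivity),
      mul_inv_cancel_left₀ (by positivity)]
  have hf' : Integrable fun y => f (ε • y) := hf.comp_smul hε.ne'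
  have e2 : ∀ y, f (ε • y) = inner ℝ (A (ε • y)) (b (fract y)) := fun y => by
    simp only [f, inv_smul_smul₀ hε.ne']
  rw [e1, (spaceLattice N).integral_eq_sum hf' s]
  · congr 1
    simp only [sum_inner]
    have hterm : ∀ k : Fin N → ℤ, ∀ z ∈ halfOpenCube N,
        f (ε • (intVec k + z)) = inner ℝ (A (ε • (z + intVec k))) (b z) := by
      intro k z hz
      rw [e2, add_comm, fract_add_intVec, fract_eq_self hz]
    have hm : MeasurableSet (halfOpenCube N) := (spaceLattice N).measurableSet_cell
    rw [integral_finsetSum]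
    · refine Finset.sum_congr rfl fun k _ => ?_
      rw [← setIntegral_cell_eq (YH := YH) fun y hy => by rw [hb0 y hy, inner_zero_right]]
      exact setIntegral_congr_fun hm (hterm k)
    · intro k _
      exact integrable_inner_of_memLp ((memLp_comp_smul_add hA hε.ne' _).restrict _) hb
  · intro x hx
    rw [e2, hA0, inner_zero_left]
    intro hxK
    refine hx (hs (fract x) (fract_mem x) _ ?_)
    have := (spaceLattice N).vec_fl_add_frac x
    rw [add_comm] at this
    exact this.symm ▸ hxK

lemma IsPeriodicTest.apply_fract {Φ : Space N → ℝ} (h : IsPeriodicTest YH Φ) (y : Space N) :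
    Φ (fract y) = Φ y := by
  obtain ⟨k, hk⟩ := exists_eq_fract_add y
  conv_rhs => rw [hk]
  exact (h.2.1 k _).symm

lemma IsPeriodicTest.fderiv_fract {Φ : Space N → ℝ} (h : IsPeriodicTest YH Φ) (y : Space N) :
    fderiv ℝ Φ (fract y) = fderiv ℝ Φ y := by
  obtain ⟨k, hk⟩ := exists_eq_fract_add y
  conv_rhs => rw [hk]
  exact (h.fderiv_add k _).symm

lemma IsPeriodicTest.notMem_tsupport (hYY : YH ⊆ unitCube N) {Φ : Space N → ℝ}
    (h : IsPeriodicTest YH Φ) {y : Space N} (hy : y ∈ YH) : y ∉ tsupport Φ := by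
  intro hy'
  have := (mem_periodicExt_iff hYY).1 (h.2.2 hy')
  rw [fract_eq_self (unitCube_subset_halfOpenCube (hYY hy))] at this
  exact this hy

lemma measurableSet_perforated {Ω : Set (Space N)} (hΩ : IsOpen Ω) (hY : IsCompact YH) (ε : ℝ) :
    MeasurableSet (perforated Ω YH ε) := by
  have : perforated Ω YH ε = Ω ∩ ⋂ k : Fin N → ℤ, ⋂ _ : cell ε k ∩ frontier Ω = ∅,
      (fun x : Space N => ε⁻¹ • x - intVec k) ⁻¹' YHᶜ := by
    ext x; simp [perforated]
  rw [this]
  refine hΩ.measurableSet.inter (MeasurableSet.iInter fun k => MeasurableSet.iInter fun _ => ?_)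
  exact (hY.isClosed.isOpen_compl.preimage (by fun_prop)).measurableSet

lemma perforated_subset {Ω : Set (Space N)} {ε : ℝ} : perforated Ω YH ε ⊆ Ω := fun _ h => h.1

/-- The cells of size `ε` that meet `A` do not meet the boundary of `Ω`. -/
def CellsInside (Ω A : Set (Space N)) (ε : ℝ) : Prop :=
  ∀ x ∈ A, cell ε ((spaceLattice N).fl (ε⁻¹ • x)) ∩ frontier Ω = ∅

lemma CellsInside.mem_perforated_iff {Ω A : Set (Space N)} {ε : ℝ} (h : CellsInside Ω A ε)
    (hYY : YH ⊆ unitCube N) {x : Space N} (hxA : x ∈ A) (hx : x ∈ Ω) :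
    x ∈ perforated Ω YH ε ↔ fract (ε⁻¹ • x) ∉ YH := by
  refine ⟨fun hp => hp.2 _ (h x hxA), fun hf => ⟨hx, fun k _ => ?_⟩⟩
  exact (mem_periodicExt_iff hYY).2 hf k

/-- The gradient of `v u` for a weakly differentiable function `u` with gradient `g`. -/
def mulGrad (v u : Space N → ℝ) (g : Space N → Space N) (x : Space N) : Space N :=
  v x • g x + u x • gradient v x

lemma IsTest.continuous_gradient {Ω : Set (Space N)} {v : Space N → ℝ} (hv : IsTest Ω v) :
    Continuous (gradient v) :=
  (InnerProductSpace.toDual ℝ (Space N)).symm.continuous.comp (hv.1.continuous_fderiv (by simp))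

lemma IsTest.gradient_eq_zero {Ω : Set (Space N)} {v : Space N → ℝ} (_hv : IsTest Ω v) {x : Space N}
    (hx : x ∉ tsupport v) : gradient v x = 0 := by
  unfold gradient
  rw [fderiv_of_notMem_tsupport ℝ hx, map_zero]

lemma exists_bound_of_compactSupport {B E : Type*} [NormedAddCommGroup B] [TopologicalSpace E]
    {f : E → B} (hf : Continuous f)
    (hc : HasCompactSupport f) : ∃ C, ∀ x, ‖f x‖ ≤ C := hf.bounded_above_of_compact_support hc

lemma memLp_bdd_smul {α B : Type*} [MeasurableSpace α] {μ : Measure α} [NormedAddCommGroup B]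
    [NormedSpace ℝ B] {c : α → ℝ} {f : α → B} (hc : AEStronglyMeasurable c μ) {C : ℝ}
    (hC : ∀ x, ‖c x‖ ≤ C) {p : ENNReal} (hf : MemLp f p μ) : MemLp (fun x => c x • f x) p μ :=
  hf.of_le_mul (hc.smul hf.1) (ae_of_all _ fun x => by
    rw [norm_smul]
    exact mul_le_mul_of_nonneg_right (hC x) (norm_nonneg _))

lemma memLp_smul_bdd {α B : Type*} [MeasurableSpace α] {μ : Measure α} [NormedAddCommGroup B]
    [NormedSpace ℝ B] {c : α → ℝ} {f : α → B} (hf : AEStronglyMeasurable f μ) {C : ℝ}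
    (hC : ∀ x, ‖f x‖ ≤ C) {p : ENNReal} (hc : MemLp c p μ) : MemLp (fun x => c x • f x) p μ :=
  hc.of_le_mul (hc.1.smul hf) (ae_of_all _ fun x => by
    rw [norm_smul, mul_comm]
    exact mul_le_mul_of_nonneg_right (hC x) (norm_nonneg _))

lemma IsTest.hasCompactSupport_gradient {Ω : Set (Space N)} {v : Space N → ℝ} (hv : IsTest Ω v) :
    HasCompactSupport (gradient v) :=
  hv.2.1.mono' fun x hx => by
    by_contra h
    exact hx (hv.gradient_eq_zero h)

lemma IsTest.memLp_mulGrad {Ω P : Set (Space N)} {v : Space N → ℝ} (hv : IsTest Ω v)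
    {u : Space N → ℝ} {g : Space N → Space N} (hu : MemLp u 2 (volume.restrict P))
    (hg : MemLp g 2 (volume.restrict P)) : MemLp (mulGrad v u g) 2 (volume.restrict P) := by
  obtain ⟨C, hC⟩ := exists_bound_of_compactSupport hv.continuous hv.2.1
  obtain ⟨C', hC'⟩ := exists_bound_of_compactSupport hv.continuous_gradient hv.hasCompactSupport_gradient
  exact (memLp_bdd_smul hv.continuous.aestronglyMeasurable hC hg).add
    (memLp_smul_bdd hv.continuous_gradient.aestronglyMeasurable hC' hu)

lemma integral_inner_indicator {H : Type*} [NormedAddCommGroup H] [InnerProductSpace ℝ H]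
    {P : Set (Space N)} (hP : MeasurableSet P) (f B : Space N → H) :
    ∫ x, inner ℝ (P.indicator f x) (B x) = ∫ x in P, inner ℝ (f x) (B x) := by
  rw [← integral_indicator hP]
  refine integral_congr_ae (ae_of_all _ fun x => ?_)
  by_cases h : x ∈ P <;> simp [h]

section Key

variable {Ω : Set (Space N)} {ε : ℝ} {v u : Space N → ℝ} {g : Space N → Space N}

/-- The weak gradient tested with an oscillating test function. -/
lemma integral_oscillating_test (hYY : YH ⊆ unitCube N) (hε : 0 < ε)
    (hv : IsTest Ω v) (hsep : CellsInside Ω (tsupport v) ε)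
    (hug : HasWeakGrad (perforated Ω YH ε) u g) (hu : MemLp u 2 (volume.restrict (perforated Ω YH ε)))
    (hg : MemLp g 2 (volume.restrict (perforated Ω YH ε))) {Φ : Space N → ℝ}
    (hΦ : IsPeriodicTest YH Φ) (ξ : Space N) :
    ∫ x in perforated Ω YH ε, u x * v x * fderiv ℝ Φ (ε⁻¹ • x) ξ =
      -(ε * ∫ x in perforated Ω YH ε, Φ (ε⁻¹ • x) * inner ℝ (mulGrad v u g x) ξ) := by
  set P := perforated Ω YH ε
  -- This is an admissible test function on the perforated domain: the support of `Φ` avoids the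
  -- holes, and that of `v` meets only cells away from the boundary of `Ω`. Its derivative carries a
  -- factor `ε⁻¹` on the part where `Φ` is differentiated, which accounts for the `ε` on the
  -- right-hand side.
  set χ : Space N → ℝ := fun x => v x * Φ (ε⁻¹ • x)
  have hs : tsupport χ ⊆ P := by
    intro x hx
    have h1 : x ∈ tsupport v := tsupport_mul_subset_left (f := v) hx
    have h2 : ε⁻¹ • x ∈ tsupport Φ := by
      have h3 : x ∈ tsupport (fun x => Φ (ε⁻¹ • x)) :=
        tsupport_mul_subset_right (f := v) (g := fun x => Φ (ε⁻¹ • x)) hx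
      exact tsupport_comp_subset_preimage Φ (f := fun x : Space N => ε⁻¹ • x) (by fun_prop) h3
    exact (hsep.mem_perforated_iff hYY h1 (hv.2.2 h1)).2 ((mem_periodicExt_iff hYY).1 (hΦ.2.2 h2))
  have hsc : ContDiff ℝ ∞ fun x : Space N => ε⁻¹ • x := contDiff_id.const_smul ε⁻¹
  have hχ : IsTest P χ := ⟨hv.1.mul (hΦ.1.comp hsc), hv.2.1.mul_right, hs⟩
  have key := hug.2.2 χ hχ ξ
  have hd : ∀ x, fderiv ℝ χ x ξ = ε⁻¹ * (v x * fderiv ℝ Φ (ε⁻¹ • x) ξ) +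
      Φ (ε⁻¹ • x) * inner ℝ (gradient v x) ξ := by
    intro x
    have d1 : HasFDerivAt (fun x : Space N => Φ (ε⁻¹ • x)) _ x :=
      (hΦ.1.differentiable (by simp) (ε⁻¹ • x)).hasFDerivAt.comp x
        ((hasFDerivAt_id x).const_smul ε⁻¹)
    have d2 : HasFDerivAt χ _ x := (hv.1.differentiable (by simp) x).hasFDerivAt.mul d1
    rw [d2.fderiv, inner_gradient_left]
    simp
    ring
  have hΦc : Continuous fun x : Space N => Φ (ε⁻¹ • x) := hΦ.1.continuous.comp (by fun_prop)
  have hdΦ : Continuous fun x : Space N => fderiv ℝ Φ (ε⁻¹ • x) ξ :=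
    (hΦ.continuous_fderiv ξ).comp (by fun_prop)
  have m1 : MemLp (fun x => v x * fderiv ℝ Φ (ε⁻¹ • x) ξ) 2 (volume.restrict P) :=
    ((hv.continuous.mul hdΦ).memLp_of_hasCompactSupport hv.2.1.mul_right).restrict P
  have hgc : HasCompactSupport fun x => inner ℝ (gradient v x) ξ :=
    hv.hasCompactSupport_gradient.comp_left (g := fun z => inner ℝ z ξ) (inner_zero_left ξ)
  have m2 : MemLp (fun x => Φ (ε⁻¹ • x) * inner ℝ (gradient v x) ξ) 2 (volume.restrict P) :=
    ((hΦc.mul (hv.continuous_gradient.inner continuous_const)).memLp_of_hasCompactSupport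
      hgc.mul_left).restrict P
  have m3 : MemLp (fun x => v x * Φ (ε⁻¹ • x)) 2 (volume.restrict P) :=
    ((hv.continuous.mul hΦc).memLp_of_hasCompactSupport hv.2.1.mul_right).restrict P
  have j1 := integrable_mul_of_memLp hu m1
  have j2 := integrable_mul_of_memLp hu m2
  have j3 := integrable_mul_of_memLp m3 (hg.inner_const (𝕜 := ℝ) ξ)
  have e1 : ∫ x in P, u x * fderiv ℝ χ x ξ = ε⁻¹ * (∫ x in P, u x * (v x * fderiv ℝ Φ (ε⁻¹ • x) ξ)) +
      ∫ x in P, u x * (Φ (ε⁻¹ • x) * inner ℝ (gradient v x) ξ) := by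
    rw [← integral_const_mul, ← integral_add (j1.const_mul _) j2]
    refine integral_congr_ae (ae_of_all _ fun x => ?_)
    simp only [hd]
    ring
  have e2 : ∫ x in P, Φ (ε⁻¹ • x) * inner ℝ (mulGrad v u g x) ξ =
      (∫ x in P, v x * Φ (ε⁻¹ • x) * inner ℝ (g x) ξ) +
      ∫ x in P, u x * (Φ (ε⁻¹ • x) * inner ℝ (gradient v x) ξ) := by
    rw [← integral_add j3 j2]
    refine integral_congr_ae (ae_of_all _ fun x => ?_)
    simp only [mulGrad, inner_add_left, real_inner_smul_left]
    ring
  rw [e1] at key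
  have e3 : ∫ x in P, u x * v x * fderiv ℝ Φ (ε⁻¹ • x) ξ =
      ∫ x in P, u x * (v x * fderiv ℝ Φ (ε⁻¹ • x) ξ) := by simp only [mul_assoc]
  have e4 : ∫ x in P, u x * (v x * fderiv ℝ Φ (ε⁻¹ • x) ξ) =
      ε * (ε⁻¹ * ∫ x in P, u x * (v x * fderiv ℝ Φ (ε⁻¹ • x) ξ)) := by
    rw [mul_inv_cancel_left₀ hε.ne']
  rw [e2, e3, e4, eq_sub_of_add_eq key]
  ring

/-- Functions on the perforated domain tested with an oscillating divergence. -/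
theorem integral_mul_cellPair (hΩ : IsOpen Ω) (hY : IsCompact YH) (hYY : YH ⊆ unitCube N) (hε : 0 < ε)
    (hv : IsTest Ω v) (hsep : CellsInside Ω (tsupport v) ε)
    (hug : HasWeakGrad (perforated Ω YH ε) u g) (hu : MemLp u 2 (volume.restrict (perforated Ω YH ε)))
    (hg : MemLp g 2 (volume.restrict (perforated Ω YH ε))) {ψ : Space N → ℝ} {Θ : Space N → Space N}
    (hψ : IsCellPair YH ψ Θ) :
    ∫ x in perforated Ω YH ε, u x * v x * ψ (fract (ε⁻¹ • x)) =
      ε * ∫ x in perforated Ω YH ε, inner ℝ (mulGrad v u g x) (Θ (fract (ε⁻¹ • x))) := by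
  set P := perforated Ω YH ε
  have hPm : MeasurableSet P := measurableSet_perforated hΩ hY ε
  set K := tsupport v
  have hK : Bornology.IsBounded K := hv.2.1.isBounded
  obtain ⟨C, hC⟩ := exists_bound_of_compactSupport hv.continuous hv.2.1
  set A₀ : Space N → ℝ := P.indicator fun x => v x • u x
  set A₁ : Space N → Space N := P.indicator (mulGrad v u g)
  have hA₀ : MemLp A₀ 2 volume := (memLp_indicator_iff_restrict hPm).2
    (memLp_bdd_smul hv.continuous.aestronglyMeasurable hC hu)
  have hA₁ : MemLp A₁ 2 volume := (memLp_indicator_iff_restrict hPm).2 (hv.memLp_mulGrad hu hg)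
  have z₀ : ∀ x, x ∉ K → A₀ x = 0 := fun x hx => indicator_apply_eq_zero.2 fun _ => by
    rw [image_eq_zero_of_notMem_tsupport hx, zero_smul]
  have z₁ : ∀ x, x ∉ K → A₁ x = 0 := fun x hx => indicator_apply_eq_zero.2 fun _ => by
    rw [mulGrad, image_eq_zero_of_notMem_tsupport hx, hv.gradient_eq_zero hx, zero_smul, smul_zero,
      add_zero]
  obtain ⟨s, hs⟩ : ∃ s : Finset (Fin N → ℤ), ∀ z ∈ halfOpenCube N, ∀ k,
      ε • (z + intVec k) ∈ K → k ∈ s := by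
    obtain ⟨s, hs⟩ := exists_finset_intVec (isBounded_halfOpenCube (N := N)) (hK.smul₀ ε⁻¹)
    refine ⟨s, fun z hz k hk => hs z hz k ?_⟩
    rw [mem_inv_smul_set_iff₀ hε.ne']
    exact hk
  -- The copies of `v u` in all cells are rescaled to the unit cell and added, and so are the copies
  -- of its gradient. Only finitely many cells meet the support of `v`.
  set w : Space N → ℝ := fun z => ∑ k ∈ s, A₀ (ε • (z + intVec k))
  set F : Space N → Space N := fun z => ∑ k ∈ s, A₁ (ε • (z + intVec k))
  have hw : MemLp w 2 (volume.restrict (solidCell YH)) :=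
    memLp_finsetSum _ fun k _ => (memLp_comp_smul_add hA₀ hε.ne' _).restrict _
  have hF : MemLp F 2 (volume.restrict (solidCell YH)) :=
    memLp_finsetSum _ fun k _ => (memLp_comp_smul_add hA₁ hε.ne' _).restrict _
  have hεN : ε ^ N ≠ 0 := by positivity
  have fold₀ : ∀ {b : Space N → ℝ}, MemLp b 2 (volume.restrict (solidCell YH)) →
      (∀ y ∈ YH, b y = 0) → ∫ x in P, u x * v x * b (fract (ε⁻¹ • x)) =
      ε ^ N * ∫ z in solidCell YH, b z * w z := by
    intro b hb hb0
    have h1 := integral_inner_comp_fract hY hε hA₀ hK z₀ hb hb0 hs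
    rw [integral_inner_indicator hPm] at h1
    simp only [RCLike.inner_apply, conj_trivial, smul_eq_mul] at h1
    rw [← h1]
    refine integral_congr_ae (ae_of_all _ fun x => ?_)
    ring
  have fold₁ : ∀ {b : Space N → Space N}, MemLp b 2 (volume.restrict (solidCell YH)) →
      (∀ y ∈ YH, b y = 0) → ∫ x in P, inner ℝ (mulGrad v u g x) (b (fract (ε⁻¹ • x))) =
      ε ^ N * ∫ z in solidCell YH, inner ℝ (b z) (F z) := by
    intro b hb hb0
    have h1 := integral_inner_comp_fract hY hε hA₁ hK z₁ hb hb0 hs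
    rw [integral_inner_indicator hPm] at h1
    rw [h1]
    simp only [F, real_inner_comm]
  -- Folding the identity for oscillating test functions says exactly that the sum of the copies has
  -- weak gradient `ε F` in the cell. The cell pair can then be applied to it although `ψ` and `Θ`
  -- are merely square integrable.
  have hgrad : CellGrad YH w (fun z => ε • F z) := by
    refine ⟨hw, hF.const_smul ε, fun Φ hΦ ξ => ?_⟩
    have h1 := integral_oscillating_test hYY hε hv hsep hug hu hg hΦ ξ
    have h2 := fold₀ (memLp_of_continuous (hΦ.continuous_fderiv ξ)) fun y hy => by
      rw [fderiv_of_notMem_tsupport ℝ (hΦ.notMem_tsupport hYY hy)]; simp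
    have h3 := fold₁ (b := fun y => Φ y • ξ)
      (memLp_of_continuous (hΦ.1.continuous.smul continuous_const)) fun y hy => by
      rw [image_eq_zero_of_notMem_tsupport (hΦ.notMem_tsupport hYY hy), zero_smul]
    simp only [hΦ.fderiv_fract, hΦ.apply_fract, real_inner_smul_left, real_inner_smul_right] at h2 h3
    rw [h2, h3] at h1
    have h4 : ε ^ N * ∫ z in solidCell YH, fderiv ℝ Φ z ξ * w z =
        ε ^ N * -(ε * ∫ z in solidCell YH, Φ z * inner ℝ ξ (F z)) := by rw [h1]; ring
    have h5 := mul_left_cancel₀ hεN h4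
    simp only [real_inner_smul_left]
    rw [← integral_const_mul] at h5
    calc _ = ∫ z in solidCell YH, fderiv ℝ Φ z ξ * w z := by simp only [mul_comm]
      _ = _ := by
        rw [h5]
        congr 1
        refine integral_congr_ae (ae_of_all _ fun y => ?_)
        simp only [real_inner_comm]
        ring
  rw [fold₀ hψ.1 hψ.2.2.1, fold₁ hψ.2.1 hψ.2.2.2.1, hψ.2.2.2.2 _ _ hgrad]
  simp only [real_inner_smul_right, integral_const_mul]
  ring

end Key

end Perforated

/-! ### Oscillating test functions in space-time. -/

namespace Perforated
variable {N : ℕ} {Ω YH : Set (Space N)}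

/-- A point of a cell of size `ε` that meets `A` is within `2 ε √N` of `A`, hence eventually in a
neighbourhood of `A` inside `Ω`, and the open set `Ω` contains none of its boundary points. -/
lemma eventually_cellsInside (hΩ : IsOpen Ω) {A : Set (Space N)} (hA : IsCompact A) (hAΩ : A ⊆ Ω)
    {ε : ℕ → ℝ} (hε : ∀ k, 0 < ε k) (hε0 : Tendsto ε atTop (𝓝 0)) :
    ∀ᶠ n in atTop, CellsInside Ω A (ε n) := by
  obtain ⟨d, hd, hdΩ⟩ := hA.exists_thickening_subset_open hΩ hAΩ
  have h1 : Tendsto (fun n => ε n * (2 * Real.sqrt N)) atTop (𝓝 0) := by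
    simpa using hε0.mul_const (2 * Real.sqrt N)
  filter_upwards [h1.eventually_lt_const hd] with n hn x hx
  rw [eq_empty_iff_forall_notMem]
  rintro y ⟨hy, hyf⟩
  have hyΩ : y ∈ Ω := by
    refine hdΩ (Metric.mem_thickening_iff.2 ⟨x, hx, ?_⟩)
    refine lt_of_le_of_lt ?_ hn
    have e : y - x = ε n • (((ε n)⁻¹ • y - intVec ((spaceLattice N).fl ((ε n)⁻¹ • x))) -
        fract ((ε n)⁻¹ • x)) := by
      change y - x = ε n • (((ε n)⁻¹ • y - intVec ((spaceLattice N).fl ((ε n)⁻¹ • x))) -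
        ((ε n)⁻¹ • x - intVec ((spaceLattice N).fl ((ε n)⁻¹ • x))))
      rw [sub_sub_sub_cancel_right, smul_sub, smul_inv_smul₀ (hε n).ne', smul_inv_smul₀ (hε n).ne']
    rw [dist_eq_norm, e, norm_smul, Real.norm_of_nonneg (hε n).le]
    refine mul_le_mul_of_nonneg_left ?_ (hε n).le
    refine (norm_sub_le _ _).trans ?_
    have n1 : ∀ z ∈ halfOpenCube N, ‖z‖ ≤ Real.sqrt N := (spaceLattice N).norm_le
    linarith [n1 _ (unitCube_subset_halfOpenCube hy), n1 _ (fract_mem ((ε n)⁻¹ • x))]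
  rw [hΩ.frontier_eq] at hyf
  exact hyf.2 hyΩ

lemma ae_memLp_slice {α β B : Type*} [MeasurableSpace α] [MeasurableSpace β] {μ : Measure α}
    {ν : Measure β} [SFinite μ] [SFinite ν] [NormedAddCommGroup B] {f : α × β → B}
    (hf : MemLp f 2 (μ.prod ν)) : ∀ᵐ t ∂ν, MemLp (fun x => f (x, t)) 2 μ := by
  have h1 := ((memLp_two_iff_integrable_sq_norm hf.1).1 hf).prod_left_ae
  filter_upwards [h1, hf.1.prodMk_right] with t ht hm
  exact (memLp_two_iff_integrable_sq_norm hm).2 ht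

/-- Evaluation of a function of the cell variables at the fast variables. -/
def osc {B : Type*} (ε r : ℝ) (b : Space N × ℝ → B) (p : Space N × ℝ) : B :=
  b (fract (ε⁻¹ • p.1), Int.fract (p.2 / ε ^ r))

/-- The product of a function of the space variable and a scalar function of time. -/
def tens {B : Type*} [SMul ℝ B] (ψ : Space N → B) (c : ℝ → ℝ) (p : Space N × ℝ) : B := c p.2 • ψ p.1

lemma osc_eq {B : Type*} {ε r : ℝ} (hε : 0 < ε) (b : Space N × ℝ → B) (p : Space N × ℝ) :
    osc ε r b p = b ((stLattice N).frac
      ((stScale ε (ε ^ r) hε.ne' (Real.rpow_pos_of_pos hε r).ne').symm p)) := by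
  rw [stScale_symm_apply]; rfl

lemma volume_restrict_prod (A : Set (Space N)) (B : Set ℝ) :
    (volume.restrict (A ×ˢ B) : Measure (Space N × ℝ)) =
      (volume.restrict A).prod (volume.restrict B) := by
  rw [Measure.volume_eq_prod, Measure.prod_restrict]

lemma memLp_tens {B : Type*} [NormedAddCommGroup B] [NormedSpace ℝ B] {ψ : Space N → B}
    {A : Set (Space N)} (hψ : MemLp ψ 2 (volume.restrict A)) {c : ℝ → ℝ} (hc : Continuous c) {M : ℝ}
    (hM : ∀ s, ‖c s‖ ≤ M) {J : Set ℝ} (hJ : volume J ≠ ⊤) :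
    MemLp (tens ψ c) 2 (volume.restrict (A ×ˢ J)) := by
  have : IsFiniteMeasure (volume.restrict J) := ⟨by simpa using hJ.lt_top⟩
  rw [volume_restrict_prod]
  exact memLp_bdd_smul (c := fun p : Space N × ℝ => c p.2)
    (hc.comp continuous_snd).aestronglyMeasurable (fun p => hM p.2) (hψ.comp_fst _)

lemma memLp_tens_cell {B : Type*} [NormedAddCommGroup B] [NormedSpace ℝ B] (hY : IsCompact YH)
    {ψ : Space N → B} (hψ : MemLp ψ 2 (volume.restrict (solidCell YH))) (hψ0 : ∀ y ∈ YH, ψ y = 0)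
    {c : ℝ → ℝ} (hc : Continuous c) {M : ℝ} (hM : ∀ s, ‖c s‖ ≤ M) :
    MemLp (tens ψ c) 2 (volume.restrict (stLattice N).cell) :=
  memLp_tens (J := Ico 0 1) (memLp_cell hY hψ hψ0) hc hM (by simp)

lemma IsSmoothPeriodic.fract_eq {c : ℝ → ℝ} (hc : IsSmoothPeriodic c) (s : ℝ) :
    c (Int.fract s) = c s := by
  have := hc.2.sub_zsmul_eq ⌊s⌋ (x := s)
  rwa [zsmul_one, Int.self_sub_floor] at this

lemma IsSmoothPeriodic.exists_bound {c : ℝ → ℝ} (hc : IsSmoothPeriodic c) : ∃ M, ∀ s, ‖c s‖ ≤ M := by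
  obtain ⟨M, hM⟩ := (isCompact_Icc (a := (0 : ℝ)) (b := 1)).exists_bound_of_continuousOn
    hc.1.continuous.continuousOn
  exact ⟨M, fun s => by
    rw [← hc.fract_eq]; exact hM _ ⟨Int.fract_nonneg s, (Int.fract_lt_one s).le⟩⟩

lemma tens_continuous {v : Space N → ℝ} {c : ℝ → ℝ} (hv : Continuous v) (hc : Continuous c) :
    Continuous (tens v c) := (hc.comp continuous_snd).smul (hv.comp continuous_fst)

lemma tens_bound {v : Space N → ℝ} {c : ℝ → ℝ} {M M' : ℝ} (hv : ∀ x, ‖v x‖ ≤ M)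
    (hc : ∀ s, ‖c s‖ ≤ M') (p : Space N × ℝ) : ‖tens v c p‖ ≤ M' * M := by
  rw [tens, norm_smul]
  exact mul_le_mul (hc _) (hv _) (norm_nonneg _) ((norm_nonneg _).trans (hc 0))

/-- Bounded continuous functions. -/
def IsBoundedContinuous {E : Type*} [TopologicalSpace E] (a : E → ℝ) : Prop :=
  Continuous a ∧ ∃ M, ∀ p, ‖a p‖ ≤ M

lemma IsSmoothPeriodic.isBoundedContinuous {c : ℝ → ℝ} (hc : IsSmoothPeriodic c) :
    IsBoundedContinuous c := ⟨hc.1.continuous, hc.exists_bound⟩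

lemma IsTest.isBoundedContinuous {F : Type*} [NormedAddCommGroup F] [NormedSpace ℝ F] {U : Set F}
    {φ : F → ℝ} (h : IsTest U φ) : IsBoundedContinuous φ :=
  ⟨h.continuous, exists_bound_of_compactSupport h.continuous h.2.1⟩

lemma IsBoundedContinuous.tens {v : Space N → ℝ} {c : ℝ → ℝ} (hv : IsBoundedContinuous v)
    (hc : IsBoundedContinuous c) : IsBoundedContinuous (tens v c) := by
  obtain ⟨M, hM⟩ := hv.2
  obtain ⟨M', hM'⟩ := hc.2
  exact ⟨tens_continuous hv.1 hc.1, _, tens_bound hM hM'⟩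

lemma memLp_osc {B : Type*} [NormedAddCommGroup B] {ε r : ℝ} (hε : 0 < ε) {b : Space N × ℝ → B}
    (hb : MemLp b 2 (volume.restrict (stLattice N).cell)) {A : Set (Space N × ℝ)}
    (hA : Bornology.IsBounded A) : MemLp (osc ε r b) 2 (volume.restrict A) := by
  have h := (stLattice N).memLp_comp_frac
    (stScale ε (ε ^ r) hε.ne' (Real.rpow_pos_of_pos hε r).ne') hb
    isClosed_closure.measurableSet hA.closure
  have h1 : osc ε r b = fun p => b ((stLattice N).frac
      ((stScale ε (ε ^ r) hε.ne' (Real.rpow_pos_of_pos hε r).ne').symm p)) :=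
    funext fun p => osc_eq hε b p
  rw [h1]
  exact h.mono_measure (Measure.restrict_mono subset_closure le_rfl)

lemma memLp_smul_osc {B : Type*} [NormedAddCommGroup B] [NormedSpace ℝ B] {ε r : ℝ} (hε : 0 < ε)
    {b : Space N × ℝ → B} (hb : MemLp b 2 (volume.restrict (stLattice N).cell))
    {a : Space N × ℝ → ℝ} (ha : IsBoundedContinuous a) {A : Set (Space N × ℝ)}
    (hA : Bornology.IsBounded A) : MemLp (fun p => a p • osc ε r b p) 2 (volume.restrict A) := by
  obtain ⟨M, hM⟩ := ha.2
  exact memLp_bdd_smul ha.1.aestronglyMeasurable hM (memLp_osc hε hb hA)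

/-- The functions of `L²(0,T;H¹)` tested with an oscillating function. -/
def jInt (Ω YH : Set (Space N)) (T r ε : ℝ) (u : Space N → ℝ → ℝ) (a b : Space N × ℝ → ℝ) : ℝ :=
  ∫ p in perforated Ω YH ε ×ˢ Ioo 0 T, u p.1 p.2 * (a p * osc ε r b p)

/-- The gradients tested with an oscillating vector field. -/
def iInt (Ω YH : Set (Space N)) (T r ε : ℝ) (g : Space N → ℝ → Space N) (a : Space N × ℝ → ℝ)
    (b : Space N × ℝ → Space N) : ℝ :=
  ∫ p in perforated Ω YH ε ×ˢ Ioo 0 T, inner ℝ (g p.1 p.2) (a p • osc ε r b p)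

/-- The partial derivative. -/
def pderiv (i : Fin N) (v : Space N → ℝ) (x : Space N) : ℝ := fderiv ℝ v x (EuclideanSpace.single i 1)

lemma IsTest.pderiv {v : Space N → ℝ} (hv : IsTest Ω v) (i : Fin N) : IsTest Ω (pderiv i v) := by
  have hs : tsupport (Perforated.pderiv i v) ⊆ tsupport v := tsupport_fderiv_apply_subset ℝ _
  refine ⟨?_, hv.2.1.mono' ((subset_tsupport _).trans hs), hs.trans hv.2.2⟩
  exact (hv.1.fderiv_right (m := ∞) (by simp)).clm_apply contDiff_const

lemma inner_gradient_eq_sum (v : Space N → ℝ) (x z : Space N) :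
    inner ℝ (gradient v x) z = ∑ i, pderiv i v x * z i := by
  rw [inner_gradient_left]
  have h : z = ∑ i, z i • EuclideanSpace.single i (1 : ℝ) := by
    ext j
    simp [Finset.sum_apply, Pi.single_apply]
  conv_lhs => rw [h]
  simp only [map_sum, map_smul, smul_eq_mul, pderiv, mul_comm]

lemma isBounded_prod_Ioo {A : Set (Space N)} (hA : Bornology.IsBounded A) (T : ℝ) :
    Bornology.IsBounded (A ×ˢ Ioo (0 : ℝ) T) := hA.prod (Metric.isBounded_Ioo _ _)

lemma memLp_apply {α : Type*} [MeasurableSpace α] {μ : Measure α} {Θ : α → Space N}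
    (h : MemLp Θ 2 μ) (i : Fin N) : MemLp (fun y => Θ y i) 2 μ :=
  (EuclideanSpace.proj (𝕜 := ℝ) i).comp_memLp' h

/-- Space-time version of the identity for oscillating divergences. -/
lemma jInt_cellPair (hΩ : IsOpen Ω) (hΩb : Bornology.IsBounded Ω) (hY : IsCompact YH)
    (hYY : YH ⊆ unitCube N) {T r ε : ℝ} (hε : 0 < ε) {v : Space N → ℝ} (hv : IsTest Ω v)
    (hsep : CellsInside Ω (tsupport v) ε) {u : Space N → ℝ → ℝ} {g : Space N → ℝ → Space N}
    (hug : IsL2H1 (perforated Ω YH ε) T u g) {c₁ c₂ : ℝ → ℝ} (hc₁ : IsBoundedContinuous c₁)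
    (hc₂ : IsBoundedContinuous c₂) {ψ : Space N → ℝ} {Θ : Space N → Space N}
    (hψ : IsCellPair YH ψ Θ) :
    jInt Ω YH T r ε u (tens v c₁) (tens ψ c₂) =
      ε * (iInt Ω YH T r ε g (tens v c₁) (tens Θ c₂) +
        ∑ i, jInt Ω YH T r ε u (tens (pderiv i v) c₁) (tens (fun y => Θ y i) c₂)) := by
  obtain ⟨hu, hg, hae⟩ := hug
  set P := perforated Ω YH ε
  have hPb : Bornology.IsBounded (P ×ˢ Ioo 0 T) :=
    isBounded_prod_Ioo (hΩb.subset perforated_subset) T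
  obtain ⟨M₂, hM₂⟩ := hc₂.2
  have cψ := memLp_tens_cell hY hψ.1 hψ.2.2.1 hc₂.1 hM₂
  have cΘ := memLp_tens_cell hY hψ.2.1 hψ.2.2.2.1 hc₂.1 hM₂
  have cΘi : ∀ i, MemLp (tens (fun y => Θ y i) c₂) 2 (volume.restrict (stLattice N).cell) := fun i =>
    memLp_tens_cell hY (memLp_apply hψ.2.1 i) (fun y hy => by rw [hψ.2.2.2.1 y hy]; rfl) hc₂.1 hM₂
  have hva := hv.isBoundedContinuous.tens hc₁
  have i1 := integrable_mul_of_memLp hu (memLp_smul_osc (r := r) hε cψ hva hPb)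
  have i2 := integrable_inner_of_memLp hg (memLp_smul_osc (r := r) hε cΘ hva hPb)
  have i3 : ∀ i, Integrable _ _ := fun i => integrable_mul_of_memLp hu
    (memLp_smul_osc (r := r) hε (cΘi i) ((hv.pderiv i).isBoundedContinuous.tens hc₁) hPb)
  simp only [smul_eq_mul] at i1 i3
  have i4 := i2.add (integrable_finsetSum Finset.univ fun i _ => i3 i)
  rw [jInt, iInt]
  simp only [jInt]
  rw [← integral_finsetSum _ fun i _ => i3 i, ← integral_add i2 (integrable_finsetSum _ fun i _ => i3 i),
    ← integral_const_mul]
  have i4' := i4.const_mul ε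
  rw [volume_restrict_prod] at i1 i4' hu hg ⊢
  rw [integral_prod_symm _ i1]
  refine Eq.trans ?_ (integral_prod_symm _ i4').symm
  refine integral_congr_ae ?_
  -- At almost every time the spatial identity holds and the time factors are constants. The
  -- gradient of `v` is expanded in partial derivatives, so that each term is again an integral of
  -- `u` against a product of a slow and a fast function.
  filter_upwards [hae, ae_memLp_slice hu, ae_memLp_slice hg] with t h1 h2 h3
  have key := integral_mul_cellPair hΩ hY hYY hε hv hsep h1 h2 h3 hψ
  have e1 : ∫ x in P, u x t * (tens v c₁ (x, t) * osc ε r (tens ψ c₂) (x, t)) =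
      c₁ t * c₂ (Int.fract (t / ε ^ r)) * ∫ x in P, u x t * v x * ψ (fract (ε⁻¹ • x)) := by
    rw [← integral_const_mul]
    refine integral_congr_ae (ae_of_all _ fun x => ?_)
    simp only [tens, osc, smul_eq_mul]
    ring
  rw [e1, key, ← integral_const_mul, ← integral_const_mul]
  refine integral_congr_ae (ae_of_all _ fun x => ?_)
  simp only [tens, osc, smul_eq_mul, mulGrad, inner_add_left, real_inner_smul_left,
    real_inner_smul_right, inner_gradient_eq_sum, Pi.add_apply]
  have e2 : ∑ i, u x t * (c₁ t * pderiv i v x * (c₂ (Int.fract (t / ε ^ r)) * Θ (fract (ε⁻¹ • x)) i)) =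
      c₁ t * c₂ (Int.fract (t / ε ^ r)) * (u x t * ∑ i, pderiv i v x * Θ (fract (ε⁻¹ • x)) i) := by
    simp only [Finset.mul_sum]
    exact Finset.sum_congr rfl fun i _ => by ring
  rw [e2]
  ring

end Perforated

/-! ### Uniform bounds and the two-scale limit against square integrable fields. -/

namespace Perforated
variable {N : ℕ} {Ω YH : Set (Space N)}

/-- The measure on `(Ω × (0,T)) × (Y* × (0,1))`. -/
def tsMeasure (Ω YH : Set (Space N)) (T : ℝ) : Measure ((Space N × ℝ) × (Space N × ℝ)) :=
  (volume.restrict (Ω ×ˢ Ioo 0 T)).prod (volume.restrict (solidCell YH ×ˢ Ioo 0 1))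

lemma measurePreserving_nested (hΩ : IsOpen Ω) (hY : IsCompact YH) (T : ℝ) :
    MeasurePreserving (MeasurableEquiv.prodAssoc : (Space N × ℝ) × (Space N × ℝ) ≃ᵐ _)
      (tsMeasure Ω YH T) (volume.restrict (Ω ×ˢ Ioo 0 T ×ˢ solidCell YH ×ˢ Ioo 0 1)) := by
  have h1 := volume_preserving_prodAssoc (α₁ := Space N) (β₁ := ℝ) (γ₁ := Space N × ℝ)
  have hm : MeasurableSet (Ω ×ˢ Ioo (0 : ℝ) T ×ˢ solidCell YH ×ˢ Ioo (0 : ℝ) 1) :=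
    hΩ.measurableSet.prod (measurableSet_Ioo.prod
      ((isOpen_solidCell hY).measurableSet.prod measurableSet_Ioo))
  have h2 := h1.restrict_preimage hm
  have h3 : (MeasurableEquiv.prodAssoc : (Space N × ℝ) × (Space N × ℝ) ≃ᵐ _) ⁻¹'
      (Ω ×ˢ Ioo (0 : ℝ) T ×ˢ solidCell YH ×ˢ Ioo (0 : ℝ) 1) =
      (Ω ×ˢ Ioo 0 T) ×ˢ (solidCell YH ×ˢ Ioo 0 1) := by
    ext ⟨⟨x, t⟩, y, s⟩
    simp [MeasurableEquiv.prodAssoc, and_assoc]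
  rw [h3, Measure.volume_eq_prod, ← Measure.prod_restrict] at h2
  exact h2

lemma integral_nested (hΩ : IsOpen Ω) (hY : IsCompact YH) (T : ℝ)
    (f : Space N × ℝ × Space N × ℝ → ℝ) :
    ∫ p in Ω ×ˢ Ioo 0 T ×ˢ solidCell YH ×ˢ Ioo 0 1, f p =
      ∫ q, f (q.1.1, q.1.2, q.2) ∂(tsMeasure Ω YH T) :=
  ((measurePreserving_nested hΩ hY T).integral_comp
    (MeasurableEquiv.measurableEmbedding _) f).symm

lemma memLp_nested_iff {B : Type*} [NormedAddCommGroup B] (hΩ : IsOpen Ω) (hY : IsCompact YH) (T : ℝ)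
    {f : Space N × ℝ × Space N × ℝ → B} :
    MemLp f 2 (volume.restrict (Ω ×ˢ Ioo 0 T ×ˢ solidCell YH ×ˢ Ioo 0 1)) ↔
      MemLp (fun q => f (q.1.1, q.1.2, q.2)) 2 (tsMeasure Ω YH T) := by
  have h := measurePreserving_nested hΩ hY T
  rw [← h.map_eq]
  exact (MeasurableEquiv.measurableEmbedding _).memLp_map_measure_iff

lemma isFiniteMeasure_spaceTime (hΩb : Bornology.IsBounded Ω) (T : ℝ) :
    IsFiniteMeasure (volume.restrict (Ω ×ˢ Ioo 0 T) : Measure (Space N × ℝ)) :=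
  ⟨by simpa using (isBounded_prod_Ioo hΩb T).measure_lt_top⟩

lemma isFiniteMeasure_cellTime :
    IsFiniteMeasure (volume.restrict (solidCell YH ×ˢ Ioo 0 1) : Measure (Space N × ℝ)) :=
  isFiniteMeasure_spaceTime isBounded_solidCell 1

lemma solidCell_prod_subset_cell : solidCell YH ×ˢ Ioo (0 : ℝ) 1 ⊆ (stLattice N).cell :=
  Set.prod_mono (sdiff_subset.trans unitCube_subset_halfOpenCube) Ioo_subset_Ico_self

lemma restrict_solidCell_le_cell :
    (volume.restrict (solidCell YH ×ˢ Ioo 0 1) : Measure (Space N × ℝ)) ≤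
      volume.restrict (stLattice N).cell :=
  Measure.restrict_mono solidCell_prod_subset_cell le_rfl

lemma stTorus_frac (z : Space N × ℝ) : stTorus ((stLattice N).frac z) = stTorus z := by
  conv_rhs => rw [← (stLattice N).vec_fl_add_frac z]
  exact (stTorus_vec_add _ _).symm

lemma osc_comp_stTorus {B : Type*} {ε r : ℝ} (hε : 0 < ε)
    (β : UnitAddTorus (Fin N) × UnitAddCircle → B) (p : Space N × ℝ) :
    osc ε r (fun z => β (stTorus z)) p =
      β (toTorus (ε⁻¹ • p.1), ((p.2 / ε ^ r : ℝ) : UnitAddCircle)) := by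
  rw [osc_eq hε]
  simp only [stTorus_frac, stScale_symm_apply]
  rfl

lemma tendsto_rpow_zero {ε : ℕ → ℝ} (hε0 : Tendsto ε atTop (𝓝 0)) {r : ℝ}
    (hr : 0 < r) : Tendsto (fun n => ε n ^ r) atTop (𝓝 0) := by
  have h := (Real.continuousAt_rpow_const (0 : ℝ) r (Or.inr hr.le)).tendsto
  rw [Real.zero_rpow hr.ne'] at h
  exact h.comp hε0

lemma eventually_max_le_one {ε : ℕ → ℝ} (hε0 : Tendsto ε atTop (𝓝 0)) {r : ℝ}
    (hr : 0 < r) : ∀ᶠ n in atTop, max (ε n) (ε n ^ r) ≤ 1 := by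
  filter_upwards [hε0.eventually_le_const one_pos,
    (tendsto_rpow_zero hε0 hr).eventually_le_const one_pos] with n h1 h2
  exact max_le h1 h2

lemma eLpNorm_bdd_smul_le {α B : Type*} [MeasurableSpace α] {μ : Measure α} [NormedAddCommGroup B]
    [NormedSpace ℝ B] {c : α → ℝ} {f : α → B} {C : ℝ} (hC : ∀ x, ‖c x‖ ≤ C) :
    eLpNorm (fun x => c x • f x) 2 μ ≤ ENNReal.ofReal C * eLpNorm f 2 μ :=
  eLpNorm_le_mul_eLpNorm_of_ae_le_mul (ae_of_all _ fun x => by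
    rw [norm_smul]; exact mul_le_mul_of_nonneg_right (hC x) (norm_nonneg _)) 2

/-- Uniform bound for oscillating functions. -/
lemma exists_eLpNorm_osc_le (hΩ : IsOpen Ω) (hΩb : Bornology.IsBounded Ω) (T : ℝ) {ε : ℕ → ℝ}
    (hε : ∀ k, 0 < ε k) (hε0 : Tendsto ε atTop (𝓝 0)) {r : ℝ} (hr : 0 < r) {a : Space N × ℝ → ℝ}
    (ha : IsBoundedContinuous a) :
    ∃ K : ENNReal, K ≠ ⊤ ∧ ∀ᶠ n in atTop, ∀ {H : Type} [NormedAddCommGroup H] [NormedSpace ℝ H]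
      (b : Space N × ℝ → H), MemLp b 2 (volume.restrict (stLattice N).cell) →
      eLpNorm (fun p => a p • osc (ε n) r b p) 2 (volume.restrict (Ω ×ˢ Ioo 0 T)) ≤
        K * eLpNorm b 2 (volume.restrict (stLattice N).cell) := by
  obtain ⟨M, hM⟩ := ha.2
  obtain ⟨C, hC, h⟩ := (stLattice N).exists_eLpNorm_comp_frac_le
    (hΩ.measurableSet.prod (measurableSet_Ioo (a := (0 : ℝ)) (b := T))) (isBounded_prod_Ioo hΩb T)
  refine ⟨ENNReal.ofReal M * C, ENNReal.mul_ne_top ENNReal.ofReal_ne_top hC, ?_⟩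
  filter_upwards [eventually_max_le_one hε0 hr] with n hn H _ _ b hb
  refine (eLpNorm_bdd_smul_le hM).trans ?_
  rw [mul_assoc]
  gcongr
  have h1 : osc (ε n) r b = fun p => b ((stLattice N).frac
      ((stScale (ε n) (ε n ^ r) (hε n).ne' (Real.rpow_pos_of_pos (hε n) r).ne').symm p)) :=
    funext fun p => osc_eq (hε n) b p
  rw [h1]
  exact h _ ((norm_stScale_le (hε n) (Real.rpow_pos_of_pos (hε n) r)).trans hn) b hb

lemma exists_iInt_bound (hΩ : IsOpen Ω) (hΩb : Bornology.IsBounded Ω) {T : ℝ} {ε : ℕ → ℝ}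
    (hε : ∀ k, 0 < ε k) (hε0 : Tendsto ε atTop (𝓝 0)) {r : ℝ} (hr : 0 < r)
    {g : ℕ → Space N → ℝ → Space N}
    (hg : ∀ n, MemLp (fun p : Space N × ℝ => g n p.1 p.2) 2
      (volume.restrict (perforated Ω YH (ε n) ×ˢ Ioo 0 T))) {C : ℝ}
    (hC : ∀ n, (eLpNorm (fun p : Space N × ℝ => g n p.1 p.2) 2
      (volume.restrict (perforated Ω YH (ε n) ×ˢ Ioo 0 T))).toReal ≤ C) {a : Space N × ℝ → ℝ}
    (ha : IsBoundedContinuous a) :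
    ∃ K : ℝ, ∀ᶠ n in atTop, ∀ b, MemLp b 2 (volume.restrict (stLattice N).cell) →
      |iInt Ω YH T r (ε n) (g n) a b| ≤
        K * (eLpNorm b 2 (volume.restrict (stLattice N).cell)).toReal := by
  obtain ⟨K, hK, h⟩ := exists_eLpNorm_osc_le hΩ hΩb T hε hε0 hr ha
  refine ⟨C * K.toReal, ?_⟩
  filter_upwards [h] with n hn b hb
  have hsub : perforated Ω YH (ε n) ×ˢ Ioo 0 T ⊆ Ω ×ˢ Ioo 0 T := prod_mono perforated_subset le_rfl
  have h1 := abs_integral_inner_le (hg n) (memLp_smul_osc (r := r) (hε n) hb ha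
    ((isBounded_prod_Ioo hΩb T).subset hsub))
  refine h1.trans ?_
  have h2 := (eLpNorm_mono_measure (fun p => a p • osc (ε n) r b p)
    (Measure.restrict_mono hsub le_rfl)).trans (hn b hb)
  have h3 := ENNReal.toReal_mono (ENNReal.mul_ne_top hK hb.eLpNorm_ne_top) h2
  rw [ENNReal.toReal_mul] at h3
  rw [mul_assoc]
  exact mul_le_mul (hC n) h3 ENNReal.toReal_nonneg (ENNReal.toReal_nonneg.trans (hC n))

lemma exists_jInt_bound (hΩ : IsOpen Ω) (hΩb : Bornology.IsBounded Ω) {T : ℝ} {ε : ℕ → ℝ}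
    (hε : ∀ k, 0 < ε k) (hε0 : Tendsto ε atTop (𝓝 0)) {r : ℝ} (hr : 0 < r)
    {u : ℕ → Space N → ℝ → ℝ}
    (hu : ∀ n, MemLp (fun p : Space N × ℝ => u n p.1 p.2) 2
      (volume.restrict (perforated Ω YH (ε n) ×ˢ Ioo 0 T))) {C : ℝ}
    (hC : ∀ n, (eLpNorm (fun p : Space N × ℝ => u n p.1 p.2) 2
      (volume.restrict (perforated Ω YH (ε n) ×ˢ Ioo 0 T))).toReal ≤ C) {a : Space N × ℝ → ℝ}
    (ha : IsBoundedContinuous a) :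
    ∃ K : ℝ, ∀ᶠ n in atTop, ∀ b, MemLp b 2 (volume.restrict (stLattice N).cell) →
      |jInt Ω YH T r (ε n) (u n) a b| ≤
        K * (eLpNorm b 2 (volume.restrict (stLattice N).cell)).toReal := by
  obtain ⟨K, hK, h⟩ := exists_eLpNorm_osc_le hΩ hΩb T hε hε0 hr ha
  refine ⟨C * K.toReal, ?_⟩
  filter_upwards [h] with n hn b hb
  have hsub : perforated Ω YH (ε n) ×ˢ Ioo 0 T ⊆ Ω ×ˢ Ioo 0 T := prod_mono perforated_subset le_rfl
  have h1 := abs_integral_mul_le (hu n) (memLp_smul_osc (r := r) (hε n) hb ha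
    ((isBounded_prod_Ioo hΩb T).subset hsub))
  refine h1.trans ?_
  have h2 := (eLpNorm_mono_measure (fun p => a p • osc (ε n) r b p)
    (Measure.restrict_mono hsub le_rfl)).trans (hn b hb)
  have h3 := ENNReal.toReal_mono (ENNReal.mul_ne_top hK hb.eLpNorm_ne_top) h2
  rw [ENNReal.toReal_mul] at h3
  rw [mul_assoc]
  exact mul_le_mul (hC n) h3 ENNReal.toReal_nonneg (ENNReal.toReal_nonneg.trans (hC n))

lemma iInt_sub {ε r T : ℝ} (hε : 0 < ε) (hΩb : Bornology.IsBounded Ω) {g : Space N → ℝ → Space N}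
    (hg : MemLp (fun p : Space N × ℝ => g p.1 p.2) 2
      (volume.restrict (perforated Ω YH ε ×ˢ Ioo 0 T))) {a : Space N × ℝ → ℝ}
    (ha : IsBoundedContinuous a) {b b' : Space N × ℝ → Space N}
    (hb : MemLp b 2 (volume.restrict (stLattice N).cell))
    (hb' : MemLp b' 2 (volume.restrict (stLattice N).cell)) :
    iInt Ω YH T r ε g a (fun z => b z - b' z) = iInt Ω YH T r ε g a b - iInt Ω YH T r ε g a b' := by
  have hB := (isBounded_prod_Ioo hΩb T).subset
    (prod_mono (perforated_subset (YH := YH) (ε := ε)) (le_refl (Ioo 0 T)))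
  rw [iInt, iInt, iInt, ← integral_sub (integrable_inner_of_memLp hg (memLp_smul_osc hε hb ha hB))
    (integrable_inner_of_memLp hg (memLp_smul_osc hε hb' ha hB))]
  refine integral_congr_ae (ae_of_all _ fun p => ?_)
  simp only [osc, smul_sub, inner_sub_right]

lemma memLp_tensor_ts {B : Type*} [NormedAddCommGroup B] [NormedSpace ℝ B]
    (hΩb : Bornology.IsBounded Ω) {T : ℝ} {a : Space N × ℝ → ℝ}
    (ha : IsBoundedContinuous a) {b : Space N × ℝ → B}
    (hb : MemLp b 2 (volume.restrict (solidCell YH ×ˢ Ioo 0 1))) :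
    MemLp (fun q : (Space N × ℝ) × (Space N × ℝ) => a q.1 • b q.2) 2 (tsMeasure Ω YH T) := by
  have := isFiniteMeasure_spaceTime hΩb T
  obtain ⟨M, hM⟩ := ha.2
  exact memLp_bdd_smul (c := fun q : (Space N × ℝ) × (Space N × ℝ) => a q.1)
    (ha.1.comp continuous_fst).aestronglyMeasurable (fun q => hM q.1) (hb.comp_snd _)

lemma eLpNorm_tensor_ts_le {B : Type*} [NormedAddCommGroup B] [NormedSpace ℝ B]
    (hΩb : Bornology.IsBounded Ω) {T : ℝ} {a : Space N × ℝ → ℝ}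
    (ha : IsBoundedContinuous a) :
    ∃ K : ENNReal, K ≠ ⊤ ∧ ∀ b : Space N × ℝ → B, MemLp b 2 (volume.restrict (stLattice N).cell) →
      eLpNorm (fun q : (Space N × ℝ) × (Space N × ℝ) => a q.1 • b q.2) 2 (tsMeasure Ω YH T) ≤
        K * eLpNorm b 2 (volume.restrict (stLattice N).cell) := by
  have := isFiniteMeasure_spaceTime hΩb T
  obtain ⟨M, hM⟩ := ha.2
  set V := (volume.restrict (Ω ×ˢ Ioo 0 T) : Measure (Space N × ℝ)) univ
  have hV : V ≠ ⊤ := measure_ne_top _ _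
  refine ⟨ENNReal.ofReal M * V ^ (1 / 2 : ℝ), ENNReal.mul_ne_top ENNReal.ofReal_ne_top
    (ENNReal.rpow_ne_top_of_nonneg (by norm_num) hV), fun b hb => ?_⟩
  refine (eLpNorm_bdd_smul_le (c := fun q : (Space N × ℝ) × (Space N × ℝ) => a q.1)
    (fun q => hM q.1)).trans ?_
  rw [mul_assoc]
  gcongr
  have hb' := hb.mono_measure (restrict_solidCell_le_cell (YH := YH))
  apply ennreal_le_of_sq_le_sq
  have hs : (V ^ (1 / 2 : ℝ)) ^ 2 = V := by
    rw [← ENNReal.rpow_natCast, ← ENNReal.rpow_mul]; norm_num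
  rw [mul_pow, hs, eLpNorm_two_sq, eLpNorm_two_sq]
  have h1 : ∫⁻ q, ‖b q.2‖ₑ ^ 2 ∂(tsMeasure Ω YH T) =
      ∫⁻ q, (fun _ => 1) q.1 * ‖b q.2‖ₑ ^ 2 ∂(tsMeasure Ω YH T) := by simp
  rw [h1, tsMeasure, lintegral_prod_mul (f := fun _ => 1) (g := fun y => ‖b y‖ₑ ^ 2)
    aemeasurable_const (hb'.1.enorm.pow_const 2)]
  simp only [lintegral_one]
  gcongr
  exact solidCell_prod_subset_cell

/-- Two-scale convergence for continuous functions of the fast variables extends to square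
integrable ones. -/
lemma tendsto_iInt_of_gradientsConverge (hΩ : IsOpen Ω) (hΩb : Bornology.IsBounded Ω)
    (hY : IsCompact YH) {T : ℝ} {ε : ℕ → ℝ}
    (hε : ∀ k, 0 < ε k) (hε0 : Tendsto ε atTop (𝓝 0)) {r : ℝ} (hr : 0 < r)
    {g : ℕ → Space N → ℝ → Space N}
    (hg : ∀ n, MemLp (fun p : Space N × ℝ => g n p.1 p.2) 2
      (volume.restrict (perforated Ω YH (ε n) ×ˢ Ioo 0 T))) {C : ℝ}
    (hC : ∀ n, (eLpNorm (fun p : Space N × ℝ => g n p.1 p.2) 2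
      (volume.restrict (perforated Ω YH (ε n) ×ˢ Ioo 0 T))).toReal ≤ C)
    {h : Space N → ℝ → Space N} {g₁ : Space N → ℝ → Space N → ℝ → Space N}
    (hG : MemLp (fun q : (Space N × ℝ) × (Space N × ℝ) => h q.1.1 q.1.2 + g₁ q.1.1 q.1.2 q.2.1 q.2.2) 2
      (tsMeasure Ω YH T))
    (hconv : GradientsConverge Ω YH T r ε g h g₁) {a : Space N × ℝ → ℝ}
    (ha : IsBoundedContinuous a) {b : Space N × ℝ → Space N}
    (hb : MemLp b 2 (volume.restrict (stLattice N).cell)) :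
    Tendsto (fun n => iInt Ω YH T r (ε n) (g n) a b) atTop
      (𝓝 (∫ q, inner ℝ (h q.1.1 q.1.2 + g₁ q.1.1 q.1.2 q.2.1 q.2.2) (a q.1 • b q.2)
        ∂(tsMeasure Ω YH T))) := by
  set L : (Space N × ℝ → Space N) → ℝ := fun b =>
    ∫ q, inner ℝ (h q.1.1 q.1.2 + g₁ q.1.1 q.1.2 q.2.1 q.2.2) (a q.1 • b q.2) ∂(tsMeasure Ω YH T)
  have hL : ∀ b b' : Space N × ℝ → Space N, MemLp b 2 (volume.restrict (stLattice N).cell) →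
      MemLp b' 2 (volume.restrict (stLattice N).cell) → L (fun z => b z - b' z) = L b - L b' := by
    intro b b' hb hb'
    have k1 := memLp_tensor_ts (YH := YH) hΩb (T := T) ha (hb.mono_measure restrict_solidCell_le_cell)
    have k2 := memLp_tensor_ts (YH := YH) hΩb (T := T) ha (hb'.mono_measure restrict_solidCell_le_cell)
    simp only [L]
    rw [← integral_sub (integrable_inner_of_memLp hG k1) (integrable_inner_of_memLp hG k2)]
    refine integral_congr_ae (ae_of_all _ fun p => ?_)
    simp only [smul_sub, inner_sub_right]
  obtain ⟨K₁, hK₁, hL1⟩ := eLpNorm_tensor_ts_le (B := Space N) (YH := YH) hΩb (T := T) ha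
  obtain ⟨K₂, hK₂⟩ := exists_iInt_bound (YH := YH) hΩ hΩb hε hε0 hr hg hC ha
  set K₃ := (eLpNorm (fun q : (Space N × ℝ) × (Space N × ℝ) =>
    h q.1.1 q.1.2 + g₁ q.1.1 q.1.2 q.2.1 q.2.2) 2 (tsMeasure Ω YH T)).toReal * K₁.toReal
  have hLb : ∀ b, MemLp b 2 (volume.restrict (stLattice N).cell) →
      |L b| ≤ K₃ * (eLpNorm b 2 (volume.restrict (stLattice N).cell)).toReal := by
    intro b hb
    refine (abs_integral_inner_le hG (memLp_tensor_ts hΩb ha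
      (hb.mono_measure restrict_solidCell_le_cell))).trans ?_
    have h3 := ENNReal.toReal_mono (ENNReal.mul_ne_top hK₁ hb.eLpNorm_ne_top) (hL1 b hb)
    rw [ENNReal.toReal_mul] at h3
    rw [mul_assoc]
    exact mul_le_mul_of_nonneg_left h3 ENNReal.toReal_nonneg
  rw [Metric.tendsto_atTop']
  intro η hη
  -- Replacing `b` by a continuous periodic `b'` costs at most `|K₂| η'` along the sequence and
  -- `|K₃| η'` in the limit, together less than `η/2`; the other half is left for the convergence
  -- with `b'`.
  set η' : ℝ := η / (2 * (|K₂| + |K₃| + 1))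
  have hη' : 0 < η' := by positivity
  obtain ⟨β, hβ⟩ := (stLattice N).exists_continuousMap_eLpNorm_sub_le continuous_stTorus
    measurable_torusSection (fun z hz => torusSection_stTorus hz) hb
    (η := ENNReal.ofReal η') (by simpa using hη')
  set b' : Space N × ℝ → Space N := fun z => β (stTorus z)
  have hfin : IsFiniteMeasure (volume.restrict (stLattice N).cell : Measure (Space N × ℝ)) :=
    ⟨by simp [(stLattice N).volume_cell]⟩
  have hb' : MemLp b' 2 (volume.restrict (stLattice N).cell) :=
    MemLp.of_bound (β.continuous.comp continuous_stTorus).aestronglyMeasurable ‖β‖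
      (ae_of_all _ fun z => β.norm_coe_le_norm _)
  have hconvβ : Tendsto (fun n => iInt Ω YH T r (ε n) (g n) a b') atTop (𝓝 (L b')) := by
    have hf := isFiniteMeasure_spaceTime hΩb T
    obtain ⟨M, hM⟩ := ha.2
    have hv : MemLp (fun p => a p • β) 2 (volume.restrict (Ω ×ˢ Ioo 0 T)) :=
      MemLp.of_bound (ha.1.smul continuous_const).aestronglyMeasurable (M * ‖β‖)
        (ae_of_all _ fun p => by
          rw [norm_smul]; exact mul_le_mul_of_nonneg_right (hM p) (norm_nonneg _))
    have := hconv _ hv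
    rw [integral_nested hΩ hY] at this
    refine this.congr fun n => ?_
    rw [iInt]
    refine integral_congr_ae (ae_of_all _ fun p => ?_)
    simp only [b', osc_comp_stTorus (hε n)]
    rfl
  have hsmall : (eLpNorm (fun z => b z - b' z) 2 (volume.restrict (stLattice N).cell)).toReal ≤ η' := by
    have := ENNReal.toReal_mono ENNReal.ofReal_ne_top hβ
    rwa [ENNReal.toReal_ofReal hη'.le] at this
  have hev := (Metric.tendsto_nhds.1 hconvβ (η / 2) (by positivity)).and hK₂
  obtain ⟨n₀, hn₀⟩ := eventually_atTop.1 hev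
  refine ⟨n₀, fun n hn => ?_⟩
  obtain ⟨h1, h2⟩ := hn₀ n hn.le
  have d1 := h2 _ (hb.sub hb')
  have d2 := hLb _ (hb.sub hb')
  have d1' : |iInt Ω YH T r (ε n) (g n) a b - iInt Ω YH T r (ε n) (g n) a b'| ≤ |K₂| * η' := by
    rw [← iInt_sub (hε n) hΩb (hg n) ha hb hb']
    exact d1.trans (mul_le_mul (le_abs_self _) hsmall ENNReal.toReal_nonneg (abs_nonneg _))
  have d2' : |L b - L b'| ≤ |K₃| * η' := by
    rw [← hL b b' hb hb']
    exact d2.trans (mul_le_mul (le_abs_self _) hsmall ENNReal.toReal_nonneg (abs_nonneg _))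
  rw [Real.dist_eq] at h1 ⊢
  have d3 : (|K₂| + |K₃| + 1) * η' = η / 2 := by
    simp only [η']; field_simp
  have d4 : iInt Ω YH T r (ε n) (g n) a b - L b =
      (iInt Ω YH T r (ε n) (g n) a b - iInt Ω YH T r (ε n) (g n) a b') +
      (iInt Ω YH T r (ε n) (g n) a b' - L b') - (L b - L b') := by ring
  change |iInt Ω YH T r (ε n) (g n) a b - L b| < η
  rw [d4]
  refine (abs_sub _ _).trans_lt ?_
  have d5 := abs_add_le (iInt Ω YH T r (ε n) (g n) a b - iInt Ω YH T r (ε n) (g n) a b')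
    (iInt Ω YH T r (ε n) (g n) a b' - L b')
  nlinarith

end Perforated

/-! ### Mean-free cell fields, bounded sequences and slices. -/

namespace Perforated
variable {N : ℕ} {Ω YH : Set (Space N)}

lemma IsCellPair.sub {ψ : Space N → ℝ} {Θ Θ' : Space N → Space N} (h : IsCellPair YH ψ Θ)
    (h' : IsCellPair YH (fun _ => 0) Θ') : IsCellPair YH ψ (fun y => Θ y - Θ' y) := by
  refine ⟨h.1, h.2.1.sub h'.2.1, h.2.2.1, fun y hy => by
    change Θ y - Θ' y = 0
    rw [h.2.2.2.1 y hy, h'.2.2.2.1 y hy, sub_zero], fun w F hw => ?_⟩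
  have h1 := h'.2.2.2.2 w F hw
  simp only [zero_mul, integral_zero] at h1
  simp only [inner_sub_left]
  rw [integral_sub (integrable_inner_of_memLp h.2.1 hw.2.1)
    (integrable_inner_of_memLp h'.2.1 hw.2.1), ← h1, sub_zero]
  exact h.2.2.2.2 w F hw

lemma isCellPair_sum {ι : Type*} (s : Finset ι) (c : ι → ℝ) {Θ : ι → Space N → Space N}
    (h : ∀ i, IsCellPair YH (fun _ => 0) (Θ i)) :
    IsCellPair YH (fun _ => 0) (fun y => ∑ i ∈ s, c i • Θ i y) := by
  refine ⟨memLp_const_solidCell 0, memLp_finsetSum _ fun i _ => (h i).2.1.const_smul (c i),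
    fun _ _ => rfl, fun y hy => Finset.sum_eq_zero fun i _ => by rw [(h i).2.2.2.1 y hy, smul_zero],
    fun w F hw => ?_⟩
  simp only [zero_mul, integral_zero, sum_inner, real_inner_smul_left]
  rw [integral_finsetSum _ fun i _ => (integrable_inner_of_memLp (h i).2.1 hw.2.1).const_mul _]
  refine (Finset.sum_eq_zero fun i _ => ?_).symm
  have h1 := (h i).2.2.2.2 w F hw
  simp only [zero_mul, integral_zero] at h1
  rw [integral_const_mul, ← h1, mul_zero]

/-- The field of a cell pair can be chosen with mean zero. -/
lemma exists_isCellPair_mean_zero (hN : 2 ≤ N) (hY : IsCompact YH) (hYY : YH ⊆ unitCube N)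
    (hYs : HasSmoothBoundary YH) (hYconn : IsConnected (solidCell YH)) {ψ : Space N → ℝ}
    (hψ : MemLp ψ 2 (volume.restrict (solidCell YH))) (hψ0 : ∀ y ∈ YH, ψ y = 0)
    (hmean : ∫ y in solidCell YH, ψ y = 0) :
    ∃ Θ, IsCellPair YH ψ Θ ∧ ∀ i, ∫ y in solidCell YH, Θ y i = 0 := by
  obtain ⟨Θ, hΘ⟩ := exists_isCellPair hY hYY hYs hYconn hψ hψ0 hmean
  choose Φ hΦ hΦ1 hΦd using exists_periodicTest_direction hN hY hYY
  -- The fields `Φ_i e_i` have mean `e_i` and zero divergence. Subtracting their combination with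
  -- the means of `Θ` as coefficients removes the mean and leaves the divergence unchanged.
  have hpair := isCellPair_sum Finset.univ (fun i => ∫ y in solidCell YH, Θ y i)
    fun i => isCellPair_direction hYY (hΦ i) (hΦd i)
  refine ⟨_, hΘ.sub hpair, fun i => ?_⟩
  have hfin := isFiniteMeasure_solidCell (YH := YH)
  have e : ∀ y, (Θ y - ∑ j, (∫ z in solidCell YH, Θ z j) • Φ j y • EuclideanSpace.single j (1 : ℝ)) i =
      Θ y i - (∫ z in solidCell YH, Θ z i) * Φ i y := by
    intro y
    simp [Finset.sum_apply, Pi.single_apply]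
  simp only [e]
  rw [integral_sub ((memLp_apply hΘ.2.1 i).integrable (by norm_num))
    (((memLp_of_continuous (hΦ i).1.continuous).integrable (by norm_num)).const_mul _),
    integral_const_mul, hΦ1, mul_one, sub_self]

/-- The standing assumptions: the geometry, and a bounded sequence of functions. -/
structure IsBoundedSequence (Ω YH : Set (Space N)) (T r : ℝ) (ε : ℕ → ℝ)
    (u : ℕ → Space N → ℝ → ℝ) (g : ℕ → Space N → ℝ → Space N) : Prop where
  two_le : 2 ≤ N
  isOpen : IsOpen Ω
  isBounded : Bornology.IsBounded Ω
  isCompact_hole : IsCompact YH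
  hole_subset : YH ⊆ unitCube N
  hole_smooth : HasSmoothBoundary YH
  connected : IsConnected (solidCell YH)
  r_pos : 0 < r
  eps_pos : ∀ k, 0 < ε k
  eps_tendsto : Tendsto ε atTop (𝓝 0)
  bdd : BoundedL2H1 Ω YH T ε u g

namespace IsBoundedSequence

variable {T r : ℝ} {ε : ℕ → ℝ} {u : ℕ → Space N → ℝ → ℝ} {g : ℕ → Space N → ℝ → Space N}

lemma comp (h : IsBoundedSequence Ω YH T r ε u g) {φ : ℕ → ℕ} (hφ : StrictMono φ) :
    IsBoundedSequence Ω YH T r (ε ∘ φ) (u ∘ φ) (g ∘ φ) :=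
  { h with
    eps_pos := fun k => h.eps_pos (φ k)
    eps_tendsto := h.eps_tendsto.comp hφ.tendsto_atTop
    bdd := ⟨fun k => h.bdd.1 (φ k), h.bdd.2.imp fun _ hC k => hC (φ k)⟩ }

lemma memLp_u (h : IsBoundedSequence Ω YH T r ε u g) (n : ℕ) :
    MemLp (fun p : Space N × ℝ => u n p.1 p.2) 2
      (volume.restrict (perforated Ω YH (ε n) ×ˢ Ioo 0 T)) := (h.bdd.1 n).1

lemma memLp_g (h : IsBoundedSequence Ω YH T r ε u g) (n : ℕ) :
    MemLp (fun p : Space N × ℝ => g n p.1 p.2) 2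
      (volume.restrict (perforated Ω YH (ε n) ×ˢ Ioo 0 T)) := (h.bdd.1 n).2.1

lemma _root_.Perforated.toReal_eLpNorm_le {α B : Type*} [MeasurableSpace α] {μ : Measure α}
    [NormedAddCommGroup B] {f : α → B} (hf : MemLp f 2 μ) {F : α → ℝ} (hF : Integrable F μ)
    (hfF : ∀ x, ‖f x‖ ^ 2 ≤ F x) {C : ℝ} (hC : ∫ x, F x ∂μ ≤ C) :
    (eLpNorm f 2 μ).toReal ≤ Real.sqrt C := by
  have h1 : ∫ x, ‖f x‖ ^ 2 ∂μ ≤ C :=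
    (integral_mono ((memLp_two_iff_integrable_sq_norm hf.1).1 hf) hF hfF).trans hC
  refine Real.le_sqrt_of_sq_le (le_trans (le_of_eq ?_) h1)
  have hm : AEStronglyMeasurable (fun x => ‖f x‖ ^ 2) μ := hf.1.norm.pow 2
  rw [← ENNReal.toReal_pow, eLpNorm_two_sq,
    integral_eq_lintegral_of_nonneg_ae (ae_of_all _ fun x => by positivity) hm]
  congr 1
  refine lintegral_congr fun x => ?_
  rw [ENNReal.ofReal_pow (norm_nonneg _), ofReal_norm]

lemma exists_bound (h : IsBoundedSequence Ω YH T r ε u g) :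
    ∃ C : ℝ, (∀ n, (eLpNorm (fun p : Space N × ℝ => u n p.1 p.2) 2
        (volume.restrict (perforated Ω YH (ε n) ×ˢ Ioo 0 T))).toReal ≤ C) ∧
      ∀ n, (eLpNorm (fun p : Space N × ℝ => g n p.1 p.2) 2
        (volume.restrict (perforated Ω YH (ε n) ×ˢ Ioo 0 T))).toReal ≤ C := by
  obtain ⟨C, hC⟩ := h.bdd.2
  have i : ∀ n, Integrable (fun p : Space N × ℝ => u n p.1 p.2 ^ 2 + ‖g n p.1 p.2‖ ^ 2)
      (volume.restrict (perforated Ω YH (ε n) ×ˢ Ioo 0 T)) := fun n =>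
    (h.memLp_u n).integrable_sq.add ((memLp_two_iff_integrable_sq_norm (h.memLp_g n).1).1 (h.memLp_g n))
  refine ⟨Real.sqrt C, fun n => toReal_eLpNorm_le (h.memLp_u n) (i n) (fun p => ?_) (hC n),
    fun n => toReal_eLpNorm_le (h.memLp_g n) (i n) (fun p => ?_) (hC n)⟩
  · rw [Real.norm_eq_abs, sq_abs]
    exact le_add_of_nonneg_right (by positivity)
  · exact le_add_of_nonneg_left (by positivity)

/-- Functions tested with an oscillating divergence tend to zero. -/
lemma tendsto_jInt_cellPair (h : IsBoundedSequence Ω YH T r ε u g) {v : Space N → ℝ} (hv : IsTest Ω v)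
    {c₁ c₂ : ℝ → ℝ} (hc₁ : IsBoundedContinuous c₁) (hc₂ : IsBoundedContinuous c₂)
    {ψ : Space N → ℝ} {Θ : Space N → Space N} (hψ : IsCellPair YH ψ Θ) :
    Tendsto (fun n => jInt Ω YH T r (ε n) (u n) (tens v c₁) (tens ψ c₂)) atTop (𝓝 0) := by
  obtain ⟨C, hCu, hCg⟩ := h.exists_bound
  obtain ⟨M₂, hM₂⟩ := hc₂.2
  obtain ⟨K, hK⟩ := exists_iInt_bound (YH := YH) h.isOpen h.isBounded h.eps_pos h.eps_tendsto h.r_pos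
    h.memLp_g hCg (hv.isBoundedContinuous.tens hc₁)
  have hJ := fun i => exists_jInt_bound (YH := YH) h.isOpen h.isBounded h.eps_pos h.eps_tendsto h.r_pos
    h.memLp_u hCu ((hv.pderiv i).isBoundedContinuous.tens hc₁)
  choose K' hK' using hJ
  have cΘ := memLp_tens_cell h.isCompact_hole hψ.2.1 hψ.2.2.2.1 hc₂.1 hM₂
  have cΘi : ∀ i, MemLp (tens (fun y => Θ y i) c₂) 2 (volume.restrict (stLattice N).cell) := fun i =>
    memLp_tens_cell h.isCompact_hole (memLp_apply hψ.2.1 i)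
      (fun y hy => by rw [hψ.2.2.2.1 y hy]; rfl) hc₂.1 hM₂
  have hb : Tendsto (fun n => ε n * (K * (eLpNorm (tens Θ c₂) 2
      (volume.restrict (stLattice N).cell)).toReal + ∑ i, K' i * (eLpNorm (tens (fun y => Θ y i) c₂) 2
      (volume.restrict (stLattice N).cell)).toReal)) atTop (𝓝 0) := by
    simpa using h.eps_tendsto.mul_const (K * (eLpNorm (tens Θ c₂) 2
      (volume.restrict (stLattice N).cell)).toReal + ∑ i, K' i * (eLpNorm (tens (fun y => Θ y i) c₂) 2
      (volume.restrict (stLattice N).cell)).toReal)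
  refine squeeze_zero_norm' ?_ hb
  filter_upwards [hK, eventually_all.2 hK',
    eventually_cellsInside h.isOpen hv.2.1 hv.2.2 h.eps_pos h.eps_tendsto] with n h1 h2 h3
  -- The integral equals `ε` times integrals of the bounded sequences against oscillating functions,
  -- which are bounded uniformly in `ε`.
  rw [jInt_cellPair h.isOpen h.isBounded h.isCompact_hole h.hole_subset (h.eps_pos n) hv h3 (h.bdd.1 n)
    hc₁ hc₂ hψ, Real.norm_eq_abs, abs_mul, abs_of_pos (h.eps_pos n)]
  refine mul_le_mul_of_nonneg_left ?_ (h.eps_pos n).le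
  refine (abs_add_le _ _).trans (add_le_add (h1 _ cΘ) ?_)
  refine (Finset.abs_sum_le_sum_abs _ _).trans (Finset.sum_le_sum fun i _ => h2 i _ (cΘi i))

/-- A mean-free profile is an oscillating divergence, so the factor `ε` of the central identity
forces the limit zero. It disposes both of the lower order terms of that identity and of the
deviation of a profile from its mean. -/
lemma tendsto_jInt_mean_zero (h : IsBoundedSequence Ω YH T r ε u g) {v : Space N → ℝ}
    (hv : IsTest Ω v) {c₁ c₂ : ℝ → ℝ} (hc₁ : IsBoundedContinuous c₁) (hc₂ : IsBoundedContinuous c₂)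
    {ψ : Space N → ℝ} (hψ : MemLp ψ 2 (volume.restrict (solidCell YH))) (hψ0 : ∀ y ∈ YH, ψ y = 0)
    (hmean : ∫ y in solidCell YH, ψ y = 0) :
    Tendsto (fun n => jInt Ω YH T r (ε n) (u n) (tens v c₁) (tens ψ c₂)) atTop (𝓝 0) := by
  obtain ⟨Θ, hΘ⟩ := exists_isCellPair h.isCompact_hole h.hole_subset h.hole_smooth h.connected
    hψ hψ0 hmean
  exact h.tendsto_jInt_cellPair hv hc₁ hc₂ hΘ

end IsBoundedSequence

section Slices

variable (N) in
/-- The reordering `(y,(x,t,s)) ↦ (x,t,y,s)`. -/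
def reorder : Space N × (Space N × ℝ × ℝ) ≃ᵐ Space N × ℝ × Space N × ℝ :=
  (MeasurableEquiv.prodComm.trans MeasurableEquiv.prodAssoc).trans
    ((MeasurableEquiv.refl _).prodCongr (MeasurableEquiv.prodAssoc.trans
      ((MeasurableEquiv.refl _).prodCongr MeasurableEquiv.prodComm)))

lemma measurePreserving_reorder (Ω YH : Set (Space N)) (T : ℝ) :
    MeasurePreserving (reorder N) ((volume.restrict (solidCell YH)).prod
      (volume.restrict (Ω ×ˢ Ioo 0 T ×ˢ Ioo 0 1)))
      (volume.restrict (Ω ×ˢ Ioo 0 T ×ˢ solidCell YH ×ˢ Ioo 0 1)) := by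
  set μ₁ : Measure (Space N) := volume.restrict Ω
  set μ₂ : Measure ℝ := volume.restrict (Ioo 0 T)
  set μ₃ : Measure (Space N) := volume.restrict (solidCell YH)
  set μ₄ : Measure ℝ := volume.restrict (Ioo 0 1)
  have e1 : (volume.restrict (Ω ×ˢ Ioo 0 T ×ˢ Ioo 0 1) : Measure (Space N × ℝ × ℝ)) =
      μ₁.prod (μ₂.prod μ₄) := by
    rw [Measure.prod_restrict, Measure.prod_restrict]; rfl
  have e2 : (volume.restrict (Ω ×ˢ Ioo 0 T ×ˢ solidCell YH ×ˢ Ioo 0 1) :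
      Measure (Space N × ℝ × Space N × ℝ)) = μ₁.prod (μ₂.prod (μ₃.prod μ₄)) := by
    rw [Measure.prod_restrict, Measure.prod_restrict, Measure.prod_restrict]; rfl
  rw [e1, e2]
  have s1 : MeasurePreserving Prod.swap (μ₃.prod (μ₁.prod (μ₂.prod μ₄)))
    ((μ₁.prod (μ₂.prod μ₄)).prod μ₃) := Measure.measurePreserving_swap
  have s2 := measurePreserving_prodAssoc μ₁ (μ₂.prod μ₄) μ₃
  have s3 := measurePreserving_prodAssoc μ₂ μ₄ μ₃
  have s4 : MeasurePreserving Prod.swap (μ₄.prod μ₃) (μ₃.prod μ₄) := Measure.measurePreserving_swap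
  have s5 := (MeasurePreserving.id μ₂).prod s4
  have s6 := (MeasurePreserving.id μ₁).prod (s5.comp s3)
  exact s6.comp (s2.comp s1)

lemma ae_slice_memLp {B : Type*} [NormedAddCommGroup B] {T : ℝ} {f : Space N × ℝ × Space N × ℝ → B}
    (hf : MemLp f 2 (volume.restrict (Ω ×ˢ Ioo 0 T ×ˢ solidCell YH ×ˢ Ioo 0 1))) :
    ∀ᵐ q : Space N × ℝ × ℝ ∂(volume.restrict (Ω ×ˢ Ioo 0 T ×ˢ Ioo 0 1)),
      MemLp (fun y => f (q.1, q.2.1, y, q.2.2)) 2 (volume.restrict (solidCell YH)) :=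
  ae_memLp_slice (hf.comp_measurePreserving (measurePreserving_reorder Ω YH T))

lemma integral_slice {T : ℝ} {f : Space N × ℝ × Space N × ℝ → ℝ}
    (hf : Integrable f (volume.restrict (Ω ×ˢ Ioo 0 T ×ˢ solidCell YH ×ˢ Ioo 0 1))) :
    ∫ p in Ω ×ˢ Ioo 0 T ×ˢ solidCell YH ×ˢ Ioo 0 1, f p =
      ∫ q in Ω ×ˢ Ioo 0 T ×ˢ Ioo 0 1, ∫ y in solidCell YH, f (q.1, q.2.1, y, q.2.2) := by
  have h := measurePreserving_reorder Ω YH T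
  rw [← h.integral_comp (reorder N).measurableEmbedding]
  exact integral_prod_symm _ (h.integrable_comp_of_integrable hf)

end Slices

end Perforated

/-! ### Convergence of `ε⁻¹ u_ε` against mean-free oscillating functions. -/

namespace Perforated
variable {N : ℕ} {Ω YH : Set (Space N)}

namespace IsBoundedSequence

variable {T r : ℝ} {ε : ℕ → ℝ} {u : ℕ → Space N → ℝ → ℝ} {g : ℕ → Space N → ℝ → Space N}

lemma memLp_ts_add (h : IsBoundedSequence Ω YH T r ε u g) {h' : Space N → ℝ → Space N}
    {g₁ : Space N → ℝ → Space N → ℝ → Space N}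
    (hh' : MemLp (fun p : Space N × ℝ => h' p.1 p.2) 2 (volume.restrict (Ω ×ˢ Ioo 0 T)))
    (hg₁ : MemLp (fun p : Space N × ℝ × Space N × ℝ => g₁ p.1 p.2.1 p.2.2.1 p.2.2.2) 2
      (volume.restrict (Ω ×ˢ Ioo 0 T ×ˢ solidCell YH ×ˢ Ioo 0 1))) :
    MemLp (fun q : (Space N × ℝ) × (Space N × ℝ) => h' q.1.1 q.1.2 + g₁ q.1.1 q.1.2 q.2.1 q.2.2) 2
      (tsMeasure Ω YH T) := by
  have := isFiniteMeasure_cellTime (YH := YH)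
  exact (hh'.comp_fst (volume.restrict (solidCell YH ×ˢ Ioo 0 1))).add
    ((memLp_nested_iff h.isOpen h.isCompact_hole T).1 hg₁)

/-- The two-scale limit tested with a mean-free divergence. -/
lemma integral_corrector_eq (h : IsBoundedSequence Ω YH T r ε u g) {h' : Space N → ℝ → Space N}
    {u₁ : Space N → ℝ → Space N → ℝ → ℝ} {g₁ : Space N → ℝ → Space N → ℝ → Space N}
    (hh' : MemLp (fun p : Space N × ℝ => h' p.1 p.2) 2 (volume.restrict (Ω ×ˢ Ioo 0 T)))
    (hc : IsCellCorrector Ω YH T u₁ g₁) {v : Space N → ℝ} (hv : IsBoundedContinuous v)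
    {c₁ c₂ : ℝ → ℝ} (hc₁ : IsBoundedContinuous c₁) (hc₂ : IsBoundedContinuous c₂)
    {ψ : Space N → ℝ} {Θ : Space N → Space N} (hψ : IsCellPair YH ψ Θ)
    (hΘ0 : ∀ i, ∫ y in solidCell YH, Θ y i = 0) :
    ∫ q, inner ℝ (h' q.1.1 q.1.2 + g₁ q.1.1 q.1.2 q.2.1 q.2.2) (tens v c₁ q.1 • tens Θ c₂ q.2)
        ∂(tsMeasure Ω YH T) =
      ∫ p in Ω ×ˢ Ioo 0 T ×ˢ solidCell YH ×ˢ Ioo 0 1,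
        u₁ p.1 p.2.1 p.2.2.1 p.2.2.2 * v p.1 * ψ p.2.2.1 * c₁ p.2.1 * c₂ p.2.2.2 := by
  obtain ⟨hu₁, hg₁, hae⟩ := hc
  have hfin := isFiniteMeasure_solidCell (YH := YH)
  obtain ⟨M₂, hM₂⟩ := hc₂.2
  have hG := h.memLp_ts_add hh' hg₁
  have hva := hv.tens hc₁
  have hfin01 : volume (Ioo (0 : ℝ) 1) ≠ ⊤ := by simp
  have cΘ : MemLp (tens Θ c₂) 2 (volume.restrict (solidCell YH ×ˢ Ioo 0 1)) :=
    memLp_tens hψ.2.1 hc₂.1 hM₂ hfin01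
  have cψ : MemLp (tens ψ c₂) 2 (volume.restrict (solidCell YH ×ˢ Ioo 0 1)) :=
    memLp_tens hψ.1 hc₂.1 hM₂ hfin01
  have tΘ := memLp_tensor_ts (YH := YH) h.isBounded (T := T) hva cΘ
  have tψ := memLp_tensor_ts (YH := YH) h.isBounded (T := T) hva cψ
  set FL : Space N × ℝ × Space N × ℝ → ℝ := fun p =>
    inner ℝ (h' p.1 p.2.1 + g₁ p.1 p.2.1 p.2.2.1 p.2.2.2) (tens v c₁ (p.1, p.2.1) • tens Θ c₂ p.2.2)
  set FR : Space N × ℝ × Space N × ℝ → ℝ := fun p =>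
    u₁ p.1 p.2.1 p.2.2.1 p.2.2.2 * v p.1 * ψ p.2.2.1 * c₁ p.2.1 * c₂ p.2.2.2
  have mL : Integrable FL (volume.restrict (Ω ×ˢ Ioo 0 T ×ˢ solidCell YH ×ˢ Ioo 0 1)) :=
    integrable_inner_of_memLp
      ((memLp_nested_iff (f := fun p => h' p.1 p.2.1 + g₁ p.1 p.2.1 p.2.2.1 p.2.2.2)
        h.isOpen h.isCompact_hole T).2 hG)
      ((memLp_nested_iff (f := fun p => tens v c₁ (p.1, p.2.1) • tens Θ c₂ p.2.2)
        h.isOpen h.isCompact_hole T).2 tΘ)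
  have mR : Integrable FR (volume.restrict (Ω ×ˢ Ioo 0 T ×ˢ solidCell YH ×ˢ Ioo 0 1)) := by
    refine (integrable_mul_of_memLp hu₁
      ((memLp_nested_iff (f := fun p => tens v c₁ (p.1, p.2.1) • tens ψ c₂ p.2.2)
        h.isOpen h.isCompact_hole T).2 tψ)).congr (ae_of_all _ fun p => ?_)
    simp only [FR, tens, smul_eq_mul]
    ring
  have e1 : ∫ q, inner ℝ (h' q.1.1 q.1.2 + g₁ q.1.1 q.1.2 q.2.1 q.2.2)
      (tens v c₁ q.1 • tens Θ c₂ q.2) ∂(tsMeasure Ω YH T) =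
      ∫ p in Ω ×ˢ Ioo 0 T ×ˢ solidCell YH ×ˢ Ioo 0 1, FL p :=
    (integral_nested h.isOpen h.isCompact_hole T FL).symm
  rw [e1, integral_slice mL, integral_slice mR]
  refine integral_congr_ae ?_
  filter_upwards [hae, ae_slice_memLp hu₁, ae_slice_memLp hg₁] with q hq hq1 hq2
  -- For almost every `(x,t,s)` the slice of `u₁` is periodic with weak gradient `g₁`, so the cell
  -- pair turns `∫ Θ · g₁` into `∫ ψ u₁`. The macroscopic gradient is constant in `y` and is
  -- annihilated by the zero mean of `Θ`.
  have hgrad := hq.2.1.cellGrad h.hole_subset h.isCompact_hole hq.1 hq1 hq2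
  have hpair := hψ.2.2.2.2 _ _ hgrad
  have e2 : ∫ y in solidCell YH, FR (q.1, q.2.1, y, q.2.2) =
      (v q.1 * c₁ q.2.1 * c₂ q.2.2) * ∫ y in solidCell YH, ψ y * u₁ q.1 q.2.1 y q.2.2 := by
    rw [← integral_const_mul]
    refine integral_congr_ae (ae_of_all _ fun y => ?_)
    simp only [FR]
    ring
  have e3 : ∫ y in solidCell YH, inner ℝ (Θ y) (h' q.1 q.2.1) = 0 := by
    simp only [PiLp.inner_apply, RCLike.inner_apply, conj_trivial]
    rw [integral_finsetSum _ fun i _ =>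
      ((memLp_apply hψ.2.1 i).integrable (by norm_num)).const_mul _]
    refine Finset.sum_eq_zero fun i _ => ?_
    rw [integral_const_mul, hΘ0, mul_zero]
  have e4 : ∫ y in solidCell YH, FL (q.1, q.2.1, y, q.2.2) =
      (v q.1 * c₁ q.2.1 * c₂ q.2.2) * ((∫ y in solidCell YH, inner ℝ (Θ y) (h' q.1 q.2.1)) +
        ∫ y in solidCell YH, inner ℝ (Θ y) (g₁ q.1 q.2.1 y q.2.2)) := by
    rw [← integral_add (integrable_inner_of_memLp hψ.2.1 (memLp_const_solidCell _))
      (integrable_inner_of_memLp hψ.2.1 hq2), ← integral_const_mul]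
    refine integral_congr_ae (ae_of_all _ fun y => ?_)
    simp only [FL, tens, smul_eq_mul, real_inner_smul_right]
    rw [← inner_add_right, real_inner_comm]
    ring
  rw [e4, e2, e3, zero_add, hpair]

/-- Convergence of `ε⁻¹ u_ε` against mean-free oscillating test functions. -/
theorem convergesVeryWeakly (h : IsBoundedSequence Ω YH T r ε u g) {u₀ : Space N → ℝ → ℝ}
    {h' : Space N → ℝ → Space N}
    {u₁ : Space N → ℝ → Space N → ℝ → ℝ} {g₁ : Space N → ℝ → Space N → ℝ → Space N}
    (hu₀ : IsL2H1 Ω T u₀ h') (hc : IsCellCorrector Ω YH T u₁ g₁)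
    (hconv : GradientsConverge Ω YH T r ε g h' g₁) : ConvergesVeryWeakly Ω YH T r ε u u₁ := by
  intro v₁ v₂ c₁ c₂ hv₁ hv₂ hc₁ hc₂
  have hb₁ := hc₁.isBoundedContinuous
  have hb₂ := hc₂.isBoundedContinuous
  -- The values of `v₂` in the hole are arbitrary, whereas the profile of a cell pair has to vanish
  -- there.
  set ψ : Space N → ℝ := YHᶜ.indicator v₂
  have hψD : ∀ y ∈ solidCell YH, ψ y = v₂ y := fun y hy => indicator_of_mem hy.2 _
  have hDm := (isOpen_solidCell h.isCompact_hole).measurableSet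
  have hψ : MemLp ψ 2 (volume.restrict (solidCell YH)) :=
    hv₂.2.2.1.ae_eq (ae_restrict_of_forall_mem hDm fun y hy => (hψD y hy).symm)
  have hmean : ∫ y in solidCell YH, ψ y = 0 := by
    rw [setIntegral_congr_fun hDm hψD]; exact hv₂.2.2.2
  have hψ0 : ∀ y ∈ YH, ψ y = 0 := fun y hy =>
    indicator_of_notMem (not_not.2 hy) _
  obtain ⟨Θ, hΘ, hΘ0⟩ := exists_isCellPair_mean_zero h.two_le h.isCompact_hole h.hole_subset
    h.hole_smooth h.connected hψ hψ0 hmean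
  have cΘ := memLp_tens_cell h.isCompact_hole hΘ.2.1 hΘ.2.2.2.1 hb₂.1 hb₂.2.choose_spec
  obtain ⟨C, hCu, hCg⟩ := h.exists_bound
  have l1 := tendsto_iInt_of_gradientsConverge h.isOpen h.isBounded h.isCompact_hole h.eps_pos
    h.eps_tendsto h.r_pos h.memLp_g hCg (h.memLp_ts_add hu₀.2.1 hc.2.1) hconv
    (hv₁.isBoundedContinuous.tens hb₁) cΘ
  -- The components of `Θ` are mean-free, hence oscillating divergences in their turn, and these
  -- terms are small with `ε`.
  have l2 : Tendsto (fun n => ∑ i, jInt Ω YH T r (ε n) (u n) (tens (pderiv i v₁) c₁)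
      (tens (fun y => Θ y i) c₂)) atTop (𝓝 0) := by
    rw [← Finset.sum_const_zero (s := (Finset.univ : Finset (Fin N)))]
    exact tendsto_finsetSum _ fun i _ => h.tendsto_jInt_mean_zero (hv₁.pderiv i) hb₁ hb₂
      (memLp_apply hΘ.2.1 i) (fun y hy => by rw [hΘ.2.2.2.1 y hy]; rfl) (hΘ0 i)
  have l3 := l1.add l2
  rw [add_zero, h.integral_corrector_eq hu₀.2.1 hc hv₁.isBoundedContinuous hb₁ hb₂ hΘ hΘ0] at l3
  have e : ∫ p in Ω ×ˢ Ioo 0 T ×ˢ solidCell YH ×ˢ Ioo 0 1,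
      u₁ p.1 p.2.1 p.2.2.1 p.2.2.2 * v₁ p.1 * v₂ p.2.2.1 * c₁ p.2.1 * c₂ p.2.2.2 =
      ∫ p in Ω ×ˢ Ioo 0 T ×ˢ solidCell YH ×ˢ Ioo 0 1,
      u₁ p.1 p.2.1 p.2.2.1 p.2.2.2 * v₁ p.1 * ψ p.2.2.1 * c₁ p.2.1 * c₂ p.2.2.2 := by
    have hm : MeasurableSet (Ω ×ˢ Ioo (0 : ℝ) T ×ˢ solidCell YH ×ˢ Ioo (0 : ℝ) 1) :=
      h.isOpen.measurableSet.prod (measurableSet_Ioo.prod (hDm.prod measurableSet_Ioo))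
    refine setIntegral_congr_fun hm fun p hp => ?_
    rw [hψD _ hp.2.2.1]
  rw [e]
  refine l3.congr' ?_
  filter_upwards [eventually_cellsInside h.isOpen hv₁.2.1 hv₁.2.2 h.eps_pos h.eps_tendsto] with n hn
  have key := jInt_cellPair h.isOpen h.isBounded h.isCompact_hole h.hole_subset (h.eps_pos n) hv₁ hn
    (h.bdd.1 n) hb₁ hb₂ hΘ (r := r)
  -- The factor `ε⁻¹` in front of `u_ε` cancels the `ε` of the central identity.
  have e5 : ∀ x : ℝ, x = (ε n)⁻¹ * (ε n * x) := fun x => by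
    rw [inv_mul_cancel_left₀ (h.eps_pos n).ne']
  rw [e5 (iInt _ _ _ _ _ _ _ _ + _), ← key, jInt, ← integral_const_mul]
  have hPm : MeasurableSet (perforated Ω YH (ε n) ×ˢ Ioo (0 : ℝ) T) :=
    (measurableSet_perforated h.isOpen h.isCompact_hole _).prod measurableSet_Ioo
  refine setIntegral_congr_fun hPm fun p hp => ?_
  simp only [tens, osc, smul_eq_mul, hc₂.fract_eq]
  -- On the support of `v₁` every cell is perforated, so the fractional part of `x/ε` avoids the
  -- hole. There `ψ` is `v₂`, and the periodicity of `v₂`, known only off the holes, can be used.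
  by_cases hx : p.1 ∈ tsupport v₁
  · have h1 := (hn.mem_perforated_iff h.hole_subset hx (hv₁.2.2 hx)).1 hp.1
    have h2 : ψ (fract ((ε n)⁻¹ • p.1)) = v₂ (fract ((ε n)⁻¹ • p.1)) := indicator_of_mem h1 _
    obtain ⟨k, hk⟩ := exists_eq_fract_add ((ε n)⁻¹ • p.1)
    have h3 : v₂ ((ε n)⁻¹ • p.1) = v₂ (fract ((ε n)⁻¹ • p.1)) := by
      conv_lhs => rw [hk]
      refine hv₂.2.1 k _ ?_
      rw [mem_periodicExt_iff h.hole_subset, fract_eq_self (fract_mem _)]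
      exact h1
    rw [h2, h3]
    ring
  · rw [image_eq_zero_of_notMem_tsupport hx]
    ring

end IsBoundedSequence
end Perforated

/-! ### Families of test functions that determine integrable functions. -/

namespace Perforated
variable {N : ℕ} {Ω YH : Set (Space N)}

/-- A family of bounded functions that detects integrable functions. -/
def IsDetermining {α : Type*} [MeasurableSpace α] (μ : Measure α) (D : Set (α → ℝ)) : Prop :=
  (∀ d ∈ D, AEStronglyMeasurable d μ ∧ ∃ M, ∀ x, ‖d x‖ ≤ M) ∧
  ∀ f, Integrable f μ → (∀ d ∈ D, ∫ x, f x * d x ∂μ = 0) → f =ᵐ[μ] 0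

/-- The positive and negative parts of `f` are densities of finite measures that agree on
rectangles, hence on all measurable sets. -/
lemma ae_eq_zero_of_integral_prod {α β : Type*} [MeasurableSpace α] [MeasurableSpace β]
    {μ : Measure α} {ν : Measure β} [SFinite μ] [SFinite ν] {f : α × β → ℝ}
    (hf : Integrable f (μ.prod ν))
    (h : ∀ A B, MeasurableSet A → MeasurableSet B → ∫ p in A ×ˢ B, f p ∂(μ.prod ν) = 0) :
    f =ᵐ[μ.prod ν] 0 := by
  have key : (μ.prod ν).withDensity (fun p => ENNReal.ofReal (f p)) =
      (μ.prod ν).withDensity (fun p => ENNReal.ofReal (-f p)) := by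
    have h1 : ∫⁻ p, ENNReal.ofReal (f p) ∂(μ.prod ν) ≠ ⊤ := hf.lintegral_lt_top.ne
    have h2 : ∫⁻ p, ENNReal.ofReal (-f p) ∂(μ.prod ν) ≠ ⊤ := hf.neg.lintegral_lt_top.ne
    have f1 := isFiniteMeasure_withDensity h1
    refine Measure.ext_prod fun {A B} hA hB => ?_
    rw [withDensity_apply _ (hA.prod hB), withDensity_apply _ (hA.prod hB)]
    have h3 := h A B hA hB
    rw [integral_eq_lintegral_pos_part_sub_lintegral_neg_part hf.integrableOn, sub_eq_zero] at h3
    exact (ENNReal.toReal_eq_toReal_iff' (hf.integrableOn (s := A ×ˢ B)).lintegral_lt_top.ne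
      (hf.neg.integrableOn (s := A ×ˢ B)).lintegral_lt_top.ne).1 h3
  refine hf.ae_eq_zero_of_forall_setIntegral_eq_zero fun s hs _ => ?_
  rw [integral_eq_lintegral_pos_part_sub_lintegral_neg_part hf.integrableOn,
    ← withDensity_apply _ hs, ← withDensity_apply _ hs, key, sub_self]

/-- The variables are treated one after the other. For each `e` the first family gives `∫ f(x,y)
e(y) dy = 0` for almost every `x`, with a null set depending on `e`. Integrating in `x` over an
arbitrary measurable set `A` absorbs this null set, after which the second family applies, and all
integrals over rectangles vanish. -/
lemma IsDetermining.prod {α β : Type*} [MeasurableSpace α] [MeasurableSpace β]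
    {μ : Measure α} {ν : Measure β} [SFinite μ] [SFinite ν] {D : Set (α → ℝ)} {E : Set (β → ℝ)}
    (hD : IsDetermining μ D) (hE : IsDetermining ν E) :
    IsDetermining (μ.prod ν) {f | ∃ d ∈ D, ∃ e ∈ E, f = fun p => d p.1 * e p.2} := by
  refine ⟨?_, fun f hf h => ?_⟩
  · rintro _ ⟨d, hd, e, he, rfl⟩
    obtain ⟨md, M, hM⟩ := hD.1 d hd
    obtain ⟨me, M', hM'⟩ := hE.1 e he
    have m1 : AEStronglyMeasurable (fun p : α × β => d p.1) (μ.prod ν) := md.comp_fst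
    have m2 : AEStronglyMeasurable (fun p : α × β => e p.2) (μ.prod ν) := me.comp_snd
    refine ⟨m1.mul m2, M * M', fun p => ?_⟩
    rw [norm_mul]
    exact mul_le_mul (hM _) (hM' _) (norm_nonneg _) ((norm_nonneg _).trans (hM p.1))
  · have i1 : ∀ e ∈ E, Integrable (fun p : α × β => f p * e p.2) (μ.prod ν) := by
      intro e he
      obtain ⟨me, M', hM'⟩ := hE.1 e he
      exact hf.mul_bdd (c := M') (me.comp_snd (μ := μ)) (ae_of_all _ fun p => hM' _)
    have i2 : ∀ e ∈ E, ∀ᵐ x ∂μ, ∫ y, f (x, y) * e y ∂ν = 0 := by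
      intro e he
      refine hD.2 (fun x => ∫ y, f (x, y) * e y ∂ν) (i1 e he).integral_prod_left fun d hd => ?_
      obtain ⟨md, M, hM⟩ := hD.1 d hd
      rw [← h _ ⟨d, hd, e, he, rfl⟩]
      have i3 : Integrable (fun p : α × β => f p * (d p.1 * e p.2)) (μ.prod ν) :=
        ((i1 e he).mul_bdd (c := M) (md.comp_fst (ν := ν)) (ae_of_all _ fun p => hM _)).congr
          (ae_of_all _ fun p => by ring)
      rw [integral_prod _ i3]
      refine integral_congr_ae (ae_of_all _ fun x => ?_)
      change (∫ y, f (x, y) * e y ∂ν) * d x = _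
      rw [← integral_mul_const]
      refine integral_congr_ae (ae_of_all _ fun y => ?_)
      change f (x, y) * e y * d x = f (x, y) * (d x * e y)
      ring
    refine ae_eq_zero_of_integral_prod hf fun A B hA hB => ?_
    have hfA : Integrable f ((μ.restrict A).prod ν) := by
      have := hf.integrableOn (s := A ×ˢ univ)
      rwa [IntegrableOn, ← Measure.prod_restrict, Measure.restrict_univ] at this
    have i4 : ∀ᵐ y ∂ν, ∫ x in A, f (x, y) ∂μ = 0 := by
      refine hE.2 (fun y => ∫ x in A, f (x, y) ∂μ) hfA.integral_prod_right fun e he => ?_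
      obtain ⟨me, M', hM'⟩ := hE.1 e he
      have i5 : Integrable (fun p : α × β => f p * e p.2) ((μ.restrict A).prod ν) :=
        hfA.mul_bdd (c := M') (me.comp_snd (μ := μ.restrict A)) (ae_of_all _ fun p => hM' _)
      have e1 : ∫ y, (∫ x in A, f (x, y) ∂μ) * e y ∂ν = ∫ y, (∫ x in A, f (x, y) * e y ∂μ) ∂ν :=
        integral_congr_ae (ae_of_all _ fun y => (integral_mul_const _ _).symm)
      rw [e1, ← integral_prod_symm _ i5, integral_prod _ i5]
      exact integral_eq_zero_of_ae (ae_restrict_of_ae (i2 e he))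
    have i6 : Integrable f ((μ.restrict A).prod (ν.restrict B)) := by
      rw [Measure.prod_restrict]; exact hf.integrableOn
    rw [← Measure.prod_restrict, integral_prod_symm _ i6]
    exact integral_eq_zero_of_ae (ae_restrict_of_ae i4)

lemma isDetermining_isTest {F : Type*} [NormedAddCommGroup F] [NormedSpace ℝ F]
    [FiniteDimensional ℝ F] [MeasurableSpace F] [BorelSpace F] {μ : Measure F} {U : Set F}
    (hU : IsOpen U) : IsDetermining (μ.restrict U) {φ | IsTest U φ} := by
  refine ⟨fun φ hφ => ⟨hφ.1.continuous.aestronglyMeasurable,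
    hφ.1.continuous.bounded_above_of_compact_support hφ.2.1⟩, fun f hf h => ?_⟩
  refine (ae_restrict_iff' hU.measurableSet).2 ?_
  refine hU.ae_eq_zero_of_integral_contDiff_smul_eq_zero
    (IntegrableOn.locallyIntegrableOn hf) fun φ h1 h2 h3 => ?_
  rw [← h φ ⟨h1, h2, h3⟩, ← integral_indicator hU.measurableSet]
  refine integral_congr_ae (ae_of_all _ fun x => ?_)
  by_cases hx : x ∈ U
  · simp only [indicator_of_mem hx, smul_eq_mul]; ring
  · simp only [indicator_of_notMem hx]
    rw [image_eq_zero_of_notMem_tsupport fun h => hx (h3 h), zero_smul]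

/-- The exceptional null set may depend on `s`. A countable dense subset of `S` has a common one,
and continuity in `s` reaches the rest. -/
lemma ae_forall_mem_eq_zero {α H : Type*} [MeasurableSpace α] {μ : Measure α}
    [PseudoMetricSpace H] [SecondCountableTopology H] {S : Set H} {L : α → H → ℝ}
    (hL : ∀ᵐ t ∂μ, Continuous (L t)) (h : ∀ s ∈ S, ∀ᵐ t ∂μ, L t s = 0) :
    ∀ᵐ t ∂μ, ∀ s ∈ S, L t s = 0 := by
  obtain ⟨c, hcS, hc, hd⟩ := (TopologicalSpace.IsSeparable.of_separableSpace S).exists_countable_dense_subset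
  have h1 : ∀ᵐ t ∂μ, ∀ s ∈ c, L t s = 0 := (ae_ball_iff hc).2 fun s hs => h s (hcS hs)
  filter_upwards [hL, h1] with t ht1 ht2 s hs
  exact closure_minimal (s := c) (t := {s | L t s = 0}) ht2
    (isClosed_eq ht1 continuous_const) (hd hs)

/-- A test function on the unit interval extends periodically. -/
lemma exists_isSmoothPeriodic_eqOn {φ : ℝ → ℝ} (h : IsTest (Ioo 0 1) φ) :
    ∃ c, IsSmoothPeriodic c ∧ ∀ s ∈ Ioo (0 : ℝ) 1, c s = φ s := by
  -- The line is regarded as `Space 1`, so that the sum of integer translates and its smoothness are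
  -- available. On the unit interval only the translate with index zero is nonzero.
  set e : Space 1 ≃L[ℝ] ℝ :=
    (EuclideanSpace.equiv (Fin 1) ℝ).trans (ContinuousLinearEquiv.funUnique (Fin 1) ℝ ℝ)
  have he : ∀ k : Fin 1 → ℤ, e (intVec k) = k 0 := fun k => rfl
  have hcs : HasCompactSupport (φ ∘ e) := h.2.1.comp_homeomorph e.toHomeomorph
  have hts : tsupport (φ ∘ e) ⊆ e ⁻¹' tsupport φ :=
    closure_minimal (fun x hx => subset_tsupport φ hx) ((isClosed_tsupport φ).preimage e.continuous)
  refine ⟨fun s => perSum (φ ∘ e) (e.symm s), ⟨?_, fun s => ?_⟩, fun s hs => ?_⟩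
  · exact (contDiff_perSum (h.1.comp e.contDiff) hcs).comp e.symm.contDiff
  · have h1 : e.symm (s + 1) = e.symm s + intVec (fun _ => 1) := by
      apply e.injective
      rw [map_add e, e.apply_symm_apply, e.apply_symm_apply, he]
      simp
    change perSum _ (e.symm (s + 1)) = perSum _ (e.symm s)
    rw [h1, perSum_add]
  · change perSum _ (e.symm s) = φ s
    rw [perSum_eq_sum (s := {0})]
    · rw [Finset.sum_singleton]
      have h0 : intVec (N := 1) 0 = 0 := by ext i; simp
      rw [h0, add_zero]
      exact congrArg φ (e.apply_symm_apply s)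
    · intro k hk
      have h1 := h.2.2 (hts hk)
      rw [map_add, e.apply_symm_apply, he] at h1
      have h2 : k 0 < 1 := by
        have : (k 0 : ℝ) < 1 := by linarith [h1.2, hs.1]
        exact_mod_cast this
      have h3 : -1 < k 0 := by
        have : (-1 : ℝ) < k 0 := by linarith [h1.1, hs.2]
        exact_mod_cast this
      rw [Finset.mem_singleton]
      ext i
      rw [Subsingleton.elim i 0]
      simp only [Pi.zero_apply]
      omega

lemma isDetermining_isSmoothPeriodic :
    IsDetermining (volume.restrict (Ioo (0 : ℝ) 1)) {c | IsSmoothPeriodic c} := by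
  refine ⟨fun c hc => ⟨hc.1.continuous.aestronglyMeasurable, hc.exists_bound⟩, fun f hf h => ?_⟩
  refine (isDetermining_isTest isOpen_Ioo).2 f hf fun φ hφ => ?_
  obtain ⟨c, hc, hcφ⟩ := exists_isSmoothPeriodic_eqOn hφ
  refine Eq.trans ?_ (h c hc)
  exact setIntegral_congr_fun measurableSet_Ioo fun s hs => by
    rw [hcφ s hs]

end Perforated

/-! ### Two-scale compactness of the gradients. -/

namespace Perforated
variable {N : ℕ} {Ω YH : Set (Space N)}

lemma memLp_indicator_of_restrict {X B : Type*} [MeasurableSpace X] {μ : Measure X}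
    [NormedAddCommGroup B] {A : Set X} (hA : MeasurableSet A) {f : X → B}
    (hf : MemLp f 2 (μ.restrict A)) : MemLp (A.indicator f) 2 μ :=
  (memLp_indicator_iff_restrict hA).2 hf

/-- In cells inside `Ω`, unfolding maps the hole out of the perforated domain. -/
lemma CellsInside.unf_notMem {A : Set (Space N)} {ε r : ℝ} (hε : 0 < ε) (h : CellsInside Ω A ε)
    {p : (Space N × ℝ) × (Space N × ℝ)} (hA : p.1.1 ∈ A) (hY : p.2.1 ∈ YH) :
    ((stLattice N).unf (stScale ε (ε ^ r) hε.ne' (Real.rpow_pos_of_pos hε r).ne') p).1 ∉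
      perforated Ω YH ε := by
  intro hp
  refine hp.2 _ (h _ hA) ?_
  have e : ε⁻¹ • ((stLattice N).unf (stScale ε (ε ^ r) hε.ne' (Real.rpow_pos_of_pos hε r).ne') p).1 =
      intVec ((spaceLattice N).fl (ε⁻¹ • p.1.1)) + p.2.1 :=
    congrArg Prod.fst ((stLattice N).symm_unf
      (stScale ε (ε ^ r) hε.ne' (Real.rpow_pos_of_pos hε r).ne') p)
  rw [e, add_sub_cancel_left]
  exact hY

lemma ae_mem_solidCell_prod : ∀ᵐ z ∂(volume.restrict (stLattice N).cell : Measure (Space N × ℝ)),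
    z.1 ∉ YH → z ∈ solidCell YH ×ˢ Ioo (0 : ℝ) 1 := by
  have e : (volume.restrict (stLattice N).cell : Measure (Space N × ℝ)) =
      (volume.restrict (halfOpenCube N)).prod (volume.restrict (Ico 0 1)) := volume_restrict_prod _ _
  rw [e]
  have h1 : ∀ᵐ y ∂(volume.restrict (halfOpenCube N)), y ∈ unitCube N := by
    rw [← Measure.restrict_congr_set unitCube_ae_eq]
    refine ae_restrict_mem ?_
    rw [unitCube_eq_preimage]
    exact (PiLp.volume_preserving_ofLp (Fin N)).measurable
      (MeasurableSet.univ_pi fun _ => measurableSet_Ioo)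
  have h2 : ∀ᵐ s ∂(volume.restrict (Ico (0 : ℝ) 1)), s ∈ Ioo (0 : ℝ) 1 := by
    rw [← Measure.restrict_congr_set Ioo_ae_eq_Ico]
    exact ae_restrict_mem measurableSet_Ioo
  filter_upwards [Measure.quasiMeasurePreserving_fst.ae h1, Measure.quasiMeasurePreserving_snd.ae h2]
    with z hz1 hz2 hz
  exact ⟨⟨hz1, hz⟩, hz2⟩

lemma restrict_unfMeasure (Ω YH : Set (Space N)) (T : ℝ) :
    ((stLattice N).unfMeasure).restrict ((Ω ×ˢ Ioo 0 T) ×ˢ (solidCell YH ×ˢ Ioo 0 1)) =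
      tsMeasure Ω YH T := by
  rw [tsMeasure, LatticeCell.unfMeasure, ← Measure.prod_restrict,
    Measure.restrict_restrict_of_subset solidCell_prod_subset_cell]

namespace IsBoundedSequence

variable {T r : ℝ} {ε : ℕ → ℝ} {u : ℕ → Space N → ℝ → ℝ} {g : ℕ → Space N → ℝ → Space N}

/-- The anisotropic dilation of the `n`-th term. -/
def scale (h : IsBoundedSequence Ω YH T r ε u g) (n : ℕ) : (Space N × ℝ) ≃L[ℝ] (Space N × ℝ) :=
  stScale (ε n) (ε n ^ r) (h.eps_pos n).ne' (Real.rpow_pos_of_pos (h.eps_pos n) r).ne'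

lemma tendsto_norm_scale (h : IsBoundedSequence Ω YH T r ε u g) :
    Tendsto (fun n => ‖(h.scale n : Space N × ℝ →L[ℝ] Space N × ℝ)‖) atTop (𝓝 0) := by
  have h1 : Tendsto (fun n => max (ε n) (ε n ^ r)) atTop (𝓝 0) := by
    simpa using h.eps_tendsto.max (tendsto_rpow_zero h.eps_tendsto h.r_pos)
  exact squeeze_zero (fun n => norm_nonneg _)
    (fun n => norm_stScale_le (h.eps_pos n) (Real.rpow_pos_of_pos (h.eps_pos n) r)) h1

lemma measurableSet_domain (h : IsBoundedSequence Ω YH T r ε u g) (n : ℕ) :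
    MeasurableSet (perforated Ω YH (ε n) ×ˢ Ioo (0 : ℝ) T) :=
  (measurableSet_perforated h.isOpen h.isCompact_hole _).prod measurableSet_Ioo

/-- Gradients extended by zero. -/
def gradExt (_ : IsBoundedSequence Ω YH T r ε u g) (n : ℕ) : Space N × ℝ → Space N :=
  (perforated Ω YH (ε n) ×ˢ Ioo 0 T).indicator fun p => g n p.1 p.2

lemma memLp_gradExt (h : IsBoundedSequence Ω YH T r ε u g) (n : ℕ) :
    MemLp (h.gradExt n) 2 volume :=
  (memLp_indicator_iff_restrict (h.measurableSet_domain n)).2 (h.memLp_g n)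

/-- The weak limit of the unfolded gradients vanishes in the hole. -/
lemma unfolded_limit_eq_zero (h : IsBoundedSequence Ω YH T r ε u g)
    {G : (Space N × ℝ) × (Space N × ℝ) → Space N} (hG : MemLp G 2 (stLattice N).unfMeasure)
    (hlim : ∀ v, MemLp v 2 (stLattice N).unfMeasure → Tendsto
      (fun n => ∫ p, inner ℝ (h.gradExt n ((stLattice N).unf (h.scale n) p)) (v p)
        ∂(stLattice N).unfMeasure) atTop
      (𝓝 (∫ p, inner ℝ (G p) (v p) ∂(stLattice N).unfMeasure))) :
    ∀ᵐ p ∂(stLattice N).unfMeasure, p.1.1 ∈ Ω → p.2.1 ∈ YH → G p = 0 := by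
  -- `Ω` is exhausted by closed sets, which are compact because `Ω` is bounded. Above each of them
  -- the unfolded gradients vanish on the hole as soon as `ε` is small. Testing the weak limit with
  -- its own restriction to this set then shows that the restriction is zero.
  obtain ⟨A, hAc, hAs, hAU, -⟩ := h.isOpen.exists_iUnion_isClosed
  have key : ∀ k, ∀ᵐ p ∂(stLattice N).unfMeasure, p.1.1 ∈ A k → p.2.1 ∈ YH → G p = 0 := by
    intro k
    have hcomp : IsCompact (A k) :=
      Metric.isCompact_of_isClosed_isBounded (hAc k) (h.isBounded.subset (hAs k))
    set S : Set ((Space N × ℝ) × (Space N × ℝ)) := {p | p.1.1 ∈ A k ∧ p.2.1 ∈ YH}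
    have hS : MeasurableSet S :=
      ((hAc k).measurableSet.preimage (measurable_fst.comp measurable_fst)).inter
        (h.isCompact_hole.isClosed.measurableSet.preimage (measurable_fst.comp measurable_snd))
    have h1 := hlim _ (hG.indicator hS)
    have h2 : ∀ᶠ n in atTop, ∫ p, inner ℝ (h.gradExt n ((stLattice N).unf (h.scale n) p))
        (S.indicator G p) ∂(stLattice N).unfMeasure = 0 := by
      filter_upwards [eventually_cellsInside h.isOpen hcomp (hAs k) h.eps_pos h.eps_tendsto] with n hn
      refine integral_eq_zero_of_ae (ae_of_all _ fun p => ?_)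
      by_cases hp : p ∈ S
      · have h3 : h.gradExt n ((stLattice N).unf (h.scale n) p) = 0 :=
          indicator_of_notMem (fun h4 => hn.unf_notMem (h.eps_pos n) hp.1 hp.2 h4.1) _
        simp only [h3, inner_zero_left, Pi.zero_apply]
      · simp only [indicator_of_notMem hp, inner_zero_right, Pi.zero_apply]
    have h3 := tendsto_nhds_unique_of_eventuallyEq h1 tendsto_const_nhds h2
    have h4 : ∫ p, ‖S.indicator G p‖ ^ 2 ∂(stLattice N).unfMeasure = 0 := by
      rw [← h3]
      refine integral_congr_ae (ae_of_all _ fun p => ?_)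
      by_cases hp : p ∈ S
      · simp only [indicator_of_mem hp, real_inner_self_eq_norm_sq]
      · simp [indicator_of_notMem hp]
    have hGS := hG.indicator hS
    rw [integral_eq_zero_iff_of_nonneg (fun p => by positivity)
      ((memLp_two_iff_integrable_sq_norm hGS.1).1 hGS)] at h4
    filter_upwards [h4] with p hp hp1 hp2
    have : S.indicator G p = 0 := by simpa using hp
    rwa [indicator_of_mem (show p ∈ S from ⟨hp1, hp2⟩)] at this
  filter_upwards [ae_all_iff.2 key] with p hp hp1 hp2
  rw [← hAU] at hp1
  obtain ⟨k, hk⟩ := mem_iUnion.1 hp1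
  exact hp k hk hp2

/-- Two-scale compactness of the gradients and weak compactness of the functions. -/
lemma exists_twoScale_limit (h : IsBoundedSequence Ω YH T r ε u g) :
    ∃ (φ : ℕ → ℕ) (U : Space N × ℝ → ℝ) (G : (Space N × ℝ) × (Space N × ℝ) → Space N),
      StrictMono φ ∧ MemLp U 2 (volume.restrict (Ω ×ˢ Ioo 0 T)) ∧ MemLp G 2 (tsMeasure Ω YH T) ∧
      (∀ v : Space N × ℝ → ℝ, MemLp v 2 (volume.restrict (Ω ×ˢ Ioo 0 T)) →
        Tendsto (fun n => ∫ p in perforated Ω YH (ε (φ n)) ×ˢ Ioo 0 T, u (φ n) p.1 p.2 * v p) atTop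
          (𝓝 (∫ p in Ω ×ˢ Ioo 0 T, U p * v p))) ∧
      GradientsConverge Ω YH T r (ε ∘ φ) (g ∘ φ) (fun _ _ => 0)
        (fun x t y s => G ((x, t), (y, s))) := by
  obtain ⟨C, hCu, hCg⟩ := h.exists_bound
  have hΩT : MeasurableSet (Ω ×ˢ Ioo (0 : ℝ) T) := h.isOpen.measurableSet.prod measurableSet_Ioo
  have hsub : ∀ n, perforated Ω YH (ε n) ×ˢ Ioo 0 T ⊆ Ω ×ˢ Ioo 0 T := fun n =>
    Set.prod_mono perforated_subset le_rfl
  set f : ℕ → Space N × ℝ → ℝ := fun n =>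
    (perforated Ω YH (ε n) ×ˢ Ioo 0 T).indicator fun p => u n p.1 p.2
  have hf : ∀ n, MemLp (f n) 2 volume := fun n =>
    (memLp_indicator_iff_restrict (h.measurableSet_domain n)).2 (h.memLp_u n)
  obtain ⟨φ₁, U, hφ₁, hU, hlimU⟩ := exists_weak_limit f hf (C := C) fun n => by
    rw [eLpNorm_indicator_eq_eLpNorm_restrict (h.measurableSet_domain n)]
    exact hCu n
  have h1 := h.comp hφ₁
  have hCF : ∀ n, (eLpNorm (h1.gradExt n) 2 volume).toReal ≤ C := fun n => by
    rw [gradExt, eLpNorm_indicator_eq_eLpNorm_restrict (h1.measurableSet_domain n)]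
    exact hCg _
  have hsf : SigmaFinite (volume.restrict (stLattice N).cell : Measure (Space N × ℝ)) := inferInstance
  have hsf' : SigmaFinite (stLattice N).unfMeasure := Measure.prod.instSigmaFinite
  have hcg : MeasurableSpace.CountablyGenerated ((Space N × ℝ) × (Space N × ℝ)) := inferInstance
  have hsep : IsSeparable (stLattice N).unfMeasure := inferInstance
  -- A second extraction, from the subsequence already chosen for the functions. Unfolding preserves
  -- the norm, so the bound on the gradients carries over.
  obtain ⟨φ₂, G, hφ₂, hG, hlimG⟩ := exists_weak_limit
    (fun n p => h1.gradExt n ((stLattice N).unf (h1.scale n) p))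
    (μ := (stLattice N).unfMeasure) (fun n => (h1.memLp_gradExt n).comp_measurePreserving
      ((stLattice N).measurePreserving_unf (h1.scale n))) (C := C) fun n => by
        have e := eLpNorm_comp_measurePreserving (p := 2) (h1.memLp_gradExt n).1
          ((stLattice N).measurePreserving_unf (h1.scale n))
        exact (congrArg ENNReal.toReal e).le.trans (hCF n)
  have h2 := h1.comp hφ₂
  have hz := h2.unfolded_limit_eq_zero hG hlimG
  refine ⟨φ₁ ∘ φ₂, U, G, hφ₁.comp hφ₂, hU.restrict _, ?_, fun v hv => ?_, fun v hv => ?_⟩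
  · rw [← restrict_unfMeasure]
    exact hG.restrict _
  · have l1 := (hlimU _ ((memLp_indicator_iff_restrict hΩT).2 hv)).comp hφ₂.tendsto_atTop
    have e1 : ∫ p, inner ℝ (U p) ((Ω ×ˢ Ioo 0 T).indicator v p) = ∫ p in Ω ×ˢ Ioo 0 T, U p * v p := by
      rw [← integral_indicator hΩT]
      refine integral_congr_ae (ae_of_all _ fun p => ?_)
      by_cases hp : p ∈ Ω ×ˢ Ioo (0 : ℝ) T
      · simp only [indicator_of_mem hp, RCLike.inner_apply, conj_trivial]; ring
      · simp only [indicator_of_notMem hp, inner_zero_right]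
    rw [e1] at l1
    refine l1.congr fun n => ?_
    rw [← integral_indicator (h.measurableSet_domain _)]
    refine integral_congr_ae (ae_of_all _ fun p => ?_)
    by_cases hp : p ∈ perforated Ω YH (ε (φ₁ (φ₂ n))) ×ˢ Ioo (0 : ℝ) T
    · simp only [f, Function.comp_apply, indicator_of_mem hp, indicator_of_mem (hsub _ hp),
        RCLike.inner_apply, conj_trivial]
      ring
    · simp only [f, Function.comp_apply, indicator_of_notMem hp, inner_zero_left]
  · have hv' : MemLp ((Ω ×ˢ Ioo 0 T).indicator v) 2 volume := memLp_indicator_of_restrict hΩT hv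
    have l1 := (stLattice N).tendsto_integral_of_unf continuous_stTorus stTorus_vec_add
      h2.tendsto_norm_scale h2.memLp_gradExt (fun n => hCF (φ₂ n)) hlimG hv'
    rw [integral_nested h.isOpen h.isCompact_hole]
    have hDm : MeasurableSet ((Ω ×ˢ Ioo (0 : ℝ) T) ×ˢ (solidCell YH ×ˢ Ioo (0 : ℝ) 1)) :=
      hΩT.prod ((isOpen_solidCell h.isCompact_hole).measurableSet.prod measurableSet_Ioo)
    -- Passing from the half-open cell to the solid cell loses nothing: the faces of the cube are
    -- null sets and `G` vanishes in the hole.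
    have e1 : ∫ p, inner ℝ (G p) ((Ω ×ˢ Ioo (0 : ℝ) T).indicator v p.1 (stTorus p.2))
        ∂(stLattice N).unfMeasure = ∫ q, inner ℝ (0 + G ((q.1.1, q.1.2), (q.2.1, q.2.2)))
          (v (q.1.1, q.1.2) (toTorus q.2.1, ((q.2.2 : ℝ) : UnitAddCircle))) ∂(tsMeasure Ω YH T) := by
      rw [← restrict_unfMeasure, ← integral_indicator hDm]
      refine integral_congr_ae ?_
      have hs : ∀ᵐ p ∂(stLattice N).unfMeasure, p.2.1 ∉ YH → p.2 ∈ solidCell YH ×ˢ Ioo (0 : ℝ) 1 :=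
        Measure.quasiMeasurePreserving_snd.ae ae_mem_solidCell_prod
      filter_upwards [hz, hs] with p hp1 hp2
      by_cases hp : p.1 ∈ Ω ×ˢ Ioo (0 : ℝ) T
      · by_cases hp' : p.2 ∈ solidCell YH ×ˢ Ioo (0 : ℝ) 1
        · rw [indicator_of_mem hp, indicator_of_mem (show p ∈ _ ×ˢ _ from ⟨hp, hp'⟩), zero_add]
          rfl
        · rw [indicator_of_notMem (s := (Ω ×ˢ Ioo (0 : ℝ) T) ×ˢ _) (fun h => hp' h.2),
            hp1 hp.1 (not_not.1 fun h => hp' (hp2 h)), inner_zero_left]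
      · rw [indicator_of_notMem hp, indicator_of_notMem (s := (Ω ×ˢ Ioo (0 : ℝ) T) ×ˢ _) (fun h => hp h.1)]
        simp
    rw [e1] at l1
    refine l1.congr fun n => ?_
    refine Eq.trans ?_ (integral_indicator (h.measurableSet_domain (φ₁ (φ₂ n))))
    refine integral_congr_ae (ae_of_all _ fun p => ?_)
    by_cases hp : p ∈ perforated Ω YH (ε (φ₁ (φ₂ n))) ×ˢ Ioo (0 : ℝ) T
    · simp only [gradExt, Function.comp_apply, indicator_of_mem hp, indicator_of_mem (hsub _ hp),
        scale, stScale_symm_apply]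
      rfl
    · simp only [gradExt, Function.comp_apply, indicator_of_notMem hp, inner_zero_left]

end IsBoundedSequence
end Perforated

/-! ### Averaging of time oscillations and the limit equation. -/

namespace Perforated
variable {N : ℕ} {Ω YH : Set (Space N)}

/-- A smooth periodic function has a smooth periodic primitive up to its mean. -/
lemma IsSmoothPeriodic.exists_primitive {c : ℝ → ℝ} (hc : IsSmoothPeriodic c) :
    ∃ C, IsSmoothPeriodic C ∧ ∀ s, HasDerivAt C (c s - ∫ σ in (0 : ℝ)..1, c σ) s := by
  set m := ∫ σ in (0 : ℝ)..1, c σ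
  have hf : Continuous fun σ => c σ - m := hc.1.continuous.sub continuous_const
  have hd : ∀ s, HasDerivAt (fun s => ∫ σ in (0 : ℝ)..s, (c σ - m)) (c s - m) s := fun s =>
    intervalIntegral.integral_hasDerivAt_right (hf.intervalIntegrable _ _)
      (hf.stronglyMeasurableAtFilter _ _) hf.continuousAt
  refine ⟨fun s => ∫ σ in (0 : ℝ)..s, (c σ - m), ⟨?_, fun s => ?_⟩, hd⟩
  · rw [contDiff_infty_iff_deriv]
    refine ⟨fun s => (hd s).differentiableAt, ?_⟩
    rw [show deriv (fun s => ∫ σ in (0 : ℝ)..s, (c σ - m)) = fun s => c s - m from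
      funext fun s => (hd s).deriv]
    exact hc.1.sub contDiff_const
  · have hper : Function.Periodic (fun σ => c σ - m) 1 := fun σ => by
      change c (σ + 1) - m = c σ - m
      rw [hc.2]
    change ∫ σ in (0 : ℝ)..(s + 1), (c σ - m) = ∫ σ in (0 : ℝ)..s, (c σ - m)
    have h0 : ∫ σ in (0 : ℝ)..1, (c σ - m) = 0 := by
      rw [intervalIntegral.integral_sub (hc.1.continuous.intervalIntegrable _ _)
        intervalIntegrable_const, intervalIntegral.integral_const]
      simp [m]
    rw [← intervalIntegral.integral_add_adjacent_intervals (hf.intervalIntegrable 0 s)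
      (hf.intervalIntegrable s (s + 1)), hper.intervalIntegral_add_eq s 0, zero_add, h0, add_zero]

lemma IsTest.deriv {U : Set ℝ} {c : ℝ → ℝ} (hc : IsTest U c) : IsTest U (deriv c) := by
  have hs : tsupport (_root_.deriv c) ⊆ tsupport c := tsupport_deriv_subset
  exact ⟨(contDiff_infty_iff_deriv.1 hc.1).2, hc.2.1.mono' ((subset_tsupport _).trans hs),
    hs.trans hc.2.2⟩

lemma memLp_tens_one {c : ℝ → ℝ} (hc : IsBoundedContinuous c) :
    MemLp (tens (fun _ : Space N => (1 : ℝ)) c) 2 (volume.restrict (stLattice N).cell) := by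
  obtain ⟨M, hM⟩ := hc.2
  have := (stLattice N).isProbabilityMeasure_cell
  exact MemLp.of_bound (tens_continuous continuous_const hc.1).aestronglyMeasurable _
    (ae_of_all _ (tens_bound (v := fun _ => 1) (M := 1) (fun _ => by simp) hM))

namespace IsBoundedSequence

variable {T r : ℝ} {ε : ℕ → ℝ} {u : ℕ → Space N → ℝ → ℝ} {g : ℕ → Space N → ℝ → Space N}

/-- `U` is the weak limit of the functions extended by zero. -/
def IsWeakLimit (Ω YH : Set (Space N)) (T : ℝ) (ε : ℕ → ℝ) (u : ℕ → Space N → ℝ → ℝ)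
    (U : Space N × ℝ → ℝ) : Prop :=
  ∀ v : Space N × ℝ → ℝ, MemLp v 2 (volume.restrict (Ω ×ˢ Ioo 0 T)) →
    Tendsto (fun n => ∫ p in perforated Ω YH (ε n) ×ˢ Ioo 0 T, u n p.1 p.2 * v p) atTop
      (𝓝 (∫ p in Ω ×ˢ Ioo 0 T, U p * v p))

lemma memLp_test (h : IsBoundedSequence Ω YH T r ε u g) {a : Space N × ℝ → ℝ}
    (ha : IsBoundedContinuous a) : MemLp a 2 (volume.restrict (Ω ×ˢ Ioo 0 T)) := by
  have := isFiniteMeasure_spaceTime h.isBounded T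
  obtain ⟨M, hM⟩ := ha.2
  exact MemLp.of_bound ha.1.aestronglyMeasurable M (ae_of_all _ hM)

lemma memLp_test_osc (h : IsBoundedSequence Ω YH T r ε u g) (n : ℕ) {a b : Space N × ℝ → ℝ}
    (ha : IsBoundedContinuous a) (hb : MemLp b 2 (volume.restrict (stLattice N).cell)) :
    MemLp (fun p => a p * osc (ε n) r b p) 2
      (volume.restrict (perforated Ω YH (ε n) ×ˢ Ioo 0 T)) :=
  memLp_smul_osc (h.eps_pos n) hb ha ((isBounded_prod_Ioo h.isBounded T).subset
    (Set.prod_mono perforated_subset le_rfl))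

/-- Fast oscillations in time average out. -/
lemma tendsto_jInt_one (h : IsBoundedSequence Ω YH T r ε u g)
    (hosc : TimeOscillationVanishes Ω YH T r ε u) {U : Space N × ℝ → ℝ}
    (hU : IsWeakLimit Ω YH T ε u U) {v : Space N → ℝ} (hv : IsTest Ω v) {c₁ c₂ : ℝ → ℝ}
    (hc₁ : IsTest (Ioo 0 T) c₁) (hc₂ : IsSmoothPeriodic c₂) :
    Tendsto (fun n => jInt Ω YH T r (ε n) (u n) (tens v c₁) (tens (fun _ => 1) c₂)) atTop
      (𝓝 ((∫ s in (0 : ℝ)..1, c₂ s) * ∫ p in Ω ×ˢ Ioo 0 T, U p * tens v c₁ p)) := by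
  obtain ⟨C, hC, hCd⟩ := hc₂.exists_primitive
  set m := ∫ s in (0 : ℝ)..1, c₂ s
  have hbv := hv.isBoundedContinuous
  have hb₁ := hc₁.isBoundedContinuous
  have hb₁' := hc₁.deriv.isBoundedContinuous
  obtain ⟨C', hCu, -⟩ := h.exists_bound
  obtain ⟨K, hK⟩ := exists_jInt_bound (YH := YH) h.isOpen h.isBounded h.eps_pos h.eps_tendsto
    h.r_pos h.memLp_u hCu (hbv.tens hb₁')
  have bC := memLp_tens_one (N := N) hC.isBoundedContinuous
  have b₂ := memLp_tens_one (N := N) hc₂.isBoundedContinuous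
  -- The hypothesis is used with a periodic primitive `C` of `c₂ - m`. Since `ε^r ∂ₜ(c₁ C(t/ε^r)) =
  -- ε^r c₁' C(t/ε^r) + c₁ (c₂(t/ε^r) - m)` and the first term is of order `ε^r`, the factor
  -- `c₂(t/ε^r)` may be replaced by its mean.
  have l1 := hosc v c₁ C hv hc₁ hC
  have l2 : Tendsto (fun n => ε n ^ r * jInt Ω YH T r (ε n) (u n) (tens v (deriv c₁))
      (tens (fun _ => 1) C)) atTop (𝓝 0) := by
    have hz := (tendsto_rpow_zero h.eps_tendsto h.r_pos).mul_const
      (K * (eLpNorm (tens (fun _ : Space N => (1 : ℝ)) C) 2 (volume.restrict (stLattice N).cell)).toReal)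
    rw [zero_mul] at hz
    refine squeeze_zero_norm' ?_ hz
    filter_upwards [hK] with n hn
    have hp := Real.rpow_pos_of_pos (h.eps_pos n) r
    rw [Real.norm_eq_abs, abs_mul, abs_of_pos hp]
    exact mul_le_mul_of_nonneg_left (hn _ bC) hp.le
  have l3 := (hU _ (h.memLp_test (hbv.tens hb₁))).const_mul m
  have l4 := (l1.sub l2).add l3
  rw [sub_zero, zero_add] at l4
  refine l4.congr fun n => ?_
  have hτ := Real.rpow_pos_of_pos (h.eps_pos n) r
  have hsub : perforated Ω YH (ε n) ×ˢ Ioo 0 T ⊆ Ω ×ˢ Ioo 0 T :=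
    Set.prod_mono perforated_subset le_rfl
  have i2 := integrable_mul_of_memLp (h.memLp_u n) (h.memLp_test_osc n (hbv.tens hb₁') bC)
  have i3 := integrable_mul_of_memLp (h.memLp_u n) ((h.memLp_test (hbv.tens hb₁)).mono_measure
    (Measure.restrict_mono hsub le_rfl))
  have i4 := integrable_mul_of_memLp (h.memLp_u n) (h.memLp_test_osc n (hbv.tens hb₁) b₂)
  have hd : ∀ t, deriv (fun τ => c₁ τ * C (τ / ε n ^ r)) t =
      deriv c₁ t * C (t / ε n ^ r) + c₁ t * ((c₂ (t / ε n ^ r) - m) / ε n ^ r) := by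
    intro t
    have d1 : HasDerivAt c₁ (deriv c₁ t) t := (hc₁.1.differentiable (by simp) t).hasDerivAt
    have d2 : HasDerivAt (fun τ => C (τ / ε n ^ r)) ((c₂ (t / ε n ^ r) - m) * (1 / ε n ^ r)) t :=
      HasDerivAt.comp t (h₂ := C) (hCd _) ((hasDerivAt_id t).div_const _)
    have d3 : HasDerivAt (fun τ => c₁ τ * C (τ / ε n ^ r)) _ t := d1.mul d2
    rw [d3.deriv]
    ring
  have e1 : ∀ p : Space N × ℝ, ε n ^ r * (u n p.1 p.2 * v p.1 *
      deriv (fun τ => c₁ τ * C (τ / ε n ^ r)) p.2) =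
      ε n ^ r * (u n p.1 p.2 * (tens v (deriv c₁) p * osc (ε n) r (tens (fun _ => 1) C) p)) +
      (u n p.1 p.2 * (tens v c₁ p * osc (ε n) r (tens (fun _ => 1) c₂) p) -
        m * (u n p.1 p.2 * tens v c₁ p)) := by
    intro p
    rw [hd]
    simp only [tens, osc, smul_eq_mul, hC.fract_eq, hc₂.fract_eq]
    field_simp
  have i5 : Integrable (fun p : Space N × ℝ =>
      u n p.1 p.2 * (tens v c₁ p * osc (ε n) r (tens (fun _ => 1) c₂) p) -
        m * (u n p.1 p.2 * tens v c₁ p))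
      (volume.restrict (perforated Ω YH (ε n) ×ˢ Ioo 0 T)) := i4.sub (i3.const_mul _)
  rw [← integral_const_mul, integral_congr_ae (ae_of_all _ e1),
    integral_add (i2.const_mul _) i5, integral_sub i4 (i3.const_mul _),
    integral_const_mul, integral_const_mul]
  simp only [jInt]
  ring

/-- The limit of the functions tested with oscillating functions. -/
lemma tendsto_jInt (h : IsBoundedSequence Ω YH T r ε u g)
    (hosc : TimeOscillationVanishes Ω YH T r ε u) {U : Space N × ℝ → ℝ}
    (hU : IsWeakLimit Ω YH T ε u U) {v : Space N → ℝ} (hv : IsTest Ω v) {c₁ c₂ : ℝ → ℝ}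
    (hc₁ : IsTest (Ioo 0 T) c₁) (hc₂ : IsSmoothPeriodic c₂) {ψ : Space N → ℝ}
    (hψ : MemLp ψ 2 (volume.restrict (solidCell YH))) (hψ0 : ∀ y ∈ YH, ψ y = 0) :
    Tendsto (fun n => jInt Ω YH T r (ε n) (u n) (tens v c₁) (tens ψ c₂)) atTop
      (𝓝 ((∫ y in solidCell YH, ψ y) * (∫ s in (0 : ℝ)..1, c₂ s) *
        ∫ p in Ω ×ˢ Ioo 0 T, (U p / volume.real (solidCell YH)) * tens v c₁ p)) := by
  set m := (∫ y in solidCell YH, ψ y) / volume.real (solidCell YH)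
  have hb₁ := hc₁.isBoundedContinuous
  have hb₂ := hc₂.isBoundedContinuous
  obtain ⟨M₂, hM₂⟩ := hb₂.2
  have hDm := (isOpen_solidCell h.isCompact_hole).measurableSet
  -- `ψ` is split into its mean over the solid cell, cut off in the hole, and a mean-free rest that
  -- contributes nothing in the limit. On the support of `v` the points of the perforated domain
  -- avoid the holes, so the cutoff is invisible there.
  set ψ₁ : Space N → ℝ := YHᶜ.indicator fun _ => m
  have hψ₁D : ∀ y ∈ solidCell YH, ψ₁ y = m := fun y hy => indicator_of_mem hy.2 _
  have hψ₁0 : ∀ y ∈ YH, ψ₁ y = 0 := fun y hy => indicator_of_notMem (not_not.2 hy) _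
  have hψ₁ : MemLp ψ₁ 2 (volume.restrict (solidCell YH)) :=
    (memLp_const_solidCell m).ae_eq (ae_restrict_of_forall_mem hDm fun y hy => (hψ₁D y hy).symm)
  have hψ₂0 : ∀ y ∈ YH, ψ y - ψ₁ y = 0 := fun y hy => by rw [hψ0 y hy, hψ₁0 y hy, sub_zero]
  have hψ₂ : MemLp (fun y => ψ y - ψ₁ y) 2 (volume.restrict (solidCell YH)) := hψ.sub hψ₁
  have hmean : ∫ y in solidCell YH, (ψ y - ψ₁ y) = 0 := by
    rw [← integral_sub_mean h.isCompact_hole h.connected hψ]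
    exact setIntegral_congr_fun hDm fun y hy => by simp only [hψ₁D y hy, m]
  have l1 := h.tendsto_jInt_mean_zero hv hb₁ hb₂ hψ₂ hψ₂0 hmean
  have l2 := (h.tendsto_jInt_one hosc hU hv hc₁ hc₂).const_mul m
  have l3 := l1.add l2
  have e0 : 0 + m * ((∫ s in (0 : ℝ)..1, c₂ s) * ∫ p in Ω ×ˢ Ioo 0 T, U p * tens v c₁ p) =
      (∫ y in solidCell YH, ψ y) * (∫ s in (0 : ℝ)..1, c₂ s) *
        ∫ p in Ω ×ˢ Ioo 0 T, (U p / volume.real (solidCell YH)) * tens v c₁ p := by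
    have e : ∀ p : Space N × ℝ, (U p / volume.real (solidCell YH)) * tens v c₁ p =
        (volume.real (solidCell YH))⁻¹ * (U p * tens v c₁ p) := fun p => by ring
    simp only [e, integral_const_mul, m]
    ring
  rw [e0] at l3
  refine l3.congr' ?_
  filter_upwards [eventually_cellsInside h.isOpen hv.2.1 hv.2.2 h.eps_pos h.eps_tendsto] with n hn
  have cψ₂ := memLp_tens_cell h.isCompact_hole hψ₂ hψ₂0 hb₂.1 hM₂
  have b₂ := memLp_tens_one (N := N) hb₂
  have ha := hv.isBoundedContinuous.tens hb₁
  have i1 := integrable_mul_of_memLp (h.memLp_u n) (h.memLp_test_osc n ha cψ₂)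
  have i2 := integrable_mul_of_memLp (h.memLp_u n) (h.memLp_test_osc n ha b₂)
  rw [jInt, jInt, jInt, ← integral_const_mul, ← integral_add i1 (i2.const_mul m)]
  refine setIntegral_congr_fun (h.measurableSet_domain n) fun p hp => ?_
  simp only [tens, osc, smul_eq_mul]
  by_cases hx : p.1 ∈ tsupport v
  · have h1 := (hn.mem_perforated_iff h.hole_subset hx (hv.2.2 hx)).1 hp.1
    have h2 : ψ₁ (fract ((ε n)⁻¹ • p.1)) = m := indicator_of_mem h1 _
    rw [h2]
    ring
  · rw [image_eq_zero_of_notMem_tsupport hx]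
    ring

/-- The limit equation tested with divergence free fields in the cell. -/
lemma integral_limit_add (h : IsBoundedSequence Ω YH T r ε u g)
    (hosc : TimeOscillationVanishes Ω YH T r ε u) {U : Space N × ℝ → ℝ}
    (hU : IsWeakLimit Ω YH T ε u U) {G : (Space N × ℝ) × (Space N × ℝ) → Space N}
    (hG : MemLp G 2 (tsMeasure Ω YH T))
    (hconv : GradientsConverge Ω YH T r ε g (fun _ _ => 0) (fun x t y s => G ((x, t), (y, s))))
    {v : Space N → ℝ} (hv : IsTest Ω v) {c₁ c₂ : ℝ → ℝ}
    (hc₁ : IsTest (Ioo 0 T) c₁) (hc₂ : IsSmoothPeriodic c₂) {Ψ : Space N → Space N}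
    (hΨ : IsCellPair YH (fun _ => 0) Ψ) :
    (∫ q, inner ℝ (G q) (tens v c₁ q.1 • tens Ψ c₂ q.2) ∂(tsMeasure Ω YH T)) +
      ∑ i, (∫ y in solidCell YH, Ψ y i) * (∫ s in (0 : ℝ)..1, c₂ s) *
        ∫ p in Ω ×ˢ Ioo 0 T, (U p / volume.real (solidCell YH)) * tens (pderiv i v) c₁ p = 0 := by
  have hb₁ := hc₁.isBoundedContinuous
  have hb₂ := hc₂.isBoundedContinuous
  obtain ⟨M₂, hM₂⟩ := hb₂.2
  obtain ⟨C, -, hCg⟩ := h.exists_bound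
  have cΨ := memLp_tens_cell h.isCompact_hole hΨ.2.1 hΨ.2.2.2.1 hb₂.1 hM₂
  have l1 := tendsto_iInt_of_gradientsConverge h.isOpen h.isBounded h.isCompact_hole h.eps_pos
    h.eps_tendsto h.r_pos h.memLp_g hCg (hG.congr_norm (by
      simp only [zero_add]; exact hG.1) (ae_of_all _ fun q => by simp only [zero_add])) hconv
    (hv.isBoundedContinuous.tens hb₁) cΨ
  simp only [zero_add] at l1
  have l2 := tendsto_finsetSum (Finset.univ : Finset (Fin N)) fun i _ =>
    h.tendsto_jInt hosc hU (hv.pderiv i) hc₁ hc₂ (memLp_apply hΨ.2.1 i)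
      (fun y hy => by rw [hΨ.2.2.2.1 y hy]; rfl)
  -- For a divergence free field the left side of the central identity is zero. Hence the bracket
  -- multiplied by `ε` vanishes for all small `ε`, and so does its limit.
  refine tendsto_nhds_unique_of_eventuallyEq (l1.add l2) tendsto_const_nhds ?_
  filter_upwards [eventually_cellsInside h.isOpen hv.2.1 hv.2.2 h.eps_pos h.eps_tendsto] with n hn
  have key := jInt_cellPair h.isOpen h.isBounded h.isCompact_hole h.hole_subset (h.eps_pos n) hv hn
    (h.bdd.1 n) hb₁ hb₂ hΨ (r := r)
  have h0 : jInt Ω YH T r (ε n) (u n) (tens v c₁) (tens (fun _ => (0 : ℝ)) c₂) = 0 :=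
    integral_eq_zero_of_ae (ae_of_all _ fun p => by simp [tens, osc])
  rw [h0] at key
  exact (mul_eq_zero.1 key.symm).resolve_left (h.eps_pos n).ne'

end IsBoundedSequence
end Perforated

/-! ### Linear problems in the fibers of a product. -/

namespace Perforated

section Fibers

variable {X Q : Type*} [MeasurableSpace X] [MeasurableSpace Q] {μ : Measure X} {ν : Measure Q}
  [SFinite μ] [IsFiniteMeasure ν] {B B' : Type*} [NormedAddCommGroup B] [InnerProductSpace ℝ B]
  [NormedAddCommGroup B'] [InnerProductSpace ℝ B']

lemma memLp_indicator_smul {s : X → B} (hs : MemLp s 2 μ) {A : Set Q} (hA : MeasurableSet A) :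
    MemLp (fun p : X × Q => A.indicator (fun _ => (1 : ℝ)) p.2 • s p.1) 2 (μ.prod ν) :=
  memLp_bdd_smul (C := 1) (c := fun p : X × Q => A.indicator (fun _ => (1 : ℝ)) p.2)
    ((measurable_const.indicator hA).comp measurable_snd).aestronglyMeasurable
    (fun p => by by_cases h : p.2 ∈ A <;> simp [h]) (hs.comp_fst ν)

lemma integrable_fiber_inner {s : X → B} (hs : MemLp s 2 μ) {f : X × Q → B}
    (hf : MemLp f 2 (μ.prod ν)) : Integrable (fun q => ∫ x, inner ℝ (s x) (f (x, q)) ∂μ) ν :=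
  (integrable_inner_of_memLp (hs.comp_fst ν) hf).integral_prod_right

lemma setIntegral_fiber_inner {s : X → B} (hs : MemLp s 2 μ) {f : X × Q → B}
    (hf : MemLp f 2 (μ.prod ν)) {A : Set Q} (hA : MeasurableSet A) :
    ∫ q in A, ∫ x, inner ℝ (s x) (f (x, q)) ∂μ ∂ν =
      ∫ p, inner ℝ (A.indicator (fun _ => (1 : ℝ)) p.2 • s p.1) (f p) ∂(μ.prod ν) := by
  rw [integral_prod_symm _ (integrable_inner_of_memLp (memLp_indicator_smul hs hA) hf),
    ← integral_indicator hA]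
  refine integral_congr_ae (ae_of_all _ fun q => ?_)
  by_cases hq : q ∈ A <;> simp [hq]

lemma ae_fiber_add_eq_zero {s : X → B} (hs : MemLp s 2 μ) {f : X × Q → B}
    (hf : MemLp f 2 (μ.prod ν)) {s' : X → B'} (hs' : MemLp s' 2 μ) {f' : X × Q → B'}
    (hf' : MemLp f' 2 (μ.prod ν))
    (h : ∀ A : Set Q, MeasurableSet A →
      (∫ p, inner ℝ (A.indicator (fun _ => (1 : ℝ)) p.2 • s p.1) (f p) ∂(μ.prod ν)) +
      ∫ p, inner ℝ (A.indicator (fun _ => (1 : ℝ)) p.2 • s' p.1) (f' p) ∂(μ.prod ν) = 0) :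
    ∀ᵐ q ∂ν, (∫ x, inner ℝ (s x) (f (x, q)) ∂μ) + ∫ x, inner ℝ (s' x) (f' (x, q)) ∂μ = 0 := by
  have i1 := integrable_fiber_inner hs hf
  have i2 := integrable_fiber_inner hs' hf'
  have i3 : Integrable (fun q => (∫ x, inner ℝ (s x) (f (x, q)) ∂μ) +
    ∫ x, inner ℝ (s' x) (f' (x, q)) ∂μ) ν := i1.add i2
  refine i3.ae_eq_zero_of_forall_setIntegral_eq_zero fun A hA _ => ?_
  rw [integral_add i1.integrableOn i2.integrableOn, setIntegral_fiber_inner hs hf hA,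
    setIntegral_fiber_inner hs' hf' hA]
  exact h A hA

open Classical in
/-- The fiber of a function as an element of `L²`. -/
def fiber (μ : Measure X) (f : X × Q → B) (q : Q) : Lp B 2 μ :=
  if h : MemLp (fun x => f (x, q)) 2 μ then h.toLp _ else 0

lemma ae_fiber_eq {f : X × Q → B} (hf : MemLp f 2 (μ.prod ν)) :
    ∀ᵐ q ∂ν, ∃ h : MemLp (fun x => f (x, q)) 2 μ, fiber μ f q = h.toLp _ := by
  filter_upwards [ae_memLp_slice hf] with q hq
  exact ⟨hq, dif_pos hq⟩

lemma ae_inner_fiber {f : X × Q → B} (hf : MemLp f 2 (μ.prod ν)) :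
    ∀ᵐ q ∂ν, ∀ s : Lp B 2 μ, inner ℝ s (fiber μ f q) = ∫ x, inner ℝ (s x) (f (x, q)) ∂μ := by
  filter_upwards [ae_fiber_eq hf] with q ⟨hq, he⟩ s
  rw [he]
  conv_lhs => rw [← Lp.toLp_coeFn s (Lp.memLp s)]
  rw [inner_toLp_eq_integral]

lemma ae_inner_fiber_eq_zero [SecondCountableTopology (Lp B 2 μ)] {f : X × Q → B}
    (hf : MemLp f 2 (μ.prod ν)) {S : Set (Lp B 2 μ)}
    (h : ∀ s ∈ S, ∀ᵐ q ∂ν, ∫ x, inner ℝ (s x) (f (x, q)) ∂μ = 0) :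
    ∀ᵐ q ∂ν, ∀ s ∈ S, inner ℝ s (fiber μ f q) = 0 := by
  refine ae_forall_mem_eq_zero (L := fun q s => inner ℝ s (fiber μ f q))
    (ae_of_all _ fun q => by fun_prop) fun s hs => ?_
  filter_upwards [ae_inner_fiber hf, h s hs] with q h1 h2
  rw [h1, h2]

lemma ae_inner_fiber_add_eq_zero [SecondCountableTopology (Lp B 2 μ)]
    [SecondCountableTopology (Lp B' 2 μ)] {f : X × Q → B} (hf : MemLp f 2 (μ.prod ν))
    {f' : X × Q → B'} (hf' : MemLp f' 2 (μ.prod ν)) {S : Set (Lp B 2 μ × Lp B' 2 μ)}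
    (h : ∀ s ∈ S, ∀ᵐ q ∂ν,
      (∫ x, inner ℝ (s.1 x) (f (x, q)) ∂μ) + ∫ x, inner ℝ (s.2 x) (f' (x, q)) ∂μ = 0) :
    ∀ᵐ q ∂ν, ∀ s ∈ S, inner ℝ s.1 (fiber μ f q) + inner ℝ s.2 (fiber μ f' q) = 0 := by
  refine ae_forall_mem_eq_zero
    (L := fun q (s : Lp B 2 μ × Lp B' 2 μ) => inner ℝ s.1 (fiber μ f q) + inner ℝ s.2 (fiber μ f' q))
    (ae_of_all _ fun q => by fun_prop) fun s hs => ?_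
  filter_upwards [ae_inner_fiber hf, ae_inner_fiber hf', h s hs] with q h1 h2 h3
  rw [h1, h2, h3]

/-- Functions on the product whose fibers satisfy the given linear equations. -/
def fiberGraph (μ : Measure X) (ν : Measure Q) [SFinite μ] [IsFiniteMeasure ν]
    (S : Set (Lp B 2 μ × Lp B' 2 μ)) : Submodule ℝ (Lp B 2 (μ.prod ν) × Lp B' 2 (μ.prod ν)) :=
  ⨅ A : {A : Set Q // MeasurableSet A}, ⨅ s : S,
    ((innerSL ℝ ((memLp_indicator_smul (ν := ν) (Lp.memLp s.1.1) A.2).toLp _)).coprod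
      (innerSL ℝ ((memLp_indicator_smul (ν := ν) (Lp.memLp s.1.2) A.2).toLp _))).ker

lemma isClosed_fiberGraph (S : Set (Lp B 2 μ × Lp B' 2 μ)) :
    IsClosed (fiberGraph μ ν S : Set (Lp B 2 (μ.prod ν) × Lp B' 2 (μ.prod ν))) := by
  rw [fiberGraph, Submodule.coe_iInf]
  refine isClosed_iInter fun A => ?_
  rw [Submodule.coe_iInf]
  exact isClosed_iInter fun s => ContinuousLinearMap.isClosed_ker _

/-- Weights `1_A(q)` with arbitrary measurable `A` localize the integrated equations at almost every
`q`, and separability of `L²` provides one null set for all members of `S`. -/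
lemma toLp_mem_fiberGraph [SecondCountableTopology (Lp B 2 μ)]
    [SecondCountableTopology (Lp B' 2 μ)] {S : Set (Lp B 2 μ × Lp B' 2 μ)}
    {f : X × Q → B} (hf : MemLp f 2 (μ.prod ν)) {f' : X × Q → B'} (hf' : MemLp f' 2 (μ.prod ν)) :
    (hf.toLp f, hf'.toLp f') ∈ fiberGraph μ ν S ↔
      ∀ᵐ q ∂ν, ∀ s ∈ S, inner ℝ s.1 (fiber μ f q) + inner ℝ s.2 (fiber μ f' q) = 0 := by
  have hval : ∀ (A : {A : Set Q // MeasurableSet A}) (s : S),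
      ((innerSL ℝ ((memLp_indicator_smul (ν := ν) (Lp.memLp s.1.1) A.2).toLp _)).coprod
      (innerSL ℝ ((memLp_indicator_smul (ν := ν) (Lp.memLp s.1.2) A.2).toLp _)))
        (hf.toLp f, hf'.toLp f') =
      (∫ p, inner ℝ (A.1.indicator (fun _ => (1 : ℝ)) p.2 • s.1.1 p.1) (f p) ∂(μ.prod ν)) +
      ∫ p, inner ℝ (A.1.indicator (fun _ => (1 : ℝ)) p.2 • s.1.2 p.1) (f' p) ∂(μ.prod ν) := by
    intro A s
    change inner ℝ ((memLp_indicator_smul (ν := ν) (Lp.memLp s.1.1) A.2).toLp _) (hf.toLp f) +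
      inner ℝ ((memLp_indicator_smul (ν := ν) (Lp.memLp s.1.2) A.2).toLp _) (hf'.toLp f') = _
    rw [inner_toLp_eq_integral, inner_toLp_eq_integral]
  constructor
  · intro h
    refine ae_inner_fiber_add_eq_zero hf hf' fun s hs => ?_
    refine ae_fiber_add_eq_zero (Lp.memLp s.1) hf (Lp.memLp s.2) hf' fun A hA => ?_
    rw [← hval ⟨A, hA⟩ ⟨s, hs⟩]
    exact (Submodule.mem_iInf _).1 ((Submodule.mem_iInf _).1 h ⟨A, hA⟩) ⟨s, hs⟩
  · intro h
    refine (Submodule.mem_iInf _).2 fun A => (Submodule.mem_iInf _).2 fun s => ?_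
    refine (hval A s).trans ?_
    have hs := Lp.memLp s.1.1
    have hs' := Lp.memLp s.1.2
    rw [← setIntegral_fiber_inner hs hf A.2, ← setIntegral_fiber_inner hs' hf' A.2,
      ← integral_add (integrable_fiber_inner hs hf).integrableOn
        (integrable_fiber_inner hs' hf').integrableOn]
    refine integral_eq_zero_of_ae (ae_restrict_of_ae ?_)
    filter_upwards [h, ae_inner_fiber hf, ae_inner_fiber hf'] with q h1 h2 h3
    rw [← h2, ← h3]
    exact h1 s.1 s.2

lemma toReal_eLpNorm_sq {α : Type*} [MeasurableSpace α] {κ : Measure α} {f : α → B}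
    (hf : MemLp f 2 κ) : (eLpNorm f 2 κ).toReal ^ 2 = ∫ x, ‖f x‖ ^ 2 ∂κ := by
  have hm : AEStronglyMeasurable (fun x => ‖f x‖ ^ 2) κ := hf.1.norm.pow 2
  rw [← ENNReal.toReal_pow, eLpNorm_two_sq,
    integral_eq_lintegral_of_nonneg_ae (ae_of_all _ fun x => by positivity) hm]
  congr 1
  refine lintegral_congr fun x => ?_
  rw [ENNReal.ofReal_pow (norm_nonneg _), ofReal_norm]

lemma ae_norm_fiber_sq {f : X × Q → B} (hf : MemLp f 2 (μ.prod ν)) :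
    ∀ᵐ q ∂ν, ‖fiber μ f q‖ ^ 2 = ∫ x, ‖f (x, q)‖ ^ 2 ∂μ := by
  filter_upwards [ae_fiber_eq hf] with q ⟨hq, he⟩
  rw [he, Lp.norm_toLp, toReal_eLpNorm_sq hq]

lemma norm_toLp_sq_eq {f : X × Q → B} (hf : MemLp f 2 (μ.prod ν)) :
    ‖hf.toLp f‖ ^ 2 = ∫ q, ‖fiber μ f q‖ ^ 2 ∂ν := by
  rw [Lp.norm_toLp, toReal_eLpNorm_sq hf,
    integral_prod_symm _ ((memLp_two_iff_integrable_sq_norm hf.1).1 hf)]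
  refine integral_congr_ae ?_
  filter_upwards [ae_norm_fiber_sq hf] with q hq
  exact hq.symm

lemma integrable_norm_fiber_sq {f : X × Q → B} (hf : MemLp f 2 (μ.prod ν)) :
    Integrable (fun q => ‖fiber μ f q‖ ^ 2) ν := by
  refine (((memLp_two_iff_integrable_sq_norm hf.1).1 hf).integral_prod_right).congr ?_
  filter_upwards [ae_norm_fiber_sq hf] with q hq
  exact hq.symm

/-- Solving a linear problem with closed graph in every fiber, with measurable dependence. -/
theorem exists_fiber_solution [CompleteSpace B] [CompleteSpace B']
    [SecondCountableTopology (Lp B 2 μ)] [SecondCountableTopology (Lp B' 2 μ)]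
    (K : Submodule ℝ (Lp B 2 μ × Lp B' 2 μ)) (S : Set (Lp B 2 μ × Lp B' 2 μ))
    (hKS : ∀ p, p ∈ K ↔ ∀ s ∈ S, inner ℝ s.1 p.1 + inner ℝ s.2 p.2 = 0) {C : NNReal}
    (hC : ∀ p ∈ K, ‖p.1‖ ≤ C * ‖p.2‖) {z : X × Q → B'} (hz : MemLp z 2 (μ.prod ν))
    (hzK : ∀ᵐ q ∂ν, ∀ Ψ : Lp B' 2 μ, (∀ p ∈ K, inner ℝ p.2 Ψ = 0) → inner ℝ Ψ (fiber μ z q) = 0) :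
    ∃ w : X × Q → B, MemLp w 2 (μ.prod ν) ∧ ∀ᵐ q ∂ν, (fiber μ w q, fiber μ z q) ∈ K := by
  -- The fiberwise problems are collected into a single closed graph over the product, consisting of
  -- the pairs whose fibers lie in `K` almost everywhere. Integrating the fiberwise bound gives the
  -- same bound on `V`, so one solution operator serves all fibers and measurability in `q` comes
  -- for free.
  set V := fiberGraph μ ν S
  have hmem : ∀ {f : X × Q → B} (hf : MemLp f 2 (μ.prod ν)) {f' : X × Q → B'}
      (hf' : MemLp f' 2 (μ.prod ν)), (hf.toLp f, hf'.toLp f') ∈ V ↔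
      ∀ᵐ q ∂ν, (fiber μ f q, fiber μ f' q) ∈ K := by
    intro f hf f' hf'
    rw [toLp_mem_fiberGraph hf hf']
    exact eventually_congr (ae_of_all _ fun q => (hKS (fiber μ f q, fiber μ f' q)).symm)
  have hbound : ∀ p ∈ V, ‖p.1‖ ≤ C * ‖p.2‖ := by
    intro p hp
    have hp' : ((Lp.memLp p.1).toLp p.1, (Lp.memLp p.2).toLp p.2) ∈ V := by
      rwa [Lp.toLp_coeFn, Lp.toLp_coeFn]
    have h2 := (hmem _ _).1 hp'
    refine le_of_sq_le_sq ?_ (by positivity)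
    rw [mul_pow]
    have e1 := norm_toLp_sq_eq (Lp.memLp p.1)
    have e2 := norm_toLp_sq_eq (Lp.memLp p.2)
    rw [Lp.toLp_coeFn] at e1 e2
    rw [e1, e2, ← integral_const_mul]
    refine integral_mono_ae (integrable_norm_fiber_sq (Lp.memLp p.1))
      ((integrable_norm_fiber_sq (Lp.memLp p.2)).const_mul _) ?_
    filter_upwards [h2] with q hq
    have h3 := hC _ hq
    calc ‖fiber μ p.1 q‖ ^ 2 ≤ (C * ‖fiber μ p.2 q‖) ^ 2 := by gcongr
      _ = (C : ℝ) ^ 2 * ‖fiber μ p.2 q‖ ^ 2 := mul_pow _ _ _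
  obtain ⟨R, -, hR⟩ := exists_solution_operator V (isClosed_fiberGraph S) hbound
  -- Solvability is checked by duality. A function `Ψ` orthogonal to `V` is orthogonal to the pairs
  -- `1_A(q) p` with `p` in `K`; hence almost all its fibers are orthogonal to the second components
  -- of `K`, and by hypothesis to the fibers of `z`.
  have hin : (R (hz.toLp z), hz.toLp z) ∈ V := by
    refine hR _ fun Ψ hΨ => ?_
    have hΨm := Lp.memLp Ψ
    have h1 : ∀ᵐ q ∂ν, ∀ s ∈ {s : Lp B' 2 μ | ∃ p ∈ K, p.2 = s}, inner ℝ s (fiber μ Ψ q) = 0 := by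
      refine ae_inner_fiber_eq_zero hΨm ?_
      rintro _ ⟨p, hp, rfl⟩
      refine (integrable_fiber_inner (Lp.memLp p.2) hΨm).ae_eq_zero_of_forall_setIntegral_eq_zero
        fun A hA _ => ?_
      rw [setIntegral_fiber_inner (Lp.memLp p.2) hΨm hA]
      have m1 := memLp_indicator_smul (ν := ν) (Lp.memLp p.1) hA
      have m2 := memLp_indicator_smul (ν := ν) (Lp.memLp p.2) hA
      have hV : (m1.toLp _, m2.toLp _) ∈ V := by
        rw [hmem]
        filter_upwards [ae_fiber_eq m1, ae_fiber_eq m2] with q ⟨a1, b1⟩ ⟨a2, b2⟩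
        set c : ℝ := A.indicator (fun _ => (1 : ℝ)) q
        have e1 : a1.toLp _ = c • p.1 := 
          ((Lp.memLp p.1).toLp_const_smul c).trans (by rw [Lp.toLp_coeFn])
        have e2 : a2.toLp _ = c • p.2 := 
          ((Lp.memLp p.2).toLp_const_smul c).trans (by rw [Lp.toLp_coeFn])
        rw [b1, b2, e1, e2]
        exact K.smul_mem c hp
      have h2 := hΨ _ hV
      conv at h2 => lhs; rw [← Lp.toLp_coeFn Ψ hΨm]
      rwa [inner_toLp_eq_integral] at h2
    conv_lhs => rw [← Lp.toLp_coeFn Ψ hΨm]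
    rw [inner_toLp_eq_integral, integral_prod_symm _ (integrable_inner_of_memLp hz hΨm)]
    refine integral_eq_zero_of_ae ?_
    filter_upwards [h1, hzK, ae_fiber_eq hz, ae_fiber_eq hΨm] with q h2 h3 ⟨a1, b1⟩ ⟨a2, b2⟩
    have h4 := h3 (fiber μ Ψ q) fun p hp => h2 _ ⟨p, hp, rfl⟩
    rw [b1, b2, real_inner_comm, inner_toLp_eq_integral] at h4
    exact h4
  refine ⟨R (hz.toLp z), Lp.memLp _, ?_⟩
  rw [← hmem (Lp.memLp _) hz, Lp.toLp_coeFn]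
  exact hin

end Fibers
end Perforated

/-! ### Fiberwise pairings, and weak derivatives at almost every time. -/

namespace Perforated
variable {N : ℕ} {Ω YH : Set (Space N)}

section Fibers

variable {X Q : Type*} [MeasurableSpace X] [MeasurableSpace Q] {μ : Measure X} {ν : Measure Q}
  [SFinite μ] [IsFiniteMeasure ν] {B : Type*} [NormedAddCommGroup B] [InnerProductSpace ℝ B]

lemma integral_toLp_inner {s f : X → B} (hs : MemLp s 2 μ) :
    ∫ x, inner ℝ (hs.toLp s x) (f x) ∂μ = ∫ x, inner ℝ (s x) (f x) ∂μ := by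
  refine integral_congr_ae ?_
  filter_upwards [hs.coeFn_toLp] with x hx
  rw [hx]

/-- Cauchy–Schwarz in each fiber bounds the pairing by `‖s‖` times the norm of the fiber of `f`, and
the latter is square integrable in `q`. -/
lemma memLp_fiber_inner {s : X → B} (hs : MemLp s 2 μ) {f : X × Q → B}
    (hf : MemLp f 2 (μ.prod ν)) : MemLp (fun q => ∫ x, inner ℝ (s x) (f (x, q)) ∂μ) 2 ν := by
  have hm := (integrable_fiber_inner hs hf).1
  refine (memLp_two_iff_integrable_sq_norm hm).2 ?_
  refine ((integrable_norm_fiber_sq hf).const_mul (‖hs.toLp s‖ ^ 2)).mono' (hm.norm.pow 2) ?_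
  filter_upwards [ae_inner_fiber hf] with q hq
  have h1 := hq (hs.toLp s)
  rw [integral_toLp_inner] at h1
  rw [← h1, Real.norm_of_nonneg (by positivity), ← mul_pow]
  gcongr
  exact norm_inner_le_norm _ _

lemma integral_fiber_inner_mul {s : X → B} (hs : MemLp s 2 μ) {f : X × Q → B}
    (hf : MemLp f 2 (μ.prod ν)) {c : Q → ℝ} (hc : AEStronglyMeasurable c ν) {M : ℝ}
    (hM : ∀ q, ‖c q‖ ≤ M) :
    ∫ q, (∫ x, inner ℝ (s x) (f (x, q)) ∂μ) * c q ∂ν =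
      ∫ p, inner ℝ (s p.1) (f p) * c p.2 ∂(μ.prod ν) := by
  have hi : Integrable (fun p : X × Q => inner ℝ (s p.1) (f p) * c p.2) (μ.prod ν) :=
    (integrable_inner_of_memLp (hs.comp_fst ν) hf).mul_bdd (c := M) (hc.comp_snd (μ := μ))
      (ae_of_all _ fun p => hM _)
  rw [integral_prod_symm _ hi]
  exact integral_congr_ae (ae_of_all _ fun q => (integral_mul_const _ _).symm)

end Fibers

lemma integral_ts_tensor (hΩb : Bornology.IsBounded Ω) {T : ℝ}
    {G : (Space N × ℝ) × (Space N × ℝ) → Space N} (hG : MemLp G 2 (tsMeasure Ω YH T))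
    {a : Space N × ℝ → ℝ} (ha : IsBoundedContinuous a) {b : Space N × ℝ → Space N}
    (hb : MemLp b 2 (volume.restrict (solidCell YH ×ˢ Ioo 0 1))) :
    ∫ q, inner ℝ (G q) (a q.1 • b q.2) ∂(tsMeasure Ω YH T) =
      ∫ p in Ω ×ˢ Ioo 0 T, (∫ z in solidCell YH ×ˢ Ioo 0 1, inner ℝ (b z) (G (p, z))) * a p := by
  refine (integral_prod _ (integrable_inner_of_memLp hG (memLp_tensor_ts hΩb ha hb))).trans ?_
  refine integral_congr_ae (ae_of_all _ fun p => ?_)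
  change ∫ z in solidCell YH ×ˢ Ioo 0 1, inner ℝ (G (p, z)) (a p • b z) =
    (∫ z in solidCell YH ×ˢ Ioo 0 1, inner ℝ (b z) (G (p, z))) * a p
  rw [← integral_mul_const]
  refine integral_congr_ae (ae_of_all _ fun z => ?_)
  change inner ℝ (G (p, z)) (a p • b z) = inner ℝ (b z) (G (p, z)) * a p
  rw [real_inner_smul_right, real_inner_comm, mul_comm]

namespace IsBoundedSequence

variable {T r : ℝ} {ε : ℕ → ℝ} {u : ℕ → Space N → ℝ → ℝ} {g : ℕ → Space N → ℝ → Space N}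

/-- The two-scale limit of the gradients tested with a field in the cell is square integrable. -/
lemma memLp_cell_inner (h : IsBoundedSequence Ω YH T r ε u g)
    {G : (Space N × ℝ) × (Space N × ℝ) → Space N} (hG : MemLp G 2 (tsMeasure Ω YH T))
    {b : Space N × ℝ → Space N} (hb : MemLp b 2 (volume.restrict (solidCell YH ×ˢ Ioo 0 1))) :
    MemLp (fun p => ∫ z in solidCell YH ×ˢ Ioo 0 1, inner ℝ (b z) (G (p, z))) 2
      (volume.restrict (Ω ×ˢ Ioo 0 T)) := by
  have := isFiniteMeasure_spaceTime h.isBounded T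
  have hGs : MemLp (fun p => G p.swap) 2 ((volume.restrict (solidCell YH ×ˢ Ioo (0 : ℝ) 1)).prod
      (volume.restrict (Ω ×ˢ Ioo 0 T))) :=
    hG.comp_measurePreserving Measure.measurePreserving_swap
  exact memLp_fiber_inner hb hGs

lemma hasWeakGrad_of_pderiv (hΩb : Bornology.IsBounded Ω) {w : Space N → ℝ} {F : Space N → Space N}
    (hw : MemLp w 2 (volume.restrict Ω)) (hF : MemLp F 2 (volume.restrict Ω))
    (h : ∀ i, ∀ v, IsTest Ω v →
      (∫ x in Ω, pderiv i v x * w x) + ∫ x in Ω, v x * F x i = 0) : HasWeakGrad Ω w F := by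
  have hfin : IsFiniteMeasure (volume.restrict Ω) := ⟨by simpa using hΩb.measure_lt_top⟩
  have i1 : IntegrableOn w Ω := hw.integrable (by norm_num)
  have i2 : IntegrableOn F Ω := hF.integrable (by norm_num)
  refine ⟨i1.locallyIntegrableOn, i2.locallyIntegrableOn, fun v hv ξ => ?_⟩
  have e1 : ∀ x, w x * fderiv ℝ v x ξ = ∑ i, ξ i * (pderiv i v x * w x) := fun x => by
    rw [← inner_gradient_left, inner_gradient_eq_sum, Finset.mul_sum]
    exact Finset.sum_congr rfl fun i _ => by ring
  have e2 : ∀ x, v x * inner ℝ (F x) ξ = ∑ i, ξ i * (v x * F x i) := fun x => by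
    rw [PiLp.inner_apply, Finset.mul_sum]
    exact Finset.sum_congr rfl fun i _ => by simp only [RCLike.inner_apply, conj_trivial]; ring
  have mem : ∀ {a : Space N → ℝ}, IsTest Ω a → MemLp a 2 (volume.restrict Ω) := fun ha => by
    obtain ⟨M, hM⟩ := ha.isBoundedContinuous.2
    exact MemLp.of_bound ha.continuous.aestronglyMeasurable M (ae_of_all _ hM)
  have j1 : ∀ i, Integrable (fun x => ξ i * (pderiv i v x * w x)) (volume.restrict Ω) := fun i =>
    (integrable_mul_of_memLp (mem (hv.pderiv i)) hw).const_mul _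
  have j2 : ∀ i, Integrable (fun x => ξ i * (v x * F x i)) (volume.restrict Ω) := fun i =>
    (integrable_mul_of_memLp (mem hv) (memLp_apply hF i)).const_mul _
  simp only [e1, e2]
  rw [integral_finsetSum _ fun i _ => j1 i, integral_finsetSum _ fun i _ => j2 i,
    ← Finset.sum_neg_distrib]
  refine Finset.sum_congr rfl fun i _ => ?_
  rw [integral_const_mul, integral_const_mul, eq_neg_of_add_eq_zero_left (h i v hv)]
  ring

/-- Weak derivatives in space-time are weak derivatives at almost every time. -/
lemma isL2H1_of_tens (h : IsBoundedSequence Ω YH T r ε u g) {w : Space N × ℝ → ℝ}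
    {F : Space N × ℝ → Space N}
    (hw : MemLp w 2 (volume.restrict (Ω ×ˢ Ioo 0 T))) (hF : MemLp F 2 (volume.restrict (Ω ×ˢ Ioo 0 T)))
    (hd : ∀ i, ∀ v c, IsTest Ω v → IsTest (Ioo 0 T) c →
      (∫ p in Ω ×ˢ Ioo 0 T, w p * tens (pderiv i v) c p) +
        ∫ p in Ω ×ˢ Ioo 0 T, F p i * tens v c p = 0) :
    IsL2H1 Ω T (fun x t => w (x, t)) (fun x t => F (x, t)) := by
  refine ⟨hw, hF, ?_⟩
  have hfin : IsFiniteMeasure (volume.restrict Ω) := ⟨by simpa using h.isBounded.measure_lt_top⟩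
  have hfin' : IsFiniteMeasure (volume.restrict (Ioo 0 T)) := ⟨by simp⟩
  rw [volume_restrict_prod] at hw hF
  simp only [volume_restrict_prod] at hd
  have mem : ∀ {a : Space N → ℝ}, IsTest Ω a → MemLp a 2 (volume.restrict Ω) := fun ha => by
    obtain ⟨M, hM⟩ := ha.isBoundedContinuous.2
    exact MemLp.of_bound ha.continuous.aestronglyMeasurable M (ae_of_all _ hM)
  have hFi := fun i => memLp_apply hF i
  -- For one `v` the test functions `c` give the equation at almost every time. The common null set
  -- for all `v` comes from the separability of `L²`, the equation being continuous in the classes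
  -- of `∂_i v` and `v`.
  have key : ∀ i, ∀ᵐ t ∂(volume.restrict (Ioo 0 T)),
      ∀ s ∈ {s : Lp ℝ 2 (volume.restrict Ω) × Lp ℝ 2 (volume.restrict Ω) |
        ∃ v, ∃ hv : IsTest Ω v, s = ((mem (hv.pderiv i)).toLp _, (mem hv).toLp _)},
      inner ℝ s.1 (fiber (volume.restrict Ω) w t) +
        inner ℝ s.2 (fiber (volume.restrict Ω) (fun p => F p i) t) = 0 := by
    intro i
    refine ae_inner_fiber_add_eq_zero hw (hFi i) ?_
    rintro _ ⟨v, hv, rfl⟩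
    simp only [integral_toLp_inner]
    have i1 := integrable_fiber_inner (mem (hv.pderiv i)) hw
    have i2 := integrable_fiber_inner (mem hv) (hFi i)
    refine (isDetermining_isTest isOpen_Ioo).2 _ (i1.add i2) fun c hc => ?_
    obtain ⟨M, hM⟩ := hc.isBoundedContinuous.2
    have hcm := hc.continuous.aestronglyMeasurable (μ := volume.restrict (Ioo 0 T))
    simp only [add_mul]
    rw [integral_add (i1.mul_bdd (c := M) hcm (ae_of_all _ hM))
      (i2.mul_bdd (c := M) hcm (ae_of_all _ hM)),
      integral_fiber_inner_mul (mem (hv.pderiv i)) hw hcm hM,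
      integral_fiber_inner_mul (mem hv) (hFi i) hcm hM]
    refine Eq.trans ?_ (hd i v c hv hc)
    congr 1
    · refine integral_congr_ae (ae_of_all _ fun p => ?_)
      simp only [tens, RCLike.inner_apply, conj_trivial, smul_eq_mul]
      ring
    · refine integral_congr_ae (ae_of_all _ fun p => ?_)
      simp only [tens, RCLike.inner_apply, conj_trivial, smul_eq_mul]
      ring
  filter_upwards [ae_all_iff.2 key, ae_fiber_eq hw, ae_all_iff.2 fun i => ae_fiber_eq (hFi i),
    ae_memLp_slice hF] with t h1 ⟨a1, b1⟩ h2 h3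
  refine hasWeakGrad_of_pderiv h.isBounded a1 h3 fun i v hv => ?_
  obtain ⟨a2, b2⟩ := h2 i
  have h4 := h1 i _ ⟨v, hv, rfl⟩
  rw [b1, b2, inner_toLp_eq_integral_mul, inner_toLp_eq_integral_mul] at h4
  exact h4

end IsBoundedSequence
end Perforated

/-! ### The macroscopic gradient and the corrector. -/

namespace Perforated
variable {N : ℕ} {Ω YH : Set (Space N)}

/-- The test pairs that characterize weak gradients and mean-free functions of the cell. -/
def cellTests (YH : Set (Space N)) : Set (CellL2 YH ℝ × CellL2 YH (Space N)) :=
  {s | ∃ Φ, ∃ hΦ : IsPeriodicTest YH Φ, ∃ ξ,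
    s = ((memLp_of_continuous (YH := YH) (hΦ.continuous_fderiv ξ)).toLp _,
      (memLp_of_continuous (YH := YH) (hΦ.1.continuous.smul (continuous_const (y := ξ)))).toLp _)} ∪
  {((memLp_const_solidCell (YH := YH) (1 : ℝ)).toLp _, 0)}

lemma mem_cellGraph_iff_cellTests (p : CellL2 YH ℝ × CellL2 YH (Space N)) :
    p ∈ cellGraph YH ↔ ∀ s ∈ cellTests YH, inner ℝ s.1 p.1 + inner ℝ s.2 p.2 = 0 := by
  rw [cellGraph, Submodule.mem_inf, Submodule.mem_iInf]
  constructor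
  · rintro ⟨h1, h2⟩ s (⟨Φ, hΦ, ξ, rfl⟩ | rfl)
    · exact (Submodule.mem_iInf _).1 (h1 ⟨Φ, hΦ⟩) ξ
    · rw [inner_zero_left, add_zero]
      exact h2
  · intro h
    refine ⟨fun Φ => (Submodule.mem_iInf _).2 fun ξ => h _ (Or.inl ⟨Φ.1, Φ.2, ξ, rfl⟩), ?_⟩
    have h1 := h _ (Or.inr rfl)
    rw [inner_zero_left, add_zero] at h1
    exact h1

lemma setIntegral_inner_tens {Ψ : Space N → Space N} (hΨ : MemLp Ψ 2 (volume.restrict (solidCell YH)))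
    (c : ℝ → ℝ) (η : Space N) :
    ∫ z in solidCell YH ×ˢ Ioo 0 1, inner ℝ (tens Ψ c z) η =
      ∑ i, (∫ y in solidCell YH, Ψ y i) * (∫ s in (0 : ℝ)..1, c s) * η i := by
  have hfin := isFiniteMeasure_solidCell (YH := YH)
  have e1 : ∀ z : Space N × ℝ, inner ℝ (tens Ψ c z) η = inner ℝ (Ψ z.1) η * c z.2 := fun z => by
    rw [tens, real_inner_smul_left, mul_comm]
  have e2 : ∀ y, inner ℝ (Ψ y) η = ∑ i, Ψ y i * η i := fun y => by
    rw [PiLp.inner_apply]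
    exact Finset.sum_congr rfl fun i _ => by simp only [RCLike.inner_apply, conj_trivial]; ring
  simp only [e1]
  rw [volume_restrict_prod, integral_prod_mul (f := fun y => inner ℝ (Ψ y) η) (g := c),
    intervalIntegral.integral_of_le zero_le_one, integral_Ioc_eq_integral_Ioo]
  simp only [e2]
  rw [integral_finsetSum _ fun i _ =>
    ((memLp_apply hΨ i).integrable (by norm_num)).mul_const _, Finset.sum_mul]
  refine Finset.sum_congr rfl fun i _ => ?_
  rw [integral_mul_const]
  ring

namespace IsBoundedSequence

variable {T r : ℝ} {ε : ℕ → ℝ} {u : ℕ → Space N → ℝ → ℝ} {g : ℕ → Space N → ℝ → Space N}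
  {U : Space N × ℝ → ℝ} {G : (Space N × ℝ) × (Space N × ℝ) → Space N}

/-- `F` is the weak gradient of the limit of the functions, tested with products. -/
def IsMacroGradient (Ω YH : Set (Space N)) (T : ℝ) (U : Space N × ℝ → ℝ) (F : Space N × ℝ → Space N) :
    Prop :=
  MemLp F 2 (volume.restrict (Ω ×ˢ Ioo 0 T)) ∧
  ∀ i, ∀ v c, IsTest Ω v → IsTest (Ioo 0 T) c →
    (∫ p in Ω ×ˢ Ioo 0 T, U p / volume.real (solidCell YH) * tens (pderiv i v) c p) +
      ∫ p in Ω ×ˢ Ioo 0 T, F p i * tens v c p = 0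

/-- The limit equation is tested with `Ψ = Φ_i e_i` and `c₂ = 1`. This field has mean `e_i`, so its
second term is the pairing of `U/|Y*|` with `∂_i v`, while the first exhibits the `i`-th derivative
as `∫ G · Ψ` over `Y* × (0,1)`, which is square integrable in `(x,t)`. -/
lemma exists_isMacroGradient (h : IsBoundedSequence Ω YH T r ε u g)
    (hosc : TimeOscillationVanishes Ω YH T r ε u) (hU : IsWeakLimit Ω YH T ε u U)
    (hG : MemLp G 2 (tsMeasure Ω YH T))
    (hconv : GradientsConverge Ω YH T r ε g (fun _ _ => 0) (fun x t y s => G ((x, t), (y, s)))) :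
    ∃ F, IsMacroGradient Ω YH T U F := by
  choose Φ hΦ hΦ1 hΦd using exists_periodicTest_direction h.two_le h.isCompact_hole h.hole_subset
  set Ψ : Fin N → Space N → Space N := fun i y => Φ i y • EuclideanSpace.single i 1
  have hΨ : ∀ i, IsCellPair YH (fun _ => 0) (Ψ i) := fun i =>
    isCellPair_direction h.hole_subset (hΦ i) (hΦd i)
  have hone : IsSmoothPeriodic fun _ => (1 : ℝ) := ⟨contDiff_const, fun _ => rfl⟩
  have hb : ∀ i, MemLp (tens (Ψ i) fun _ => 1) 2 (volume.restrict (solidCell YH ×ˢ Ioo 0 1)) :=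
    fun i => memLp_tens (hΨ i).2.1 continuous_const (M := 1) (fun _ => by simp) (by simp)
  have hH := fun i => h.memLp_cell_inner hG (hb i)
  set H : Fin N → Space N × ℝ → ℝ := fun i p =>
    ∫ z in solidCell YH ×ˢ Ioo 0 1, inner ℝ (tens (Ψ i) (fun _ => 1) z) (G (p, z))
  have hFi : ∀ p i, (∑ j, H j p • EuclideanSpace.single j (1 : ℝ)) i = H i p := fun p i => by
    simp [Finset.sum_apply, Pi.single_apply]
  refine ⟨fun p => ∑ j, H j p • EuclideanSpace.single j (1 : ℝ), memLp_finsetSum _ fun j _ => ?_,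
    fun i v c hv hc => ?_⟩
  · exact (ContinuousLinearMap.toSpanSingleton ℝ (EuclideanSpace.single j (1 : ℝ))).comp_memLp' (hH j)
  · simp only [hFi]
    have key := h.integral_limit_add hosc hU hG hconv hv hc hone (hΨ i)
    rw [integral_ts_tensor h.isBounded hG
      (hv.isBoundedContinuous.tens hc.isBoundedContinuous) (hb i)] at key
    have hsum : ∀ j, ∫ y in solidCell YH, Ψ i y j = if j = i then 1 else 0 := by
      intro j
      by_cases hj : j = i
      · subst hj
        simp [Ψ, hΦ1]
      · simp [Ψ, hj]
    simp only [hsum] at key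
    simp only [intervalIntegral.integral_const, sub_zero, one_smul, mul_one, ite_mul, one_mul,
      zero_mul, Finset.sum_ite_eq', Finset.mem_univ, if_true] at key
    rw [add_comm]
    exact key

/-- The two-scale limit of the gradients minus the macroscopic gradient is orthogonal to divergence
free fields of the cell. -/
lemma integral_limit_sub_eq_zero (h : IsBoundedSequence Ω YH T r ε u g)
    (hosc : TimeOscillationVanishes Ω YH T r ε u) (hU : IsWeakLimit Ω YH T ε u U)
    (hG : MemLp G 2 (tsMeasure Ω YH T))
    (hconv : GradientsConverge Ω YH T r ε g (fun _ _ => 0) (fun x t y s => G ((x, t), (y, s))))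
    {F : Space N × ℝ → Space N} (hF : IsMacroGradient Ω YH T U F)
    {v : Space N → ℝ} (hv : IsTest Ω v) {c₁ c₂ : ℝ → ℝ}
    (hc₁ : IsTest (Ioo 0 T) c₁) (hc₂ : IsSmoothPeriodic c₂) {Ψ : Space N → Space N}
    (hΨ : IsCellPair YH (fun _ => 0) Ψ) :
    ∫ q, inner ℝ (G q - F q.1) (tens v c₁ q.1 • tens Ψ c₂ q.2) ∂(tsMeasure Ω YH T) = 0 := by
  have hfin := isFiniteMeasure_cellTime (YH := YH)
  have ha := hv.isBoundedContinuous.tens hc₁.isBoundedContinuous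
  obtain ⟨M₂, hM₂⟩ := hc₂.exists_bound
  have hb : MemLp (tens Ψ c₂) 2 (volume.restrict (solidCell YH ×ˢ Ioo 0 1)) :=
    memLp_tens hΨ.2.1 hc₂.1.continuous hM₂ (by simp)
  have hF' : MemLp (fun q : (Space N × ℝ) × (Space N × ℝ) => F q.1) 2 (tsMeasure Ω YH T) :=
    hF.1.comp_fst (volume.restrict (solidCell YH ×ˢ Ioo 0 1))
  have ht := memLp_tensor_ts (YH := YH) h.isBounded (T := T) ha hb
  simp only [inner_sub_left]
  rw [integral_sub (integrable_inner_of_memLp hG ht) (integrable_inner_of_memLp hF' ht),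
    eq_neg_of_add_eq_zero_left (h.integral_limit_add hosc hU hG hconv hv hc₁ hc₂ hΨ),
    integral_ts_tensor h.isBounded hF' ha hb]
  -- `F` does not depend on the fast variables and sees only the means of `Ψ` and `c₂`. Its
  -- contribution thus matches the second term of the limit equation, by the defining property of
  -- `F`.
  simp only [setIntegral_inner_tens hΨ.2.1, Finset.sum_mul]
  have i1 : ∀ i, Integrable (fun p : Space N × ℝ => (∫ y in solidCell YH, Ψ y i) *
      (∫ s in (0 : ℝ)..1, c₂ s) * F p i * tens v c₁ p) (volume.restrict (Ω ×ˢ Ioo 0 T)) := fun i =>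
    ((integrable_mul_of_memLp (memLp_apply hF.1 i) (h.memLp_test ha)).const_mul
      ((∫ y in solidCell YH, Ψ y i) * (∫ s in (0 : ℝ)..1, c₂ s))).congr
      (ae_of_all _ fun p => by ring)
  rw [integral_finsetSum _ fun i _ => i1 i, ← Finset.sum_neg_distrib, ← Finset.sum_sub_distrib]
  refine Finset.sum_eq_zero fun i _ => ?_
  simp only [mul_assoc, integral_const_mul]
  have := hF.2 i v c₁ hv hc₁
  rw [eq_neg_of_add_eq_zero_left this]
  ring

lemma isDetermining_tests (h : IsBoundedSequence Ω YH T r ε u g) :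
    IsDetermining (volume.restrict (Ω ×ˢ Ioo 0 T ×ˢ Ioo 0 1) : Measure (Space N × ℝ × ℝ))
      {f | ∃ v, IsTest Ω v ∧ ∃ c₁, IsTest (Ioo 0 T) c₁ ∧ ∃ c₂, IsSmoothPeriodic c₂ ∧
        f = fun q => v q.1 * (c₁ q.2.1 * c₂ q.2.2)} := by
  have e1 : (volume.restrict (Ω ×ˢ Ioo 0 T ×ˢ Ioo 0 1) : Measure (Space N × ℝ × ℝ)) =
      (volume.restrict Ω).prod ((volume.restrict (Ioo 0 T)).prod (volume.restrict (Ioo 0 1))) := by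
    rw [Measure.prod_restrict, Measure.prod_restrict]; rfl
  rw [e1]
  have h1 := (isDetermining_isTest (μ := volume) h.isOpen).prod
    ((isDetermining_isTest (μ := volume) (isOpen_Ioo (a := (0 : ℝ)) (b := T))).prod
      isDetermining_isSmoothPeriodic)
  refine ⟨?_, fun f hf hd => h1.2 f hf ?_⟩
  · rintro _ ⟨v, hv, c₁, hc₁, c₂, hc₂, rfl⟩
    exact h1.1 _ ⟨v, hv, _, ⟨c₁, hc₁, c₂, hc₂, rfl⟩, rfl⟩
  · rintro _ ⟨v, hv, _, ⟨c₁, hc₁, c₂, hc₂, rfl⟩, rfl⟩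
    exact hd _ ⟨v, hv, c₁, hc₁, c₂, hc₂, rfl⟩

/-- The oscillating part of the limit of the gradients, in the variables `(y,(x,t,s))`. -/
def cellPart (G : (Space N × ℝ) × (Space N × ℝ) → Space N) (F : Space N × ℝ → Space N)
    (p : Space N × (Space N × ℝ × ℝ)) : Space N :=
  G ((p.2.1, p.2.2.1), (p.1, p.2.2.2)) - F (p.2.1, p.2.2.1)

lemma memLp_cellPart (h : IsBoundedSequence Ω YH T r ε u g) (hG : MemLp G 2 (tsMeasure Ω YH T))
    {F : Space N × ℝ → Space N} (hF : MemLp F 2 (volume.restrict (Ω ×ˢ Ioo 0 T))) :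
    MemLp (cellPart G F) 2 ((volume.restrict (solidCell YH)).prod
      (volume.restrict (Ω ×ˢ Ioo 0 T ×ˢ Ioo 0 1))) := by
  have hfin := isFiniteMeasure_cellTime (YH := YH)
  have hF' : MemLp (fun q : (Space N × ℝ) × (Space N × ℝ) => F q.1) 2 (tsMeasure Ω YH T) :=
    hF.comp_fst (volume.restrict (solidCell YH ×ˢ Ioo 0 1))
  have h1 := (memLp_nested_iff (f := fun p : Space N × ℝ × Space N × ℝ =>
    G ((p.1, p.2.1), p.2.2) - F (p.1, p.2.1)) h.isOpen h.isCompact_hole T).2 (hG.sub hF')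
  exact h1.comp_measurePreserving (measurePreserving_reorder Ω YH T)

/-- Almost every slice is orthogonal to divergence free fields. -/
lemma ae_inner_cellPart_eq_zero (h : IsBoundedSequence Ω YH T r ε u g)
    (hosc : TimeOscillationVanishes Ω YH T r ε u) (hU : IsWeakLimit Ω YH T ε u U)
    (hG : MemLp G 2 (tsMeasure Ω YH T))
    (hconv : GradientsConverge Ω YH T r ε g (fun _ _ => 0) (fun x t y s => G ((x, t), (y, s))))
    {F : Space N × ℝ → Space N} (hF : IsMacroGradient Ω YH T U F) :
    ∀ᵐ q ∂(volume.restrict (Ω ×ˢ Ioo 0 T ×ˢ Ioo 0 1) : Measure (Space N × ℝ × ℝ)),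
      ∀ Ψ : CellL2 YH (Space N), (∀ p ∈ cellGraph YH, inner ℝ p.2 Ψ = 0) →
        inner ℝ Ψ (fiber (volume.restrict (solidCell YH)) (cellPart G F) q) = 0 := by
  have hfin := isFiniteMeasure_spaceTime h.isBounded T
  have hfin' : IsFiniteMeasure
      (volume.restrict (Ω ×ˢ Ioo 0 T ×ˢ Ioo 0 1) : Measure (Space N × ℝ × ℝ)) :=
    ⟨by simpa using (h.isBounded.prod ((Metric.isBounded_Ioo 0 T).prod
      (Metric.isBounded_Ioo 0 1))).measure_lt_top⟩
  have hz := h.memLp_cellPart hG hF.1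
  refine ae_inner_fiber_eq_zero hz (S := {Ψ | ∀ p ∈ cellGraph YH, inner ℝ p.2 Ψ = 0})
    fun Ψ hΨ => ?_
  have hpair := isCellPair_zero_of_orthogonal h.isCompact_hole h.hole_subset h.connected hΨ
  have hΨm := Lp.memLp Ψ
  -- Products `v c₁ c₂` determine integrable functions of `(x,t,s)`, so the integrated orthogonality
  -- gives orthogonality of almost every slice.
  refine h.isDetermining_tests.2 _ (integrable_fiber_inner hΨm hz) ?_
  rintro _ ⟨v, hv, c₁, hc₁, c₂, hc₂, rfl⟩
  obtain ⟨hdm, M, hM⟩ := h.isDetermining_tests.1 _ ⟨v, hv, c₁, hc₁, c₂, hc₂, rfl⟩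
  rw [integral_fiber_inner_mul hΨm hz hdm hM]
  have hDm := (isOpen_solidCell h.isCompact_hole).measurableSet
  have key := h.integral_limit_sub_eq_zero hosc hU hG hconv hF hv hc₁ hc₂ hpair
  have e1 := integral_nested h.isOpen h.isCompact_hole T (fun p : Space N × ℝ × Space N × ℝ =>
    inner ℝ (G ((p.1, p.2.1), p.2.2) - F (p.1, p.2.1))
      (tens v c₁ (p.1, p.2.1) • tens ((solidCell YH).indicator Ψ) c₂ p.2.2))
  refine Eq.trans ?_ (e1.trans key)
  rw [← (measurePreserving_reorder Ω YH T).integral_comp (reorder N).measurableEmbedding]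
  refine integral_congr_ae ?_
  filter_upwards [Measure.quasiMeasurePreserving_fst.ae (ae_restrict_mem hDm)] with p hp
  change inner ℝ (Ψ p.1) (cellPart G F p) * (v p.2.1 * (c₁ p.2.2.1 * c₂ p.2.2.2)) =
    inner ℝ (cellPart G F p) ((c₁ p.2.2.1 • v p.2.1) • (c₂ p.2.2.2 • (solidCell YH).indicator Ψ p.1))
  rw [indicator_of_mem hp, real_inner_smul_right, real_inner_smul_right, real_inner_comm, smul_eq_mul]
  ring

end IsBoundedSequence
end Perforated

namespace Perforated
variable {N : ℕ} {Ω YH : Set (Space N)}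

/-- The periodic extension of a function of `(y,(x,t,s))` on the solid cell, by zero in the hole. -/
def periodize {B : Type*} [Zero B] (YH : Set (Space N)) (w : Space N × (Space N × ℝ × ℝ) → B)
    (x : Space N) (t : ℝ) (y : Space N) (s : ℝ) : B :=
  (solidCell YH).indicator (fun z => w (z, (x, t, s))) (fract y)

lemma periodize_of_mem {B : Type*} [Zero B] (w : Space N × (Space N × ℝ × ℝ) → B) (x : Space N)
    (t : ℝ) {y : Space N} (hy : y ∈ solidCell YH) (s : ℝ) : periodize YH w x t y s = w (y, (x, t, s)) := by
  rw [periodize, fract_eq_self (unitCube_subset_halfOpenCube hy.1), indicator_of_mem hy]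

lemma memLp_periodize {B : Type*} [NormedAddCommGroup B] (hY : IsCompact YH) {T : ℝ}
    {w : Space N × (Space N × ℝ × ℝ) → B}
    (hw : MemLp w 2 ((volume.restrict (solidCell YH)).prod
      (volume.restrict (Ω ×ˢ Ioo 0 T ×ˢ Ioo 0 1)))) :
    MemLp (fun p : Space N × ℝ × Space N × ℝ => periodize YH w p.1 p.2.1 p.2.2.1 p.2.2.2) 2
      (volume.restrict (Ω ×ˢ Ioo 0 T ×ˢ solidCell YH ×ˢ Ioo 0 1)) := by
  rw [← (measurePreserving_reorder Ω YH T).map_eq,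
    (reorder N).measurableEmbedding.memLp_map_measure_iff]
  refine hw.ae_eq ?_
  filter_upwards [Measure.quasiMeasurePreserving_fst.ae
    (ae_restrict_mem (isOpen_solidCell hY).measurableSet)] with p hp
  exact (periodize_of_mem w _ _ hp _).symm

namespace IsBoundedSequence

variable {T r : ℝ} {ε : ℕ → ℝ} {u : ℕ → Space N → ℝ → ℝ} {g : ℕ → Space N → ℝ → Space N}
  {U : Space N × ℝ → ℝ} {G : (Space N × ℝ) × (Space N × ℝ) → Space N}

/-- The oscillating part of the limit is the gradient of a corrector. -/
lemma exists_corrector (h : IsBoundedSequence Ω YH T r ε u g)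
    (hosc : TimeOscillationVanishes Ω YH T r ε u) (hU : IsWeakLimit Ω YH T ε u U)
    (hG : MemLp G 2 (tsMeasure Ω YH T))
    (hconv : GradientsConverge Ω YH T r ε g (fun _ _ => 0) (fun x t y s => G ((x, t), (y, s))))
    {F : Space N × ℝ → Space N} (hF : IsMacroGradient Ω YH T U F) :
    ∃ u₁ g₁, IsCellCorrector Ω YH T u₁ g₁ ∧
      GradientsConverge Ω YH T r ε g (fun x t => F (x, t)) g₁ := by
  have hfin : IsFiniteMeasure
      (volume.restrict (Ω ×ˢ Ioo 0 T ×ˢ Ioo 0 1) : Measure (Space N × ℝ × ℝ)) :=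
    ⟨by simpa using (h.isBounded.prod ((Metric.isBounded_Ioo 0 T).prod
      (Metric.isBounded_Ioo 0 1))).measure_lt_top⟩
  have hDm := (isOpen_solidCell h.isCompact_hole).measurableSet
  have hz := h.memLp_cellPart hG hF.1
  obtain ⟨C, hC⟩ := exists_cellGraph_bound h.isCompact_hole h.hole_subset h.hole_smooth h.connected
  -- Almost every slice of `G - F` is orthogonal to the complement of the gradients, hence a
  -- gradient itself; its mean-free potential is chosen measurably in `(x,t,s)`.
  obtain ⟨w, hw, hwK⟩ := exists_fiber_solution (cellGraph YH) (cellTests YH)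
    mem_cellGraph_iff_cellTests hC hz (h.ae_inner_cellPart_eq_zero hosc hU hG hconv hF)
  refine ⟨periodize YH w, periodize YH (cellPart G F),
    ⟨memLp_periodize h.isCompact_hole hw, memLp_periodize h.isCompact_hole hz, ?_⟩, fun v hv => ?_⟩
  · filter_upwards [hwK, ae_fiber_eq hw, ae_fiber_eq hz] with q hq ⟨a1, b1⟩ ⟨a2, b2⟩
    rw [b1, b2, toLp_mem_cellGraph] at hq
    refine ⟨fun k => ae_of_all _ fun y => ?_, ?_, ?_⟩
    · simp only [periodize, fract_add_intVec]
    · have hg := hq.1.congr (indicator_ae_eq_restrict hDm).symm (indicator_ae_eq_restrict hDm).symm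
      exact hg.hasWeakGrad_fract h.isCompact_hole h.hole_subset
        (fun y hy => indicator_of_notMem (fun h => h.2 hy) _)
        (fun y hy => indicator_of_notMem (fun h => h.2 hy) _)
    · rw [← hq.2]
      exact setIntegral_congr_fun hDm fun y hy => periodize_of_mem w _ _ hy _
  · have h1 := hconv v hv
    have hm : MeasurableSet (Ω ×ˢ Ioo (0 : ℝ) T ×ˢ solidCell YH ×ˢ Ioo (0 : ℝ) 1) :=
      h.isOpen.measurableSet.prod (measurableSet_Ioo.prod (hDm.prod measurableSet_Ioo))
    -- On the solid cell `F + (G - F) = G`, so the limit already obtained is only rewritten.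
    have h2 : ∀ p ∈ Ω ×ˢ Ioo (0 : ℝ) T ×ˢ solidCell YH ×ˢ Ioo (0 : ℝ) 1,
        inner ℝ (0 + G ((p.1, p.2.1), (p.2.2.1, p.2.2.2)))
          (v (p.1, p.2.1) (toTorus p.2.2.1, ((p.2.2.2 : ℝ) : UnitAddCircle))) =
        inner ℝ (F (p.1, p.2.1) + periodize YH (cellPart G F) p.1 p.2.1 p.2.2.1 p.2.2.2)
          (v (p.1, p.2.1) (toTorus p.2.2.1, ((p.2.2.2 : ℝ) : UnitAddCircle))) := fun p hp => by
      rw [periodize_of_mem _ _ _ hp.2.2.1, cellPart, zero_add, add_sub_cancel]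
    rw [setIntegral_congr_fun hm h2] at h1
    exact h1

/-- Two-scale compactness of bounded sequences in `L²(0,T;H¹)`. -/
theorem exists_gradientsConverge (h : IsBoundedSequence Ω YH T r ε u g)
    (hosc : TimeOscillationVanishes Ω YH T r ε u) :
    ∃ (φ : ℕ → ℕ) (u₀ : Space N → ℝ → ℝ) (h' : Space N → ℝ → Space N)
      (u₁ : Space N → ℝ → Space N → ℝ → ℝ) (g₁ : Space N → ℝ → Space N → ℝ → Space N),
      StrictMono φ ∧ IsL2H1 Ω T u₀ h' ∧ IsCellCorrector Ω YH T u₁ g₁ ∧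
      GradientsConverge Ω YH T r (ε ∘ φ) (g ∘ φ) h' g₁ := by
  obtain ⟨φ, U, G, hφ, hUm, hG, hU, hconv⟩ := h.exists_twoScale_limit
  have hs := h.comp hφ
  have hosc' : TimeOscillationVanishes Ω YH T r (ε ∘ φ) (u ∘ φ) := fun v₁ c₁ c₂ hv₁ hc₁ hc₂ =>
    (hosc v₁ c₁ c₂ hv₁ hc₁ hc₂).comp hφ.tendsto_atTop
  obtain ⟨F, hF⟩ := hs.exists_isMacroGradient hosc' hU hG hconv
  obtain ⟨u₁, g₁, hc, hg⟩ := hs.exists_corrector hosc' hU hG hconv hF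
  -- `U` is the limit of the functions extended by zero into the holes and so carries the volume
  -- fraction `|Y*|` of the solid part; the macroscopic function is `U / |Y*|`.
  have hUm' : MemLp (fun p => U p / volume.real (solidCell YH)) 2
      (volume.restrict (Ω ×ˢ Ioo 0 T)) := by
    simp only [div_eq_mul_inv]
    exact hUm.mul_const _
  exact ⟨φ, _, _, u₁, g₁, hφ, hs.isL2H1_of_tens hUm' hF.1 hF.2, hc, hg⟩

end IsBoundedSequence
end Perforated

end

theorem corollary2 (N : ℕ) (hN : 2 ≤ N)
    (Ω : Set (Space N)) (hΩo : IsOpen Ω) (hΩb : Bornology.IsBounded Ω)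
    (hΩs : HasSmoothBoundary Ω)
    (YH : Set (Space N)) (hYc : IsCompact YH) (hYY : YH ⊆ unitCube N)
    (hYs : HasSmoothBoundary YH) (hYconn : IsConnected (solidCell YH))
    (T : ℝ) (hT : 0 < T) (r : ℝ) (hr : 0 < r)
    (ε : ℕ → ℝ) (hε : ∀ k, 0 < ε k) (hε0 : Tendsto ε atTop (𝓝 0))
    (u : ℕ → Space N → ℝ → ℝ) (g : ℕ → Space N → ℝ → Space N)
    (hu : BoundedL2H1 Ω YH T ε u g)
    (hosc : TimeOscillationVanishes Ω YH T r ε u) :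
    (∃ (φ : ℕ → ℕ) (u₀ : Space N → ℝ → ℝ) (h : Space N → ℝ → Space N)
        (u₁ : Space N → ℝ → Space N → ℝ → ℝ) (g₁ : Space N → ℝ → Space N → ℝ → Space N),
      StrictMono φ ∧ IsL2H1 Ω T u₀ h ∧ IsCellCorrector Ω YH T u₁ g₁ ∧
      GradientsConverge Ω YH T r (ε ∘ φ) (g ∘ φ) h g₁) ∧
    (∀ (φ : ℕ → ℕ) (u₀ : Space N → ℝ → ℝ) (h : Space N → ℝ → Space N)
        (u₁ : Space N → ℝ → Space N → ℝ → ℝ) (g₁ : Space N → ℝ → Space N → ℝ → Space N),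
      StrictMono φ → IsL2H1 Ω T u₀ h → IsCellCorrector Ω YH T u₁ g₁ →
      GradientsConverge Ω YH T r (ε ∘ φ) (g ∘ φ) h g₁ →
      ConvergesVeryWeakly Ω YH T r (ε ∘ φ) (u ∘ φ) u₁) := by
  have hseq : IsBoundedSequence Ω YH T r ε u g :=
    ⟨hN, hΩo, hΩb, hYc, hYY, hYs, hYconn, hr, hε, hε0, hu⟩
  exact ⟨hseq.exists_gradientsConverge hosc, fun φ u₀ h u₁ g₁ hφ hu₀ hc hconv =>
    (hseq.comp hφ).convergesVeryWeakly hu₀ hc hconv⟩
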